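/- Let $M$ be a connected Riemann surface and let $y:M\to\mathbb{S}^3$ be a smooth conformal immersion without umbilic points which is a Willmore surface, i.e. a critical point of the Willmore functional $\int (H^2-k_1k_2)\,dA$ ($k_1,k_2$ the principal curvatures, $H$ the mean curvature and $dA$ the induced area element of the surface in $\mathbb{S}^3$) under compactly supported smooth variations of the map, it being enough to vary inside coordinate domains. In a local complex coordinate $z$ let $Y$ be the canonical lift of $y$, that is, the positive multiple of $(1,y)$ in the light cone of $\mathbb{R}^{4,1}$ with $\langle Y_z,Y_{\bar z}\rangle=\tfrac12$, and write $Y_{zz}=-\tfrac{s}{2}Y+\kappa$ with $s$ a complex function and $\kappa$ orthogonal to $Y,Y_z,Y_{\bar z},Y_{z\bar z}$. The Möbius metric of $y$ is the Riemannian metric $g=e^{2\omega}|dz|^2=4\langle\kappa,\bar\kappa\rangle|dz|^2$ on $M$ (it does not depend on the choice of $z$), and the Möbius curvature $\mathcal{K}=-4e^{-2\omega}\omega_{z\bar z}$ is its Gaussian curvature. Suppose that $(M,g)$ is complete and that $\mathcal{K}\le 0$ everywhere on $M$. Then $\mathcal{K}\equiv 0$, and $y$ is Möbius equivalent to the Clifford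 torus $T=\{x\in\mathbb{S}^3: x_1^2+x_2^2=x_3^2+x_4^2=\tfrac12\}$ in the following sense: there is a Möbius transformation $\varphi$ of $\mathbb{S}^3$ (the projective action of a linear isometry of $\mathbb{R}^{4,1}$ on the light cone) such that $\varphi\circ y$ maps $M$ onto $T$ and $\varphi\circ y:M\to T$ is a covering map. -/

import Mathlib

open scoped Manifold ContDiff

noncomputable section

namespace MobiusSurface

/-- Euclidean four-space. -/
abbrev E4 : Type := EuclideanSpace ℝ (Fin 4)

/-- The unit three-sphere in `ℝ⁴`. -/
abbrev S3 : Type := Metric.sphere (0 : E4) 1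

/-! ### Minkowski space and the light cone -/

/-- The form `-v₀w₀ + v₁w₁ + ⋯ + v₄w₄` on `R⁵`: for `R = ℝ` the Lorentzian product of `ℝ^{4,1}`,
for `R = ℂ` its complex bilinear extension. -/
def mink {R : Type*} [CommRing R] (v w : Fin 5 → R) : R :=
  -(v 0 * w 0) + ∑ i : Fin 4, v i.succ * w i.succ

/-- The light-like vector `(1, x)` over a point `x` of the sphere. -/
def coneVector (x : E4) : Fin 5 → ℝ := Fin.cons 1 (fun i => x i)

/-- A Möbius transformation of `S³`: the projective action, on the light cone, of a linear
isometry of `ℝ^{4,1}`. -/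
def IsMobiusTransformation (φ : S3 → S3) : Prop :=
  ∃ A : (Fin 5 → ℝ) →ₗ[ℝ] (Fin 5 → ℝ),
    (∀ v w, mink (A v) (A w) = mink v w) ∧
    ∀ x : S3, ∃ c : ℝ, c ≠ 0 ∧ A (coneVector x) = c • coneVector (φ x)

/-- The Clifford torus `x₀² + x₁² = x₂² + x₃² = 1/2` in `S³`. -/
def cliffordTorus : Set S3 :=
  {x | (x : E4) 0 ^ 2 + (x : E4) 1 ^ 2 = 1 / 2 ∧ (x : E4) 2 ^ 2 + (x : E4) 3 ^ 2 = 1 / 2}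

/-! ### Conformal invariants of a conformal immersion `f` of a planar domain into `S³` -/

/-- The Wirtinger derivative `∂f/∂z = (∂f/∂u - i ∂f/∂v) / 2`, where `z = u + iv`. -/
def dz {V : Type*} [NormedAddCommGroup V] [NormedSpace ℂ V] (f : ℂ → V) (z : ℂ) : V :=
  (1 / 2 : ℂ) • (fderiv ℝ f z 1 - Complex.I • fderiv ℝ f z Complex.I)

/-- The Wirtinger derivative `∂f/∂z̄ = (∂f/∂u + i ∂f/∂v) / 2`, where `z = u + iv`. -/
def dzbar {V : Type*} [NormedAddCommGroup V] [NormedSpace ℂ V] (f : ℂ → V) (z : ℂ) : V :=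
  (1 / 2 : ℂ) • (fderiv ℝ f z 1 + Complex.I • fderiv ℝ f z Complex.I)

/-- The lift `F = (1, f)` of `f` to the light cone, as a map into `ℂ⁵`. -/
def coneLift (f : ℂ → E4) (z : ℂ) : Fin 5 → ℂ := fun i => (coneVector (f z) i : ℂ)

/-- The canonical lift `Y`: the positive multiple of `F = (1, f)` with `|dY|² = |dz|²`, that is,
`⟨Y_z, Y_z̄⟩ = 1/2`. -/
def canonicalLift (f : ℂ → E4) (z : ℂ) : Fin 5 → ℂ :=
  (((Real.sqrt (2 * (mink (dz (coneLift f) z) (dzbar (coneLift f) z)).re))⁻¹ : ℝ) : ℂ) •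
    coneLift f z

/-- The vector `N` in the span of `Y, Y_z, Y_z̄, Y_{zz̄}` with
`⟨N, N⟩ = 0`, `⟨N, Y⟩ = -1`, `⟨N, Y_z⟩ = ⟨N, Y_z̄⟩ = 0`; it is
`N = 2 Y_{zz̄} + 2 ⟨Y_{zz̄}, Y_{zz̄}⟩ Y`. -/
def normalizedN (f : ℂ → E4) (z : ℂ) : Fin 5 → ℂ :=
  let Y := canonicalLift f
  let Yzzbar := dzbar (dz Y) z
  (2 : ℂ) • Yzzbar + (2 * mink Yzzbar Yzzbar) • Y z

/-- The Schwarzian `s`, the coefficient in `Y_{zz} = -(s/2) Y + κ`. -/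
def schwarzian (f : ℂ → E4) (z : ℂ) : ℂ :=
  2 * mink (dz (dz (canonicalLift f)) z) (normalizedN f z)

/-- The Hopfian (normal-valued Hopf differential) `κ = Y_{zz} + (s/2) Y`. -/
def hopfian (f : ℂ → E4) (z : ℂ) : Fin 5 → ℂ :=
  dz (dz (canonicalLift f)) z + (schwarzian f z / 2) • canonicalLift f z

/-- The conformal factor `e^{2ω} = 4 ⟨κ, κ̄⟩` of the Möbius metric `e^{2ω} |dz|²`. -/
def mobiusFactor (f : ℂ → E4) (z : ℂ) : ℝ :=
  4 * (mink (hopfian f z) (star (hopfian f z))).re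

/-- The Gaussian curvature `𝒦 = -4 e^{-2ω} ω_{zz̄} = -e^{-2ω} (ω_{uu} + ω_{vv})` of the Möbius
metric, where `ω = (1/2) log e^{2ω}`. -/
def mobiusCurvatureAt (f : ℂ → E4) (z : ℂ) : ℝ :=
  -(mobiusFactor f z)⁻¹ * Laplacian.laplacian (fun w => Real.log (mobiusFactor f w) / 2) z

/-! ### Fundamental forms and the Willmore energy of a parametrized surface in `S³`

Here `f` is an immersion of a planar domain into `S³`, not necessarily conformal. -/

/-- The partial derivative `∂f/∂u`, where `z = u + iv`. -/
def du (f : ℂ → E4) (z : ℂ) : E4 := fderiv ℝ f z 1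

/-- The partial derivative `∂f/∂v`, where `z = u + iv`. -/
def dv (f : ℂ → E4) (z : ℂ) : E4 := fderiv ℝ f z Complex.I

/-- First fundamental form, coefficient `E`. -/
def formE (f : ℂ → E4) (z : ℂ) : ℝ := inner ℝ (du f z) (du f z)

/-- First fundamental form, coefficient `F`. -/
def formF (f : ℂ → E4) (z : ℂ) : ℝ := inner ℝ (du f z) (dv f z)

/-- First fundamental form, coefficient `G`. -/
def formG (f : ℂ → E4) (z : ℂ) : ℝ := inner ℝ (dv f z) (dv f z)

/-- The determinant `EG - F²` of the first fundamental form. -/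
def gramDet (f : ℂ → E4) (z : ℂ) : ℝ := formE f z * formG f z - formF f z ^ 2

/-- The component `⟨w, n⟩ = det (f, f_u, f_v, w) / √(EG - F²)` of a vector `w` along the unit
normal `n` of the surface in `S³` (the unit vector orthogonal to `f`, `f_u`, `f_v`). -/
def normalComponent (f : ℂ → E4) (z : ℂ) (w : E4) : ℝ :=
  Matrix.det (Matrix.of fun i j : Fin 4 => (![f z, du f z, dv f z, w] : Fin 4 → E4) i j) /
    Real.sqrt (gramDet f z)

/-- Second fundamental form in `S³`, coefficient `L = ⟨f_uu, n⟩`. -/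
def formL (f : ℂ → E4) (z : ℂ) : ℝ := normalComponent f z (du (du f) z)

/-- Second fundamental form in `S³`, coefficient `M = ⟨f_uv, n⟩`. -/
def formM (f : ℂ → E4) (z : ℂ) : ℝ := normalComponent f z (du (dv f) z)

/-- Second fundamental form in `S³`, coefficient `N = ⟨f_vv, n⟩`. -/
def formN (f : ℂ → E4) (z : ℂ) : ℝ := normalComponent f z (dv (dv f) z)

/-- The mean curvature `H` in `S³`, half the trace of the shape operator. -/
def meanCurvature (f : ℂ → E4) (z : ℂ) : ℝ :=
  (formE f z * formN f z - 2 * formF f z * formM f z + formG f z * formL f z) /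
    (2 * gramDet f z)

/-- The determinant of the shape operator in `S³` (the product of the principal curvatures). -/
def shapeDet (f : ℂ → E4) (z : ℂ) : ℝ :=
  (formL f z * formN f z - formM f z ^ 2) / gramDet f z

/-- The integrand of the Willmore functional, `(H² - k₁k₂) dA = ((k₁ - k₂)/2)² dA`. It is the area
density of the Möbius metric and is invariant under conformal changes of the ambient metric. -/
def willmoreDensity (f : ℂ → E4) (z : ℂ) : ℝ :=
  (meanCurvature f z ^ 2 - shapeDet f z) * Real.sqrt (gramDet f z)

/-! ### Surfaces -/

section Surface

variable {M : Type*} [TopologicalSpace M] [ChartedSpace ℂ M]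

/-- The expression of `y : M → S³` in a complex coordinate `e`. -/
def localExpr (y : M → S3) (e : OpenPartialHomeomorph M ℂ) : ℂ → E4 := fun z => y (e.symm z)

/-- `y` is a smooth conformal immersion of the Riemann surface `M` into `S³`. -/
structure IsConformalImmersion (y : M → S3) : Prop where
  smooth : ContMDiff 𝓘(ℝ, ℂ) 𝓘(ℝ, E4) ∞ (fun p => (y p : E4))
  conformal : ∀ p : M, ConformalAt (localExpr y (chartAt ℂ p)) (chartAt ℂ p p)

/-- `p` is an umbilic point: the second fundamental form at `p` is a multiple of the first. -/
def IsUmbilic (y : M → S3) (p : M) : Prop :=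
  let f := localExpr y (chartAt ℂ p)
  let z := chartAt ℂ p p
  ∃ k : ℝ, formL f z = k * formE f z ∧ formM f z = k * formF f z ∧ formN f z = k * formG f z

/-- `y` is a Willmore surface: it is a critical point of the Willmore functional with respect to
smooth variations through maps into `S³` supported in a compact subset of a coordinate domain.
`F t` is the varied surface in the coordinate `e`; for small `t` it is an immersion near `K`. -/
def IsWillmore (y : M → S3) : Prop :=
  ∀ e ∈ atlas ℂ M, ∀ K ⊆ e.target, IsCompact K → ∀ F : ℝ → ℂ → S3,
    ContDiffOn ℝ ∞ (fun q : ℝ × ℂ => (F q.1 q.2 : E4)) (Set.univ ×ˢ e.target) →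
    (∀ z ∈ e.target, F 0 z = y (e.symm z)) →
    (∀ t, ∀ z ∈ e.target \ K, F t z = y (e.symm z)) →
    HasDerivAt (fun t => ∫ z in K, willmoreDensity (fun w => (F t w : E4)) z) 0 0

/-- The length of a tangent vector at `p` in the Möbius metric. The tangent space at `p` is
identified with `ℂ` by means of the coordinate `chartAt ℂ p`. -/
@[reducible]
def mobiusENorm (y : M → S3) (p : M) : ENorm (TangentSpace 𝓘(ℝ, ℂ) p) where
  enorm := fun v : ℂ => ENNReal.ofReal
    (Real.sqrt (mobiusFactor (localExpr y (chartAt ℂ p)) (chartAt ℂ p p)) * ‖v‖)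

/-- The distance of the Möbius metric: the infimum of the lengths of `C¹` paths. -/
def mobiusEDist (y : M → S3) (p q : M) : ENNReal :=
  @Manifold.riemannianEDist ℂ _ _ ℂ _ 𝓘(ℝ, ℂ) M _ _ (mobiusENorm y) p q

/-- `M` is complete with respect to the Möbius metric: Cauchy sequences converge. -/
def IsMobiusComplete (y : M → S3) : Prop :=
  ∀ u : ℕ → M,
    (∀ ε > 0, ∃ n₀, ∀ m ≥ n₀, ∀ n ≥ n₀, mobiusEDist y (u m) (u n) < ε) →
    ∃ p, Filter.Tendsto (fun n => mobiusEDist y (u n) p) Filter.atTop (nhds 0)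

/-- The Möbius curvature `𝒦 : M → ℝ`, computed in the coordinate `chartAt ℂ p` at `p`. -/
def mobiusCurvature (y : M → S3) (p : M) : ℝ :=
  mobiusCurvatureAt (localExpr y (chartAt ℂ p)) (chartAt ℂ p p)

/-- `y` is Möbius equivalent to the Clifford torus: some Möbius transformation carries `y` to a
covering map of `M` onto the Clifford torus. -/
def IsMobiusEquivalentToCliffordTorus (y : M → S3) : Prop :=
  ∃ φ : S3 → S3, IsMobiusTransformation φ ∧
    ∃ h : ∀ p, φ (y p) ∈ cliffordTorus,
      IsCoveringMap (Set.codRestrict (fun p => φ (y p)) cliffordTorus h) ∧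
      Function.Surjective (Set.codRestrict (fun p => φ (y p)) cliffordTorus h)

end Surface

end MobiusSurface

end

open MobiusSurface

/-! Write the Hopfian as κ = kξ, where ξ is the conformal Gauss map, a real vector of length one, so
that the Möbius metric is 4|k|²|dz|². The surface is Willmore exactly when k_z̄z̄ + (s̄/2)k = 0.
Together with the Gauss equation this makes Q = ⟨ξ_zz, ξ_zz⟩/4 = k k_zz̄ − k_z k_z̄ + k³k̄
holomorphic (`bryant_holomorphic`), and Q dz⁴ is Bryant's quartic differential. Dividing by k² gives
Q/k² = (log k)_zz̄ + |k|², whose real part is the identity Re(Q k̄²) = (1 − 𝒦)|k|⁶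
(`bryant_curvature`).

If 𝒦 ≤ 0 and there are no umbilic points, then |Q| ≥ |k|⁴ > 0. Hence Q dz⁴ has no zeros, and around
every point there is a coordinate with Q = 1, unique up to w ↦ b + cw with c⁴ = 1. In such a natural
coordinate |k| ≤ 1, so the Möbius metric is at most 4|dz|². Euclidean Cauchy sequences in the
coordinate therefore have Möbius-Cauchy images, and completeness lets a natural parametrization be
continued along every ray (`exists_entire`). The outcome is a map Φ : ℂ → M that is locally
biholomorphic and onto.

On ℂ the inequality 𝒦 ≤ 0 says that log |k| is subharmonic. It is bounded above, hence constant by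
Liouville's theorem in the plane (`eq_of_laplacian_nonneg`), so 𝒦 = 0. Now Re k̄² = |k|⁶ with |k|
constant leaves finitely many values for k, so k is constant by continuity. Then Q = 1 reads k³k̄ =
1, so k = ±1. The Willmore equation kills s, and the structure equations become a linear system with
constant coefficients (`CliffordSystem`). It is solved by trigonometric functions of Re z and Im z,
and in the Lorentz frame at z = 0 the solution is the Clifford torus. Finally Φ is the quotient of ℂ
by a group of translations that are periods of the torus, which gives the covering property
(`isCoveringMap_of_translations`).

The Willmore hypothesis is variational, so the Euler-Lagrange equation H_zz̄ + 2|k|²H = 0 has to be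
derived. For a normal variation with speed φ the density changes by 4φ(H_zz̄ + 2|k|²H) plus the real
part of a z-derivative, which integrates to zero (`densityVariation_eq`, `willmoreAt_of_critical`).

The structure equations are proved over an arbitrary commutative ring with two commuting derivations
and then applied to germs of smooth functions. Differential identities become polynomial identities
in this way. -/

noncomputable section

namespace MobiusSurface

/-! ### The moving frame over a ring with two commuting derivations. -/

section Algebra

variable {R : Type*} [CommRing R]

theorem mink_comm (v w : Fin 5 → R) : mink v w = mink w v := by
  simp only [mink, mul_comm]

theorem mink_add_left (u v w : Fin 5 → R) : mink (u + v) w = mink u w + mink v w := by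
  simp only [mink, Fin.sum_univ_four, Pi.add_apply]; ring

theorem mink_sub_left (u v w : Fin 5 → R) : mink (u - v) w = mink u w - mink v w := by
  simp only [mink, Fin.sum_univ_four, Pi.sub_apply]; ring

theorem mink_neg_left (u w : Fin 5 → R) : mink (-u) w = -mink u w := by
  simp only [mink, Fin.sum_univ_four, Pi.neg_apply]; ring

theorem mink_smul_left (c : R) (u w : Fin 5 → R) : mink (c • u) w = c * mink u w := by
  simp only [mink, Fin.sum_univ_four, Pi.smul_apply, smul_eq_mul]; ring

theorem mink_zero_left (w : Fin 5 → R) : mink 0 w = 0 := by simp [mink]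

theorem mink_add_right (u v w : Fin 5 → R) : mink w (u + v) = mink w u + mink w v := by
  simp only [mink_comm w, mink_add_left]

theorem mink_sub_right (u v w : Fin 5 → R) : mink w (u - v) = mink w u - mink w v := by
  simp only [mink_comm w, mink_sub_left]

theorem mink_neg_right (u w : Fin 5 → R) : mink w (-u) = -mink w u := by
  simp only [mink_comm w, mink_neg_left]

theorem mink_smul_right (c : R) (u w : Fin 5 → R) : mink w (c • u) = c * mink w u := by
  simp only [mink_comm w, mink_smul_left]

theorem mink_eq_dotProduct (v w : Fin 5 → R) :
    mink v w = v ⬝ᵥ (Matrix.diagonal (Fin.cons (-1) fun _ => 1)).mulVec w := by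
  simp [mink, dotProduct, Matrix.mulVec_diagonal, Fin.sum_univ_succ]

/-- A vector is determined by its products with a frame whose Gram matrix has an inverse. -/
theorem eq_zero_of_mink_eq_zero (b : Fin 5 → Fin 5 → R) (G : Matrix (Fin 5) (Fin 5) R)
    (hG : Matrix.of (fun i j => mink (b i) (b j)) * G = 1) {w : Fin 5 → R}
    (hw : ∀ i, mink (b i) w = 0) : w = 0 := by
  set η : Matrix (Fin 5) (Fin 5) R := Matrix.diagonal (Fin.cons (-1) fun _ => 1) with hη
  have hηη : η * η = 1 := by
    rw [hη, Matrix.diagonal_mul_diagonal, ← Matrix.diagonal_one]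
    congr 1
    funext i
    refine Fin.cases ?_ (fun j => ?_) i <;> simp
  have h1 : Matrix.of (fun i j => mink (b i) (b j)) = Matrix.of b * (η * (Matrix.of b).transpose) := by
    ext i j
    rw [Matrix.of_apply, mink_eq_dotProduct, ← hη, Matrix.mul_apply]
    simp only [dotProduct, Matrix.mul_apply, Matrix.mulVec, Matrix.of_apply, Matrix.transpose_apply]
  rw [h1, mul_assoc] at hG
  -- A one-sided inverse of a square matrix over a commutative ring is two-sided, so the matrix of
  -- the frame itself has a left inverse.
  have h2 := mul_eq_one_comm.1 hG
  have h3 : (Matrix.of b).mulVec (η.mulVec w) = 0 := by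
    funext i
    have := hw i
    rw [mink_eq_dotProduct] at this
    exact this
  have h4 : η.mulVec w = 0 := by
    rw [← Matrix.one_mulVec (η.mulVec w), ← h2, ← Matrix.mulVec_mulVec, h3, Matrix.mulVec_zero]
  rw [← Matrix.one_mulVec w, ← hηη, ← Matrix.mulVec_mulVec, h4, Matrix.mulVec_zero]

variable [Algebra ℂ R]

/-- A derivation applied to each component of a vector. -/
def vd (D : Derivation ℂ R R) (v : Fin 5 → R) : Fin 5 → R := fun i => D (v i)

theorem derivation_mink (D : Derivation ℂ R R) (v w : Fin 5 → R) :
    D (mink v w) = mink (vd D v) w + mink v (vd D w) := by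
  simp only [mink, vd, map_add, map_neg, Derivation.leibniz, smul_eq_mul, Fin.sum_univ_four]
  ring

theorem vd_add (D : Derivation ℂ R R) (v w : Fin 5 → R) : vd D (v + w) = vd D v + vd D w := by
  funext i; simp [vd]

theorem vd_sub (D : Derivation ℂ R R) (v w : Fin 5 → R) : vd D (v - w) = vd D v - vd D w := by
  funext i; simp [vd]

theorem vd_smul (D : Derivation ℂ R R) (c : R) (v : Fin 5 → R) :
    vd D (c • v) = D c • v + c • vd D v := by
  funext i; simp [vd]; ring

/-- A ring of germs has zero divisors, so factors of two are cancelled as units throughout. -/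
theorem isUnit_two_of_algebra : IsUnit (2 : R) := by
  have h : IsUnit (algebraMap ℂ R 2) := (IsUnit.mk0 (2 : ℂ) two_ne_zero).map _
  rwa [map_ofNat] at h

/-- The equations satisfied by the canonical lift `Y` and the conformal Gauss map `ξ` of a
conformal surface in the three-sphere; `D` and `D'` stand for `∂/∂z` and `∂/∂z̄`. -/
structure ConformalFrame (D D' : Derivation ℂ R R) (Y ξ : Fin 5 → R) : Prop where
  comm : ∀ a, D (D' a) = D' (D a)
  YY : mink Y Y = 0
  dYdY : mink (vd D Y) (vd D Y) = 0
  bYbY : mink (vd D' Y) (vd D' Y) = 0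
  dYbY : 2 * mink (vd D Y) (vd D' Y) = 1
  ξξ : mink ξ ξ = 1
  ξY : mink ξ Y = 0
  ξdY : mink ξ (vd D Y) = 0
  ξbY : mink ξ (vd D' Y) = 0
  ξdbY : mink ξ (vd D (vd D' Y)) = 0

namespace ConformalFrame

variable {D D' : Derivation ℂ R R} {Y ξ : Fin 5 → R}

theorem vcomm (h : ConformalFrame D D' Y ξ) (v : Fin 5 → R) : vd D (vd D' v) = vd D' (vd D v) := by
  funext i; exact h.comm _

theorem symm (h : ConformalFrame D D' Y ξ) : ConformalFrame D' D Y ξ :=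
  ⟨fun a => (h.comm a).symm, h.YY, h.bYbY, h.dYdY, by rw [mink_comm]; exact h.dYbY, h.ξξ, h.ξY,
    h.ξbY, h.ξdY, by rw [← h.vcomm]; exact h.ξdbY⟩

end ConformalFrame

/-- The null vector `N` of the frame. -/
def frameN (D D' : Derivation ℂ R R) (Y : Fin 5 → R) : Fin 5 → R :=
  (2 : R) • vd D' (vd D Y) + (2 * mink (vd D' (vd D Y)) (vd D' (vd D Y))) • Y

/-- The coefficient `k` of the Hopfian, `κ = k ξ`. -/
def frameK (D : Derivation ℂ R R) (Y ξ : Fin 5 → R) : R := mink (vd D (vd D Y)) ξ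

/-- Half of the Schwarzian. -/
def frameP (D D' : Derivation ℂ R R) (Y : Fin 5 → R) : R :=
  mink (vd D (vd D Y)) (frameN D D' Y)

namespace ConformalFrame

variable {D D' : Derivation ℂ R R} {Y ξ : Fin 5 → R}

theorem frameN_symm (h : ConformalFrame D D' Y ξ) : frameN D' D Y = frameN D D' Y := by
  simp only [frameN, h.vcomm]

theorem YdY (h : ConformalFrame D D' Y ξ) : mink Y (vd D Y) = 0 := by
  have := congrArg D h.YY
  rw [derivation_mink, map_zero, mink_comm (vd D Y) Y, ← two_mul] at this
  exact (isUnit_two_of_algebra.mul_right_eq_zero).1 this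

theorem YbY (h : ConformalFrame D D' Y ξ) : mink Y (vd D' Y) = 0 := h.symm.YdY

theorem YddY (h : ConformalFrame D D' Y ξ) : mink Y (vd D (vd D Y)) = 0 := by
  have := congrArg D h.YdY
  rw [derivation_mink, map_zero, h.dYdY, zero_add] at this
  exact this

theorem YbdY (h : ConformalFrame D D' Y ξ) : 2 * mink Y (vd D' (vd D Y)) = -1 := by
  have := congrArg D' h.YdY
  rw [derivation_mink, map_zero, mink_comm (vd D' Y)] at this
  linear_combination 2 * this - h.dYbY

theorem dYddY (h : ConformalFrame D D' Y ξ) : mink (vd D Y) (vd D (vd D Y)) = 0 := by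
  have := congrArg D h.dYdY
  rw [derivation_mink, map_zero, mink_comm (vd D (vd D Y)), ← two_mul] at this
  exact (isUnit_two_of_algebra.mul_right_eq_zero).1 this

theorem dYbdY (h : ConformalFrame D D' Y ξ) : mink (vd D Y) (vd D' (vd D Y)) = 0 := by
  have := congrArg D' h.dYdY
  rw [derivation_mink, map_zero, mink_comm (vd D' (vd D Y)), ← two_mul] at this
  exact (isUnit_two_of_algebra.mul_right_eq_zero).1 this

theorem bYbdY (h : ConformalFrame D D' Y ξ) : mink (vd D' Y) (vd D' (vd D Y)) = 0 := by
  rw [← h.vcomm]; exact h.symm.dYbdY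

theorem bYddY (h : ConformalFrame D D' Y ξ) : mink (vd D' Y) (vd D (vd D Y)) = 0 := by
  have := congrArg D h.dYbY
  rw [Derivation.leibniz, derivation_mink, mink_comm (vd D (vd D Y)), h.vcomm, h.dYbdY] at this
  have h2 : D (2 : R) = 0 := by simpa using D.map_natCast 2
  rw [h2, D.map_one_eq_zero, smul_zero, add_zero, smul_eq_mul, add_zero] at this
  exact (isUnit_two_of_algebra.mul_right_eq_zero).1 this

theorem YN (h : ConformalFrame D D' Y ξ) : mink Y (frameN D D' Y) = -1 := by
  rw [frameN, mink_add_right, mink_smul_right, mink_smul_right, h.YY, h.YbdY]; ring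

theorem dYN (h : ConformalFrame D D' Y ξ) : mink (vd D Y) (frameN D D' Y) = 0 := by
  rw [frameN, mink_add_right, mink_smul_right, mink_smul_right, mink_comm _ Y, h.YdY, h.dYbdY]; ring

theorem bYN (h : ConformalFrame D D' Y ξ) : mink (vd D' Y) (frameN D D' Y) = 0 := by
  rw [← h.frameN_symm]; exact h.symm.dYN

theorem ξN (h : ConformalFrame D D' Y ξ) : mink ξ (frameN D D' Y) = 0 := by
  rw [frameN, mink_add_right, mink_smul_right, mink_smul_right, h.ξY, ← h.vcomm, h.ξdbY]; ring

theorem NN (h : ConformalFrame D D' Y ξ) : mink (frameN D D' Y) (frameN D D' Y) = 0 := by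
  have h1 := h.YbdY
  simp only [frameN, mink_add_right, mink_smul_right, mink_add_left, mink_smul_left, h.YY,
    mink_comm _ Y]
  set m := mink (vd D' (vd D Y)) (vd D' (vd D Y))
  linear_combination (4 * m) * h1

/-- The Gram matrix of Y, N, Y_z, Y_z̄, ξ consists of two hyperbolic blocks and an entry 1; its
inverse is the matrix displayed in the proof. The expansions of Y_zz and ξ_z below are found by
comparing products with this frame. -/
theorem ext (h : ConformalFrame D D' Y ξ) {v w : Fin 5 → R} (h1 : mink Y v = mink Y w)
    (h2 : mink (vd D Y) v = mink (vd D Y) w) (h3 : mink (vd D' Y) v = mink (vd D' Y) w)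
    (h4 : mink (frameN D D' Y) v = mink (frameN D D' Y) w) (h5 : mink ξ v = mink ξ w) :
    v = w := by
  rw [← sub_eq_zero]
  refine eq_zero_of_mink_eq_zero ![Y, frameN D D' Y, vd D Y, vd D' Y, ξ]
    (!![0, -1, 0, 0, 0; -1, 0, 0, 0, 0; 0, 0, 0, 2, 0; 0, 0, 2, 0, 0; 0, 0, 0, 0, 1]) ?_ ?_
  · have e1 := h.YN
    have e2 := h.dYbY
    have e3 : mink (vd D Y) (vd D' Y) * 2 = 1 := by rw [mul_comm]; exact e2
    have e4 : mink (vd D' Y) (vd D Y) * 2 = 1 := by rw [mink_comm]; exact e3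
    have e5 : mink (frameN D D' Y) Y = -1 := by rw [mink_comm]; exact e1
    have z1 := h.YdY
    have z2 := h.YbY
    have z3 := h.ξY
    have z4 := h.dYN
    have z5 := h.bYN
    have z6 := h.ξN
    have z7 := h.ξdY
    have z8 := h.ξbY
    have y1 := z1; rw [mink_comm] at y1
    have y2 := z2; rw [mink_comm] at y2
    have y3 := z3; rw [mink_comm] at y3
    have y4 := z4; rw [mink_comm] at y4
    have y5 := z5; rw [mink_comm] at y5
    have y6 := z6; rw [mink_comm] at y6
    have y7 := z7; rw [mink_comm] at y7
    have y8 := z8; rw [mink_comm] at y8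
    ext i j
    fin_cases i <;> fin_cases j <;>
      simp [Matrix.mul_apply, Fin.sum_univ_five, e1, e3, e4, e5, h.NN, h.YY, h.dYdY, h.bYbY, h.ξξ,
        z1, z2, z3, z4, z5, z6, z7, z8, y1, y2, y3, y4, y5, y6, y7, y8]
  · intro i
    rw [mink_sub_right, sub_eq_zero]
    fin_cases i
    exacts [h1, h4, h2, h3, h5]

/-- Since Y_zz is orthogonal to Y, Y_z and Y_z̄, its components along the dual vectors N, Y_z̄ and
Y_z vanish. -/
theorem ddY (h : ConformalFrame D D' Y ξ) :
    vd D (vd D Y) = -frameP D D' Y • Y + frameK D Y ξ • ξ := by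
  apply h.ext <;>
    simp only [mink_add_right, mink_smul_right, h.YY, h.YddY, h.dYddY, h.bYddY, mink_comm Y ξ, h.ξY,
      mink_comm (vd D Y) Y, mink_comm (vd D' Y) Y, mink_comm (vd D Y) ξ, mink_comm (vd D' Y) ξ,
      h.YdY, h.YbY, h.ξdY, h.ξbY, mink_comm (frameN D D' Y) Y, mink_comm (frameN D D' Y) ξ, h.ξN,
      h.YN, h.ξξ]
  · ring
  · ring
  · ring
  · rw [frameP, mink_comm]; ring
  · rw [frameK, mink_comm]; ring

theorem bbY (h : ConformalFrame D D' Y ξ) :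
    vd D' (vd D' Y) = -frameP D' D Y • Y + frameK D' Y ξ • ξ := h.symm.ddY

end ConformalFrame

end Algebra

/-! ### Integrability conditions and Bryant's quartic differential. -/

section Algebra

variable {R : Type*} [CommRing R]

theorem two_smul_bdY [Algebra ℂ R] (D D' : Derivation ℂ R R) (Y : Fin 5 → R) :
    (2 : R) • vd D' (vd D Y) =
      frameN D D' Y - (2 * mink (vd D' (vd D Y)) (vd D' (vd D Y))) • Y := by
  rw [frameN]; abel

variable [Algebra ℂ R]

theorem derivation_two (D : Derivation ℂ R R) : D (2 : R) = 0 := by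
  simpa using D.map_natCast 2

namespace ConformalFrame

variable {D D' : Derivation ℂ R R} {Y ξ : Fin 5 → R}

theorem ξdξ (h : ConformalFrame D D' Y ξ) : mink ξ (vd D ξ) = 0 := by
  have := congrArg D h.ξξ
  rw [derivation_mink, D.map_one_eq_zero, mink_comm (vd D ξ) ξ, ← two_mul] at this
  exact (isUnit_two_of_algebra.mul_right_eq_zero).1 this

theorem Ydξ (h : ConformalFrame D D' Y ξ) : mink Y (vd D ξ) = 0 := by
  have := congrArg D h.ξY
  rw [derivation_mink, map_zero, h.ξdY, add_zero, mink_comm] at this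
  exact this

theorem dYdξ (h : ConformalFrame D D' Y ξ) : mink (vd D Y) (vd D ξ) = -frameK D Y ξ := by
  have := congrArg D h.ξdY
  rw [derivation_mink, map_zero, mink_comm, mink_comm ξ] at this
  rw [frameK]; linear_combination this

theorem bYdξ (h : ConformalFrame D D' Y ξ) : mink (vd D' Y) (vd D ξ) = 0 := by
  have := congrArg D h.ξbY
  rw [derivation_mink, map_zero, mink_comm, h.ξdbY, add_zero] at this
  exact this

/-- The equality of mixed derivatives `∂̄ Y_zz = ∂ Y_zz̄`. -/
theorem mixed (h : ConformalFrame D D' Y ξ) :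
    (2 : R) • (-D' (frameP D D' Y) • Y - frameP D D' Y • vd D' Y + D' (frameK D Y ξ) • ξ +
      frameK D Y ξ • vd D' ξ) = vd D (frameN D D' Y) -
        (D (2 * mink (vd D' (vd D Y)) (vd D' (vd D Y))) • Y +
          (2 * mink (vd D' (vd D Y)) (vd D' (vd D Y))) • vd D Y) := by
  have h1 := congrArg (vd D') h.ddY
  have h2 := congrArg (vd D) (two_smul_bdY D D' Y)
  rw [vd_smul, derivation_two, zero_smul, zero_add, vd_sub, vd_smul, h.vcomm, h1, vd_add, vd_smul,
    vd_smul, map_neg] at h2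
  rw [← h2, neg_smul (frameP D D' Y)]
  congr 1
  abel

/-- Codazzi: pairing `mixed` with ξ gives ⟨ξ, N_z⟩ = 2k_z̄, and differentiating ⟨ξ, N⟩ = 0 moves the
derivative onto ξ. -/
theorem Nξ_deriv (h : ConformalFrame D D' Y ξ) :
    mink (frameN D D' Y) (vd D ξ) = -(2 * D' (frameK D Y ξ)) := by
  have h1 := congrArg (mink ξ) h.mixed
  have h2 := congrArg D h.ξN
  rw [derivation_mink, map_zero, mink_comm] at h2
  simp only [mink_add_right, mink_sub_right, mink_smul_right, h.ξY, h.ξbY, h.ξdY, h.ξξ,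
    h.symm.ξdξ] at h1
  linear_combination h2 + h1

/-- This is the pairing of `mixed` with Y_z̄. With m the left side, ⟨N, Y_zz̄⟩ = m, hence ⟨Y_z̄,
N_z⟩ = −m, and the pairing reads −2kk̄ = −2m. -/
theorem bdY_sq (h : ConformalFrame D D' Y ξ) :
    mink (vd D' (vd D Y)) (vd D' (vd D Y)) = frameK D Y ξ * frameK D' Y ξ := by
  have h1 := congrArg (mink (vd D' Y)) h.mixed
  have h2 := congrArg D h.bYN
  have h3 := congrArg (mink (frameN D D' Y)) (two_smul_bdY D D' Y)
  rw [derivation_mink, map_zero, h.vcomm, mink_comm] at h2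
  simp only [mink_sub_right, mink_smul_right, h.NN, mink_comm (frameN D D' Y) Y, h.YN] at h3
  simp only [mink_add_right, mink_sub_right, mink_smul_right, mink_comm (vd D' Y) Y, h.YbY, h.bYbY,
    mink_comm (vd D' Y) ξ, h.ξbY, mink_comm (vd D' Y) (vd D Y), h.symm.dYdξ] at h1
  refine isUnit_two_of_algebra.mul_left_cancel (isUnit_two_of_algebra.mul_left_cancel ?_)
  set m := mink (vd D' (vd D Y)) (vd D' (vd D Y))
  linear_combination 2 * h2 + 2 * h1 - h3 - 2 * m * h.dYbY

/-- The pairing of `mixed` with N, where ⟨N, N_z⟩ = 0 because N is null: the Gauss equation for the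
Schwarzian. -/
theorem gauss (h : ConformalFrame D D' Y ξ) :
    D' (frameP D D' Y) =
      3 * frameK D Y ξ * D (frameK D' Y ξ) + D (frameK D Y ξ) * frameK D' Y ξ := by
  have h1 := congrArg (mink (frameN D D' Y)) h.mixed
  have h2 := congrArg D h.NN
  have h3 := h.symm.Nξ_deriv
  rw [h.frameN_symm] at h3
  rw [derivation_mink, map_zero, mink_comm, ← two_mul] at h2
  rw [isUnit_two_of_algebra.mul_right_eq_zero] at h2
  simp only [mink_add_right, mink_sub_right, mink_smul_right, mink_comm (frameN D D' Y) Y, h.YN,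
    mink_comm (frameN D D' Y) ξ, h.ξN, mink_comm (frameN D D' Y) (vd D Y), h.dYN,
    mink_comm (frameN D D' Y) (vd D' Y), h.bYN, h3, h2, h.bdY_sq, Derivation.leibniz, smul_eq_mul,
    derivation_two] at h1
  refine isUnit_two_of_algebra.mul_left_cancel ?_
  linear_combination h1

theorem dξ (h : ConformalFrame D D' Y ξ) :
    vd D ξ = (2 * D' (frameK D Y ξ)) • Y - (2 * frameK D Y ξ) • vd D' Y := by
  apply h.ext <;>
    simp only [mink_sub_right, mink_smul_right, h.YY, h.Ydξ, h.dYdξ, h.bYdξ, h.Nξ_deriv, h.ξdξ,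
      h.YbY, mink_comm (vd D Y) Y, h.YdY, h.bYbY, mink_comm (vd D' Y) Y,
      mink_comm (frameN D D' Y) Y, h.YN, mink_comm (frameN D D' Y) (vd D' Y), h.bYN, h.ξY, h.ξbY]
  · ring
  · linear_combination frameK D Y ξ * h.dYbY
  · ring
  · ring
  · ring

/-- The invariant form of the Willmore equation: the coefficient of `Y` in `ξ_{zz̄}`. -/
theorem bdξ (h : ConformalFrame D D' Y ξ) :
    vd D' (vd D ξ) =
      (2 * (D' (D' (frameK D Y ξ)) + frameP D' D Y * frameK D Y ξ)) • Y -
        (2 * (frameK D Y ξ * frameK D' Y ξ)) • ξ := by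
  rw [h.dξ, vd_sub, vd_smul, vd_smul, h.bbY]
  simp only [Derivation.leibniz, derivation_two, smul_eq_mul]
  funext i
  simp only [Pi.add_apply, Pi.sub_apply, Pi.smul_apply, smul_eq_mul]
  ring

/-- By `dξ` the vector ξ_z lies in the isotropic span of Y and Y_z̄; in other words the conformal
Gauss map is conformal. -/
theorem dξdξ (h : ConformalFrame D D' Y ξ) : mink (vd D ξ) (vd D ξ) = 0 := by
  rw [h.dξ]
  simp only [mink_sub_left, mink_sub_right, mink_smul_left, mink_smul_right, h.YY,
    mink_comm (vd D' Y) Y, h.YbY, h.bYbY]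
  ring

/-- The coefficient of Bryant's quartic differential. -/
theorem ddξ_sq (h : ConformalFrame D D' Y ξ) :
    mink (vd D (vd D ξ)) (vd D (vd D ξ)) =
      4 * (frameK D Y ξ * D (D' (frameK D Y ξ)) - D (frameK D Y ξ) * D' (frameK D Y ξ) +
        frameK D Y ξ ^ 3 * frameK D' Y ξ) := by
  -- In the null frame only the pairs Y, N and Y_z, Y_z̄ contribute to the square.
  have h1 : vd D (vd D ξ) = (2 * D (D' (frameK D Y ξ)) +
      2 * frameK D Y ξ * (frameK D Y ξ * frameK D' Y ξ)) • Y + (2 * D' (frameK D Y ξ)) • vd D Y -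
      (2 * D (frameK D Y ξ)) • vd D' Y - frameK D Y ξ • frameN D D' Y := by
    have h2 := two_smul_bdY D D' Y
    rw [h.bdY_sq, eq_sub_iff_add_eq] at h2
    rw [h.dξ, vd_sub, vd_smul, vd_smul, ← h2, h.vcomm]
    simp only [Derivation.leibniz, derivation_two, smul_eq_mul]
    funext i
    simp only [Pi.add_apply, Pi.sub_apply, Pi.smul_apply, smul_eq_mul]
    ring
  rw [h1]
  simp only [mink_add_left, mink_sub_left, mink_add_right, mink_sub_right, mink_smul_left,
    mink_smul_right, h.YY, h.YdY, h.YbY, h.YN, mink_comm _ Y, h.dYdY, h.bYbY, h.dYN, h.bYN,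
    mink_comm (frameN D D' Y) _, h.NN, mink_comm (vd D' Y) (vd D Y)]
  linear_combination (-4 * D (frameK D Y ξ) * D' (frameK D Y ξ)) * h.dYbY

/-- With E = k_z̄z̄ + (s̄/2)k, the z̄-derivative of the quartic coefficient equals k E_z − k_z E,
once the z-derivative of s̄/2 is eliminated by the conjugate of `gauss`. -/
theorem bryant_holomorphic (h : ConformalFrame D D' Y ξ)
    (hE : D' (D' (frameK D Y ξ)) + frameP D' D Y * frameK D Y ξ = 0) :
    D' (frameK D Y ξ * D (D' (frameK D Y ξ)) - D (frameK D Y ξ) * D' (frameK D Y ξ) +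
        frameK D Y ξ ^ 3 * frameK D' Y ξ) = 0 := by
  have h1 := congrArg D hE
  have h2 := h.symm.gauss
  rw [map_zero, map_add, Derivation.leibniz, h2] at h1
  simp only [map_add, map_sub, Derivation.leibniz, Derivation.leibniz_pow, smul_eq_mul,
    nsmul_eq_mul, ← h.comm] at h1 ⊢
  push_cast
  linear_combination frameK D Y ξ * h1 - D (frameK D Y ξ) * hE

end ConformalFrame

end Algebra

open Filter Topology

/-! ### Germs of smooth functions on the plane -/

/-- The functions that are smooth at `z`. -/
def smoothAt (z : ℂ) : Subalgebra ℂ (ℂ → ℂ) where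
  carrier := {f | ContDiffAt ℝ ∞ f z}
  mul_mem' {f g} (hf : ContDiffAt ℝ ∞ f z) (hg : ContDiffAt ℝ ∞ g z) := hf.mul hg
  add_mem' {f g} (hf : ContDiffAt ℝ ∞ f z) (hg : ContDiffAt ℝ ∞ g z) := hf.add hg
  algebraMap_mem' c := (contDiffAt_const : ContDiffAt ℝ ∞ (fun _ : ℂ => c) z)

/-- The functions that vanish near `z`. -/
def vanishingNear (z : ℂ) : Ideal (smoothAt z) where
  carrier := {f | (f : ℂ → ℂ) =ᶠ[𝓝 z] 0}
  add_mem' {f g} hf hg := by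
    have := Filter.EventuallyEq.add hf hg
    simpa using this
  zero_mem' := EventuallyEq.rfl
  smul_mem' c f hf := by
    have hf' : (f : ℂ → ℂ) =ᶠ[𝓝 z] 0 := hf
    have := (EventuallyEq.refl (𝓝 z) (c : ℂ → ℂ)).mul hf'
    simpa using this

/-- The ring of germs at `z` of smooth functions. -/
def SmoothGerm (z : ℂ) : Type := smoothAt z ⧸ vanishingNear z

namespace SmoothGerm

instance (z : ℂ) : CommRing (SmoothGerm z) := inferInstanceAs (CommRing (smoothAt z ⧸ vanishingNear z))

instance (z : ℂ) : Algebra ℂ (SmoothGerm z) :=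
  inferInstanceAs (Algebra ℂ (smoothAt z ⧸ vanishingNear z))

/-- A function that is smooth at `z`, as an element of the algebra of such functions. -/
def bundle {z : ℂ} {f : ℂ → ℂ} (hf : ContDiffAt ℝ ∞ f z) : smoothAt z := ⟨f, hf⟩

open Classical in
/-- The germ of a function that is smooth at `z`; zero if the function is not smooth. -/
def germ (z : ℂ) (f : ℂ → ℂ) : SmoothGerm z :=
  if h : ContDiffAt ℝ ∞ f z then Ideal.Quotient.mk (vanishingNear z) (bundle h) else 0

variable {z : ℂ} {f g : ℂ → ℂ}

theorem germ_of (hf : ContDiffAt ℝ ∞ f z) :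
    germ z f = Ideal.Quotient.mk (vanishingNear z) (bundle hf) := dif_pos hf

theorem germ_eq_iff (hf : ContDiffAt ℝ ∞ f z) (hg : ContDiffAt ℝ ∞ g z) :
    germ z f = germ z g ↔ f =ᶠ[𝓝 z] g := by
  rw [germ_of hf, germ_of hg]
  exact Ideal.Quotient.eq.trans (eventuallyEq_iff_sub (f := f) (g := g)).symm

theorem germ_congr (hf : ContDiffAt ℝ ∞ f z) (h : f =ᶠ[𝓝 z] g) : germ z f = germ z g :=
  (germ_eq_iff hf (hf.congr_of_eventuallyEq h.symm)).2 h

theorem exists_rep (a : SmoothGerm z) : ∃ f, ContDiffAt ℝ ∞ f z ∧ germ z f = a := by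
  obtain ⟨⟨f, hf⟩, rfl⟩ := Ideal.Quotient.mk_surjective a
  exact ⟨f, hf, germ_of hf⟩

theorem germ_add (hf : ContDiffAt ℝ ∞ f z) (hg : ContDiffAt ℝ ∞ g z) :
    germ z (fun w => f w + g w) = germ z f + germ z g := by
  rw [germ_of hf, germ_of hg, germ_of (hf.add hg)]
  exact map_add (Ideal.Quotient.mk (vanishingNear z)) (bundle hf) (bundle hg)

theorem germ_sub (hf : ContDiffAt ℝ ∞ f z) (hg : ContDiffAt ℝ ∞ g z) :
    germ z (fun w => f w - g w) = germ z f - germ z g := by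
  rw [germ_of hf, germ_of hg, germ_of (hf.sub hg)]
  exact map_sub (Ideal.Quotient.mk (vanishingNear z)) (bundle hf) (bundle hg)

theorem germ_neg (hf : ContDiffAt ℝ ∞ f z) : germ z (fun w => -f w) = -germ z f := by
  
  rw [germ_of hf, germ_of hf.neg]
  exact map_neg (Ideal.Quotient.mk (vanishingNear z)) (bundle hf)

theorem germ_mul (hf : ContDiffAt ℝ ∞ f z) (hg : ContDiffAt ℝ ∞ g z) :
    germ z (fun w => f w * g w) = germ z f * germ z g := by
  rw [germ_of hf, germ_of hg, germ_of (hf.mul hg)]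
  exact map_mul (Ideal.Quotient.mk (vanishingNear z)) (bundle hf) (bundle hg)

theorem germ_pow (hf : ContDiffAt ℝ ∞ f z) (n : ℕ) :
    germ z (fun w => f w ^ n) = germ z f ^ n := by
  rw [germ_of hf, germ_of (hf.pow n)]
  exact map_pow (Ideal.Quotient.mk (vanishingNear z)) (bundle hf) n

theorem germ_const (c : ℂ) : germ z (fun _ => c) = algebraMap ℂ (SmoothGerm z) c := by
  rw [germ_of contDiffAt_const]; rfl

theorem germ_zero : germ z (fun _ => 0) = 0 := by rw [germ_const, map_zero]

theorem germ_one : germ z (fun _ => 1) = 1 := by rw [germ_const, map_one]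

theorem germ_ofNat (n : ℕ) [n.AtLeastTwo] :
    germ z (fun _ => (OfNat.ofNat n : ℂ)) = OfNat.ofNat n := by rw [germ_const, map_ofNat]

theorem germ_sum {ι : Type*} (s : Finset ι) (F : ι → ℂ → ℂ) (hF : ∀ i ∈ s, ContDiffAt ℝ ∞ (F i) z) :
    germ z (fun w => ∑ i ∈ s, F i w) = ∑ i ∈ s, germ z (F i) := by
  classical
  induction s using Finset.induction_on with
  | empty => simp [germ_zero]
  | insert a s ha ih =>
    simp only [Finset.sum_insert ha]
    rw [germ_add (hF a (by simp)) (ContDiffAt.sum fun i hi => hF i (by simp [hi])),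
      ih fun i hi => hF i (by simp [hi])]

theorem one_le_infty : (1 : WithTop ℕ∞) ≤ ∞ := WithTop.coe_le_coe.2 le_top

theorem two_le_infty : (2 : WithTop ℕ∞) ≤ ∞ := WithTop.coe_le_coe.2 (le_top : (2 : ℕ∞) ≤ ⊤)

theorem smooth_fderiv_apply {E : Type*} [NormedAddCommGroup E] [NormedSpace ℝ E] {f : ℂ → E}
    (hf : ContDiffAt ℝ ∞ f z) (v : ℂ) : ContDiffAt ℝ ∞ (fun w => fderiv ℝ f w v) z :=
  ContDiffAt.clm_apply (hf.fderiv_right (m := ∞) (by simp)) contDiffAt_const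

theorem eventually_differentiableAt {E : Type*} [NormedAddCommGroup E] [NormedSpace ℝ E] {f : ℂ → E}
    (hf : ContDiffAt ℝ ∞ f z) : ∀ᶠ w in 𝓝 z, DifferentiableAt ℝ f w := by
  have h1 : ContDiffAt ℝ 1 f z := hf.of_le one_le_infty
  filter_upwards [h1.eventually (by simp)] with w hw
  exact hw.differentiableAt (by simp)

/-- The directional derivative of a germ. -/
def derivFun (v : ℂ) (a : SmoothGerm z) : SmoothGerm z :=
  germ z fun w => fderiv ℝ (exists_rep a).choose w v

/-- Functions that agree near z have derivatives that agree near z, so the representative chosen in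
`derivFun` is immaterial. -/
theorem derivFun_germ (v : ℂ) (hf : ContDiffAt ℝ ∞ f z) :
    derivFun v (germ z f) = germ z fun w => fderiv ℝ f w v := by
  have h := (exists_rep (germ z f)).choose_spec
  have h1 := (germ_eq_iff h.1 hf).1 h.2
  refine germ_congr (smooth_fderiv_apply h.1 v) ?_
  filter_upwards [h1.fderiv (𝕜 := ℝ)] with w hw
  rw [hw]

/-- The directional derivative as a derivation on germs. -/
def pderiv (z v : ℂ) : Derivation ℂ (SmoothGerm z) (SmoothGerm z) where
  toFun := derivFun v
  map_add' a b := by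
    obtain ⟨f, hf, rfl⟩ := exists_rep a
    obtain ⟨g, hg, rfl⟩ := exists_rep b
    rw [← germ_add hf hg, derivFun_germ v hf, derivFun_germ v hg, derivFun_germ v (hf.add hg),
      ← germ_add (smooth_fderiv_apply hf v) (smooth_fderiv_apply hg v)]
    refine germ_congr (smooth_fderiv_apply (hf.add hg) v) ?_
    filter_upwards [eventually_differentiableAt hf, eventually_differentiableAt hg] with w h1 h2
    rw [fderiv_fun_add h1 h2]; rfl
  map_smul' c a := by
    obtain ⟨f, hf, rfl⟩ := exists_rep a
    rw [RingHom.id_apply, Algebra.smul_def, Algebra.smul_def, ← germ_const, derivFun_germ v hf,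
      ← germ_mul contDiffAt_const hf, derivFun_germ v (contDiffAt_const.mul hf),
      ← germ_mul contDiffAt_const (smooth_fderiv_apply hf v)]
    refine germ_congr (smooth_fderiv_apply (contDiffAt_const.mul hf) v) ?_
    filter_upwards [eventually_differentiableAt hf] with w h1
    rw [fderiv_const_mul h1]; rfl
  map_one_eq_zero' := by
    change derivFun v 1 = 0
    rw [← germ_one, derivFun_germ v contDiffAt_const, ← germ_zero]
    congr 1
    funext w
    simp
  leibniz' a b := by
    obtain ⟨f, hf, rfl⟩ := exists_rep a
    obtain ⟨g, hg, rfl⟩ := exists_rep b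
    change derivFun v _ = _ • derivFun v _ + _ • derivFun v _
    rw [← germ_mul hf hg, derivFun_germ v hf, derivFun_germ v hg, derivFun_germ v (hf.mul hg),
      smul_eq_mul, smul_eq_mul, ← germ_mul hf (smooth_fderiv_apply hg v),
      ← germ_mul hg (smooth_fderiv_apply hf v),
      ← germ_add (hf.mul (smooth_fderiv_apply hg v)) (hg.mul (smooth_fderiv_apply hf v))]
    refine germ_congr (smooth_fderiv_apply (hf.mul hg) v) ?_
    filter_upwards [eventually_differentiableAt hf, eventually_differentiableAt hg] with w h1 h2
    rw [fderiv_fun_mul h1 h2]; rfl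

theorem pderiv_germ (v : ℂ) (hf : ContDiffAt ℝ ∞ f z) :
    pderiv z v (germ z f) = germ z fun w => fderiv ℝ f w v := derivFun_germ v hf

theorem pderiv_comm (u v : ℂ) (a : SmoothGerm z) :
    pderiv z u (pderiv z v a) = pderiv z v (pderiv z u a) := by
  obtain ⟨f, hf, rfl⟩ := exists_rep a
  rw [pderiv_germ v hf, pderiv_germ u hf, pderiv_germ u (smooth_fderiv_apply hf v),
    pderiv_germ v (smooth_fderiv_apply hf u)]
  refine germ_congr (smooth_fderiv_apply (smooth_fderiv_apply hf v) u) ?_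
  have h2 : ContDiffAt ℝ 2 f z := hf.of_le (two_le_infty)
  filter_upwards [h2.eventually (by simp)] with w hw
  have h3 : DifferentiableAt ℝ (fderiv ℝ f) w :=
    (hw.fderiv_right (m := 1) (by norm_num)).differentiableAt (by simp)
  rw [fderiv_clm_apply h3 (by fun_prop), fderiv_clm_apply h3 (by fun_prop)]
  have h4 := hw.isSymmSndFDerivAt (by simp)
  simpa using h4 u v

/-- `∂/∂z` on germs. -/
def del (z : ℂ) : Derivation ℂ (SmoothGerm z) (SmoothGerm z) :=
  (1 / 2 : ℂ) • (pderiv z 1 - Complex.I • pderiv z Complex.I)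

/-- `∂/∂z̄` on germs. -/
def delbar (z : ℂ) : Derivation ℂ (SmoothGerm z) (SmoothGerm z) :=
  (1 / 2 : ℂ) • (pderiv z 1 + Complex.I • pderiv z Complex.I)

theorem smooth_dz {V : Type*} [NormedAddCommGroup V] [NormedSpace ℂ V] {f : ℂ → V}
    (hf : ContDiffAt ℝ ∞ f z) : ContDiffAt ℝ ∞ (dz f) z :=
  ((smooth_fderiv_apply hf _).sub ((smooth_fderiv_apply hf _).const_smul Complex.I)).const_smul
    (1 / 2 : ℂ)

theorem smooth_dzbar {V : Type*} [NormedAddCommGroup V] [NormedSpace ℂ V] {f : ℂ → V}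
    (hf : ContDiffAt ℝ ∞ f z) : ContDiffAt ℝ ∞ (dzbar f) z :=
  ((smooth_fderiv_apply hf _).add ((smooth_fderiv_apply hf _).const_smul Complex.I)).const_smul
    (1 / 2 : ℂ)

theorem germ_smul (c : ℂ) (hf : ContDiffAt ℝ ∞ f z) : germ z (fun w => c • f w) = c • germ z f := by
  rw [Algebra.smul_def, ← germ_const, ← germ_mul contDiffAt_const hf]; rfl

theorem del_germ (hf : ContDiffAt ℝ ∞ f z) : del z (germ z f) = germ z (dz f) := by
  have h1 := smooth_fderiv_apply hf 1
  have h2 := smooth_fderiv_apply hf Complex.I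
  simp only [del, Derivation.smul_apply, Derivation.sub_apply, pderiv_germ _ hf]
  rw [← germ_smul _ h2, ← germ_sub h1 (h2.const_smul Complex.I),
    ← germ_smul _ (h1.sub (h2.const_smul Complex.I))]
  rfl

theorem delbar_germ (hf : ContDiffAt ℝ ∞ f z) : delbar z (germ z f) = germ z (dzbar f) := by
  have h1 := smooth_fderiv_apply hf 1
  have h2 := smooth_fderiv_apply hf Complex.I
  simp only [delbar, Derivation.smul_apply, Derivation.add_apply, pderiv_germ _ hf]
  rw [← germ_smul _ h2, ← germ_add h1 (h2.const_smul Complex.I),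
    ← germ_smul _ (h1.add (h2.const_smul Complex.I))]
  rfl

theorem del_delbar_comm (a : SmoothGerm z) : del z (delbar z a) = delbar z (del z a) := by
  simp only [del, delbar, Derivation.smul_apply, Derivation.add_apply, Derivation.sub_apply,
    map_add, map_sub, Derivation.map_smul, pderiv_comm Complex.I 1]
  module

/-- Evaluation of germs. -/
theorem germ_eq_apply (hf : ContDiffAt ℝ ∞ f z) (hg : ContDiffAt ℝ ∞ g z)
    (h : germ z f = germ z g) : f z = g z := ((germ_eq_iff hf hg).1 h).eq_of_nhds

theorem isUnit_germ (hf : ContDiffAt ℝ ∞ f z) (h : f z ≠ 0) : IsUnit (germ z f) := by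
  refine IsUnit.of_mul_eq_one (germ z fun w => (f w)⁻¹) ?_
  rw [← germ_mul (g := fun w => (f w)⁻¹) hf (hf.inv h), ← germ_one]
  refine germ_congr (hf.mul (hf.inv h)) ?_
  filter_upwards [hf.continuousAt.eventually_ne h] with w hw
  exact mul_inv_cancel₀ hw

/-- The vector of germs of the components of a vector-valued function. -/
def vgerm (z : ℂ) (F : ℂ → Fin 5 → ℂ) : Fin 5 → SmoothGerm z := fun i => germ z fun w => F w i

variable {F G : ℂ → Fin 5 → ℂ}

theorem smooth_apply (hF : ContDiffAt ℝ ∞ F z) (i : Fin 5) : ContDiffAt ℝ ∞ (fun w => F w i) z :=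
  contDiffAt_pi.1 hF i

theorem smooth_mink (hF : ContDiffAt ℝ ∞ F z) (hG : ContDiffAt ℝ ∞ G z) :
    ContDiffAt ℝ ∞ (fun w => mink (F w) (G w)) z :=
  ((smooth_apply hF 0).mul (smooth_apply hG 0)).neg.add
    (ContDiffAt.sum fun i _ => (smooth_apply hF i.succ).mul (smooth_apply hG i.succ))

theorem germ_mink (hF : ContDiffAt ℝ ∞ F z) (hG : ContDiffAt ℝ ∞ G z) :
    germ z (fun w => mink (F w) (G w)) = mink (vgerm z F) (vgerm z G) := by
  have h := fun i => (smooth_apply hF i).mul (smooth_apply hG i)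
  simp only [mink, vgerm]
  rw [germ_add (h 0).neg (ContDiffAt.sum fun i _ => h i.succ), germ_neg (h 0),
    germ_mul (smooth_apply hF 0) (smooth_apply hG 0), germ_sum _ _ fun i _ => h i.succ]
  congr 1
  refine Finset.sum_congr rfl fun i _ => ?_
  rw [germ_mul (smooth_apply hF _) (smooth_apply hG _)]

theorem dz_apply (hF : DifferentiableAt ℝ F z) (i : Fin 5) : dz F z i = dz (fun w => F w i) z := by
  simp only [dz, Pi.smul_apply, Pi.sub_apply, fderiv_apply hF, ContinuousLinearMap.comp_apply,
    ContinuousLinearMap.proj_apply]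

theorem dzbar_apply (hF : DifferentiableAt ℝ F z) (i : Fin 5) :
    dzbar F z i = dzbar (fun w => F w i) z := by
  simp only [dzbar, Pi.smul_apply, Pi.add_apply, fderiv_apply hF, ContinuousLinearMap.comp_apply,
    ContinuousLinearMap.proj_apply]

theorem vd_del_vgerm (hF : ContDiffAt ℝ ∞ F z) : vd (del z) (vgerm z F) = vgerm z (dz F) := by
  funext i
  simp only [vd, vgerm]
  rw [del_germ (smooth_apply hF i)]
  refine germ_congr (smooth_dz (smooth_apply hF i)) ?_
  filter_upwards [eventually_differentiableAt hF] with w hw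
  exact (dz_apply hw i).symm

theorem vd_delbar_vgerm (hF : ContDiffAt ℝ ∞ F z) :
    vd (delbar z) (vgerm z F) = vgerm z (dzbar F) := by
  funext i
  simp only [vd, vgerm]
  rw [delbar_germ (smooth_apply hF i)]
  refine germ_congr (smooth_dzbar (smooth_apply hF i)) ?_
  filter_upwards [eventually_differentiableAt hF] with w hw
  exact (dzbar_apply hw i).symm

end SmoothGerm

open SmoothGerm

/-! ### Conformal surfaces in the three-sphere -/

/-- Near `z`, the map `f` is a smooth conformal immersion into the unit sphere. -/
def ConfAt (f : ℂ → E4) (z : ℂ) : Prop :=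
  ∀ᶠ w in 𝓝 z, ContDiffAt ℝ ∞ f w ∧ ‖f w‖ = 1 ∧ ConformalAt f w

/-- The unit normal of a surface in the three-sphere. -/
def unitNormal (f : ℂ → E4) (z : ℂ) : E4 :=
  WithLp.toLp 2 fun i => normalComponent f z (EuclideanSpace.single i 1)

theorem inner_E4 (v w : E4) : inner ℝ v w = v 0 * w 0 + v 1 * w 1 + v 2 * w 2 + v 3 * w 3 := by
  simp [PiLp.inner_apply, Fin.sum_univ_four, mul_comm]

/-- The determinant of four vectors of `ℝ⁴`. -/
def det4 (a b c d : E4) : ℝ := Matrix.det (Matrix.of fun i j : Fin 4 => (![a, b, c, d] : Fin 4 → E4) i j)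

theorem det4_eq (a b c d : E4) : det4 a b c d =
    d 0 * (-(a 1 * (b 2 * c 3 - b 3 * c 2)) + a 2 * (b 1 * c 3 - b 3 * c 1) -
      a 3 * (b 1 * c 2 - b 2 * c 1)) +
    d 1 * (a 0 * (b 2 * c 3 - b 3 * c 2) - a 2 * (b 0 * c 3 - b 3 * c 0) +
      a 3 * (b 0 * c 2 - b 2 * c 0)) +
    d 2 * (-(a 0 * (b 1 * c 3 - b 3 * c 1)) + a 1 * (b 0 * c 3 - b 3 * c 0) -
      a 3 * (b 0 * c 1 - b 1 * c 0)) +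
    d 3 * (a 0 * (b 1 * c 2 - b 2 * c 1) - a 1 * (b 0 * c 2 - b 2 * c 0) +
      a 2 * (b 0 * c 1 - b 1 * c 0)) := by
  simp [det4, Matrix.det_succ_row_zero, Fin.sum_univ_succ, Fin.succAbove]
  ring

theorem normalComponent_eq_det4 (f : ℂ → E4) (z : ℂ) (w : E4) :
    normalComponent f z w = det4 (f z) (du f z) (dv f z) w / √(gramDet f z) := rfl

theorem normalComponent_eq_inner (f : ℂ → E4) (z : ℂ) (w : E4) :
    normalComponent f z w = inner ℝ (unitNormal f z) w := by
  rw [inner_E4]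
  simp only [unitNormal, normalComponent_eq_det4, det4_eq]
  simp
  ring

/-- The left side is the squared length of the triple vector product of a, b, c; the right side is
their Gram determinant. -/
theorem det4_single_sq (a b c : E4) :
    ∑ i : Fin 4, det4 a b c (EuclideanSpace.single i 1) ^ 2 =
      inner ℝ a a * (inner ℝ b b * inner ℝ c c - inner ℝ b c ^ 2) -
      inner ℝ a b * (inner ℝ a b * inner ℝ c c - inner ℝ b c * inner ℝ a c) +
      inner ℝ a c * (inner ℝ a b * inner ℝ b c - inner ℝ b b * inner ℝ a c) := by
  simp only [inner_E4, Fin.sum_univ_four, det4_eq]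
  simp
  ring

theorem unitNormal_inner_point (f : ℂ → E4) (z : ℂ) : inner ℝ (unitNormal f z) (f z) = 0 := by
  rw [← normalComponent_eq_inner, normalComponent_eq_det4, det4_eq]; ring

theorem unitNormal_inner_du (f : ℂ → E4) (z : ℂ) : inner ℝ (unitNormal f z) (du f z) = 0 := by
  rw [← normalComponent_eq_inner, normalComponent_eq_det4, det4_eq]; ring

theorem unitNormal_inner_dv (f : ℂ → E4) (z : ℂ) : inner ℝ (unitNormal f z) (dv f z) = 0 := by
  rw [← normalComponent_eq_inner, normalComponent_eq_det4, det4_eq]; ring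

theorem unitNormal_inner_self {f : ℂ → E4} {z : ℂ} (h1 : ‖f z‖ = 1)
    (hu : inner ℝ (f z) (du f z) = 0) (hv : inner ℝ (f z) (dv f z) = 0) (hg : 0 < gramDet f z) :
    inner ℝ (unitNormal f z) (unitNormal f z) = 1 := by
  have h2 := det4_single_sq (f z) (du f z) (dv f z)
  rw [real_inner_self_eq_norm_sq (f z), h1, hu, hv, Fin.sum_univ_four] at h2
  have h3 : √(gramDet f z) ^ 2 = gramDet f z := Real.sq_sqrt hg.le
  have h4 : √(gramDet f z) ≠ 0 := (Real.sqrt_pos.2 hg).ne'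
  rw [inner_E4]
  simp only [unitNormal, normalComponent_eq_det4]
  field_simp
  rw [h3, h2, gramDet, formE, formF, formG]
  ring

namespace ConfAt

variable {f : ℂ → E4} {z : ℂ}

theorem eventually (h : ConfAt f z) : ∀ᶠ w in 𝓝 z, ConfAt f w := eventually_eventually_nhds.2 h

theorem smooth (h : ConfAt f z) : ContDiffAt ℝ ∞ f z := h.self_of_nhds.1

theorem norm_eq (h : ConfAt f z) : ‖f z‖ = 1 := h.self_of_nhds.2.1

theorem exists_factor (h : ConfAt f z) : ∃ c : ℝ, 0 < c ∧
    ∀ u v : ℂ, inner ℝ (fderiv ℝ f z u) (fderiv ℝ f z v) = c * inner ℝ u v :=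
  conformalAt_iff'.1 h.self_of_nhds.2.2

theorem formF_eq (h : ConfAt f z) : formF f z = 0 := by
  obtain ⟨c, hc, hf⟩ := h.exists_factor
  simp [formF, du, dv, hf]

theorem formE_pos (h : ConfAt f z) : 0 < formE f z := by
  obtain ⟨c, hc, hf⟩ := h.exists_factor
  rw [formE, du, hf]; simpa using hc

theorem formG_eq (h : ConfAt f z) : formG f z = formE f z := by
  obtain ⟨c, hc, hf⟩ := h.exists_factor
  rw [formE, formG, du, dv, hf, hf]; simp

theorem gramDet_eq (h : ConfAt f z) : gramDet f z = formE f z ^ 2 := by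
  rw [gramDet, h.formF_eq, h.formG_eq]; ring

theorem gramDet_pos (h : ConfAt f z) : 0 < gramDet f z := by
  rw [h.gramDet_eq]; exact pow_pos h.formE_pos 2

theorem sqrt_gramDet (h : ConfAt f z) : √(gramDet f z) = formE f z := by
  rw [h.gramDet_eq, Real.sqrt_sq h.formE_pos.le]

theorem inner_fderiv (h : ConfAt f z) (v : ℂ) : inner ℝ (f z) (fderiv ℝ f z v) = 0 := by
  have h1 : (fun w => inner ℝ (f w) (f w)) =ᶠ[𝓝 z] fun _ => (1 : ℝ) := by
    filter_upwards [h] with w hw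
    rw [real_inner_self_eq_norm_sq, hw.2.1, one_pow]
  have h2 := h1.fderiv_eq (𝕜 := ℝ)
  have hd : DifferentiableAt ℝ f z := h.smooth.differentiableAt (by simp)
  have h3 := congrArg (fun L => L v) h2
  rw [fderiv_inner_apply ℝ hd hd] at h3
  simp only [fderiv_fun_const, Pi.zero_apply, zero_apply] at h3
  rw [real_inner_comm (f z)] at h3
  linarith

theorem inner_du (h : ConfAt f z) : inner ℝ (f z) (du f z) = 0 := h.inner_fderiv _

theorem inner_dv (h : ConfAt f z) : inner ℝ (f z) (dv f z) = 0 := h.inner_fderiv _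

theorem normal_sq (h : ConfAt f z) : inner ℝ (unitNormal f z) (unitNormal f z) = 1 :=
  unitNormal_inner_self h.norm_eq h.inner_du h.inner_dv h.gramDet_pos

theorem meanCurvature_eq (h : ConfAt f z) :
    2 * formE f z * meanCurvature f z = formL f z + formN f z := by
  have := h.formE_pos.ne'
  rw [meanCurvature, h.gramDet_eq, h.formF_eq, h.formG_eq]
  field_simp
  ring

end ConfAt

/-! ### Smoothness of the invariants -/

section Smooth

variable {f : ℂ → E4} {z : ℂ}

theorem smooth_det4 {X : Type*} [NormedAddCommGroup X] [NormedSpace ℝ X] {n : WithTop ℕ∞}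
    {a b c d : X → E4} {x : X} (ha : ContDiffAt ℝ n a x)
    (hb : ContDiffAt ℝ n b x) (hc : ContDiffAt ℝ n c x) (hd : ContDiffAt ℝ n d x) :
    ContDiffAt ℝ n (fun y => det4 (a y) (b y) (c y) (d y)) x := by
  have ha' := fun i => (contDiffAt_piLp_apply (p := 2) (i := i)).comp x ha
  have hb' := fun i => (contDiffAt_piLp_apply (p := 2) (i := i)).comp x hb
  have hc' := fun i => (contDiffAt_piLp_apply (p := 2) (i := i)).comp x hc
  have hd' := fun i => (contDiffAt_piLp_apply (p := 2) (i := i)).comp x hd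
  simp only [Function.comp_def] at ha' hb' hc' hd'
  simp only [det4_eq]
  fun_prop (disch := first | assumption | apply ha' | apply hb' | apply hc' | apply hd')

theorem smooth_du (hf : ContDiffAt ℝ ∞ f z) : ContDiffAt ℝ ∞ (du f) z := smooth_fderiv_apply hf _

theorem smooth_dv (hf : ContDiffAt ℝ ∞ f z) : ContDiffAt ℝ ∞ (dv f) z := smooth_fderiv_apply hf _

theorem smooth_formE (hf : ContDiffAt ℝ ∞ f z) : ContDiffAt ℝ ∞ (formE f) z :=
  (smooth_du hf).inner ℝ (smooth_du hf)

theorem smooth_formF (hf : ContDiffAt ℝ ∞ f z) : ContDiffAt ℝ ∞ (formF f) z :=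
  (smooth_du hf).inner ℝ (smooth_dv hf)

theorem smooth_formG (hf : ContDiffAt ℝ ∞ f z) : ContDiffAt ℝ ∞ (formG f) z :=
  (smooth_dv hf).inner ℝ (smooth_dv hf)

theorem smooth_gramDet (hf : ContDiffAt ℝ ∞ f z) : ContDiffAt ℝ ∞ (gramDet f) z :=
  ((smooth_formE hf).mul (smooth_formG hf)).sub ((smooth_formF hf).pow 2)

theorem smooth_normalComponent (hf : ContDiffAt ℝ ∞ f z) (hg : 0 < gramDet f z) {w : ℂ → E4}
    (hw : ContDiffAt ℝ ∞ w z) : ContDiffAt ℝ ∞ (fun x => normalComponent f x (w x)) z :=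
  (smooth_det4 hf (smooth_du hf) (smooth_dv hf) hw).div ((smooth_gramDet hf).sqrt hg.ne')
    (Real.sqrt_pos.2 hg).ne'

theorem smooth_unitNormal (h : ConfAt f z) : ContDiffAt ℝ ∞ (unitNormal f) z :=
  contDiffAt_piLp' _ fun _ =>
    smooth_normalComponent h.smooth h.gramDet_pos contDiffAt_const

theorem smooth_meanCurvature (h : ConfAt f z) : ContDiffAt ℝ ∞ (meanCurvature f) z := by
  have hg := h.gramDet_pos
  have h1 := h.smooth
  have hL : ContDiffAt ℝ ∞ (formL f) z := smooth_normalComponent h1 hg (smooth_du (smooth_du h1))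
  have hM : ContDiffAt ℝ ∞ (formM f) z := smooth_normalComponent h1 hg (smooth_du (smooth_dv h1))
  have hN : ContDiffAt ℝ ∞ (formN f) z := smooth_normalComponent h1 hg (smooth_dv (smooth_dv h1))
  exact ((((smooth_formE h1).mul hN).sub ((contDiffAt_const.mul (smooth_formF h1)).mul hM)).add
    ((smooth_formG h1).mul hL)).div (contDiffAt_const.mul (smooth_gramDet h1))
    (mul_ne_zero two_ne_zero hg.ne')

end Smooth

/-- The inclusion of `ℝ⁴` into `ℂ⁵` as the last four real coordinates. -/
def coneLin : E4 →L[ℝ] (Fin 5 → ℂ) :=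
  ContinuousLinearMap.pi (Fin.cons 0 fun i =>
    Complex.ofRealCLM.comp (EuclideanSpace.proj i : E4 →L[ℝ] ℝ))

theorem coneLin_zero (v : E4) : coneLin v 0 = 0 := rfl

theorem coneLin_succ (v : E4) (i : Fin 4) : coneLin v i.succ = (v i : ℂ) := rfl

theorem coneLift_eq (f : ℂ → E4) (z : ℂ) :
    coneLift f z = (Fin.cons 1 0 : Fin 5 → ℂ) + coneLin (f z) := by
  funext i
  refine Fin.cases ?_ (fun j => ?_) i
  · simp [coneLift, coneVector, coneLin_zero]
  · simp [coneLift, coneVector, coneLin_succ]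

theorem mink_coneLin (v w : E4) : mink (coneLin v) (coneLin w) = (inner ℝ v w : ℝ) := by
  simp [mink, coneLin_zero, coneLin_succ, inner_E4, Fin.sum_univ_four]

theorem mink_coneLin_coneLift (v : E4) (f : ℂ → E4) (z : ℂ) :
    mink (coneLin v) (coneLift f z) = (inner ℝ v (f z) : ℝ) := by
  rw [coneLift_eq, mink_add_right, mink_coneLin]
  simp [mink, coneLin_zero]

theorem mink_coneLift (f : ℂ → E4) (z : ℂ) :
    mink (coneLift f z) (coneLift f z) = ((-1 + inner ℝ (f z) (f z) : ℝ) : ℂ) := by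
  rw [inner_E4]
  simp [mink, coneLift, coneVector, Fin.sum_univ_four]

/-! ### Wirtinger derivatives of the light-cone lift. -/

section

variable {z : ℂ}

theorem dz_coneLin {g : ℂ → E4} (hg : DifferentiableAt ℝ g z) :
    dz (fun w => coneLin (g w)) z =
      (1 / 2 : ℂ) • (coneLin (du g z) - Complex.I • coneLin (dv g z)) := by
  have h : HasFDerivAt (fun w => coneLin (g w)) (coneLin.comp (fderiv ℝ g z)) z :=
    coneLin.hasFDerivAt.comp z hg.hasFDerivAt
  rw [dz, h.fderiv]; rfl

theorem dzbar_coneLin {g : ℂ → E4} (hg : DifferentiableAt ℝ g z) :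
    dzbar (fun w => coneLin (g w)) z =
      (1 / 2 : ℂ) • (coneLin (du g z) + Complex.I • coneLin (dv g z)) := by
  have h : HasFDerivAt (fun w => coneLin (g w)) (coneLin.comp (fderiv ℝ g z)) z :=
    coneLin.hasFDerivAt.comp z hg.hasFDerivAt
  rw [dzbar, h.fderiv]; rfl

theorem fderiv_coneLift (f : ℂ → E4) (z : ℂ) :
    fderiv ℝ (coneLift f) z = fderiv ℝ (fun w => coneLin (f w)) z := by
  have : coneLift f = fun w => (Fin.cons 1 0 : Fin 5 → ℂ) + coneLin (f w) :=
    funext (coneLift_eq f)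
  rw [this, fderiv_const_add]

theorem dz_coneLift {f : ℂ → E4} (hf : DifferentiableAt ℝ f z) :
    dz (coneLift f) z = (1 / 2 : ℂ) • (coneLin (du f z) - Complex.I • coneLin (dv f z)) := by
  rw [← dz_coneLin hf, dz, dz, fderiv_coneLift]

theorem dzbar_coneLift {f : ℂ → E4} (hf : DifferentiableAt ℝ f z) :
    dzbar (coneLift f) z = (1 / 2 : ℂ) • (coneLin (du f z) + Complex.I • coneLin (dv f z)) := by
  rw [← dzbar_coneLin hf, dzbar, dzbar, fderiv_coneLift]

theorem dz_congr {V : Type*} [NormedAddCommGroup V] [NormedSpace ℂ V] {f g : ℂ → V}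
    (h : f =ᶠ[𝓝 z] g) : dz f =ᶠ[𝓝 z] dz g := by
  filter_upwards [h.fderiv (𝕜 := ℝ)] with w hw
  rw [dz, dz, hw]

theorem dzbar_congr {V : Type*} [NormedAddCommGroup V] [NormedSpace ℂ V] {f g : ℂ → V}
    (h : f =ᶠ[𝓝 z] g) : dzbar f =ᶠ[𝓝 z] dzbar g := by
  filter_upwards [h.fderiv (𝕜 := ℝ)] with w hw
  rw [dzbar, dzbar, hw]

theorem smooth_coneLift {f : ℂ → E4} (hf : ContDiffAt ℝ ∞ f z) : ContDiffAt ℝ ∞ (coneLift f) z := by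
  have : coneLift f = fun w => (Fin.cons 1 0 : Fin 5 → ℂ) + coneLin (f w) :=
    funext (coneLift_eq f)
  rw [this]
  exact contDiffAt_const.add (coneLin.contDiff.contDiffAt.comp z hf)

theorem dv_du {f : ℂ → E4} (hf : ContDiffAt ℝ ∞ f z) : dv (du f) z = du (dv f) z := by
  have h2 : ContDiffAt ℝ 2 f z := hf.of_le two_le_infty
  have h3 : DifferentiableAt ℝ (fderiv ℝ f) z :=
    (h2.fderiv_right (m := 1) (by norm_num)).differentiableAt (by simp)
  have h4 := h2.isSymmSndFDerivAt (by simp)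
  have e : ∀ a b : ℂ, fderiv ℝ (fun w => fderiv ℝ f w a) z b = fderiv ℝ (fderiv ℝ f) z b a := by
    intro a b
    rw [fderiv_clm_apply h3 (by fun_prop)]
    simp
  simp only [dv, du]
  change fderiv ℝ (fun w => fderiv ℝ f w 1) z Complex.I = fderiv ℝ (fun w => fderiv ℝ f w Complex.I) z 1
  rw [e, e, h4]

theorem fderiv_dz_aux {f : ℂ → E4} (hf : ContDiffAt ℝ ∞ f z) (a : ℂ) :
    fderiv ℝ (fun w => (1 / 2 : ℂ) • (coneLin (du f w) - Complex.I • coneLin (dv f w))) z a =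
      (1 / 2 : ℂ) • (coneLin (fderiv ℝ (du f) z a) - Complex.I • coneLin (fderiv ℝ (dv f) z a)) := by
  have hu : DifferentiableAt ℝ (du f) z := (smooth_du hf).differentiableAt (by simp)
  have hv : DifferentiableAt ℝ (dv f) z := (smooth_dv hf).differentiableAt (by simp)
  have h : HasFDerivAt (fun w => (1 / 2 : ℂ) • (coneLin (du f w) - Complex.I • coneLin (dv f w)))
      ((1 / 2 : ℂ) • (coneLin.comp (fderiv ℝ (du f) z) - Complex.I • coneLin.comp (fderiv ℝ (dv f) z)))
      z := by
    have h1 := coneLin.hasFDerivAt.comp z hu.hasFDerivAt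
    have h2 := (coneLin.hasFDerivAt.comp z hv.hasFDerivAt).const_smul Complex.I
    exact (h1.sub h2).const_smul (1 / 2 : ℂ)
  rw [h.fderiv]; rfl

theorem dz_dz_coneLift {f : ℂ → E4} (hf : ContDiffAt ℝ ∞ f z) : dz (dz (coneLift f)) z =
    (1 / 4 : ℂ) • (coneLin (du (du f) z) - coneLin (dv (dv f) z) -
      (2 * Complex.I) • coneLin (du (dv f) z)) := by
  have h1 : dz (coneLift f) =ᶠ[𝓝 z] fun w =>
      (1 / 2 : ℂ) • (coneLin (du f w) - Complex.I • coneLin (dv f w)) := by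
    filter_upwards [eventually_differentiableAt hf] with w hw using dz_coneLift hw
  rw [(dz_congr h1).eq_of_nhds, dz, fderiv_dz_aux hf, fderiv_dz_aux hf]
  have h5 := dv_du hf
  simp only [du, dv] at h5 ⊢
  rw [h5]
  funext i
  simp only [Pi.smul_apply, Pi.sub_apply, smul_eq_mul]
  linear_combination (1 / 4) * coneLin (fderiv ℝ (dv f) z Complex.I) i *
    Complex.I_mul_I

theorem dzbar_dz_coneLift {f : ℂ → E4} (hf : ContDiffAt ℝ ∞ f z) : dzbar (dz (coneLift f)) z =
    (1 / 4 : ℂ) • (coneLin (du (du f) z) + coneLin (dv (dv f) z)) := by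
  have h1 : dz (coneLift f) =ᶠ[𝓝 z] fun w =>
      (1 / 2 : ℂ) • (coneLin (du f w) - Complex.I • coneLin (dv f w)) := by
    filter_upwards [eventually_differentiableAt hf] with w hw using dz_coneLift hw
  rw [(dzbar_congr h1).eq_of_nhds, dzbar, fderiv_dz_aux hf, fderiv_dz_aux hf]
  have h5 := dv_du hf
  simp only [du, dv] at h5 ⊢
  rw [h5]
  funext i
  simp only [Pi.smul_apply, Pi.sub_apply, Pi.add_apply, smul_eq_mul]
  linear_combination (-1 / 4) * coneLin (fderiv ℝ (dv f) z Complex.I) i *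
    Complex.I_mul_I

end

/-! ### From the light-cone lift to the canonical lift. -/

section

variable {R : Type*} [CommRing R] [Algebra ℂ R] {D D' : Derivation ℂ R R} {F n : Fin 5 → R}
  {σ H l : R}

theorem mink_deriv_self (D : Derivation ℂ R R) (h : mink F F = 0) : mink F (vd D F) = 0 := by
  have := congrArg D h
  rw [derivation_mink, map_zero, mink_comm (vd D F) F, ← two_mul] at this
  exact (isUnit_two_of_algebra.mul_right_eq_zero).1 this

theorem mink_lift_second (D D' : Derivation ℂ R R) (h : mink F F = 0) :
    mink F (vd D (vd D' F)) = -mink (vd D F) (vd D' F) := by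
  have := congrArg D (mink_deriv_self D' h)
  rw [derivation_mink, map_zero] at this
  linear_combination this

/-- Products of the unscaled lift F = (1, f) are inner products in ℝ⁴, so the frame equations are
reduced to it. Here l is the conformal factor and σ = l^(−1/2). Adding H F to the normal n makes ξ
orthogonal to the mixed derivative, because 2⟨F, F_zz̄⟩ = −l while 2⟨n, F_zz̄⟩ = H l. -/
theorem ConformalFrame.of_lift (comm : ∀ a, D (D' a) = D' (D a)) (hσ : σ ^ 2 * l = 1)
    (FF : mink F F = 0) (nF : mink n F = 0) (nn : mink n n = 1) (ndF : mink n (vd D F) = 0)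
    (nbF : mink n (vd D' F) = 0) (dFdF : mink (vd D F) (vd D F) = 0)
    (bFbF : mink (vd D' F) (vd D' F) = 0) (dFbF : 2 * mink (vd D F) (vd D' F) = l)
    (ndbF : 2 * mink n (vd D (vd D' F)) = H * l) :
    ConformalFrame D D' (σ • F) (n + H • F) := by
  have a1 := mink_deriv_self D FF
  have a2 := mink_deriv_self D' FF
  have a3 := mink_lift_second D D' FF
  refine ⟨comm, ?_, ?_, ?_, ?_, ?_, ?_, ?_, ?_, ?_⟩ <;>
    simp only [vd_smul, vd_add, mink_add_left, mink_add_right, mink_smul_left, mink_smul_right, FF,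
      mink_comm F n, nF, nn, ndF, nbF, dFdF, bFbF, a1, a2, a3, mink_comm (vd D F) F,
      mink_comm (vd D' F) F]
  · ring
  · ring
  · ring
  · linear_combination σ ^ 2 * dFbF + hσ
  · ring
  · ring
  · ring
  · ring
  · refine isUnit_two_of_algebra.mul_left_cancel ?_
    linear_combination σ * ndbF - σ * H * dFbF

/-- Derivatives of σ multiply F and F_z, which are orthogonal to ξ, and ⟨F, F_zz⟩ = −⟨F_z, F_z⟩ = 0
removes H. -/
theorem frameK_of_lift (FF : mink F F = 0) (nF : mink n F = 0) (ndF : mink n (vd D F) = 0)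
    (dFdF : mink (vd D F) (vd D F) = 0) :
    frameK D (σ • F) (n + H • F) = σ * mink (vd D (vd D F)) n := by
  have a1 := mink_deriv_self D FF
  have a3 := mink_lift_second D D FF
  simp only [frameK, vd_smul, vd_add, mink_add_left, mink_add_right, mink_smul_left,
    mink_smul_right, FF, mink_comm F n, nF, mink_comm (vd D F) n, ndF, dFdF, a1, a3,
    mink_comm (vd D F) F, mink_comm (vd D (vd D F)) F]
  ring

end

/-- The scale factor of the canonical lift. -/
def liftScale (f : ℂ → E4) (z : ℂ) : ℝ := (√(formE f z))⁻¹

/-- The unit normal as a vector of `ℂ⁵`. -/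
def normalLift (f : ℂ → E4) (z : ℂ) : Fin 5 → ℂ := coneLin (unitNormal f z)

/-- The conformal Gauss map. -/
def gaussMap (f : ℂ → E4) (z : ℂ) : Fin 5 → ℂ :=
  normalLift f z + (meanCurvature f z : ℂ) • coneLift f z

/-- The coefficient of the Hopfian. -/
def hopfCoeff (f : ℂ → E4) (z : ℂ) : ℂ := mink (dz (dz (canonicalLift f)) z) (gaussMap f z)

theorem vgerm_congr {z : ℂ} {F G : ℂ → Fin 5 → ℂ} (hF : ContDiffAt ℝ ∞ F z) (h : F =ᶠ[𝓝 z] G) :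
    vgerm z F = vgerm z G := by
  funext i
  refine germ_congr (smooth_apply hF i) ?_
  filter_upwards [h] with w hw
  rw [hw]

theorem vgerm_smul {z : ℂ} {s : ℂ → ℂ} {F : ℂ → Fin 5 → ℂ} (hs : ContDiffAt ℝ ∞ s z)
    (hF : ContDiffAt ℝ ∞ F z) : vgerm z (fun w => s w • F w) = germ z s • vgerm z F := by
  funext i
  exact germ_mul hs (smooth_apply hF i)

theorem vgerm_add {z : ℂ} {F G : ℂ → Fin 5 → ℂ} (hF : ContDiffAt ℝ ∞ F z)
    (hG : ContDiffAt ℝ ∞ G z) : vgerm z (fun w => F w + G w) = vgerm z F + vgerm z G := by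
  funext i
  exact germ_add (smooth_apply hF i) (smooth_apply hG i)

theorem smooth_ofReal {z : ℂ} {g : ℂ → ℝ} (hg : ContDiffAt ℝ ∞ g z) :
    ContDiffAt ℝ ∞ (fun w => (g w : ℂ)) z := Complex.ofRealCLM.contDiff.contDiffAt.comp z hg

namespace ConfAt

variable {f : ℂ → E4} {z : ℂ}

theorem differentiableAt (h : ConfAt f z) : DifferentiableAt ℝ f z :=
  h.smooth.differentiableAt (by simp)

theorem mink_dz_dzbar (h : ConfAt f z) :
    mink (dz (coneLift f) z) (dzbar (coneLift f) z) = ((formE f z / 2 : ℝ) : ℂ) := by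
  rw [dz_coneLift h.differentiableAt, dzbar_coneLift h.differentiableAt]
  have h1 : inner ℝ (du f z) (du f z) = formE f z := rfl
  have h2 : inner ℝ (dv f z) (dv f z) = formE f z := h.formG_eq
  have h3 : inner ℝ (du f z) (dv f z) = 0 := h.formF_eq
  simp only [mink_smul_left, mink_smul_right, mink_add_right, mink_sub_left, mink_coneLin, h1, h2,
    h3, mink_comm (coneLin (dv f z)) (coneLin (du f z))]
  push_cast
  linear_combination (-(formE f z : ℂ) / 4) * Complex.I_mul_I

theorem mink_dz_dz (h : ConfAt f z) : mink (dz (coneLift f) z) (dz (coneLift f) z) = 0 := by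
  rw [dz_coneLift h.differentiableAt]
  have h1 : inner ℝ (du f z) (du f z) = formE f z := rfl
  have h2 : inner ℝ (dv f z) (dv f z) = formE f z := h.formG_eq
  have h3 : inner ℝ (du f z) (dv f z) = 0 := h.formF_eq
  simp only [mink_smul_left, mink_smul_right, mink_sub_right, mink_sub_left, mink_coneLin, h1, h2,
    h3, mink_comm (coneLin (dv f z)) (coneLin (du f z))]
  push_cast
  linear_combination ((formE f z : ℂ) / 4) * Complex.I_mul_I

theorem mink_dzbar_dzbar (h : ConfAt f z) :
    mink (dzbar (coneLift f) z) (dzbar (coneLift f) z) = 0 := by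
  rw [dzbar_coneLift h.differentiableAt]
  have h1 : inner ℝ (du f z) (du f z) = formE f z := rfl
  have h2 : inner ℝ (dv f z) (dv f z) = formE f z := h.formG_eq
  have h3 : inner ℝ (du f z) (dv f z) = 0 := h.formF_eq
  simp only [mink_smul_left, mink_smul_right, mink_add_right, mink_add_left, mink_coneLin, h1, h2,
    h3, mink_comm (coneLin (dv f z)) (coneLin (du f z))]
  push_cast
  linear_combination ((formE f z : ℂ) / 4) * Complex.I_mul_I

theorem canonicalLift_apply (h : ConfAt f z) :
    canonicalLift f z = (liftScale f z : ℂ) • coneLift f z := by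
  rw [canonicalLift, h.mink_dz_dzbar, Complex.ofReal_re, mul_div_cancel₀ _ two_ne_zero]
  rfl

theorem canonicalLift_eq (h : ConfAt f z) :
    canonicalLift f =ᶠ[𝓝 z] fun w => (liftScale f w : ℂ) • coneLift f w := by
  filter_upwards [h.eventually] with w hw using hw.canonicalLift_apply

theorem smooth_liftScale (h : ConfAt f z) : ContDiffAt ℝ ∞ (liftScale f) z :=
  ((smooth_formE h.smooth).sqrt h.formE_pos.ne').inv (Real.sqrt_pos.2 h.formE_pos).ne'

theorem smooth_canonicalLift (h : ConfAt f z) : ContDiffAt ℝ ∞ (canonicalLift f) z :=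
  ((smooth_ofReal h.smooth_liftScale).smul (smooth_coneLift h.smooth)).congr_of_eventuallyEq
    h.canonicalLift_eq

theorem smooth_normalLift (h : ConfAt f z) : ContDiffAt ℝ ∞ (normalLift f) z :=
  coneLin.contDiff.contDiffAt.comp z (smooth_unitNormal h)

theorem smooth_gaussMap (h : ConfAt f z) : ContDiffAt ℝ ∞ (gaussMap f) z :=
  h.smooth_normalLift.add
    ((smooth_ofReal (smooth_meanCurvature h)).smul (smooth_coneLift h.smooth))

theorem smooth_hopfCoeff (h : ConfAt f z) : ContDiffAt ℝ ∞ (hopfCoeff f) z :=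
  smooth_mink (smooth_dz (smooth_dz h.smooth_canonicalLift)) h.smooth_gaussMap

theorem vgerm_canonicalLift (h : ConfAt f z) :
    vgerm z (canonicalLift f) = germ z (fun w => (liftScale f w : ℂ)) • vgerm z (coneLift f) := by
  rw [vgerm_congr h.smooth_canonicalLift h.canonicalLift_eq,
    vgerm_smul (smooth_ofReal h.smooth_liftScale) (smooth_coneLift h.smooth)]

theorem vgerm_gaussMap (h : ConfAt f z) : vgerm z (gaussMap f) =
    vgerm z (normalLift f) + germ z (fun w => (meanCurvature f w : ℂ)) • vgerm z (coneLift f) := by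
  have h1 := smooth_ofReal (smooth_meanCurvature h)
  have h2 := smooth_coneLift h.smooth
  rw [← vgerm_smul h1 h2, ← vgerm_add h.smooth_normalLift
    (show ContDiffAt ℝ ∞ (fun w => (meanCurvature f w : ℂ) • coneLift f w) z from h1.smul h2)]
  rfl

theorem liftScale_sq (h : ConfAt f z) : liftScale f z ^ 2 * formE f z = 1 := by
  rw [liftScale, inv_pow, Real.sq_sqrt h.formE_pos.le, inv_mul_cancel₀ h.formE_pos.ne']

/-- An identity between smooth functions near `z` gives an identity between germs. -/
theorem germ_mink_eq {F G : ℂ → Fin 5 → ℂ} {c : ℂ → ℂ} (hF : ContDiffAt ℝ ∞ F z)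
    (hG : ContDiffAt ℝ ∞ G z) (h : ∀ᶠ w in 𝓝 z, mink (F w) (G w) = c w) :
    mink (vgerm z F) (vgerm z G) = germ z c := by
  rw [← germ_mink hF hG]
  exact germ_congr (smooth_mink hF hG) h

theorem mink_normalLift_coneLin (f : ℂ → E4) (z : ℂ) (v : E4) :
    mink (normalLift f z) (coneLin v) = (normalComponent f z v : ℂ) := by
  rw [normalLift, mink_coneLin, normalComponent_eq_inner]

theorem FF (h : ConfAt f z) : mink (vgerm z (coneLift f)) (vgerm z (coneLift f)) = 0 := by
  have hF := smooth_coneLift h.smooth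
  rw [← germ_zero]
  refine germ_mink_eq hF hF ?_
  filter_upwards [h.eventually] with w hw
  rw [mink_coneLift, real_inner_self_eq_norm_sq, hw.norm_eq]; simp

theorem nF (h : ConfAt f z) : mink (vgerm z (normalLift f)) (vgerm z (coneLift f)) = 0 := by
  rw [← germ_zero]
  refine germ_mink_eq h.smooth_normalLift (smooth_coneLift h.smooth) (Eventually.of_forall ?_)
  intro w
  rw [normalLift, mink_coneLin_coneLift, unitNormal_inner_point]; simp

theorem ndF (h : ConfAt f z) :
    mink (vgerm z (normalLift f)) (vd (del z) (vgerm z (coneLift f))) = 0 := by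
  have hF := smooth_coneLift h.smooth
  rw [← germ_zero, vd_del_vgerm hF]
  refine germ_mink_eq h.smooth_normalLift (smooth_dz hF) ?_
  filter_upwards [h.eventually] with w hw
  rw [dz_coneLift hw.differentiableAt, mink_smul_right, mink_sub_right, mink_smul_right,
    mink_normalLift_coneLin, mink_normalLift_coneLin, normalComponent_eq_inner,
    normalComponent_eq_inner, unitNormal_inner_du, unitNormal_inner_dv]
  simp

theorem dFdF (h : ConfAt f z) :
    mink (vd (del z) (vgerm z (coneLift f))) (vd (del z) (vgerm z (coneLift f))) = 0 := by
  have hF := smooth_coneLift h.smooth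
  rw [← germ_zero, vd_del_vgerm hF]
  refine germ_mink_eq (smooth_dz hF) (smooth_dz hF) ?_
  filter_upwards [h.eventually] with w hw using hw.mink_dz_dz

theorem mink_normalLift_second (h : ConfAt f z) :
    2 * mink (normalLift f z) (dzbar (dz (coneLift f)) z) = (meanCurvature f z * formE f z : ℝ) := by
  rw [dzbar_dz_coneLift h.smooth, mink_smul_right, mink_add_right, mink_normalLift_coneLin,
    mink_normalLift_coneLin]
  have h1 : normalComponent f z (du (du f) z) + normalComponent f z (dv (dv f) z) =
    2 * formE f z * meanCurvature f z := h.meanCurvature_eq.symm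
  rw [← Complex.ofReal_add, h1]; push_cast; ring

/-- The structure equations of a conformal surface. -/
theorem conformalFrame (h : ConfAt f z) :
    ConformalFrame (del z) (delbar z) (vgerm z (canonicalLift f)) (vgerm z (gaussMap f)) := by
  have hF := smooth_coneLift h.smooth
  have hn := h.smooth_normalLift
  have hσ := smooth_ofReal h.smooth_liftScale
  have hH := smooth_ofReal (smooth_meanCurvature h)
  have hE := smooth_ofReal (smooth_formE h.smooth)
  rw [h.vgerm_canonicalLift, h.vgerm_gaussMap]
  refine ConformalFrame.of_lift (l := germ z (fun w => (formE f w : ℂ))) del_delbar_comm ?_ h.FF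
    h.nF ?_ h.ndF ?_ h.dFdF ?_ ?_ ?_
  · rw [← germ_pow hσ, ← germ_mul (hσ.pow 2) hE, ← germ_one]
    refine germ_congr ((hσ.pow 2).mul hE) ?_
    filter_upwards [h.eventually] with w hw
    exact_mod_cast hw.liftScale_sq
  · rw [← germ_one]
    refine germ_mink_eq hn hn ?_
    filter_upwards [h.eventually] with w hw
    rw [normalLift, mink_coneLin, hw.normal_sq]; simp
  · rw [← germ_zero, vd_delbar_vgerm hF]
    refine germ_mink_eq hn (smooth_dzbar hF) ?_
    filter_upwards [h.eventually] with w hw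
    rw [dzbar_coneLift hw.differentiableAt, mink_smul_right, mink_add_right, mink_smul_right,
      mink_normalLift_coneLin, mink_normalLift_coneLin, normalComponent_eq_inner,
      normalComponent_eq_inner, unitNormal_inner_du, unitNormal_inner_dv]
    simp
  · rw [← germ_zero, vd_delbar_vgerm hF]
    refine germ_mink_eq (smooth_dzbar hF) (smooth_dzbar hF) ?_
    filter_upwards [h.eventually] with w hw using hw.mink_dzbar_dzbar
  · rw [vd_del_vgerm hF, vd_delbar_vgerm hF, ← germ_mink (smooth_dz hF) (smooth_dzbar hF),
      ← germ_ofNat, ← germ_mul contDiffAt_const (smooth_mink (smooth_dz hF) (smooth_dzbar hF))]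
    refine germ_congr (contDiffAt_const.mul (smooth_mink (smooth_dz hF) (smooth_dzbar hF))) ?_
    filter_upwards [h.eventually] with w hw
    rw [hw.mink_dz_dzbar]; push_cast; ring
  · have hc : vd (del z) (vd (delbar z) (vgerm z (coneLift f))) =
        vgerm z (dzbar (dz (coneLift f))) := by
      rw [← vd_delbar_vgerm (smooth_dz hF), ← vd_del_vgerm hF]
      funext i; exact del_delbar_comm _
    have hm := smooth_mink hn (smooth_dzbar (smooth_dz hF))
    rw [hc, ← germ_mink hn (smooth_dzbar (smooth_dz hF)), ← germ_ofNat,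
      ← germ_mul contDiffAt_const hm, ← germ_mul hH hE]
    refine germ_congr (contDiffAt_const.mul hm) ?_
    filter_upwards [h.eventually] with w hw
    rw [hw.mink_normalLift_second]; push_cast; rfl

theorem germ_hopfCoeff (h : ConfAt f z) : germ z (hopfCoeff f) =
    frameK (del z) (vgerm z (canonicalLift f)) (vgerm z (gaussMap f)) := by
  have h1 := h.smooth_canonicalLift
  rw [frameK, vd_del_vgerm h1, vd_del_vgerm (smooth_dz h1),
    ← germ_mink (smooth_dz (smooth_dz h1)) h.smooth_gaussMap]
  rfl

theorem hopfCoeff_eq_mink (h : ConfAt f z) : hopfCoeff f z =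
    (liftScale f z : ℂ) * mink (dz (dz (coneLift f)) z) (normalLift f z) := by
  have hF := smooth_coneLift h.smooth
  have hσ := smooth_ofReal h.smooth_liftScale
  have hm := smooth_mink (smooth_dz (smooth_dz hF)) h.smooth_normalLift
  have h1 := h.germ_hopfCoeff
  rw [h.vgerm_canonicalLift, h.vgerm_gaussMap, frameK_of_lift h.FF h.nF h.ndF h.dFdF,
    vd_del_vgerm hF, vd_del_vgerm (smooth_dz hF),
    ← germ_mink (smooth_dz (smooth_dz hF)) h.smooth_normalLift, ← germ_mul hσ hm] at h1
  exact germ_eq_apply h.smooth_hopfCoeff (hσ.mul hm) h1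

/-- In a conformal coordinate k carries the trace-free part of the second fundamental form, so it
vanishes exactly at umbilic points. -/
theorem hopfCoeff_eq (h : ConfAt f z) : hopfCoeff f z =
    (liftScale f z : ℂ) * ((formL f z - formN f z - 2 * Complex.I * formM f z) / 4) := by
  rw [h.hopfCoeff_eq_mink, dz_dz_coneLift h.smooth, mink_comm, mink_smul_right, mink_sub_right,
    mink_sub_right, mink_smul_right, mink_normalLift_coneLin, mink_normalLift_coneLin,
    mink_normalLift_coneLin]
  simp only [formL, formM, formN]
  ring

end ConfAt

/-! ### Conjugation, the Hopfian and the invariants built from `k`. -/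

section

variable {z : ℂ} {V : Type*} [NormedAddCommGroup V] [NormedSpace ℂ V]

theorem dz_star [StarAddMonoid V] [ContinuousStar V] [StarModule ℂ V] [StarModule ℝ V]
    (f : ℂ → V) (z : ℂ) : dz (fun w => star (f w)) z = star (dzbar f z) := by
  have h : fderiv ℝ (fun w => star (f w)) z = ((starL' ℝ : V ≃L[ℝ] V) : V →L[ℝ] V).comp (fderiv ℝ f z) :=
    (starL' ℝ : V ≃L[ℝ] V).comp_fderiv
  simp only [dz, dzbar, h]
  simp [sub_eq_add_neg]

theorem dzbar_star [StarAddMonoid V] [ContinuousStar V] [StarModule ℂ V] [StarModule ℝ V]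
    (f : ℂ → V) (z : ℂ) : dzbar (fun w => star (f w)) z = star (dz f z) := by
  have h : fderiv ℝ (fun w => star (f w)) z = ((starL' ℝ : V ≃L[ℝ] V) : V →L[ℝ] V).comp (fderiv ℝ f z) :=
    (starL' ℝ : V ≃L[ℝ] V).comp_fderiv
  simp only [dz, dzbar, h]
  simp [sub_eq_add_neg]

theorem star_mink (v w : Fin 5 → ℂ) : star (mink v w) = mink (star v) (star w) := by
  simp [mink]

end

theorem star_coneLin (v : E4) : star (coneLin v) = coneLin v := by
  funext i
  refine Fin.cases ?_ (fun j => ?_) i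
  · simp [coneLin_zero]
  · simp [coneLin_succ]

theorem star_coneLift (f : ℂ → E4) (z : ℂ) : star (coneLift f z) = coneLift f z := by
  funext i; simp [coneLift]

theorem star_canonicalLift (f : ℂ → E4) (z : ℂ) : star (canonicalLift f z) = canonicalLift f z := by
  rw [canonicalLift, star_smul, star_coneLift]; simp

theorem star_gaussMap (f : ℂ → E4) (z : ℂ) : star (gaussMap f z) = gaussMap f z := by
  rw [gaussMap, star_add, star_smul, star_coneLift, normalLift, star_coneLin]; simp

theorem dzbar_eq_star {F : ℂ → Fin 5 → ℂ} (hF : ∀ w, star (F w) = F w) (z : ℂ) :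
    dzbar F z = star (dz F z) := by
  rw [← dzbar_star]
  simp only [hF]

theorem dzbar_dzbar_eq_star {F : ℂ → Fin 5 → ℂ} (hF : ∀ w, star (F w) = F w) (z : ℂ) :
    dzbar (dzbar F) z = star (dz (dz F) z) := by
  rw [← dzbar_star]
  congr 1
  funext w
  exact dzbar_eq_star hF w

/-- The coefficient of Bryant's quartic differential. -/
def bryantCoeff (f : ℂ → E4) (z : ℂ) : ℂ :=
  mink (dz (dz (gaussMap f)) z) (dz (dz (gaussMap f)) z) / 4

/-- The Euler-Lagrange equation of the Willmore functional, `H_{zz̄} + 2 |k|² H = 0`. -/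
def WillmoreAt (f : ℂ → E4) (z : ℂ) : Prop :=
  dzbar (dz fun w => (meanCurvature f w : ℂ)) z +
    2 * (hopfCoeff f z * star (hopfCoeff f z)) * meanCurvature f z = 0

theorem smooth_star {z : ℂ} {g : ℂ → ℂ} (hg : ContDiffAt ℝ ∞ g z) :
    ContDiffAt ℝ ∞ (fun w => star (g w)) z :=
  (starL' ℝ : ℂ ≃L[ℝ] ℂ).contDiff.contDiffAt.comp z hg

namespace ConfAt

variable {f : ℂ → E4} {z : ℂ}

theorem germ_star_hopfCoeff (h : ConfAt f z) : germ z (fun w => star (hopfCoeff f w)) =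
    frameK (delbar z) (vgerm z (canonicalLift f)) (vgerm z (gaussMap f)) := by
  have h1 := h.smooth_canonicalLift
  rw [frameK, vd_delbar_vgerm h1, vd_delbar_vgerm (smooth_dzbar h1),
    ← germ_mink (smooth_dzbar (smooth_dzbar h1)) h.smooth_gaussMap]
  congr 1
  funext w
  rw [hopfCoeff, star_mink, star_gaussMap, dzbar_dzbar_eq_star (star_canonicalLift f)]

/-- The equation `ddY`, evaluated at z, ties the Hopfian of the statement to the scalar k used in
the proof. -/
theorem hopfian_apply (h : ConfAt f z) : hopfian f z = hopfCoeff f z • gaussMap f z := by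
  have hY := h.smooth_canonicalLift
  have hξ := h.smooth_gaussMap
  have hddY := smooth_dz (smooth_dz hY)
  have hbdY := smooth_dzbar (smooth_dz hY)
  have hN : ContDiffAt ℝ ∞ (normalizedN f) z := by
    have e : normalizedN f =ᶠ[𝓝 z] fun w => (2 : ℂ) • dzbar (dz (canonicalLift f)) w +
      (2 * mink (dzbar (dz (canonicalLift f)) w) (dzbar (dz (canonicalLift f)) w)) •
        canonicalLift f w := EventuallyEq.rfl
    exact ((hbdY.const_smul (2 : ℂ)).add
      ((contDiffAt_const.mul (smooth_mink hbdY hbdY)).smul hY)).congr_of_eventuallyEq e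
  have hNg : vgerm z (normalizedN f) = frameN (del z) (delbar z) (vgerm z (canonicalLift f)) := by
    have hm := smooth_mink hbdY hbdY
    rw [frameN, vd_del_vgerm hY, vd_delbar_vgerm (smooth_dz hY), ← germ_mink hbdY hbdY,
      ← germ_ofNat, ← germ_mul contDiffAt_const hm, ← vgerm_smul contDiffAt_const hbdY,
      ← vgerm_smul (contDiffAt_const.mul hm) hY, ← vgerm_add]
    · rfl
    · exact hbdY.const_smul (2 : ℂ)
    · exact (contDiffAt_const.mul hm).smul hY
  have hk := h.smooth_hopfCoeff
  have hp := smooth_mink hddY hN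
  have h1 := h.conformalFrame.ddY
  rw [← h.germ_hopfCoeff, frameP, ← hNg, vd_del_vgerm hY, vd_del_vgerm (smooth_dz hY),
    ← germ_mink hddY hN, ← germ_neg hp, ← vgerm_smul hp.neg hY, ← vgerm_smul hk hξ,
    ← vgerm_add (show ContDiffAt ℝ ∞ (fun w => _ • _) z from hp.neg.smul hY)
      (show ContDiffAt ℝ ∞ (fun w => _ • _) z from hk.smul hξ)] at h1
  have h2 : dz (dz (canonicalLift f)) z = -mink (dz (dz (canonicalLift f)) z) (normalizedN f z) •
      canonicalLift f z + hopfCoeff f z • gaussMap f z := by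
    funext i
    exact germ_eq_apply (smooth_apply hddY i)
      (smooth_apply ((hp.neg.smul hY).add (hk.smul hξ)) i) (congrFun h1 i)
  rw [hopfian, schwarzian, mul_div_cancel_left₀ _ two_ne_zero]
  nth_rewrite 1 [h2]
  rw [neg_smul]
  abel

theorem gaussMap_sq (h : ConfAt f z) : mink (gaussMap f z) (gaussMap f z) = 1 := by
  have h1 := h.conformalFrame.ξξ
  rw [← germ_mink h.smooth_gaussMap h.smooth_gaussMap, ← germ_one] at h1
  exact germ_eq_apply (smooth_mink h.smooth_gaussMap h.smooth_gaussMap) contDiffAt_const h1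

theorem mobiusFactor_eq (h : ConfAt f z) : mobiusFactor f z = 4 * ‖hopfCoeff f z‖ ^ 2 := by
  rw [mobiusFactor, h.hopfian_apply, star_smul, star_gaussMap, mink_smul_left, mink_smul_right,
    h.gaussMap_sq, mul_one, Complex.star_def, Complex.mul_conj, Complex.ofReal_re,
    Complex.normSq_eq_norm_sq]

theorem smooth_bryantCoeff (h : ConfAt f z) : ContDiffAt ℝ ∞ (bryantCoeff f) z := by
  have h1 := smooth_dz (smooth_dz h.smooth_gaussMap)
  exact (smooth_mink h1 h1).div_const 4

theorem germ_bryantCoeff (h : ConfAt f z) : germ z (bryantCoeff f) =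
    germ z (hopfCoeff f) * del z (delbar z (germ z (hopfCoeff f))) -
      del z (germ z (hopfCoeff f)) * delbar z (germ z (hopfCoeff f)) +
      germ z (hopfCoeff f) ^ 3 * germ z (fun w => star (hopfCoeff f w)) := by
  have h1 := h.conformalFrame.ddξ_sq
  have h2 := smooth_dz (smooth_dz h.smooth_gaussMap)
  rw [← h.germ_hopfCoeff, ← h.germ_star_hopfCoeff, vd_del_vgerm h.smooth_gaussMap,
    vd_del_vgerm (smooth_dz h.smooth_gaussMap), ← germ_mink h2 h2] at h1
  have h3 : germ z (fun w => mink (dz (dz (gaussMap f)) w) (dz (dz (gaussMap f)) w)) =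
      4 * germ z (bryantCoeff f) := by
    rw [← germ_ofNat, ← germ_mul contDiffAt_const h.smooth_bryantCoeff]
    congr 1
    funext w
    rw [bryantCoeff]; ring
  have h4 : IsUnit (4 : SmoothGerm z) := by
    have : (4 : SmoothGerm z) = 2 * 2 := by norm_num
    rw [this]; exact isUnit_two_of_algebra.mul isUnit_two_of_algebra
  exact h4.mul_left_cancel (h3.symm.trans h1)

/-- The time coordinate of Y is the scale E^(−1/2), which never vanishes; this allows the
coefficient of Y to be isolated from a single coordinate. -/
theorem isUnit_lift_zero (h : ConfAt f z) : IsUnit (vgerm z (canonicalLift f) 0) := by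
  refine isUnit_germ (smooth_apply h.smooth_canonicalLift 0) ?_
  rw [h.canonicalLift_apply]
  simp [coneLift, coneVector, liftScale, (Real.sqrt_pos.2 h.formE_pos).ne']

theorem gaussMap_zero (f : ℂ → E4) (z : ℂ) : gaussMap f z 0 = meanCurvature f z := by
  simp [gaussMap, normalLift, coneLin_zero, coneLift, coneVector]

/-- The Euler-Lagrange equation in terms of the frame. -/
theorem frame_willmore (h : ConfAt f z) (hW : ∀ᶠ w in 𝓝 z, WillmoreAt f w) :
    delbar z (delbar z (germ z (hopfCoeff f))) +
      frameP (delbar z) (del z) (vgerm z (canonicalLift f)) * germ z (hopfCoeff f) = 0 := by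
  -- The time coordinate of ξ is H and that of Y is the scale factor. Hence this coordinate of the
  -- formula for ξ_zz̄ equates H_zz̄ + 2|k|²H with a nonvanishing multiple of k_z̄z̄ + (s̄/2)k.
  have h1 := congrFun h.conformalFrame.bdξ 0
  rw [← h.germ_hopfCoeff, ← h.germ_star_hopfCoeff] at h1
  have hH := smooth_ofReal (smooth_meanCurvature h)
  have hk := h.smooth_hopfCoeff
  have hg0 : vgerm z (gaussMap f) 0 = germ z (fun w => (meanCurvature f w : ℂ)) := by
    simp only [vgerm, gaussMap_zero]
  have h2 : delbar z (del z (germ z (fun w => (meanCurvature f w : ℂ)))) +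
      2 * (germ z (hopfCoeff f) * germ z (fun w => star (hopfCoeff f w))) *
        germ z (fun w => (meanCurvature f w : ℂ)) = 0 := by
    have s1 := hk.mul (smooth_star hk)
    have s2 := contDiffAt_const (c := (2 : ℂ)).mul s1
    rw [del_germ hH, delbar_germ (smooth_dz hH), ← germ_mul hk (smooth_star hk), ← germ_ofNat,
      ← germ_mul contDiffAt_const s1, ← germ_mul s2 hH,
      ← germ_add (smooth_dzbar (smooth_dz hH)) (s2.mul hH), ← germ_zero]
    refine germ_congr ((smooth_dzbar (smooth_dz hH)).add (s2.mul hH)) ?_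
    filter_upwards [hW] with w hw using hw
  simp only [vd, Pi.sub_apply, Pi.smul_apply, smul_eq_mul, hg0] at h1
  have h3 := isUnit_two_of_algebra.mul_right_eq_zero.1
    (h.isUnit_lift_zero.mul_left_eq_zero.1 (show 2 * (delbar z (delbar z (germ z (hopfCoeff f))) +
      frameP (delbar z) (del z) (vgerm z (canonicalLift f)) * germ z (hopfCoeff f)) *
        vgerm z (canonicalLift f) 0 = 0 by linear_combination h2 - h1))
  exact h3

/-- Bryant's quartic differential of a Willmore surface is holomorphic. -/
theorem dzbar_bryantCoeff (h : ConfAt f z) (hW : ∀ᶠ w in 𝓝 z, WillmoreAt f w) :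
    dzbar (bryantCoeff f) z = 0 := by
  have h1 := h.frame_willmore hW
  rw [h.germ_hopfCoeff] at h1
  have h2 := h.conformalFrame.bryant_holomorphic h1
  rw [← h.germ_hopfCoeff, ← h.germ_star_hopfCoeff, ← h.germ_bryantCoeff,
    delbar_germ h.smooth_bryantCoeff, ← germ_zero] at h2
  exact germ_eq_apply (smooth_dzbar h.smooth_bryantCoeff) contDiffAt_const h2

end ConfAt

/-! ### The curvature of the Möbius metric -/

theorem laplacian_eq_dz_dzbar {g : ℂ → ℝ} {z : ℂ} (hg : ContDiffAt ℝ ∞ g z) :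
    ((Laplacian.laplacian g z : ℝ) : ℂ) = 4 * dz (dzbar fun w => (g w : ℂ)) z := by
  have e : ∀ a b : ℂ, iteratedFDeriv ℝ 2 g z ![a, b] = fderiv ℝ (fun w => fderiv ℝ g w b) z a := by
    intro a b
    have h3 : DifferentiableAt ℝ (fderiv ℝ g) z :=
      (hg.fderiv_right (m := 1) two_le_infty).differentiableAt (by simp)
    rw [iteratedFDeriv_two_apply, fderiv_clm_apply h3 (by fun_prop)]
    simp
  have hsym : fderiv ℝ (fun w => fderiv ℝ g w Complex.I) z 1 =
      fderiv ℝ (fun w => fderiv ℝ g w 1) z Complex.I := by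
    have h4 := (hg.of_le two_le_infty).isSymmSndFDerivAt (by simp)
    rw [← e, ← e, iteratedFDeriv_two_apply, iteratedFDeriv_two_apply]
    exact h4 1 Complex.I
  have h1 : dzbar (fun w => (g w : ℂ)) =ᶠ[𝓝 z] fun w =>
      (1 / 2 : ℂ) • (((fderiv ℝ g w 1 : ℝ) : ℂ) + Complex.I • ((fderiv ℝ g w Complex.I : ℝ) : ℂ)) := by
    filter_upwards [eventually_differentiableAt hg] with w hw
    have : HasFDerivAt (fun w => (g w : ℂ)) (Complex.ofRealCLM.comp (fderiv ℝ g w)) w :=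
      Complex.ofRealCLM.hasFDerivAt.comp w hw.hasFDerivAt
    rw [dzbar, this.fderiv]; rfl
  have h2 : ∀ a, fderiv ℝ (fun w => (1 / 2 : ℂ) • (((fderiv ℝ g w 1 : ℝ) : ℂ) +
      Complex.I • ((fderiv ℝ g w Complex.I : ℝ) : ℂ))) z a =
      (1 / 2 : ℂ) • (((fderiv ℝ (fun w => fderiv ℝ g w 1) z a : ℝ) : ℂ) +
        Complex.I • ((fderiv ℝ (fun w => fderiv ℝ g w Complex.I) z a : ℝ) : ℂ)) := by
    intro a
    have d1 : DifferentiableAt ℝ (fun w => fderiv ℝ g w 1) z :=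
      (smooth_fderiv_apply hg _).differentiableAt (by simp)
    have d2 : DifferentiableAt ℝ (fun w => fderiv ℝ g w Complex.I) z :=
      (smooth_fderiv_apply hg _).differentiableAt (by simp)
    have e1 := Complex.ofRealCLM.hasFDerivAt.comp z d1.hasFDerivAt
    have e2 := (Complex.ofRealCLM.hasFDerivAt.comp z d2.hasFDerivAt).const_smul Complex.I
    have e3 : HasFDerivAt (fun w => (1 / 2 : ℂ) • (((fderiv ℝ g w 1 : ℝ) : ℂ) +
      Complex.I • ((fderiv ℝ g w Complex.I : ℝ) : ℂ))) _ z := (e1.add e2).const_smul (1 / 2 : ℂ)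
    rw [e3.fderiv]; rfl
  rw [(dz_congr h1).eq_of_nhds, dz, h2, h2, InnerProductSpace.laplacian_eq_iteratedFDeriv_complexPlane]
  beta_reduce
  rw [e, e, hsym]
  simp only [smul_eq_mul]
  push_cast
  linear_combination (fderiv ℝ (fun w => fderiv ℝ g w Complex.I) z Complex.I : ℂ) * Complex.I_mul_I

theorem dz_log {u : ℂ → ℝ} {z : ℂ} (hu : DifferentiableAt ℝ u z) (h : u z ≠ 0) :
    2 * (u z : ℂ) * dz (fun w => ((Real.log (u w) / 2 : ℝ) : ℂ)) z = dz (fun w => (u w : ℂ)) z := by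
  have h1 : HasFDerivAt (fun w => (u w : ℂ)) (Complex.ofRealCLM.comp (fderiv ℝ u z)) z :=
    Complex.ofRealCLM.hasFDerivAt.comp z hu.hasFDerivAt
  have h2 : HasFDerivAt (fun w => ((Real.log (u w) / 2 : ℝ) : ℂ))
      (Complex.ofRealCLM.comp ((2 : ℝ)⁻¹ • ((u z)⁻¹ • fderiv ℝ u z))) z := by
    have h3 : HasFDerivAt (fun w => Real.log (u w) / 2) ((2 : ℝ)⁻¹ • ((u z)⁻¹ • fderiv ℝ u z)) z := by
      simp only [div_eq_inv_mul]
      exact (hu.hasFDerivAt.log h).const_mul _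
    exact Complex.ofRealCLM.hasFDerivAt.comp z h3
  have h3 : (u z : ℂ) ≠ 0 := by exact_mod_cast h
  rw [dz, dz, h1.fderiv, h2.fderiv]
  simp
  field_simp

theorem dzbar_log {u : ℂ → ℝ} {z : ℂ} (hu : DifferentiableAt ℝ u z) (h : u z ≠ 0) :
    2 * (u z : ℂ) * dzbar (fun w => ((Real.log (u w) / 2 : ℝ) : ℂ)) z =
      dzbar (fun w => (u w : ℂ)) z := by
  have h1 : ∀ g : ℂ → ℝ, dzbar (fun w => (g w : ℂ)) z = star (dz (fun w => (g w : ℂ)) z) := by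
    intro g
    rw [← dzbar_star]; simp
  rw [h1, h1, ← dz_log hu h]
  simp

namespace ConfAt

variable {f : ℂ → E4} {z : ℂ}

/-- Formally Q/k² = (log k)_zz̄ + |k|²; the real part is ω_zz̄ + |k|² with ω = log(2|k|), and ω_zz̄
= −𝒦|k|². To avoid a branch of log k, the proof uses only u = 4kk̄ and ω = (log u)/2, through 2uω_z
= u_z and 2uω_z̄ = u_z̄. -/
theorem bryant_curvature (h : ConfAt f z) (hk : hopfCoeff f z ≠ 0) :
    (bryantCoeff f z * star (hopfCoeff f z) ^ 2).re =
      (1 - mobiusCurvatureAt f z) * ‖hopfCoeff f z‖ ^ 6 := by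
  have sk := h.smooth_hopfCoeff
  have skb := smooth_star sk
  have hev : ∀ᶠ w in 𝓝 z, hopfCoeff f w ≠ 0 := sk.continuousAt.eventually_ne hk
  set u : ℂ → ℝ := fun w => 4 * ‖hopfCoeff f w‖ ^ 2 with hu
  have huc : ∀ w, (u w : ℂ) = 4 * (hopfCoeff f w * star (hopfCoeff f w)) := by
    intro w
    rw [hu, Complex.star_def, Complex.mul_conj, Complex.normSq_eq_norm_sq]; push_cast; ring
  have su : ContDiffAt ℝ ∞ u z := by
    have h1 : ContDiffAt ℝ ∞ (fun w => 4 * (hopfCoeff f w * star (hopfCoeff f w))) z :=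
      contDiffAt_const.mul (sk.mul skb)
    have h2 : u = fun w => (4 * (hopfCoeff f w * star (hopfCoeff f w))).re := by
      funext w; rw [← huc, Complex.ofReal_re]
    rw [h2]
    exact Complex.reCLM.contDiff.contDiffAt.comp z h1
  have hune : ∀ᶠ w in 𝓝 z, u w ≠ 0 := by
    filter_upwards [hev] with w hw
    rw [hu]; positivity
  have hmf : (fun w => Real.log (mobiusFactor f w) / 2) =ᶠ[𝓝 z] fun w => Real.log (u w) / 2 := by
    filter_upwards [h.eventually] with w hw
    rw [hw.mobiusFactor_eq]
  have sl : ContDiffAt ℝ ∞ (fun w => Real.log (u w) / 2) z :=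
    (su.log hune.self_of_nhds).div_const 2
  have slc := smooth_ofReal sl
  have suc := smooth_ofReal su
  have hΔ := laplacian_eq_dz_dzbar sl
  -- germ identities
  set K := germ z (hopfCoeff f) with hK
  set Kb := germ z (fun w => star (hopfCoeff f w)) with hKb
  set U := germ z (fun w => (u w : ℂ)) with hU
  set ℓ := germ z (fun w => ((Real.log (u w) / 2 : ℝ) : ℂ)) with hℓ
  have hUK : U = 4 * (K * Kb) := by
    rw [hU, hK, hKb, ← germ_mul sk skb, ← germ_ofNat, ← germ_mul contDiffAt_const (sk.mul skb)]
    congr 1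
    funext w; exact huc w
  have hdl : 2 * U * del z ℓ = del z U := by
    rw [hU, hℓ, del_germ slc, del_germ suc, ← germ_ofNat, ← germ_mul contDiffAt_const suc,
      ← germ_mul (contDiffAt_const.mul suc) (smooth_dz slc)]
    refine germ_congr ((contDiffAt_const.mul suc).mul (smooth_dz slc)) ?_
    filter_upwards [hune, eventually_differentiableAt su] with w h1 h2 using dz_log h2 h1
  have hbl : 2 * U * delbar z ℓ = delbar z U := by
    rw [hU, hℓ, delbar_germ slc, delbar_germ suc, ← germ_ofNat, ← germ_mul contDiffAt_const suc,
      ← germ_mul (contDiffAt_const.mul suc) (smooth_dzbar slc)]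
    refine germ_congr ((contDiffAt_const.mul suc).mul (smooth_dzbar slc)) ?_
    filter_upwards [hune, eventually_differentiableAt su] with w h1 h2 using dzbar_log h2 h1
  have hB := h.germ_bryantCoeff
  have hBs := smooth_star h.smooth_bryantCoeff
  have hBb : germ z (fun w => star (bryantCoeff f w)) =
      Kb * del z (delbar z Kb) - del z Kb * delbar z Kb + Kb ^ 3 * K := by
    have e1 : ∀ {g : ℂ → ℂ}, ContDiffAt ℝ ∞ g z →
        germ z (fun w => star (dz g w)) = delbar z (germ z fun w => star (g w)) := by
      intro g hg
      rw [delbar_germ (smooth_star hg)]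
      congr 1
      funext w; exact (dzbar_star g w).symm
    have e2 : ∀ {g : ℂ → ℂ}, ContDiffAt ℝ ∞ g z →
        germ z (fun w => star (dzbar g w)) = del z (germ z fun w => star (g w)) := by
      intro g hg
      rw [del_germ (smooth_star hg)]
      congr 1
      funext w; exact (dz_star g w).symm
    have s1 := smooth_dz (smooth_dzbar sk)
    have s2 := smooth_dz sk
    have s3 := smooth_dzbar sk
    rw [delbar_germ sk, del_germ (smooth_dzbar sk), del_germ sk, ← germ_mul sk s1,
      ← germ_mul s2 s3, ← germ_pow sk, ← germ_mul (sk.pow 3) skb,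
      ← germ_sub (sk.mul s1) (s2.mul s3),
      ← germ_add ((sk.mul s1).sub (s2.mul s3)) ((sk.pow 3).mul skb)] at hB
    have hB' := (germ_eq_iff h.smooth_bryantCoeff
      (((sk.mul s1).sub (s2.mul s3)).add ((sk.pow 3).mul skb))).1 hB
    have hB2 : (fun w => star (bryantCoeff f w)) =ᶠ[𝓝 z] fun w =>
        star (hopfCoeff f w) * star (dz (dzbar (hopfCoeff f)) w) -
          star (dz (hopfCoeff f) w) * star (dzbar (hopfCoeff f) w) +
          star (hopfCoeff f w) ^ 3 * hopfCoeff f w := by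
      filter_upwards [hB'] with w hw
      rw [hw]; simp
    have t1 := smooth_star s1
    have t2 := smooth_star s2
    have t3 := smooth_star s3
    rw [germ_congr hBs hB2, germ_add ((skb.mul t1).sub (t2.mul t3)) ((skb.pow 3).mul sk),
      germ_sub (skb.mul t1) (t2.mul t3), germ_mul skb t1, germ_mul t2 t3,
      germ_mul (skb.pow 3) sk, germ_pow skb, e1 s3, e2 sk, e1 sk, ← del_delbar_comm]
    ring
  -- Twice the real part of Q/k² = (log k)_zz̄ + |k|², multiplied by |k|⁴ to clear denominators.
  have hK2 : (K * Kb) ^ 2 * (2 * del z (delbar z ℓ)) =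
      germ z (bryantCoeff f) * Kb ^ 2 + germ z (fun w => star (bryantCoeff f w)) * K ^ 2 -
        2 * (K * Kb) ^ 3 := by
    rw [hB, hBb]
    have h3 := congrArg (del z) hbl
    have hd2 : ∀ D : Derivation ℂ (SmoothGerm z) (SmoothGerm z), D (4 : SmoothGerm z) = 0 := by
      intro D; simpa using D.map_natCast 4
    rw [hUK] at hdl hbl h3
    simp only [Derivation.leibniz, derivation_two, hd2, smul_eq_mul, map_add, map_zero] at hdl hbl h3
    have hu16 : IsUnit (8 : SmoothGerm z) := by
      have : (8 : SmoothGerm z) = 2 * 2 * 2 := by norm_num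
      rw [this]
      exact (isUnit_two_of_algebra.mul isUnit_two_of_algebra).mul isUnit_two_of_algebra
    refine hu16.mul_left_cancel ?_
    linear_combination (2 * (K * Kb)) * h3 - 2 * (K * del z Kb + Kb * del z K) * hbl
  have sB := h.smooth_bryantCoeff
  have sdd := smooth_dz (smooth_dzbar slc)
  have L1 := (sk.mul skb).pow 2 |>.mul ((contDiffAt_const (c := (2 : ℂ))).mul sdd)
  have R1 := sB.mul (skb.pow 2)
  have R2 := hBs.mul (sk.pow 2)
  have R3 := (contDiffAt_const (c := (2 : ℂ))).mul ((sk.mul skb).pow 3)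
  have hval : germ z (fun w => (hopfCoeff f w * star (hopfCoeff f w)) ^ 2 *
      (2 * dz (dzbar fun w => ((Real.log (u w) / 2 : ℝ) : ℂ)) w)) =
      germ z (fun w => bryantCoeff f w * star (hopfCoeff f w) ^ 2 +
        star (bryantCoeff f w) * hopfCoeff f w ^ 2 -
        2 * (hopfCoeff f w * star (hopfCoeff f w)) ^ 3) := by
    rw [germ_sub (R1.add R2) R3, germ_add R1 R2, germ_mul sB (skb.pow 2), germ_mul hBs (sk.pow 2),
      germ_mul contDiffAt_const ((sk.mul skb).pow 3), germ_pow (sk.mul skb), germ_mul sk skb,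
      germ_pow skb, germ_pow sk, germ_ofNat, germ_mul ((sk.mul skb).pow 2) (contDiffAt_const.mul sdd),
      germ_pow (sk.mul skb), germ_mul sk skb, germ_mul contDiffAt_const sdd, germ_ofNat,
      ← del_germ (smooth_dzbar slc), ← delbar_germ slc]
    exact hK2
  have hv := germ_eq_apply L1 ((R1.add R2).sub R3) hval
  have hn : hopfCoeff f z * star (hopfCoeff f z) = ((‖hopfCoeff f z‖ ^ 2 : ℝ) : ℂ) := by
    rw [Complex.star_def, Complex.mul_conj, Complex.normSq_eq_norm_sq]
  have hre : bryantCoeff f z * star (hopfCoeff f z) ^ 2 + star (bryantCoeff f z) * hopfCoeff f z ^ 2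
      = ((2 * (bryantCoeff f z * star (hopfCoeff f z) ^ 2).re : ℝ) : ℂ) := by
    have := Complex.add_conj (bryantCoeff f z * star (hopfCoeff f z) ^ 2)
    rw [← this]; simp
  rw [hn, hre] at hv
  have hv2 : (‖hopfCoeff f z‖ ^ 2) ^ 2 * (Laplacian.laplacian (fun w => Real.log (u w) / 2) z) =
      4 * (bryantCoeff f z * star (hopfCoeff f z) ^ 2).re - 4 * (‖hopfCoeff f z‖ ^ 2) ^ 3 := by
    have : (((‖hopfCoeff f z‖ ^ 2) ^ 2 * (Laplacian.laplacian (fun w => Real.log (u w) / 2) z) : ℝ) : ℂ)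
        = ((4 * (bryantCoeff f z * star (hopfCoeff f z) ^ 2).re - 4 * (‖hopfCoeff f z‖ ^ 2) ^ 3 : ℝ) : ℂ) := by
      rw [Complex.ofReal_mul, hΔ]
      push_cast at hv ⊢
      linear_combination 2 * hv
    exact_mod_cast this
  have hne : ‖hopfCoeff f z‖ ≠ 0 := norm_ne_zero_iff.2 hk
  rw [mobiusCurvatureAt, InnerProductSpace.laplacian_congr_nhds hmf |>.eq_of_nhds, h.mobiusFactor_eq]
  field_simp
  linear_combination -hv2

end ConfAt

/-! ### Change of coordinate -/

/-- `τ` is holomorphic near `z` with nonvanishing derivative. -/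
def HolAt (τ : ℂ → ℂ) (z : ℂ) : Prop := AnalyticAt ℂ τ z ∧ deriv τ z ≠ 0

namespace HolAt

variable {τ : ℂ → ℂ} {z : ℂ}

theorem eventually (h : HolAt τ z) : ∀ᶠ w in 𝓝 z, HolAt τ w := by
  filter_upwards [h.1.eventually_analyticAt, h.1.deriv.continuousAt.eventually_ne h.2] with w h1 h2
  exact ⟨h1, h2⟩

theorem smooth (h : HolAt τ z) : ContDiffAt ℝ ∞ τ z := (h.1.contDiffAt (n := ∞)).restrict_scalars ℝ

theorem smooth_deriv (h : HolAt τ z) : ContDiffAt ℝ ∞ (deriv τ) z :=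
  (h.1.deriv.contDiffAt (n := ∞)).restrict_scalars ℝ

theorem fderiv_apply (h : HolAt τ z) (v : ℂ) : fderiv ℝ τ z v = deriv τ z * v := by
  have h1 := (h.1.differentiableAt.hasDerivAt.hasFDerivAt.restrictScalars ℝ).fderiv
  rw [h1]; simp [mul_comm]

theorem conformalAt (h : HolAt τ z) : ConformalAt τ z :=
  h.1.differentiableAt.conformalAt h.2

theorem comp {σ : ℂ → ℂ} (hσ : HolAt σ (τ z)) (h : HolAt τ z) : HolAt (σ ∘ τ) z := by
  refine ⟨hσ.1.comp h.1, ?_⟩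
  rw [deriv_comp z hσ.1.differentiableAt h.1.differentiableAt]
  exact mul_ne_zero hσ.2 h.2

theorem tendsto (h : HolAt τ z) : Tendsto τ (𝓝 z) (𝓝 (τ z)) := h.1.continuousAt

end HolAt

section Comp

variable {V : Type*} [NormedAddCommGroup V] [NormedSpace ℂ V] {τ : ℂ → ℂ} {z : ℂ} {g : ℂ → V}

theorem fderiv_comp_hol (hg : DifferentiableAt ℝ g (τ z)) (h : HolAt τ z) (v : ℂ) :
    fderiv ℝ (g ∘ τ) z v = ((deriv τ z * v).re : ℂ) • fderiv ℝ g (τ z) 1 +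
      ((deriv τ z * v).im : ℂ) • fderiv ℝ g (τ z) Complex.I := by
  have hτ : DifferentiableAt ℝ τ z := h.smooth.differentiableAt (by simp)
  rw [fderiv_comp z hg hτ, ContinuousLinearMap.comp_apply, h.fderiv_apply, Complex.coe_smul,
    Complex.coe_smul, ← map_smul, ← map_smul, ← map_add]
  congr 1
  simp [Complex.ext_iff]

theorem dz_comp (hg : DifferentiableAt ℝ g (τ z)) (h : HolAt τ z) :
    dz (g ∘ τ) z = deriv τ z • dz g (τ z) := by
  rw [dz, dz, fderiv_comp_hol hg h, fderiv_comp_hol hg h]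
  set a := deriv τ z
  conv_rhs => rw [← Complex.re_add_im a]
  simp only [mul_one, Complex.mul_re, Complex.mul_im, Complex.I_re, Complex.I_im, mul_zero,
    zero_sub, add_zero]
  push_cast
  match_scalars
  · ring
  · linear_combination (a.im : ℂ) / 2 * Complex.I_mul_I

theorem dzbar_comp (hg : DifferentiableAt ℝ g (τ z)) (h : HolAt τ z) :
    dzbar (g ∘ τ) z = star (deriv τ z) • dzbar g (τ z) := by
  rw [dzbar, dzbar, fderiv_comp_hol hg h, fderiv_comp_hol hg h]
  set a := deriv τ z
  have ha : star a = a.re - a.im * Complex.I := by simp [Complex.ext_iff]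
  rw [ha]
  simp only [mul_one, Complex.mul_re, Complex.mul_im, Complex.I_re, Complex.I_im, mul_zero,
    zero_sub, add_zero]
  push_cast
  match_scalars
  · ring
  · linear_combination (a.im : ℂ) / 2 * Complex.I_mul_I

theorem dzbar_eq_zero {s : ℂ → ℂ} (hs : DifferentiableAt ℂ s z) : dzbar s z = 0 := by
  have h1 := (hs.hasDerivAt.hasFDerivAt.restrictScalars ℝ).fderiv
  rw [dzbar, h1]
  simp only [ContinuousLinearMap.coe_restrictScalars', ContinuousLinearMap.toSpanSingleton_apply,
    smul_eq_mul, one_mul]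
  linear_combination (1 / 2) * deriv s z * Complex.I_mul_I

theorem dz_eq_deriv {s : ℂ → ℂ} (hs : DifferentiableAt ℂ s z) : dz s z = deriv s z := by
  have h1 := (hs.hasDerivAt.hasFDerivAt.restrictScalars ℝ).fderiv
  rw [dz, h1]
  simp only [ContinuousLinearMap.coe_restrictScalars', ContinuousLinearMap.toSpanSingleton_apply,
    smul_eq_mul, one_mul]
  linear_combination -(1 / 2) * deriv s z * Complex.I_mul_I

theorem differentiableAt_of_dzbar {s : ℂ → ℂ} (hs : DifferentiableAt ℝ s z) (h : dzbar s z = 0) :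
    DifferentiableAt ℂ s z := by
  rw [dzbar, smul_eq_zero_iff_right (by norm_num)] at h
  rw [differentiableAt_complex_iff_differentiableAt_real]
  refine ⟨hs, ?_⟩
  rw [smul_eq_mul] at h ⊢
  linear_combination -Complex.I * h + fderiv ℝ s z Complex.I * Complex.I_mul_I

theorem dz_smul {s : ℂ → ℂ} (hs : DifferentiableAt ℝ s z) (hg : DifferentiableAt ℝ g z) :
    dz (fun w => s w • g w) z = dz s z • g z + s z • dz g z := by
  simp only [dz, fderiv_fun_smul hs hg]
  simp
  module

theorem dzbar_smul {s : ℂ → ℂ} (hs : DifferentiableAt ℝ s z) (hg : DifferentiableAt ℝ g z) :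
    dzbar (fun w => s w • g w) z = dzbar s z • g z + s z • dzbar g z := by
  simp only [dzbar, fderiv_fun_smul hs hg]
  simp
  module

end Comp

namespace ConfAt

variable {f : ℂ → E4} {τ : ℂ → ℂ} {z : ℂ}

theorem comp (h : ConfAt f (τ z)) (hτ : HolAt τ z) : ConfAt (f ∘ τ) z := by
  filter_upwards [hτ.tendsto.eventually h, hτ.eventually] with w hw h2
  exact ⟨hw.1.comp w h2.smooth, hw.2.1, hw.2.2.comp w h2.conformalAt⟩

theorem fderiv_comp' (h : ConfAt f (τ z)) (hτ : HolAt τ z) (v : ℂ) :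
    fderiv ℝ (f ∘ τ) z v = (deriv τ z * v).re • du f (τ z) + (deriv τ z * v).im • dv f (τ z) := by
  rw [fderiv_comp z h.differentiableAt (hτ.smooth.differentiableAt (by simp)),
    ContinuousLinearMap.comp_apply, hτ.fderiv_apply, du, dv, ← map_smul, ← map_smul, ← map_add]
  congr 1
  simp [Complex.ext_iff]

theorem du_comp (h : ConfAt f (τ z)) (hτ : HolAt τ z) :
    du (f ∘ τ) z = (deriv τ z).re • du f (τ z) + (deriv τ z).im • dv f (τ z) := by
  rw [du, h.fderiv_comp' hτ, mul_one]

theorem dv_comp (h : ConfAt f (τ z)) (hτ : HolAt τ z) :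
    dv (f ∘ τ) z = -(deriv τ z).im • du f (τ z) + (deriv τ z).re • dv f (τ z) := by
  rw [dv, h.fderiv_comp' hτ]; simp

theorem formE_comp (h : ConfAt f (τ z)) (hτ : HolAt τ z) :
    formE (f ∘ τ) z = ‖deriv τ z‖ ^ 2 * formE f (τ z) := by
  have h2 : inner ℝ (dv f (τ z)) (dv f (τ z)) = formE f (τ z) := h.formG_eq
  have h3 : inner ℝ (du f (τ z)) (dv f (τ z)) = 0 := h.formF_eq
  have h4 : inner ℝ (dv f (τ z)) (du f (τ z)) = 0 := by rw [real_inner_comm]; exact h3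
  rw [formE, h.du_comp hτ, ← Complex.normSq_eq_norm_sq, Complex.normSq_apply]
  simp only [inner_add_left, inner_add_right, real_inner_smul_left, real_inner_smul_right, h2, h3,
    h4, formE]
  ring

/-- A holomorphic change of coordinate preserves orientation: the determinant and the square root of
EG − F² acquire the same factor |τ'|². -/
theorem unitNormal_comp (h : ConfAt f (τ z)) (hτ : HolAt τ z) :
    unitNormal (f ∘ τ) z = unitNormal f (τ z) := by
  have hpos : (0 : ℝ) < ‖deriv τ z‖ ^ 2 := pow_pos (norm_pos_iff.2 hτ.2) 2
  have hE := h.formE_pos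
  ext i
  change normalComponent (f ∘ τ) z _ = normalComponent f (τ z) _
  rw [normalComponent_eq_det4, normalComponent_eq_det4, (h.comp hτ).sqrt_gramDet, h.sqrt_gramDet,
    h.formE_comp hτ, h.du_comp hτ, h.dv_comp hτ, div_eq_div_iff (by positivity) hE.ne',
    ← Complex.normSq_eq_norm_sq, Complex.normSq_apply, det4_eq, det4_eq]
  simp only [Function.comp_apply, PiLp.add_apply, PiLp.smul_apply, smul_eq_mul]
  ring

theorem normalLift_comp (h : ConfAt f (τ z)) (hτ : HolAt τ z) :
    normalLift (f ∘ τ) z = normalLift f (τ z) := by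
  rw [normalLift, normalLift, h.unitNormal_comp hτ]

theorem eventually_comp (h : ConfAt f (τ z)) (hτ : HolAt τ z) :
    ∀ᶠ w in 𝓝 z, ConfAt f (τ w) ∧ HolAt τ w :=
  (hτ.tendsto.eventually h.eventually).and hτ.eventually

theorem dz_comp_eventually {V : Type*} [NormedAddCommGroup V] [NormedSpace ℂ V] {g : ℂ → V}
    (hg : ContDiffAt ℝ ∞ g (τ z)) (hτ : HolAt τ z) :
    dz (g ∘ τ) =ᶠ[𝓝 z] fun w => deriv τ w • (dz g ∘ τ) w := by
  filter_upwards [hτ.tendsto.eventually (eventually_differentiableAt hg), hτ.eventually] with w h1 h2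
  exact dz_comp h1 h2

theorem dzbar_dz_comp {V : Type*} [NormedAddCommGroup V] [NormedSpace ℂ V] {g : ℂ → V}
    (hg : ContDiffAt ℝ ∞ g (τ z)) (hτ : HolAt τ z) :
    dzbar (dz (g ∘ τ)) z = (‖deriv τ z‖ ^ 2 : ℂ) • dzbar (dz g) (τ z) := by
  have h1 : DifferentiableAt ℝ (dz g) (τ z) := (smooth_dz hg).differentiableAt (by simp)
  have hτd : DifferentiableAt ℝ τ z := hτ.smooth.differentiableAt (by simp)
  rw [(dzbar_congr (dz_comp_eventually hg hτ)).eq_of_nhds,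
    dzbar_smul (hτ.smooth_deriv.differentiableAt (by simp)) (h1.comp z hτd),
    dzbar_eq_zero hτ.1.deriv.differentiableAt, dzbar_comp h1 hτ, zero_smul, zero_add, smul_smul,
    Complex.star_def, Complex.mul_conj, Complex.normSq_eq_norm_sq]
  push_cast; rfl

theorem dz_dz_comp {V : Type*} [NormedAddCommGroup V] [NormedSpace ℂ V] {g : ℂ → V}
    (hg : ContDiffAt ℝ ∞ g (τ z)) (hτ : HolAt τ z) :
    dz (dz (g ∘ τ)) z = deriv (deriv τ) z • dz g (τ z) + deriv τ z ^ 2 • dz (dz g) (τ z) := by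
  have h1 : DifferentiableAt ℝ (dz g) (τ z) := (smooth_dz hg).differentiableAt (by simp)
  have hτd : DifferentiableAt ℝ τ z := hτ.smooth.differentiableAt (by simp)
  rw [(dz_congr (dz_comp_eventually hg hτ)).eq_of_nhds,
    dz_smul (hτ.smooth_deriv.differentiableAt (by simp)) (h1.comp z hτd),
    dz_eq_deriv hτ.1.deriv.differentiableAt, dz_comp h1 hτ, smul_smul, sq]
  rfl

theorem coneLift_comp (f : ℂ → E4) (τ : ℂ → ℂ) : coneLift (f ∘ τ) = coneLift f ∘ τ := rfl

/-- Both sides of 2⟨n, F_zz̄⟩ = H E scale by |τ'|². -/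
theorem meanCurvature_comp (h : ConfAt f (τ z)) (hτ : HolAt τ z) :
    meanCurvature (f ∘ τ) z = meanCurvature f (τ z) := by
  have h1 := (h.comp hτ).mink_normalLift_second
  have h2 := h.mink_normalLift_second
  have hpos : (0 : ℝ) < ‖deriv τ z‖ ^ 2 := pow_pos (norm_pos_iff.2 hτ.2) 2
  have hE := h.formE_pos
  rw [h.normalLift_comp hτ, coneLift_comp, dzbar_dz_comp (smooth_coneLift h.smooth) hτ,
    mink_smul_right, h.formE_comp hτ] at h1
  have h3 : ((meanCurvature (f ∘ τ) z * (‖deriv τ z‖ ^ 2 * formE f (τ z)) : ℝ) : ℂ) =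
      ((meanCurvature f (τ z) * (‖deriv τ z‖ ^ 2 * formE f (τ z)) : ℝ) : ℂ) := by
    push_cast at h1 h2 ⊢
    linear_combination (‖deriv τ z‖ ^ 2 : ℂ) * h2 - h1
  have h4 : meanCurvature (f ∘ τ) z * (‖deriv τ z‖ ^ 2 * formE f (τ z)) =
      meanCurvature f (τ z) * (‖deriv τ z‖ ^ 2 * formE f (τ z)) := by exact_mod_cast h3
  exact mul_right_cancel₀ (mul_pos hpos hE).ne' h4

theorem gaussMap_comp (h : ConfAt f (τ z)) (hτ : HolAt τ z) :
    gaussMap (f ∘ τ) =ᶠ[𝓝 z] gaussMap f ∘ τ := by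
  filter_upwards [h.eventually_comp hτ] with w hw
  rw [Function.comp_apply, gaussMap, gaussMap, hw.1.normalLift_comp hw.2,
    hw.1.meanCurvature_comp hw.2, coneLift_comp, Function.comp_apply]

theorem liftScale_comp (h : ConfAt f (τ z)) (hτ : HolAt τ z) :
    liftScale (f ∘ τ) z = ‖deriv τ z‖⁻¹ * liftScale f (τ z) := by
  rw [liftScale, liftScale, h.formE_comp hτ, Real.sqrt_mul (by positivity), Real.sqrt_sq (norm_nonneg _),
    mul_inv]

/-- F_zz acquires the term τ''F_z, which is orthogonal to the normal, and the scale of the lift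
contributes 1/|τ'|. Thus k dz²/|dz| is invariant and |k||dz| is a metric. -/
theorem hopfCoeff_comp (h : ConfAt f (τ z)) (hτ : HolAt τ z) :
    hopfCoeff (f ∘ τ) z = deriv τ z ^ 2 / ‖deriv τ z‖ * hopfCoeff f (τ z) := by
  have h0 : mink (dz (coneLift f) (τ z)) (normalLift f (τ z)) = 0 := by
    rw [dz_coneLift h.differentiableAt, mink_comm, mink_smul_right, mink_sub_right, mink_smul_right,
      mink_normalLift_coneLin, mink_normalLift_coneLin, normalComponent_eq_inner,
      normalComponent_eq_inner, unitNormal_inner_du, unitNormal_inner_dv]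
    simp
  rw [(h.comp hτ).hopfCoeff_eq_mink, h.hopfCoeff_eq_mink, h.liftScale_comp hτ, h.normalLift_comp hτ,
    coneLift_comp, dz_dz_comp (smooth_coneLift h.smooth) hτ, mink_add_left, mink_smul_left,
    mink_smul_left, h0]
  push_cast
  ring

theorem norm_hopfCoeff_comp (h : ConfAt f (τ z)) (hτ : HolAt τ z) :
    ‖hopfCoeff (f ∘ τ) z‖ = ‖deriv τ z‖ * ‖hopfCoeff f (τ z)‖ := by
  have : ‖deriv τ z‖ ≠ 0 := norm_ne_zero_iff.2 hτ.2
  rw [h.hopfCoeff_comp hτ, norm_mul, norm_div, norm_pow]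
  simp only [Complex.norm_real, norm_norm]
  field_simp

theorem mink_dz_gaussMap (h : ConfAt f z) : mink (dz (gaussMap f) z) (dz (gaussMap f) z) = 0 := by
  have h1 := h.conformalFrame.dξdξ
  have h2 := smooth_dz h.smooth_gaussMap
  rw [vd_del_vgerm h.smooth_gaussMap, ← germ_mink h2 h2, ← germ_zero] at h1
  exact germ_eq_apply (smooth_mink h2 h2) contDiffAt_const h1

theorem mink_dz_dz_gaussMap (h : ConfAt f z) :
    mink (dz (gaussMap f) z) (dz (dz (gaussMap f)) z) = 0 := by
  have h1 := mink_deriv_self (del z) h.conformalFrame.dξdξ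
  have h2 := smooth_dz h.smooth_gaussMap
  rw [vd_del_vgerm h.smooth_gaussMap, vd_del_vgerm h2, ← germ_mink h2 (smooth_dz h2),
    ← germ_zero] at h1
  exact germ_eq_apply (smooth_mink h2 (smooth_dz h2)) contDiffAt_const h1

/-- The second-derivative term τ''ξ_z is null and orthogonal to ξ_zz, so only τ'⁴ survives: Q dz⁴ is
a quartic differential. -/
theorem bryantCoeff_comp (h : ConfAt f (τ z)) (hτ : HolAt τ z) :
    bryantCoeff (f ∘ τ) z = deriv τ z ^ 4 * bryantCoeff f (τ z) := by
  rw [bryantCoeff, (dz_congr (dz_congr (h.gaussMap_comp hτ))).eq_of_nhds,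
    dz_dz_comp h.smooth_gaussMap hτ, bryantCoeff]
  simp only [mink_add_left, mink_add_right, mink_smul_left, mink_smul_right, h.mink_dz_gaussMap,
    mink_comm (dz (dz (gaussMap f)) (τ z)) (dz (gaussMap f) (τ z)), h.mink_dz_dz_gaussMap]
  ring

/-- H is invariant, and H_zz̄ and |k|² both scale by |τ'|². -/
theorem willmoreAt_comp (h : ConfAt f (τ z)) (hτ : HolAt τ z) (hW : WillmoreAt f (τ z)) :
    WillmoreAt (f ∘ τ) z := by
  have h1 : (fun w => (meanCurvature (f ∘ τ) w : ℂ)) =ᶠ[𝓝 z]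
      (fun w => (meanCurvature f w : ℂ)) ∘ τ := by
    filter_upwards [h.eventually_comp hτ] with w hw
    rw [Function.comp_apply, hw.1.meanCurvature_comp hw.2]
  have h2 : ∀ g w, hopfCoeff g w * star (hopfCoeff g w) = (‖hopfCoeff g w‖ ^ 2 : ℂ) := by
    intro g w
    rw [Complex.star_def, Complex.mul_conj, Complex.normSq_eq_norm_sq]; push_cast; rfl
  rw [WillmoreAt, h2] at hW ⊢
  rw [(dzbar_congr (dz_congr h1)).eq_of_nhds,
    dzbar_dz_comp (smooth_ofReal (smooth_meanCurvature h)) hτ, h.norm_hopfCoeff_comp hτ,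
    h.meanCurvature_comp hτ, smul_eq_mul]
  push_cast
  linear_combination (‖deriv τ z‖ ^ 2 : ℂ) * hW

/-- The sign of the Möbius curvature does not depend on the coordinate. -/
theorem bryant_re_comp (h : ConfAt f (τ z)) (hτ : HolAt τ z) :
    (bryantCoeff (f ∘ τ) z * star (hopfCoeff (f ∘ τ) z) ^ 2).re =
      ‖deriv τ z‖ ^ 6 * (bryantCoeff f (τ z) * star (hopfCoeff f (τ z)) ^ 2).re := by
  have hne : (‖deriv τ z‖ : ℂ) ≠ 0 := by exact_mod_cast norm_ne_zero_iff.2 hτ.2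
  have h1 : bryantCoeff (f ∘ τ) z * star (hopfCoeff (f ∘ τ) z) ^ 2 =
      ((‖deriv τ z‖ ^ 6 : ℝ) : ℂ) * (bryantCoeff f (τ z) * star (hopfCoeff f (τ z)) ^ 2) := by
    have h2 : deriv τ z * star (deriv τ z) = (‖deriv τ z‖ : ℂ) ^ 2 := by
      rw [Complex.star_def, Complex.mul_conj, Complex.normSq_eq_norm_sq]; push_cast; rfl
    rw [h.bryantCoeff_comp hτ, h.hopfCoeff_comp hτ, star_mul', star_div₀, star_pow]
    have h3 : star (‖deriv τ z‖ : ℂ) = ‖deriv τ z‖ := by simp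
    rw [h3]
    push_cast
    field_simp
    have h4 : deriv τ z ^ 4 * star (deriv τ z) ^ 4 = (‖deriv τ z‖ : ℂ) ^ 8 := by
      rw [← mul_pow, h2]; ring
    linear_combination (bryantCoeff f (τ z) * star (hopfCoeff f (τ z)) ^ 2) * h4
  rw [h1, Complex.re_ofReal_mul]

end ConfAt

/-! ### The first variation of the Willmore functional -/

/-- The Willmore density as a function of the second jet. -/
def jetDensity (x a b p q r : E4) : ℝ :=
  let g := inner ℝ a a * inner ℝ b b - inner ℝ a b ^ 2
  (((inner ℝ a a * (det4 x a b r / √g) - 2 * inner ℝ a b * (det4 x a b q / √g) +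
    inner ℝ b b * (det4 x a b p / √g)) / (2 * g)) ^ 2 -
    ((det4 x a b p / √g) * (det4 x a b r / √g) - (det4 x a b q / √g) ^ 2) / g) * √g

theorem willmoreDensity_eq_jetDensity (f : ℂ → E4) (z : ℂ) :
    willmoreDensity f z =
      jetDensity (f z) (du f z) (dv f z) (du (du f) z) (du (dv f) z) (dv (dv f) z) := rfl

theorem smooth_jetDensity {X : Type*} [NormedAddCommGroup X] [NormedSpace ℝ X] {m : WithTop ℕ∞}
    {x a b p q r : X → E4} {t : X} (hx : ContDiffAt ℝ m x t) (ha : ContDiffAt ℝ m a t)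
    (hb : ContDiffAt ℝ m b t) (hp : ContDiffAt ℝ m p t) (hq : ContDiffAt ℝ m q t)
    (hr : ContDiffAt ℝ m r t)
    (hg : 0 < inner ℝ (a t) (a t) * inner ℝ (b t) (b t) - inner ℝ (a t) (b t) ^ 2) :
    ContDiffAt ℝ m (fun s => jetDensity (x s) (a s) (b s) (p s) (q s) (r s)) t := by
  have hE := ha.inner ℝ ha
  have hF := ha.inner ℝ hb
  have hG := hb.inner ℝ hb
  have hgr := (hE.mul hG).sub (hF.pow 2)
  have hs := hgr.sqrt hg.ne'
  have hs0 := (Real.sqrt_pos.2 hg).ne'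
  have hl := (smooth_det4 hx ha hb hp).div hs hs0
  have hm := (smooth_det4 hx ha hb hq).div hs hs0
  have hn := (smooth_det4 hx ha hb hr).div hs hs0
  exact (((((hE.mul hn).sub ((contDiffAt_const.mul hF).mul hm)).add (hG.mul hl)).div
    (contDiffAt_const.mul hgr) (mul_ne_zero two_ne_zero hg.ne')).pow 2 |>.sub
      (((hl.mul hn).sub (hm.pow 2)).div hgr hg.ne')).mul hs

theorem hasDerivAt_det3 {a1 a2 a3 b1 b2 b3 c1 c2 c3 : ℝ → ℝ}
    {a1' a2' a3' b1' b2' b3' c1' c2' c3' t : ℝ} (ha1 : HasDerivAt a1 a1' t)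
    (ha2 : HasDerivAt a2 a2' t) (ha3 : HasDerivAt a3 a3' t) (hb1 : HasDerivAt b1 b1' t)
    (hb2 : HasDerivAt b2 b2' t) (hb3 : HasDerivAt b3 b3' t) (hc1 : HasDerivAt c1 c1' t)
    (hc2 : HasDerivAt c2 c2' t) (hc3 : HasDerivAt c3 c3' t) :
    HasDerivAt (fun s => a1 s * (b2 s * c3 s - b3 s * c2 s) - a2 s * (b1 s * c3 s - b3 s * c1 s) +
      a3 s * (b1 s * c2 s - b2 s * c1 s))
      ((a1' * (b2 t * c3 t - b3 t * c2 t) - a2' * (b1 t * c3 t - b3 t * c1 t) +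
        a3' * (b1 t * c2 t - b2 t * c1 t)) +
      (a1 t * (b2' * c3 t - b3' * c2 t) - a2 t * (b1' * c3 t - b3' * c1 t) +
        a3 t * (b1' * c2 t - b2' * c1 t)) +
      (a1 t * (b2 t * c3' - b3 t * c2') - a2 t * (b1 t * c3' - b3 t * c1') +
        a3 t * (b1 t * c2' - b2 t * c1'))) t := by
  refine (((ha1.mul ((hb2.mul hc3).sub (hb3.mul hc2))).sub
    (ha2.mul ((hb1.mul hc3).sub (hb3.mul hc1)))).add
      (ha3.mul ((hb1.mul hc2).sub (hb2.mul hc1)))).congr_deriv ?_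
  simp only [Pi.mul_apply, Pi.sub_apply]
  ring

theorem hasDerivAt_coord {a : ℝ → E4} {a' : E4} {t : ℝ} (ha : HasDerivAt a a' t) (i : Fin 4) :
    HasDerivAt (fun s => a s i) (a' i) t := by
  exact (EuclideanSpace.proj i : E4 →L[ℝ] ℝ).hasFDerivAt.comp_hasDerivAt t ha

theorem HasDerivAt.det4 {a b c d : ℝ → E4} {a' b' c' d' : E4} {t : ℝ} (ha : HasDerivAt a a' t)
    (hb : HasDerivAt b b' t) (hc : HasDerivAt c c' t) (hd : HasDerivAt d d' t) :
    HasDerivAt (fun s => det4 (a s) (b s) (c s) (d s))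
      (MobiusSurface.det4 a' (b t) (c t) (d t) + MobiusSurface.det4 (a t) b' (c t) (d t) +
        MobiusSurface.det4 (a t) (b t) c' (d t) + MobiusSurface.det4 (a t) (b t) (c t) d') t := by
  have A := hasDerivAt_coord ha
  have B := hasDerivAt_coord hb
  have C := hasDerivAt_coord hc
  have D := hasDerivAt_coord hd
  have m0 := hasDerivAt_det3 (A 1) (A 2) (A 3) (B 1) (B 2) (B 3) (C 1) (C 2) (C 3)
  have m1 := hasDerivAt_det3 (A 0) (A 2) (A 3) (B 0) (B 2) (B 3) (C 0) (C 2) (C 3)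
  have m2 := hasDerivAt_det3 (A 0) (A 1) (A 3) (B 0) (B 1) (B 3) (C 0) (C 1) (C 3)
  have m3 := hasDerivAt_det3 (A 0) (A 1) (A 2) (B 0) (B 1) (B 2) (C 0) (C 1) (C 2)
  have h := ((((D 1).mul m1).sub ((D 0).mul m0)).sub ((D 2).mul m2)).add ((D 3).mul m3)
  refine (h.congr_of_eventuallyEq (Eventually.of_forall fun s => ?_)).congr_deriv ?_
  · simp only [det4_eq, Pi.mul_apply, Pi.sub_apply, Pi.add_apply]; ring
  · simp only [det4_eq]; ring

/-- det A · det Bᵀ = det(ABᵀ). Multiplying by the determinant of an adapted frame turns an unknown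
determinant into one whose entries are known inner products. -/
theorem det4_mul_det4 (a b c d a' b' c' d' : E4) :
    MobiusSurface.det4 a b c d * MobiusSurface.det4 a' b' c' d' =
      MobiusSurface.det4 (!₂[inner ℝ a a', inner ℝ a b', inner ℝ a c', inner ℝ a d'])
        (!₂[inner ℝ b a', inner ℝ b b', inner ℝ b c', inner ℝ b d'])
        (!₂[inner ℝ c a', inner ℝ c b', inner ℝ c c', inner ℝ c d'])
        (!₂[inner ℝ d a', inner ℝ d b', inner ℝ d c', inner ℝ d d']) := by
  rw [det4, det4, ← Matrix.det_transpose (Matrix.of fun i j => ![a', b', c', d'] i j),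
    ← Matrix.det_mul, det4]
  congr 1
  ext i j
  fin_cases i <;> fin_cases j <;> simp [Matrix.mul_apply, Fin.sum_univ_four, inner_E4]

/-- The derivative of the Willmore density in terms of the derivatives of the fundamental forms. -/
theorem hasDerivAt_density {E F G l m n : ℝ → ℝ} {E' F' G' l' m' n' lam a b c : ℝ} (hlam : 0 < lam)
    (hE : HasDerivAt E E' 0) (hF : HasDerivAt F F' 0) (hG : HasDerivAt G G' 0)
    (hl : HasDerivAt l l' 0) (hm : HasDerivAt m m' 0) (hn : HasDerivAt n n' 0)
    (E0 : E 0 = lam) (F0 : F 0 = 0) (G0 : G 0 = lam) (l0 : l 0 = lam * a) (m0 : m 0 = lam * b)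
    (n0 : n 0 = lam * c) :
    HasDerivAt (fun t => (((E t * (n t / √(E t * G t - F t ^ 2)) -
        2 * F t * (m t / √(E t * G t - F t ^ 2)) + G t * (l t / √(E t * G t - F t ^ 2))) /
          (2 * (E t * G t - F t ^ 2))) ^ 2 -
        ((l t / √(E t * G t - F t ^ 2)) * (n t / √(E t * G t - F t ^ 2)) -
          (m t / √(E t * G t - F t ^ 2)) ^ 2) / (E t * G t - F t ^ 2)) * √(E t * G t - F t ^ 2))
      (((a - c) * (l' - n') + 4 * b * m') / (2 * lam ^ 2) +
        ((a + c) * (c * E' - 2 * b * F' + a * G') / (2 * lam ^ 2) -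
          (5 * (a + c) ^ 2 / 8 - 3 * (a * c - b ^ 2) / 2) * (E' + G') / lam ^ 2)) 0 := by
  have hg := (hE.mul hG).sub (hF.pow 2)
  -- At time 0 the first form is `lam` times the identity. The functions `l`, `m`, `n` are
  -- determinants not yet divided by the area factor, so the second form at time 0 has coefficients
  -- `a`, `b`, `c`.
  have g0 : E 0 * G 0 - F 0 ^ 2 = lam ^ 2 := by rw [E0, F0, G0]; ring
  have hgp : 0 < E 0 * G 0 - F 0 ^ 2 := by rw [g0]; positivity
  have hs := hg.sqrt hgp.ne'
  have s0 : √(E 0 * G 0 - F 0 ^ 2) = lam := by rw [g0, Real.sqrt_sq hlam.le]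
  have hs0 : √(E 0 * G 0 - F 0 ^ 2) ≠ 0 := by rw [s0]; exact hlam.ne'
  have hl1 := hl.div hs hs0
  have hm1 := hm.div hs hs0
  have hn1 := hn.div hs hs0
  refine (((((hE.mul hn1).sub ((hF.const_mul 2).mul hm1)).add (hG.mul hl1)).div
    (hg.const_mul 2) (mul_ne_zero two_ne_zero hgp.ne')).pow 2 |>.sub
      (((hl1.mul hn1).sub (hm1.pow 2)).div hg hgp.ne')).mul hs |>.congr_deriv ?_
  simp only [Pi.mul_apply, Pi.sub_apply, Pi.add_apply, Pi.pow_apply, Pi.div_apply, E0, F0, G0, l0, m0, n0]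
  have s1 : √(lam * lam - 0 ^ 2) = lam := by
    rw [show lam * lam - 0 ^ 2 = lam ^ 2 by ring, Real.sqrt_sq hlam.le]
  rw [s1]
  rw [show lam * lam - 0 ^ 2 = lam ^ 2 by ring]
  have hlam' := hlam.ne'
  simp only [mul_zero, zero_mul, Nat.cast_ofNat, mul_div_cancel_left₀ _ hlam', sub_zero, pow_one,
    show 2 - 1 = 1 from rfl, add_zero]
  rw [← sub_eq_zero]
  field_simp
  ring_nf

/-! ### Differentiation under the spatial derivative -/

section Family

variable {V : Type*} [NormedAddCommGroup V] [NormedSpace ℝ V] {G : ℝ × ℂ → V} {t : ℝ} {z : ℂ}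

theorem fderiv_slice {q : ℝ × ℂ} (hG : DifferentiableAt ℝ G q) (v : ℂ) :
    fderiv ℝ (fun w => G (q.1, w)) q.2 v = fderiv ℝ G q (0, v) := by
  have h1 : HasFDerivAt G (fderiv ℝ G q) (q.1, q.2) := hG.hasFDerivAt
  have h2 := h1.comp q.2 (hasFDerivAt_prodMk_right (𝕜 := ℝ) q.1 q.2)
  have h3 : HasFDerivAt (fun w => G (q.1, w)) _ q.2 := h2
  rw [h3.fderiv]; rfl

theorem deriv_slice {q : ℝ × ℂ} (hG : DifferentiableAt ℝ G q) :
    HasDerivAt (fun s => G (s, q.2)) (fderiv ℝ G q (1, 0)) q.1 := by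
  have h1 : HasFDerivAt G (fderiv ℝ G q) (q.1, q.2) := hG.hasFDerivAt
  have h2 := h1.comp q.1 (hasFDerivAt_prodMk_left (𝕜 := ℝ) q.1 q.2)
  have h3 : HasFDerivAt (fun s => G (s, q.2)) _ q.1 := h2
  exact h3.hasDerivAt

theorem eventually_differentiableAt_prod (hG : ContDiffAt ℝ ∞ G (t, z)) :
    ∀ᶠ q in 𝓝 (t, z), DifferentiableAt ℝ G q := by
  have h1 : ContDiffAt ℝ 1 G (t, z) := hG.of_le one_le_infty
  filter_upwards [h1.eventually (by simp)] with w hw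
  exact hw.differentiableAt (by simp)

theorem slice_eventuallyEq (hG : ContDiffAt ℝ ∞ G (t, z)) (v : ℂ) :
    (fun q : ℝ × ℂ => fderiv ℝ (fun w => G (q.1, w)) q.2 v) =ᶠ[𝓝 (t, z)]
      fun q => fderiv ℝ G q (0, v) := by
  filter_upwards [eventually_differentiableAt_prod hG] with q hq using fderiv_slice hq v

theorem smooth_slice (hG : ContDiffAt ℝ ∞ G (t, z)) (v : ℂ) :
    ContDiffAt ℝ ∞ (fun q : ℝ × ℂ => fderiv ℝ (fun w => G (q.1, w)) q.2 v) (t, z) :=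
  (ContDiffAt.clm_apply (hG.fderiv_right (m := ∞) (by simp)) contDiffAt_const).congr_of_eventuallyEq
    (slice_eventuallyEq hG v)

/-- The time derivative and the spatial derivative commute by symmetry of the second derivative of G
on ℝ × ℂ. -/
theorem hasDerivAt_slice (hG : ContDiffAt ℝ ∞ G (t, z)) (v : ℂ) {X : ℂ → V}
    (hX : ∀ᶠ w in 𝓝 z, HasDerivAt (fun s => G (s, w)) (X w) t) :
    HasDerivAt (fun s => fderiv ℝ (fun w => G (s, w)) z v) (fderiv ℝ X z v) t := by
  have h1 : DifferentiableAt ℝ (fderiv ℝ G) (t, z) :=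
    (hG.fderiv_right (m := ∞) (by simp)).differentiableAt (by simp)
  have hs := deriv_slice ((smooth_slice hG v).differentiableAt (by simp))
  refine hs.congr_deriv ?_
  rw [(slice_eventuallyEq hG v).fderiv_eq (𝕜 := ℝ)]
  have hX' : X =ᶠ[𝓝 z] fun w => fderiv ℝ G (t, w) (1, 0) := by
    have hc : Tendsto (fun w : ℂ => (t, w)) (𝓝 z) (𝓝 (t, z)) :=
      (Continuous.prodMk_right t).tendsto z
    filter_upwards [hX, hc.eventually (eventually_differentiableAt_prod hG)] with w hw hd
    exact hw.unique (deriv_slice (q := (t, w)) hd)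
  rw [hX'.fderiv_eq (𝕜 := ℝ)]
  have h2 : DifferentiableAt ℝ (fun q => fderiv ℝ G q ((1 : ℝ), (0 : ℂ))) (t, z) :=
    h1.clm_apply (differentiableAt_const _)
  rw [fderiv_slice (G := fun q => fderiv ℝ G q ((1 : ℝ), (0 : ℂ))) h2 v]
  rw [fderiv_clm_apply h1 (differentiableAt_const _), fderiv_clm_apply h1 (differentiableAt_const _)]
  simp only [fderiv_fun_const, Pi.zero_apply, ContinuousLinearMap.comp_zero, zero_add,
    ContinuousLinearMap.flip_apply]
  have hsymm : IsSymmSndFDerivAt ℝ G (t, z) := by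
    refine hG.isSymmSndFDerivAt ?_
    simp only [minSmoothness_of_isRCLikeNormedField]
    exact two_le_infty
  exact hsymm _ _

end Family

/-! ### Inner products of the derivatives of a conformal immersion -/

theorem inner_fderiv_eq {a b : ℂ → E4} {c : ℂ → ℝ} {z : ℂ} (ha : DifferentiableAt ℝ a z)
    (hb : DifferentiableAt ℝ b z) (h : ∀ᶠ w in 𝓝 z, inner ℝ (a w) (b w) = c w) (v : ℂ) :
    inner ℝ (a z) (fderiv ℝ b z v) + inner ℝ (fderiv ℝ a z v) (b z) = fderiv ℝ c z v := by
  have h1 : (fun w => inner ℝ (a w) (b w)) =ᶠ[𝓝 z] c := h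
  rw [← h1.fderiv_eq (𝕜 := ℝ), fderiv_inner_apply ℝ ha hb]

namespace ConfAt

variable {f : ℂ → E4} {z : ℂ}

theorem det4_eq_normal (h : ConfAt f z) (w : E4) :
    MobiusSurface.det4 (f z) (du f z) (dv f z) w = formE f z * inner ℝ (unitNormal f z) w := by
  rw [← normalComponent_eq_inner, normalComponent_eq_det4, h.sqrt_gramDet,
    mul_div_cancel₀ _ h.formE_pos.ne']

theorem formL_eq_inner (f : ℂ → E4) (z : ℂ) : formL f z = inner ℝ (unitNormal f z) (du (du f) z) :=
  normalComponent_eq_inner _ _ _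

theorem formM_eq_inner (f : ℂ → E4) (z : ℂ) : formM f z = inner ℝ (unitNormal f z) (du (dv f) z) :=
  normalComponent_eq_inner _ _ _

theorem formN_eq_inner (f : ℂ → E4) (z : ℂ) : formN f z = inner ℝ (unitNormal f z) (dv (dv f) z) :=
  normalComponent_eq_inner _ _ _

theorem second_inner_point (h : ConfAt f z) : inner ℝ (f z) (du (du f) z) = -formE f z ∧
    inner ℝ (f z) (du (dv f) z) = 0 ∧ inner ℝ (f z) (dv (dv f) z) = -formE f z := by
  have hf := h.differentiableAt
  have hu : DifferentiableAt ℝ (du f) z := (smooth_du h.smooth).differentiableAt (by simp)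
  have hv : DifferentiableAt ℝ (dv f) z := (smooth_dv h.smooth).differentiableAt (by simp)
  have a1 := inner_fderiv_eq (c := fun _ => 0) hf hu (h.eventually.mono fun w hw => hw.inner_du) 1
  have a2 := inner_fderiv_eq (c := fun _ => 0) hf hv (h.eventually.mono fun w hw => hw.inner_dv) 1
  have a3 := inner_fderiv_eq (c := fun _ => 0) hf hv (h.eventually.mono fun w hw => hw.inner_dv)
    Complex.I
  simp only [fderiv_fun_const, Pi.zero_apply, zero_apply] at a1 a2 a3
  have e1 : inner ℝ (fderiv ℝ f z 1) (du f z) = formE f z := rfl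
  have e2 : inner ℝ (fderiv ℝ f z 1) (dv f z) = 0 := h.formF_eq
  have e3 : inner ℝ (fderiv ℝ f z Complex.I) (dv f z) = formE f z := h.formG_eq
  rw [e1] at a1; rw [e2] at a2; rw [e3] at a3
  change inner ℝ (f z) (du (du f) z) + _ = _ at a1
  change inner ℝ (f z) (du (dv f) z) + _ = _ at a2
  change inner ℝ (f z) (dv (dv f) z) + _ = _ at a3
  exact ⟨by linarith, by linarith, by linarith⟩

/-- The Christoffel symbols of E(du² + dv²), obtained by differentiating the relations E = G and F =
0. -/
theorem second_inner_tangent (h : ConfAt f z) :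
    2 * inner ℝ (du f z) (du (du f) z) = fderiv ℝ (formE f) z 1 ∧
    2 * inner ℝ (du f z) (du (dv f) z) = fderiv ℝ (formE f) z Complex.I ∧
    2 * inner ℝ (du f z) (dv (dv f) z) = -fderiv ℝ (formE f) z 1 ∧
    2 * inner ℝ (dv f z) (du (du f) z) = -fderiv ℝ (formE f) z Complex.I ∧
    2 * inner ℝ (dv f z) (du (dv f) z) = fderiv ℝ (formE f) z 1 ∧
    2 * inner ℝ (dv f z) (dv (dv f) z) = fderiv ℝ (formE f) z Complex.I := by
  have hu : DifferentiableAt ℝ (du f) z := (smooth_du h.smooth).differentiableAt (by simp)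
  have hv : DifferentiableAt ℝ (dv f) z := (smooth_dv h.smooth).differentiableAt (by simp)
  have hE : ∀ᶠ w in 𝓝 z, inner ℝ (du f w) (du f w) = formE f w := Eventually.of_forall fun _ => rfl
  have hG : ∀ᶠ w in 𝓝 z, inner ℝ (dv f w) (dv f w) = formE f w :=
    h.eventually.mono fun _ hw => hw.formG_eq
  have hF : ∀ᶠ w in 𝓝 z, inner ℝ (du f w) (dv f w) = 0 :=
    h.eventually.mono fun _ hw => hw.formF_eq
  have a1 := inner_fderiv_eq hu hu hE 1
  have a2 := inner_fderiv_eq hu hu hE Complex.I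
  have b1 := inner_fderiv_eq hv hv hG 1
  have b2 := inner_fderiv_eq hv hv hG Complex.I
  have c1 := inner_fderiv_eq hu hv (c := fun _ => 0) hF 1
  have c2 := inner_fderiv_eq hu hv (c := fun _ => 0) hF Complex.I
  simp only [fderiv_fun_const, Pi.zero_apply, zero_apply] at c1 c2
  change inner ℝ (du f z) (du (du f) z) + inner ℝ (du (du f) z) (du f z) = _ at a1
  change inner ℝ (du f z) (dv (du f) z) + inner ℝ (dv (du f) z) (du f z) = _ at a2
  change inner ℝ (dv f z) (du (dv f) z) + inner ℝ (du (dv f) z) (dv f z) = _ at b1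
  change inner ℝ (dv f z) (dv (dv f) z) + inner ℝ (dv (dv f) z) (dv f z) = _ at b2
  change inner ℝ (du f z) (du (dv f) z) + inner ℝ (du (du f) z) (dv f z) = _ at c1
  change inner ℝ (du f z) (dv (dv f) z) + inner ℝ (dv (du f) z) (dv f z) = _ at c2
  rw [real_inner_comm (du f z)] at a1
  rw [dv_du h.smooth, real_inner_comm (du f z)] at a2
  rw [real_inner_comm (dv f z)] at b1 b2 c1
  rw [dv_du h.smooth, real_inner_comm (dv f z)] at c2
  exact ⟨by linarith, by linarith, by linarith, by linarith, by linarith, by linarith⟩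

theorem normal_deriv_point (h : ConfAt f z) (v : ℂ) :
    inner ℝ (f z) (fderiv ℝ (unitNormal f) z v) = 0 := by
  have hn : DifferentiableAt ℝ (unitNormal f) z := (smooth_unitNormal h).differentiableAt (by simp)
  obtain ⟨c, -, hc⟩ := h.exists_factor
  have a := inner_fderiv_eq (c := fun _ => 0) hn h.differentiableAt
    (Eventually.of_forall fun w => unitNormal_inner_point f w) v
  simp only [fderiv_fun_const, Pi.zero_apply, zero_apply] at a
  have hv : fderiv ℝ f z v = v.re • du f z + v.im • dv f z := by
    rw [du, dv, ← map_smul, ← map_smul, ← map_add]; congr 1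
    apply Complex.ext <;> simp
  rw [hv, inner_add_right, inner_smul_right, inner_smul_right, unitNormal_inner_du,
    unitNormal_inner_dv, real_inner_comm] at a
  linarith

theorem normal_deriv_normal (h : ConfAt f z) (v : ℂ) :
    inner ℝ (unitNormal f z) (fderiv ℝ (unitNormal f) z v) = 0 := by
  have hn : DifferentiableAt ℝ (unitNormal f) z := (smooth_unitNormal h).differentiableAt (by simp)
  have a := inner_fderiv_eq (c := fun _ => 1) hn hn (h.eventually.mono fun w hw => hw.normal_sq) v
  simp only [fderiv_fun_const, Pi.zero_apply, zero_apply] at a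
  rw [real_inner_comm (unitNormal f z)] at a
  linarith

/-- The Weingarten equations, from ⟨n, f_u⟩ = ⟨n, f_v⟩ = 0. -/
theorem normal_deriv_tangent (h : ConfAt f z) :
    inner ℝ (du f z) (du (unitNormal f) z) = -formL f z ∧
    inner ℝ (dv f z) (du (unitNormal f) z) = -formM f z ∧
    inner ℝ (du f z) (dv (unitNormal f) z) = -formM f z ∧
    inner ℝ (dv f z) (dv (unitNormal f) z) = -formN f z := by
  have hu : DifferentiableAt ℝ (du f) z := (smooth_du h.smooth).differentiableAt (by simp)
  have hv : DifferentiableAt ℝ (dv f) z := (smooth_dv h.smooth).differentiableAt (by simp)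
  have hn : DifferentiableAt ℝ (unitNormal f) z := (smooth_unitNormal h).differentiableAt (by simp)
  have hU := Eventually.of_forall (f := 𝓝 z) fun w => unitNormal_inner_du f w
  have hV := Eventually.of_forall (f := 𝓝 z) fun w => unitNormal_inner_dv f w
  have a1 := inner_fderiv_eq (c := fun _ => 0) hn hu hU 1
  have a2 := inner_fderiv_eq (c := fun _ => 0) hn hu hU Complex.I
  have b1 := inner_fderiv_eq (c := fun _ => 0) hn hv hV 1
  have b2 := inner_fderiv_eq (c := fun _ => 0) hn hv hV Complex.I
  simp only [fderiv_fun_const, Pi.zero_apply, zero_apply] at a1 a2 b1 b2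
  change inner ℝ (unitNormal f z) (du (du f) z) + inner ℝ (du (unitNormal f) z) (du f z) = _ at a1
  change inner ℝ (unitNormal f z) (dv (du f) z) + inner ℝ (dv (unitNormal f) z) (du f z) = _ at a2
  change inner ℝ (unitNormal f z) (du (dv f) z) + inner ℝ (du (unitNormal f) z) (dv f z) = _ at b1
  change inner ℝ (unitNormal f z) (dv (dv f) z) + inner ℝ (dv (unitNormal f) z) (dv f z) = _ at b2
  rw [dv_du h.smooth] at a2
  rw [real_inner_comm (du f z)] at a1 a2
  rw [real_inner_comm (dv f z)] at b1 b2
  rw [formL_eq_inner, formM_eq_inner, formN_eq_inner]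
  exact ⟨by linarith, by linarith, by linarith, by linarith⟩

/-- Parseval's identity in the orthogonal frame `f, f_u, f_v, n`. -/
theorem parseval (h : ConfAt f z) (a b : E4) : inner ℝ a b =
    inner ℝ (f z) a * inner ℝ (f z) b + inner ℝ (du f z) a * inner ℝ (du f z) b / formE f z +
      inner ℝ (dv f z) a * inner ℝ (dv f z) b / formE f z +
      inner ℝ (unitNormal f z) a * inner ℝ (unitNormal f z) b := by
  set s := liftScale f z with hs
  have hsE := h.liftScale_sq
  have e1 : inner ℝ (du f z) (du f z) = formE f z := rfl
  have e2 : inner ℝ (du f z) (dv f z) = 0 := h.formF_eq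
  have e3 : inner ℝ (dv f z) (dv f z) = formE f z := h.formG_eq
  have e4 : inner ℝ (dv f z) (du f z) = 0 := by rw [real_inner_comm]; exact e2
  have e5 : inner ℝ (f z) (f z) = 1 := by rw [real_inner_self_eq_norm_sq, h.norm_eq]; simp
  have e6 : inner ℝ (du f z) (f z) = 0 := by rw [real_inner_comm]; exact h.inner_du
  have e7 : inner ℝ (dv f z) (f z) = 0 := by rw [real_inner_comm]; exact h.inner_dv
  have n1 := unitNormal_inner_point f z
  have n2 := unitNormal_inner_du f z
  have n3 := unitNormal_inner_dv f z
  have n4 : inner ℝ (f z) (unitNormal f z) = 0 := by rw [real_inner_comm]; exact n1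
  have n5 : inner ℝ (du f z) (unitNormal f z) = 0 := by rw [real_inner_comm]; exact n2
  have n6 : inner ℝ (dv f z) (unitNormal f z) = 0 := by rw [real_inner_comm]; exact n3
  have n7 := h.normal_sq
  have h1 : s * (s * formE f z) = 1 := by rw [← hsE]; ring
  have ho : Orthonormal ℝ ![f z, s • du f z, s • dv f z, unitNormal f z] := by
    rw [orthonormal_iff_ite]
    intro i j
    fin_cases i <;> fin_cases j <;>
      simp [-inner_self_eq_norm_sq_to_K, inner_smul_left, inner_smul_right, e1, e2, e3, e4, e5, e6, e7,
        h.inner_du, h.inner_dv, n1, n2, n3, n4, n5, n6, n7, h1]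
  let B := basisOfOrthonormalOfCardEqFinrank ho (by simp)
  have hB : Orthonormal ℝ B := by
    rw [coe_basisOfOrthonormalOfCardEqFinrank]; exact ho
  have hp := (B.toOrthonormalBasis hB).sum_inner_mul_inner a b
  rw [Fin.sum_univ_four] at hp
  simp only [Module.Basis.coe_toOrthonormalBasis, B, coe_basisOfOrthonormalOfCardEqFinrank] at hp
  rw [← hp]
  have hE : s * s = 1 / formE f z := by
    rw [eq_div_iff h.formE_pos.ne', mul_assoc, h1]
  have q := fun v => real_inner_comm v a
  simp only [Matrix.cons_val, inner_smul_left, q]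
  simp
  linear_combination (inner ℝ (du f z) a * inner ℝ (du f z) b +
    inner ℝ (dv f z) a * inner ℝ (dv f z) b) * hE

end ConfAt

/-- For a variation with velocity X = φn the left side is the time derivative of det(f, f_u, f_v,
p), p being a second derivative of f. Each determinant is multiplied by det(f, f_u, f_v, n) = λ,
which gives a sparse Gram determinant; the tangential parts of X_u and X_v are those of the
Weingarten equations. -/
theorem det4_update_sum {f fu fv n X Xu Xv Xp p : E4} {lam L M N φ φu φv : ℝ} (hlam : lam ≠ 0)
    (e0 : inner ℝ f f = 1) (e1 : inner ℝ fu fu = lam) (e2 : inner ℝ fv fv = lam)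
    (e3 : inner ℝ f fu = 0) (e4 : inner ℝ f fv = 0) (e5 : inner ℝ fu fv = 0)
    (n0 : inner ℝ f n = 0) (n1 : inner ℝ fu n = 0) (n2 : inner ℝ fv n = 0)
    (det : det4 f fu fv n = lam)
    (x0 : inner ℝ X f = 0) (x1 : inner ℝ X fu = 0) (x2 : inner ℝ X fv = 0) (x3 : inner ℝ X n = φ)
    (u1 : inner ℝ Xu fu = -(φ * L)) (u2 : inner ℝ Xu fv = -(φ * M)) (u3 : inner ℝ Xu n = φu)
    (v1 : inner ℝ Xv fu = -(φ * M)) (v2 : inner ℝ Xv fv = -(φ * N)) (v3 : inner ℝ Xv n = φv) :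
    det4 X fu fv p + det4 f Xu fv p + det4 f fu Xv p + det4 f fu fv Xp =
      -(φ * lam * inner ℝ p f) - φ * (L + N) * inner ℝ p n - φu * inner ℝ p fu - φv * inner ℝ p fv
        + lam * inner ℝ Xp n := by
  have e3' : inner ℝ fu f = 0 := by rw [real_inner_comm]; exact e3
  have e4' : inner ℝ fv f = 0 := by rw [real_inner_comm]; exact e4
  have e5' : inner ℝ fv fu = 0 := by rw [real_inner_comm]; exact e5
  have h1 := det4_mul_det4 X fu fv p f fu fv n
  have h2 := det4_mul_det4 f Xu fv p f fu fv n
  have h3 := det4_mul_det4 f fu Xv p f fu fv n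
  have h4 := det4_mul_det4 f fu fv Xp f fu fv n
  rw [det] at h1 h2 h3 h4
  rw [det4_eq !₂[_, _, _, _]] at h1 h2 h3 h4
  simp only [e0, e1, e2, e3, e4, e5, e3', e4', e5', n0, n1, n2, x0, x1, x2, x3, u1, u2, u3, v1, v2,
    v3, Matrix.cons_val] at h1 h2 h3 h4
  refine mul_right_cancel₀ hlam ?_
  rw [add_mul, add_mul, add_mul, h1, h2, h3, h4]
  ring

/-- A smooth normal variation of a surface, at the parameter `z`. -/
structure NormalVariation (f : ℂ → E4) (G : ℝ × ℂ → E4) (φ : ℂ → ℝ) (z : ℂ) : Prop where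
  conf : ConfAt f z
  smooth : ∀ᶠ w in 𝓝 z, ContDiffAt ℝ ∞ G (0, w)
  smooth_φ : ContDiffAt ℝ ∞ φ z
  zero : ∀ᶠ w in 𝓝 z, G (0, w) = f w
  deriv : ∀ᶠ w in 𝓝 z, HasDerivAt (fun s => G (s, w)) (φ w • unitNormal f w) 0

/-- The first variation of the Willmore density. -/
def densityVariation (f : ℂ → E4) (φ : ℂ → ℝ) (z : ℂ) : ℝ :=
  ((formL f z - formN f z) * (fderiv ℝ (fun w => fderiv ℝ φ w 1) z 1 -
      fderiv ℝ (fun w => fderiv ℝ φ w Complex.I) z Complex.I -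
      (fderiv ℝ (formE f) z 1 * fderiv ℝ φ z 1 -
        fderiv ℝ (formE f) z Complex.I * fderiv ℝ φ z Complex.I) / formE f z) +
    4 * formM f z * (fderiv ℝ (fun w => fderiv ℝ φ w Complex.I) z 1 -
      (fderiv ℝ (formE f) z Complex.I * fderiv ℝ φ z 1 +
        fderiv ℝ (formE f) z 1 * fderiv ℝ φ z Complex.I) / (2 * formE f z))) / (2 * formE f z) +
  ((formL f z - formN f z) ^ 2 + 4 * formM f z ^ 2) * (formL f z + formN f z) /
    (4 * formE f z ^ 2) * φ z

namespace NormalVariation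

variable {f : ℂ → E4} {G : ℝ × ℂ → E4} {φ : ℂ → ℝ} {z : ℂ}

theorem eventually (h : NormalVariation f G φ z) : ∀ᶠ w in 𝓝 z, HasDerivAt (fun s => G (s, w))
    (φ w • unitNormal f w) 0 ∧ ContDiffAt ℝ ∞ G (0, w) ∧
    ∀ᶠ x in 𝓝 w, HasDerivAt (fun s => G (s, x)) (φ x • unitNormal f x) 0 :=
  h.deriv.and (h.smooth.and (eventually_eventually_nhds.2 h.deriv))

theorem deriv_second (h : NormalVariation f G φ z) (v v' : ℂ) :
    HasDerivAt (fun s => fderiv ℝ (fun w => fderiv ℝ (fun w => G (s, w)) w v') z v)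
      (fderiv ℝ (fun w => fderiv ℝ (fun w => φ w • unitNormal f w) w v') z v) 0 := by
  refine hasDerivAt_slice (G := fun q => fderiv ℝ (fun w => G (q.1, w)) q.2 v')
    (smooth_slice h.smooth.self_of_nhds v') v ?_
  filter_upwards [h.eventually] with w hw
  exact hasDerivAt_slice hw.2.1 v' hw.2.2

theorem deriv_first (h : NormalVariation f G φ z) (v : ℂ) :
    HasDerivAt (fun s => fderiv ℝ (fun w => G (s, w)) z v)
      (fderiv ℝ (fun w => φ w • unitNormal f w) z v) 0 :=
  hasDerivAt_slice h.smooth.self_of_nhds v h.deriv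

theorem fderiv_normal (h : ConfAt f z) (hφ : ContDiffAt ℝ ∞ φ z) (v : ℂ) :
    fderiv ℝ (fun w => φ w • unitNormal f w) z v =
      φ z • fderiv ℝ (unitNormal f) z v + fderiv ℝ φ z v • unitNormal f z := by
  rw [fderiv_fun_smul (hφ.differentiableAt (by simp)) ((smooth_unitNormal h).differentiableAt (by simp))]
  simp

theorem inner_normal_first (h : ConfAt f z) (hφ : ContDiffAt ℝ ∞ φ z) (v : ℂ) :
    inner ℝ (fderiv ℝ (fun w => φ w • unitNormal f w) z v) (unitNormal f z) = fderiv ℝ φ z v := by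
  rw [fderiv_normal h hφ, inner_add_left, inner_smul_left, inner_smul_left,
    real_inner_comm, h.normal_deriv_normal, h.normal_sq]
  simp

/-- Differentiate ⟨(φn)_v', n⟩ = φ_v' in the direction v. In the correction ⟨(φn)_v', n_v⟩ the part
φ_v' n drops out because n is orthogonal to its derivatives. -/
theorem inner_normal_second (h : ConfAt f z) (hφ : ContDiffAt ℝ ∞ φ z) (v v' : ℂ) :
    inner ℝ (fderiv ℝ (fun w => fderiv ℝ (fun w => φ w • unitNormal f w) w v') z v)
      (unitNormal f z) = fderiv ℝ (fun w => fderiv ℝ φ w v') z v -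
        φ z * inner ℝ (fderiv ℝ (unitNormal f) z v') (fderiv ℝ (unitNormal f) z v) := by
  have hs : ContDiffAt ℝ ∞ (fun w => φ w • unitNormal f w) z := hφ.smul (smooth_unitNormal h)
  have hd : DifferentiableAt ℝ (fun w => fderiv ℝ (fun w => φ w • unitNormal f w) w v') z :=
    (smooth_fderiv_apply hs v').differentiableAt (by simp)
  have hn : DifferentiableAt ℝ (unitNormal f) z := (smooth_unitNormal h).differentiableAt (by simp)
  have hφ' : ∀ᶠ w in 𝓝 z, ContDiffAt ℝ 1 φ w := (hφ.of_le one_le_infty).eventually (by simp)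
  have he : ∀ᶠ w in 𝓝 z, inner ℝ (fderiv ℝ (fun w => φ w • unitNormal f w) w v')
      (unitNormal f w) = fderiv ℝ φ w v' := by
    filter_upwards [hφ', h.eventually] with w hw hc
    rw [fderiv_fun_smul (hw.differentiableAt (by simp))
      ((smooth_unitNormal hc).differentiableAt (by simp))]
    simp only [add_apply, smul_apply, ContinuousLinearMap.smulRight_apply]
    rw [inner_add_left, inner_smul_left, inner_smul_left,
      real_inner_comm, hc.normal_deriv_normal, hc.normal_sq]
    simp
  have := inner_fderiv_eq hd hn he v
  rw [fderiv_normal h hφ v', inner_add_left, inner_smul_left, inner_smul_left,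
    h.normal_deriv_normal] at this
  simp at this
  linarith

/-- The chain rule `hasDerivAt_density` is fed with the variation of the three determinants; all
inner products are then expressed through E, L, M, N and the derivatives of E and φ, by the
Christoffel, Weingarten and Parseval relations. -/
theorem hasDerivAt_willmoreDensity (h : NormalVariation f G φ z) :
    HasDerivAt (fun t => willmoreDensity (fun w => G (t, w)) z) (densityVariation f φ z) 0 := by
  have hc := h.conf
  have hG0 : (fun w => G (0, w)) =ᶠ[𝓝 z] f := h.zero
  have ez : G (0, z) = f z := hG0.eq_of_nhds
  have eu : fderiv ℝ (fun w => G (0, w)) z 1 = du f z := by rw [hG0.fderiv_eq (𝕜 := ℝ)]; rfl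
  have ev : fderiv ℝ (fun w => G (0, w)) z Complex.I = dv f z := by
    rw [hG0.fderiv_eq (𝕜 := ℝ)]; rfl
  have e2 : ∀ v v', fderiv ℝ (fun w => fderiv ℝ (fun w => G (0, w)) w v') z v =
      fderiv ℝ (fun w => fderiv ℝ f w v') z v := by
    intro v v'
    have : (fun w => fderiv ℝ (fun w => G (0, w)) w v') =ᶠ[𝓝 z] fun w => fderiv ℝ f w v' := by
      filter_upwards [hG0.fderiv (𝕜 := ℝ)] with w hw
      rw [hw]
    rw [this.fderiv_eq (𝕜 := ℝ)]
  have euu : _ = du (du f) z := e2 1 1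
  have euv : _ = du (dv f) z := e2 1 Complex.I
  have evv : _ = dv (dv f) z := e2 Complex.I Complex.I
  have dX : HasDerivAt (fun s => G (s, z)) (φ z • unitNormal f z) 0 := h.deriv.self_of_nhds
  have dU := h.deriv_first 1
  have dV := h.deriv_first Complex.I
  have dP := h.deriv_second 1 1
  have dQ := h.deriv_second 1 Complex.I
  have dR := h.deriv_second Complex.I Complex.I
  obtain ⟨p0, q0, r0⟩ := hc.second_inner_point
  obtain ⟨pu, qu, ru, pv, qv, rv⟩ := hc.second_inner_tangent
  obtain ⟨n1, n2, n3, n4⟩ := hc.normal_deriv_tangent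
  have i0 : inner ℝ (f z) (f z) = 1 := by rw [real_inner_self_eq_norm_sq, hc.norm_eq]; simp
  have i1 : inner ℝ (du f z) (du f z) = formE f z := rfl
  have i2 : inner ℝ (dv f z) (dv f z) = formE f z := hc.formG_eq
  have i3 : inner ℝ (du f z) (dv f z) = 0 := hc.formF_eq
  have j1 : inner ℝ (f z) (unitNormal f z) = 0 := by rw [real_inner_comm]; exact unitNormal_inner_point f z
  have j2 : inner ℝ (du f z) (unitNormal f z) = 0 := by rw [real_inner_comm]; exact unitNormal_inner_du f z
  have j3 : inner ℝ (dv f z) (unitNormal f z) = 0 := by rw [real_inner_comm]; exact unitNormal_inner_dv f z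
  have hdet : det4 (f z) (du f z) (dv f z) (unitNormal f z) = formE f z := by
    rw [hc.det4_eq_normal, hc.normal_sq, mul_one]
  have tang : ∀ (a : E4) (v : ℂ), inner ℝ a (unitNormal f z) = 0 →
      inner ℝ (fderiv ℝ (fun w => φ w • unitNormal f w) z v) a = φ z * inner ℝ a (fderiv ℝ (unitNormal f) z v) := by
    intro a v ha
    rw [fderiv_normal hc h.smooth_φ, inner_add_left, inner_smul_left, inner_smul_left,
      real_inner_comm a (unitNormal f z), ha, real_inner_comm a]
    simp
  -- One formula serves for all three second derivatives of the surface.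
  have key := fun (p Xp : E4) => det4_update_sum (f := f z) (fu := du f z) (fv := dv f z) (n := unitNormal f z)
    (X := φ z • unitNormal f z) (Xu := fderiv ℝ (fun w => φ w • unitNormal f w) z 1)
    (Xv := fderiv ℝ (fun w => φ w • unitNormal f w) z Complex.I) (Xp := Xp) (p := p) (φ := φ z)
    (L := formL f z) (M := formM f z) (N := formN f z) hc.formE_pos.ne' i0 i1 i2 hc.inner_du
    hc.inner_dv i3 j1 j2 j3 hdet
    (by rw [inner_smul_left, real_inner_comm, j1]; simp)
    (by rw [inner_smul_left, real_inner_comm, j2]; simp)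
    (by rw [inner_smul_left, real_inner_comm, j3]; simp)
    (by rw [inner_smul_left, hc.normal_sq]; simp)
    (by rw [tang _ _ j2]; exact (congrArg _ n1).trans (by ring))
    (by rw [tang _ _ j3]; exact (congrArg _ n2).trans (by ring))
    (inner_normal_first hc h.smooth_φ 1)
    (by rw [tang _ _ j2]; exact (congrArg _ n3).trans (by ring))
    (by rw [tang _ _ j3]; exact (congrArg _ n4).trans (by ring))
    (inner_normal_first hc h.smooth_φ Complex.I)
  have kP := key (du (du f) z) (fderiv ℝ (fun w => fderiv ℝ (fun w => φ w • unitNormal f w) w 1) z 1)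
  have kQ := key (du (dv f) z) (fderiv ℝ (fun w => fderiv ℝ (fun w => φ w • unitNormal f w) w Complex.I) z 1)
  have kR := key (dv (dv f) z)
    (fderiv ℝ (fun w => fderiv ℝ (fun w => φ w • unitNormal f w) w Complex.I) z Complex.I)
  have nn : ∀ v v', inner ℝ (fderiv ℝ (unitNormal f) z v') (fderiv ℝ (unitNormal f) z v) =
      inner ℝ (du f z) (fderiv ℝ (unitNormal f) z v') * inner ℝ (du f z) (fderiv ℝ (unitNormal f) z v) / formE f z +
      inner ℝ (dv f z) (fderiv ℝ (unitNormal f) z v') * inner ℝ (dv f z) (fderiv ℝ (unitNormal f) z v) / formE f z := by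
    intro v v'
    rw [hc.parseval, hc.normal_deriv_point, hc.normal_deriv_normal]; ring
  have n1' : inner ℝ (du f z) (fderiv ℝ (unitNormal f) z 1) = -formL f z := n1
  have n2' : inner ℝ (dv f z) (fderiv ℝ (unitNormal f) z 1) = -formM f z := n2
  have n3' : inner ℝ (du f z) (fderiv ℝ (unitNormal f) z Complex.I) = -formM f z := n3
  have n4' : inner ℝ (dv f z) (fderiv ℝ (unitNormal f) z Complex.I) = -formN f z := n4
  rw [inner_normal_second hc h.smooth_φ, nn, n1', n2', real_inner_comm (f z), p0,
    real_inner_comm (unitNormal f z), ← ConfAt.formL_eq_inner,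
    real_inner_comm (du f z), real_inner_comm (dv f z)] at kP
  rw [inner_normal_second hc h.smooth_φ, nn, n1', n2', n3', n4', real_inner_comm (f z), q0,
    real_inner_comm (unitNormal f z), ← ConfAt.formM_eq_inner,
    real_inner_comm (du f z), real_inner_comm (dv f z)] at kQ
  rw [inner_normal_second hc h.smooth_φ, nn, n3', n4', real_inner_comm (f z), r0,
    real_inner_comm (unitNormal f z), ← ConfAt.formN_eq_inner,
    real_inner_comm (du f z), real_inner_comm (dv f z)] at kR
  have D := hasDerivAt_density hc.formE_pos (dU.inner ℝ dU) (dU.inner ℝ dV) (dV.inner ℝ dV)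
    (dX.det4 dU dV dP) (dX.det4 dU dV dQ) (dX.det4 dU dV dR)
    (by rw [eu]; rfl) (by rw [eu, ev]; exact i3) (by rw [ev]; exact i2)
    (a := formL f z) (b := formM f z) (c := formN f z)
    (by rw [ez, eu, ev, euu, ConfAt.formL_eq_inner]; exact hc.det4_eq_normal _)
    (by rw [ez, eu, ev, euv, ConfAt.formM_eq_inner]; exact hc.det4_eq_normal _)
    (by rw [ez, eu, ev, evv, ConfAt.formN_eq_inner]; exact hc.det4_eq_normal _)
  rw [ez, eu, ev, euu, euv, evv] at D
  change HasDerivAt (fun t => willmoreDensity (fun w => G (t, w)) z) _ 0 at D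
  refine D.congr_deriv ?_
  have tu := (tang (du f z) 1 j2).trans (congrArg (φ z * ·) n1')
  have tuv := (tang (dv f z) 1 j3).trans (congrArg (φ z * ·) n2')
  have tvu := (tang (du f z) Complex.I j2).trans (congrArg (φ z * ·) n3')
  have tv := (tang (dv f z) Complex.I j3).trans (congrArg (φ z * ·) n4')
  have hE := hc.formE_pos.ne'
  have half : ∀ {a b : E4} {c : ℝ}, 2 * inner ℝ a b = c → inner ℝ a b = c / 2 ∧
      inner ℝ b a = c / 2 := fun {a b c} h => by
    have h' := real_inner_comm a b
    constructor <;> linarith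
  rw [kP, kQ, kR, densityVariation]
  simp only [tu, tuv, tv, (real_inner_comm _ _).trans tu,
    (real_inner_comm _ _).trans tvu, (real_inner_comm _ _).trans tv, half pu, half qu, half ru,
    half pv, half qv, half rv]
  field_simp
  ring

end NormalVariation

/-! ### The first variation as Euler-Lagrange term plus divergence. -/

theorem dz_ofReal {g : ℂ → ℝ} {z : ℂ} (hg : DifferentiableAt ℝ g z) :
    dz (fun w => (g w : ℂ)) z = (fderiv ℝ g z 1 - Complex.I * fderiv ℝ g z Complex.I) / 2 := by
  have h1 : HasFDerivAt (fun w => (g w : ℂ)) (Complex.ofRealCLM.comp (fderiv ℝ g z)) z :=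
    Complex.ofRealCLM.hasFDerivAt.comp z hg.hasFDerivAt
  rw [dz, h1.fderiv]
  simp
  ring

theorem dz_dz_ofReal {g : ℂ → ℝ} {z : ℂ} (hg : ContDiffAt ℝ ∞ g z) :
    dz (dz fun w => (g w : ℂ)) z =
      (fderiv ℝ (fun w => fderiv ℝ g w 1) z 1 -
        fderiv ℝ (fun w => fderiv ℝ g w Complex.I) z Complex.I -
        2 * Complex.I * fderiv ℝ (fun w => fderiv ℝ g w Complex.I) z 1) / 4 := by
  have h1 : (dz fun w => (g w : ℂ)) =ᶠ[𝓝 z] fun w =>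
      (1 / 2 : ℂ) * (fderiv ℝ g w 1 : ℂ) - (Complex.I / 2) * (fderiv ℝ g w Complex.I : ℂ) := by
    filter_upwards [eventually_differentiableAt hg] with w hw
    rw [dz_ofReal hw]; ring
  have a1 := smooth_fderiv_apply hg 1
  have a2 := smooth_fderiv_apply hg Complex.I
  have d1 : HasFDerivAt (fun w => (fderiv ℝ g w 1 : ℂ)) (Complex.ofRealCLM.comp
      (fderiv ℝ (fun w => fderiv ℝ g w 1) z)) z :=
    Complex.ofRealCLM.hasFDerivAt.comp z (a1.differentiableAt (by simp)).hasFDerivAt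
  have d2 : HasFDerivAt (fun w => (fderiv ℝ g w Complex.I : ℂ)) (Complex.ofRealCLM.comp
      (fderiv ℝ (fun w => fderiv ℝ g w Complex.I) z)) z :=
    Complex.ofRealCLM.hasFDerivAt.comp z (a2.differentiableAt (by simp)).hasFDerivAt
  have d3 := (d1.const_mul (1 / 2 : ℂ)).sub (d2.const_mul (Complex.I / 2))
  have hs : IsSymmSndFDerivAt ℝ g z := by
    refine hg.isSymmSndFDerivAt ?_
    simp only [minSmoothness_of_isRCLikeNormedField]
    exact two_le_infty
  have hf : DifferentiableAt ℝ (fderiv ℝ g) z :=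
    (hg.fderiv_right (m := ∞) (by simp)).differentiableAt (by simp)
  have e : ∀ a b : ℂ, fderiv ℝ (fun w => fderiv ℝ g w b) z a = fderiv ℝ (fderiv ℝ g) z a b := by
    intro a b
    rw [fderiv_clm_apply hf (differentiableAt_const _)]
    simp
  have hsym : fderiv ℝ (fun w => fderiv ℝ g w 1) z Complex.I =
      fderiv ℝ (fun w => fderiv ℝ g w Complex.I) z 1 := by
    rw [e, e]; exact hs _ _
  rw [dz, h1.fderiv_eq (𝕜 := ℝ)]
  have d4 : HasFDerivAt (fun w => (1 / 2 : ℂ) * (fderiv ℝ g w 1 : ℂ) -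
    (Complex.I / 2) * (fderiv ℝ g w Complex.I : ℂ)) _ z := d3
  rw [d4.fderiv]
  simp [hsym]
  linear_combination ((fderiv ℝ (fun w => fderiv ℝ g w Complex.I) z Complex.I : ℂ) / 4) *
    Complex.I_mul_I

namespace ConfAt

variable {f : ℂ → E4} {z : ℂ} {φ : ℂ → ℝ}

/-- The Codazzi equation. -/
theorem codazzi (h : ConfAt f z) :
    delbar z (germ z fun w => (meanCurvature f w : ℂ)) =
      2 * del z (germ z fun w => star (hopfCoeff f w)) * germ z (fun w => (liftScale f w : ℂ)) -
      2 * germ z (fun w => star (hopfCoeff f w)) * del z (germ z fun w => (liftScale f w : ℂ)) := by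
  have h1 := congrFun h.conformalFrame.symm.dξ 0
  rw [← h.germ_star_hopfCoeff] at h1
  have hY0 : vgerm z (canonicalLift f) 0 = germ z fun w => (liftScale f w : ℂ) := by
    refine germ_congr (smooth_apply h.smooth_canonicalLift 0) ?_
    filter_upwards [h.canonicalLift_eq] with w hw
    rw [hw]; simp [coneLift, coneVector]
  have hξ0 : vgerm z (gaussMap f) 0 = germ z fun w => (meanCurvature f w : ℂ) :=
    congrArg (germ z) (funext fun w => gaussMap_zero f w)
  simp only [vd, Pi.sub_apply, Pi.smul_apply, smul_eq_mul, hY0, hξ0] at h1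
  rw [h1]

/-- The vector field whose divergence appears in the first variation of the Willmore functional. -/
def _root_.MobiusSurface.variationField (f : ℂ → E4) (φ : ℂ → ℝ) (z : ℂ) : ℂ :=
  liftScale f z * star (hopfCoeff f z) * dz (fun w => (φ w : ℂ)) z -
    1 / 2 * dzbar (fun w => (meanCurvature f w : ℂ)) z * φ z

theorem smooth_variationField (h : ConfAt f z) (hφ : ContDiffAt ℝ ∞ φ z) :
    ContDiffAt ℝ ∞ (variationField f φ) z :=
  (((smooth_ofReal h.smooth_liftScale).mul (smooth_star h.smooth_hopfCoeff)).mul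
    (smooth_dz (smooth_ofReal hφ))).sub ((contDiffAt_const.mul
      (smooth_dzbar (smooth_ofReal (smooth_meanCurvature h)))).mul (smooth_ofReal hφ))

/-- With σ the scale of the lift, Codazzi reads H_z̄ = 2σk̄_z − 2k̄σ_z. The φ_z terms (σk̄)_z −
H_z̄/2 therefore collapse to 2k̄σ_z, leaving no derivative of k. -/
theorem dz_variationField (h : ConfAt f z) (hφ : ContDiffAt ℝ ∞ φ z) :
    dz (variationField f φ) z =
      liftScale f z * star (hopfCoeff f z) * dz (dz fun w => (φ w : ℂ)) z +
      2 * star (hopfCoeff f z) * dz (fun w => (liftScale f w : ℂ)) z * dz (fun w => (φ w : ℂ)) z -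
      1 / 2 * dzbar (dz fun w => (meanCurvature f w : ℂ)) z * φ z := by
  have s1 := smooth_ofReal h.smooth_liftScale
  have s2 := smooth_star h.smooth_hopfCoeff
  have s3 := smooth_ofReal hφ
  have s4 := smooth_ofReal (smooth_meanCurvature h)
  have g1 := smooth_dz s3
  have g2 := smooth_dzbar s4
  have e : germ z (variationField f φ) = germ z (fun w => (liftScale f w : ℂ)) *
      germ z (fun w => star (hopfCoeff f w)) * del z (germ z fun w => (φ w : ℂ)) -
      algebraMap ℂ _ (1 / 2) * delbar z (germ z fun w => (meanCurvature f w : ℂ)) *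
        germ z fun w => (φ w : ℂ) := by
    rw [del_germ s3, delbar_germ s4, ← germ_const, ← germ_mul s1 s2, ← germ_mul (s1.mul s2) g1,
      ← germ_mul contDiffAt_const g2, ← germ_mul (contDiffAt_const.mul g2) s3,
      ← germ_sub ((s1.mul s2).mul g1) ((contDiffAt_const.mul g2).mul s3)]
    rfl
  have two : algebraMap ℂ (SmoothGerm z) (1 / 2) * 2 = 1 := by
    rw [← map_ofNat (algebraMap ℂ (SmoothGerm z)) 2, ← map_mul]; norm_num
  have e2 := congrArg (del z) e
  simp only [map_sub, Derivation.leibniz, smul_eq_mul, Derivation.map_algebraMap, mul_zero,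
    add_zero] at e2
  have e3 : del z (germ z (variationField f φ)) = germ z (fun w => (liftScale f w : ℂ)) *
      germ z (fun w => star (hopfCoeff f w)) * del z (del z (germ z fun w => (φ w : ℂ))) +
      2 * germ z (fun w => star (hopfCoeff f w)) * del z (germ z fun w => (liftScale f w : ℂ)) *
        del z (germ z fun w => (φ w : ℂ)) -
      algebraMap ℂ _ (1 / 2) * delbar z (del z (germ z fun w => (meanCurvature f w : ℂ))) *
        germ z fun w => (φ w : ℂ) := by
    rw [e2, del_delbar_comm, h.codazzi]
    linear_combination (-(del z (germ z fun w => star (hopfCoeff f w)) *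
      germ z (fun w => (liftScale f w : ℂ)) - germ z (fun w => star (hopfCoeff f w)) *
      del z (germ z fun w => (liftScale f w : ℂ))) * del z (germ z fun w => (φ w : ℂ))) * two
  rw [del_germ (h.smooth_variationField hφ), del_germ s3, del_germ s1, del_germ s4,
    delbar_germ (smooth_dz s4), del_germ g1, ← germ_const, ← germ_mul s1 s2,
    ← germ_mul (s1.mul s2) (smooth_dz g1), ← germ_ofNat, ← germ_mul contDiffAt_const s2,
    ← germ_mul (contDiffAt_const.mul s2) (smooth_dz s1),
    ← germ_mul ((contDiffAt_const.mul s2).mul (smooth_dz s1)) g1,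
    ← germ_mul contDiffAt_const (smooth_dzbar (smooth_dz s4)),
    ← germ_mul (contDiffAt_const.mul (smooth_dzbar (smooth_dz s4))) s3,
    ← germ_add ((s1.mul s2).mul (smooth_dz g1)) (((contDiffAt_const.mul s2).mul (smooth_dz s1)).mul g1),
    ← germ_sub (((s1.mul s2).mul (smooth_dz g1)).add
      (((contDiffAt_const.mul s2).mul (smooth_dz s1)).mul g1))
      ((contDiffAt_const.mul (smooth_dzbar (smooth_dz s4))).mul s3)] at e3
  exact germ_eq_apply (smooth_dz (h.smooth_variationField hφ))
    ((((s1.mul s2).mul (smooth_dz g1)).add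
      (((contDiffAt_const.mul s2).mul (smooth_dz s1)).mul g1)).sub
      ((contDiffAt_const.mul (smooth_dzbar (smooth_dz s4))).mul s3)) e3

theorem dz_liftScale (h : ConfAt f z) : 2 * formE f z * dz (fun w => (liftScale f w : ℂ)) z =
    -(liftScale f z * ((fderiv ℝ (formE f) z 1 - Complex.I * fderiv ℝ (formE f) z Complex.I) / 2)) := by
  have d1 := h.smooth_liftScale.differentiableAt (n := ∞) (by simp)
  have d2 := (smooth_formE h.smooth).differentiableAt (n := ∞) (by simp)
  have e1 : (fun w => liftScale f w ^ 2 * formE f w) =ᶠ[𝓝 z] fun _ => 1 := by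
    filter_upwards [h.eventually] with w hw using hw.liftScale_sq
  have h0 : liftScale f z ≠ 0 := by
    intro h0
    have := h.liftScale_sq
    simp [h0] at this
  have e2 : ∀ v, 2 * formE f z * fderiv ℝ (liftScale f) z v =
      -(liftScale f z * fderiv ℝ (formE f) z v) := by
    intro v
    have e3 := congrArg (fun L => L v) (e1.fderiv_eq (𝕜 := ℝ))
    simp only [fderiv_fun_const, Pi.zero_apply, zero_apply] at e3
    rw [fderiv_fun_mul (d1.fun_pow 2) d2, fderiv_fun_pow 2 d1] at e3
    simp only [add_apply, smul_apply, smul_eq_mul] at e3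
    refine mul_left_cancel₀ h0 ?_
    simp at e3
    linarith
  rw [dz_ofReal d1]
  have a1 := congrArg (fun x : ℝ => (x : ℂ)) (e2 1)
  have a2 := congrArg (fun x : ℝ => (x : ℂ)) (e2 Complex.I)
  push_cast at a1 a2
  linear_combination (1 / 2 : ℂ) * a1 - Complex.I / 2 * a2

/-- The first variation of the Willmore density, up to a divergence. -/
theorem densityVariation_eq (h : ConfAt f z) (hφ : ContDiffAt ℝ ∞ φ z) :
    densityVariation f φ z = 4 * φ z * (dzbar (dz fun w => (meanCurvature f w : ℂ)) z +
      2 * (hopfCoeff f z * star (hopfCoeff f z)) * meanCurvature f z).re +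
      8 * (dz (variationField f φ) z).re := by
  have hE := h.formE_pos.ne'
  have hEc : (formE f z : ℂ) ≠ 0 := by exact_mod_cast hE
  have hs : (liftScale f z : ℂ) ^ 2 = 1 / formE f z := by
    rw [eq_div_iff hEc]; exact_mod_cast h.liftScale_sq
  have hk : star (hopfCoeff f z) =
      (liftScale f z : ℂ) * ((formL f z - formN f z + 2 * Complex.I * formM f z) / 4) := by
    rw [h.hopfCoeff_eq]; simp
  have hH : meanCurvature f z = (formL f z + formN f z) / (2 * formE f z) := by
    rw [eq_div_iff (mul_ne_zero two_ne_zero hE), ← h.meanCurvature_eq]; ring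
  have hA : liftScale f z * star (hopfCoeff f z) =
      (((formL f z - formN f z) / (4 * formE f z) : ℝ) : ℂ) +
        ((formM f z / (2 * formE f z) : ℝ) : ℂ) * Complex.I := by
    rw [hk, ← mul_assoc, ← pow_two, hs]
    push_cast
    field_simp
    ring
  have hkk : hopfCoeff f z * star (hopfCoeff f z) =
      ((((formL f z - formN f z) ^ 2 + 4 * formM f z ^ 2) / (16 * formE f z) : ℝ) : ℂ) := by
    rw [hk, h.hopfCoeff_eq]
    push_cast
    linear_combination ((((formL f z : ℂ) - formN f z) ^ 2 + 4 * (formM f z : ℂ) ^ 2) / 16) * hs -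
      (liftScale f z : ℂ) ^ 2 * (formM f z : ℂ) ^ 2 / 4 * Complex.I_mul_I
  have hσ : 2 * star (hopfCoeff f z) * dz (fun w => (liftScale f w : ℂ)) z =
      -(liftScale f z * star (hopfCoeff f z)) *
        (((fderiv ℝ (formE f) z 1 / (2 * formE f z) : ℝ) : ℂ) -
          ((fderiv ℝ (formE f) z Complex.I / (2 * formE f z) : ℝ) : ℂ) * Complex.I) := by
    have h1 := h.dz_liftScale
    refine mul_left_cancel₀ hEc ?_
    push_cast
    field_simp
    linear_combination star (hopfCoeff f z) * 2 * h1
  have hd1 : dz (fun w => (φ w : ℂ)) z = ((fderiv ℝ φ z 1 / 2 : ℝ) : ℂ) -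
      ((fderiv ℝ φ z Complex.I / 2 : ℝ) : ℂ) * Complex.I := by
    rw [dz_ofReal (hφ.differentiableAt (by simp))]; push_cast; ring
  have hd2 : dz (dz fun w => (φ w : ℂ)) z =
      (((fderiv ℝ (fun w => fderiv ℝ φ w 1) z 1 -
        fderiv ℝ (fun w => fderiv ℝ φ w Complex.I) z Complex.I) / 4 : ℝ) : ℂ) -
        ((fderiv ℝ (fun w => fderiv ℝ φ w Complex.I) z 1 / 2 : ℝ) : ℂ) * Complex.I := by
    rw [dz_dz_ofReal hφ]; push_cast; ring
  rw [h.dz_variationField hφ, hσ, hA, hd1, hd2, hkk, hH, densityVariation]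
  simp only [Complex.add_re, Complex.sub_re, Complex.mul_re, Complex.ofReal_re, Complex.ofReal_im,
    Complex.mul_im, Complex.add_im, Complex.sub_im, Complex.neg_re, Complex.neg_im, Complex.I_re,
    Complex.I_im, Complex.re_ofNat, Complex.im_ofNat, Complex.one_re, Complex.one_im,
    Complex.div_ofNat_re, Complex.div_ofNat_im, mul_zero, mul_one, sub_zero, add_zero, zero_mul,
    zero_add, zero_div]
  field_simp
  ring

end ConfAt

/-! ### Critical points of the Willmore functional satisfy the Euler-Lagrange equation. -/

section

open MeasureTheory

/-- Differentiation under the integral over a compact set. -/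
theorem hasDerivAt_setIntegral_of_contDiffAt {D : ℝ × ℂ → ℝ} {D' : ℂ → ℝ} {K : Set ℂ}
    (hK : IsCompact K) (hD : ∀ z ∈ K, ContDiffAt ℝ 1 D (0, z))
    (hD' : ∀ z ∈ K, HasDerivAt (fun t => D (t, z)) (D' z) 0) :
    HasDerivAt (fun t => ∫ z in K, D (t, z)) (∫ z in K, D' z) 0 := by
  set W : Set (ℝ × ℂ) := {q | ContDiffAt ℝ 1 D q} with hW
  have hWo : IsOpen W := isOpen_iff_mem_nhds.2 fun q hq => ContDiffAt.eventually hq (by simp)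
  -- The set where D is C¹ is open and contains {0} × K, so it contains a compact interval around 0
  -- times K; there the time derivative has a uniform bound, which dominates.
  obtain ⟨u, v, huo, -, hu, hv, huv⟩ := generalized_tube_lemma (isCompact_singleton (x := (0 : ℝ)))
    hK hWo (by rintro ⟨t, z⟩ ⟨rfl, hz⟩; exact hD z hz)
  obtain ⟨ε, hε, hball⟩ := Metric.nhds_basis_closedBall.mem_iff.1 (huo.mem_nhds (hu rfl))
  have hsub : Metric.closedBall (0 : ℝ) ε ×ˢ K ⊆ W :=
    (Set.prod_mono hball hv).trans huv
  have hsub' : ∀ q ∈ Metric.closedBall (0 : ℝ) ε ×ˢ K, ContDiffAt ℝ 1 D q := fun q hq => hsub hq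
  have hcpt : IsCompact (Metric.closedBall (0 : ℝ) ε ×ˢ K) := (isCompact_closedBall _ _).prod hK
  have hcf : ContinuousOn (fun q => fderiv ℝ D q ((1 : ℝ), (0 : ℂ))) (Metric.closedBall (0 : ℝ) ε ×ˢ K) := by
    intro q hq
    have h1 : ContDiffAt ℝ 0 (fderiv ℝ D) q := (hsub' q hq).fderiv_right (by simp)
    exact (h1.continuousAt.clm_apply continuousAt_const).continuousWithinAt
  have hcD : ContinuousOn D (Metric.closedBall (0 : ℝ) ε ×ˢ K) := fun q hq =>
    (hsub' q hq).continuousAt.continuousWithinAt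
  obtain ⟨C, hC⟩ := hcpt.exists_bound_of_continuousOn hcf
  have slice : ∀ {g : ℝ × ℂ → ℝ}, ContinuousOn g (Metric.closedBall (0 : ℝ) ε ×ˢ K) →
      ∀ t ∈ Metric.closedBall (0 : ℝ) ε, ContinuousOn (fun z => g (t, z)) K := fun hg t ht =>
    hg.comp (Continuous.prodMk_right t).continuousOn fun z hz => ⟨ht, hz⟩
  have h0 : (0 : ℝ) ∈ Metric.closedBall (0 : ℝ) ε := Metric.mem_closedBall_self hε.le
  have hKm := hK.measurableSet
  have main := (hasDerivAt_integral_of_dominated_loc_of_deriv_le (μ := volume.restrict K)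
    (F := fun t z => D (t, z)) (F' := fun t z => fderiv ℝ D (t, z) ((1 : ℝ), (0 : ℂ)))
    (x₀ := (0 : ℝ)) (s := Metric.ball (0 : ℝ) ε) (bound := fun _ => C)
    (Metric.ball_mem_nhds _ hε) ?_ ?_ ?_ ?_ ?_ ?_).2
  · refine main.congr_deriv (setIntegral_congr_fun hKm fun z hz => ?_)
    exact (deriv_slice (q := (0, z)) ((hD z hz).differentiableAt (by simp))).unique (hD' z hz)
  · filter_upwards [Metric.ball_mem_nhds (0 : ℝ) hε] with t ht
    exact (slice hcD t (Metric.ball_subset_closedBall ht)).aestronglyMeasurable hKm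
  · exact (slice hcD 0 h0).integrableOn_compact hK
  · exact (slice hcf 0 h0).aestronglyMeasurable hKm
  · filter_upwards [ae_restrict_mem hKm] with z hz t ht
    exact hC (t, z) ⟨Metric.ball_subset_closedBall ht, hz⟩
  · exact integrableOn_const hK.measure_lt_top.ne
  · filter_upwards [ae_restrict_mem hKm] with z hz t ht
    exact deriv_slice (q := (t, z)) ((hsub' (t, z)
      ⟨Metric.ball_subset_closedBall ht, hz⟩).differentiableAt (by simp))

/-- Integration by parts against the constant 1. -/
theorem integral_fderiv_apply_eq_zero {g : ℂ → ℝ} (hg : ContDiff ℝ 1 g) (hc : HasCompactSupport g)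
    (v : ℂ) : ∫ z, fderiv ℝ g z v = 0 := by
  have h := integral_mul_fderiv_eq_neg_fderiv_mul_of_integrable (μ := (volume : Measure ℂ))
    (f := fun _ => (1 : ℝ)) (g := g) (v := v) (by simp) ?_ ?_ (by simp)
    (fun x _ => hg.differentiable (by simp) x)
  · simpa using h
  · simp only [one_mul]
    exact ((hg.continuous_fderiv (by simp)).clm_apply continuous_const).integrable_of_hasCompactSupport
      (hc.fderiv_apply ℝ v)
  · simp only [one_mul]
    exact hg.continuous.integrable_of_hasCompactSupport hc

/-- The integrand is half the divergence of the vector field (Re g, Im g). -/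
theorem integral_dz_re_eq_zero {g : ℂ → ℂ} (hg : ContDiff ℝ 1 g) (hc : HasCompactSupport g) :
    ∫ z, (dz g z).re = 0 := by
  have h1 : ContDiff ℝ 1 fun z => (g z).re := Complex.reCLM.contDiff.comp hg
  have h2 : ContDiff ℝ 1 fun z => (g z).im := Complex.imCLM.contDiff.comp hg
  have c1 : HasCompactSupport fun z => (g z).re := hc.comp_left (g := Complex.re) rfl
  have c2 : HasCompactSupport fun z => (g z).im := hc.comp_left (g := Complex.im) rfl
  have e : ∀ z, (dz g z).re = (1 / 2) * (fderiv ℝ (fun z => (g z).re) z 1 +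
      fderiv ℝ (fun z => (g z).im) z Complex.I) := by
    intro z
    have hd := (hg.differentiable (by simp) z).hasFDerivAt
    have d1 : HasFDerivAt (fun z => (g z).re) (Complex.reCLM.comp (fderiv ℝ g z)) z :=
      Complex.reCLM.hasFDerivAt.comp z hd
    have d2 : HasFDerivAt (fun z => (g z).im) (Complex.imCLM.comp (fderiv ℝ g z)) z :=
      Complex.imCLM.hasFDerivAt.comp z hd
    rw [d1.fderiv, d2.fderiv, dz]
    simp
  simp only [e]
  rw [integral_const_mul, integral_add, integral_fderiv_apply_eq_zero h1 c1,
    integral_fderiv_apply_eq_zero h2 c2]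
  · simp
  · exact ((h1.continuous_fderiv (by simp)).clm_apply continuous_const).integrable_of_hasCompactSupport
      (c1.fderiv_apply ℝ 1)
  · exact ((h2.continuous_fderiv (by simp)).clm_apply continuous_const).integrable_of_hasCompactSupport
      (c2.fderiv_apply ℝ _)

theorem smooth_willmoreDensity {G : ℝ × ℂ → E4} {t : ℝ} {z : ℂ} (hG : ContDiffAt ℝ ∞ G (t, z))
    (hg : 0 < gramDet (fun w => G (t, w)) z) :
    ContDiffAt ℝ ∞ (fun q : ℝ × ℂ => willmoreDensity (fun w => G (q.1, w)) q.2) (t, z) := by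
  refine smooth_jetDensity (x := G)
    (a := fun q : ℝ × ℂ => fderiv ℝ (fun w => G (q.1, w)) q.2 1)
    (b := fun q : ℝ × ℂ => fderiv ℝ (fun w => G (q.1, w)) q.2 Complex.I)
    (p := fun q : ℝ × ℂ => fderiv ℝ (fun w => fderiv ℝ (fun w => G (q.1, w)) w 1) q.2 1)
    (q := fun q : ℝ × ℂ => fderiv ℝ (fun w => fderiv ℝ (fun w => G (q.1, w)) w Complex.I) q.2 1)
    (r := fun q : ℝ × ℂ =>
      fderiv ℝ (fun w => fderiv ℝ (fun w => G (q.1, w)) w Complex.I) q.2 Complex.I)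
    hG (smooth_slice hG _) (smooth_slice hG _) ?_ ?_ ?_ hg
  · exact smooth_slice (G := fun q : ℝ × ℂ => fderiv ℝ (fun w => G (q.1, w)) q.2 1)
      (smooth_slice hG _) _
  · exact smooth_slice (G := fun q : ℝ × ℂ => fderiv ℝ (fun w => G (q.1, w)) q.2 Complex.I)
      (smooth_slice hG _) _
  · exact smooth_slice (G := fun q : ℝ × ℂ => fderiv ℝ (fun w => G (q.1, w)) q.2 Complex.I)
      (smooth_slice hG _) _

theorem willmoreDensity_congr {f g : ℂ → E4} {z : ℂ} (h : f =ᶠ[𝓝 z] g) :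
    willmoreDensity f z = willmoreDensity g z := by
  have d : ∀ {f g : ℂ → E4} {v : ℂ}, f =ᶠ[𝓝 z] g →
      (fun w => fderiv ℝ f w v) =ᶠ[𝓝 z] fun w => fderiv ℝ g w v := fun {f g v} h => by
    filter_upwards [h.fderiv (𝕜 := ℝ)] with w hw
    rw [hw]
  have a : du f z = du g z := (d h).eq_of_nhds
  have b : dv f z = dv g z := (d h).eq_of_nhds
  have p : du (du f) z = du (du g) z := (d (d h)).eq_of_nhds
  have q : du (dv f) z = du (dv g) z := (d (d h)).eq_of_nhds
  have r : dv (dv f) z = dv (dv g) z := (d (d h)).eq_of_nhds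
  rw [willmoreDensity_eq_jetDensity, willmoreDensity_eq_jetDensity, h.eq_of_nhds, a, b, p, q, r]

/-- The surface obtained by rotating `f` towards its unit normal by the angle `t φ`. -/
def rotated (f : ℂ → E4) (φ : ℂ → ℝ) (q : ℝ × ℂ) : E4 :=
  Real.cos (q.1 * φ q.2) • f q.2 + Real.sin (q.1 * φ q.2) • unitNormal f q.2

theorem norm_rotated {f : ℂ → E4} {z : ℂ} (h : ConfAt f z) (φ : ℂ → ℝ) (t : ℝ) :
    ‖rotated f φ (t, z)‖ = 1 := by
  have h1 : inner ℝ (f z) (f z) = 1 := by rw [real_inner_self_eq_norm_sq, h.norm_eq]; simp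
  have h2 : inner ℝ (f z) (unitNormal f z) = 0 := by
    rw [real_inner_comm]; exact unitNormal_inner_point f z
  have h3 : ‖rotated f φ (t, z)‖ ^ 2 = 1 := by
    rw [← real_inner_self_eq_norm_sq, rotated]
    simp only [inner_add_left, inner_add_right, inner_smul_left, inner_smul_right, h1, h2,
      unitNormal_inner_point, h.normal_sq]
    simp
    linear_combination Real.sin_sq_add_cos_sq (t * φ z)
  exact (pow_eq_one_iff_of_nonneg (norm_nonneg _) two_ne_zero).1 h3

theorem smooth_rotated {f : ℂ → E4} {φ : ℂ → ℝ} {z : ℂ} (h : ConfAt f z)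
    (hφ : ContDiffAt ℝ ∞ φ z) (t : ℝ) : ContDiffAt ℝ ∞ (rotated f φ) (t, z) := by
  have s : ContDiffAt ℝ ∞ (Prod.snd : ℝ × ℂ → ℂ) (t, z) := contDiffAt_snd
  have h1 : ContDiffAt ℝ ∞ (fun q : ℝ × ℂ => f q.2) (t, z) := h.smooth.comp (t, z) s
  have h2 : ContDiffAt ℝ ∞ (fun q : ℝ × ℂ => unitNormal f q.2) (t, z) :=
    ContDiffAt.comp (g := unitNormal f) (t, z) (smooth_unitNormal h) s
  have h3 : ContDiffAt ℝ ∞ (fun q : ℝ × ℂ => φ q.2) (t, z) := hφ.comp (t, z) s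
  have h4 : ContDiffAt ℝ ∞ (fun q : ℝ × ℂ => q.1 * φ q.2) (t, z) := contDiffAt_fst.mul h3
  exact (h4.cos.smul h1).add (h4.sin.smul h2)

theorem normalVariation_rotated {f : ℂ → E4} {φ : ℂ → ℝ} {z : ℂ} (h : ConfAt f z)
    (hφ : ContDiff ℝ ∞ φ) : NormalVariation f (rotated f φ) φ z where
  conf := h
  smooth := h.eventually.mono fun _ hw => smooth_rotated hw hφ.contDiffAt 0
  smooth_φ := hφ.contDiffAt
  zero := Eventually.of_forall fun w => by simp [rotated]
  deriv := Eventually.of_forall fun w => by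
    have h0 : HasDerivAt (fun s : ℝ => s * φ w) (φ w) 0 := by
      simpa using (hasDerivAt_id (0 : ℝ)).mul_const (φ w)
    have h1 := (h0.cos.smul_const (f w)).add (h0.sin.smul_const (unitNormal f w))
    simp at h1
    exact h1

/-- H_zz̄ is a quarter of the Laplacian of a real function. The variational argument yields only the
real part of the Euler-Lagrange expression, and this shows that nothing is lost. -/
theorem meanCurvature_laplacian {f : ℂ → E4} {z : ℂ} (h : ConfAt f z) :
    ∃ r : ℝ, dzbar (dz fun w => (meanCurvature f w : ℂ)) z = r := by
  have s := smooth_ofReal (smooth_meanCurvature h)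
  have h1 := laplacian_eq_dz_dzbar (smooth_meanCurvature h)
  have h2 := del_delbar_comm (germ z fun w => (meanCurvature f w : ℂ))
  rw [delbar_germ s, del_germ s, del_germ (smooth_dzbar s), delbar_germ (smooth_dz s)] at h2
  have h3 := germ_eq_apply (smooth_dz (smooth_dzbar s)) (smooth_dzbar (smooth_dz s)) h2
  refine ⟨Laplacian.laplacian (meanCurvature f) z / 4, ?_⟩
  rw [← h3]; push_cast; rw [h1]; ring

open Classical in
/-- A critical point of the Willmore functional satisfies the Euler-Lagrange equation. -/
theorem willmoreAt_of_critical {U : Set ℂ} (hU : IsOpen U) {f : ℂ → E4} (hf : ∀ z ∈ U, ConfAt f z)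
    (hcrit : ∀ K ⊆ U, IsCompact K → ∀ F : ℝ → ℂ → S3,
      ContDiffOn ℝ ∞ (fun q : ℝ × ℂ => (F q.1 q.2 : E4)) (Set.univ ×ˢ U) →
      (∀ z ∈ U, (F 0 z : E4) = f z) → (∀ t, ∀ z ∈ U \ K, (F t z : E4) = f z) →
      HasDerivAt (fun t => ∫ z in K, willmoreDensity (fun w => (F t w : E4)) z) 0 0) :
    ∀ z ∈ U, WillmoreAt f z := by
  set EL : ℂ → ℝ := fun z => (dzbar (dz fun w => (meanCurvature f w : ℂ)) z +
    2 * (hopfCoeff f z * star (hopfCoeff f z)) * meanCurvature f z).re with hEL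
  have hELs : ∀ z ∈ U, ContDiffAt ℝ ∞ EL z := by
    intro z hz
    have h := hf z hz
    have s1 := smooth_ofReal (smooth_meanCurvature h)
    have s2 := h.smooth_hopfCoeff
    exact Complex.reCLM.contDiff.contDiffAt.comp z ((smooth_dzbar (smooth_dz s1)).add
      ((contDiffAt_const.mul (s2.mul (smooth_star s2))).mul s1))
  have hELc : ContinuousOn EL U := fun z hz => (hELs z hz).continuousAt.continuousWithinAt
  have key : ∀ φ : ℂ → ℝ, ContDiff ℝ ∞ φ → HasCompactSupport φ → tsupport φ ⊆ U →
      ∫ z, φ z • EL z = 0 := by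
    intro φ hφ hφc hφU
    set K := tsupport φ with hKdef
    have hK : IsCompact K := hφc
    have φ0 : ∀ z ∉ K, φ z = 0 := fun z hz => image_eq_zero_of_notMem_tsupport hz
    -- The rotated surface is known to lie on the sphere only over `U`; elsewhere an arbitrary point
    -- of the sphere is a default value when needed.
    let F : ℝ → ℂ → S3 := fun t w => if h : ‖rotated f φ (t, w)‖ = 1 then
      ⟨rotated f φ (t, w), by simpa using h⟩ else ⟨EuclideanSpace.single 0 1, by simp⟩
    have hF : ∀ t, ∀ w ∈ U, (F t w : E4) = rotated f φ (t, w) := fun t w hw => by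
      simp only [F, dif_pos (norm_rotated (hf w hw) φ t)]
    have hd := hcrit K hφU hK F ?_ ?_ ?_
    · have hd2 := hasDerivAt_setIntegral_of_contDiffAt
        (D := fun q => willmoreDensity (fun w => rotated f φ (q.1, w)) q.2) hK
        (fun z hz => (smooth_willmoreDensity (smooth_rotated (hf z (hφU hz)) hφ.contDiffAt 0)
          (by simpa [rotated] using (hf z (hφU hz)).gramDet_pos)).of_le one_le_infty)
        (fun z hz => (normalVariation_rotated (hf z (hφU hz)) hφ).hasDerivAt_willmoreDensity)
      have e1 : (fun t => ∫ z in K, willmoreDensity (fun w => (F t w : E4)) z) =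
          fun t => ∫ z in K, willmoreDensity (fun w => rotated f φ (t, w)) z := by
        funext t
        refine setIntegral_congr_fun hK.measurableSet fun z hz => willmoreDensity_congr ?_
        filter_upwards [hU.mem_nhds (hφU hz)] with w hw using hF t w hw
      rw [e1] at hd
      have h0 := hd2.unique hd
      have hv0 : ∀ z ∉ K, variationField f φ =ᶠ[𝓝 z] fun _ => 0 := by
        intro z hz
        have hev : ∀ᶠ w in 𝓝 z, w ∉ K := (isClosed_tsupport φ).isOpen_compl.mem_nhds hz
        filter_upwards [hev.eventually_nhds] with w hw
        have : (fun x => (φ x : ℂ)) =ᶠ[𝓝 w] fun _ => 0 := by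
          filter_upwards [hw] with x hx
          rw [φ0 x hx, Complex.ofReal_zero]
        rw [variationField, dz, this.fderiv_eq (𝕜 := ℝ), φ0 w hw.self_of_nhds]
        simp
      have hvs : ContDiff ℝ ∞ (variationField f φ) := by
        rw [contDiff_iff_contDiffAt]
        intro z
        by_cases hz : z ∈ K
        · exact (hf z (hφU hz)).smooth_variationField hφ.contDiffAt
        · exact contDiffAt_const.congr_of_eventuallyEq (hv0 z hz)
      have hvc : HasCompactSupport (variationField f φ) :=
        HasCompactSupport.intro hK fun z hz => (hv0 z hz).eq_of_nhds
      -- Off the support of φ both the Euler-Lagrange term and the field vanish, so the integral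
      -- extends to the whole plane, where the divergence integrates to zero.
      have e2 : ∫ z in K, densityVariation f φ z =
          ∫ z, (4 * (φ z • EL z) + 8 * (dz (variationField f φ) z).re) := by
        rw [← setIntegral_eq_integral_of_forall_compl_eq_zero (s := K) (f := fun z =>
          4 * (φ z • EL z) + 8 * (dz (variationField f φ) z).re)]
        · refine setIntegral_congr_fun hK.measurableSet fun z hz => ?_
          rw [(hf z (hφU hz)).densityVariation_eq hφ.contDiffAt, smul_eq_mul]
          ring
        · intro z hz
          simp only [φ0 z hz, dz, (hv0 z hz).fderiv_eq (𝕜 := ℝ)]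
          simp
      have hφEL : Continuous fun z => φ z • EL z := by
        rw [continuous_iff_continuousAt]
        intro z
        by_cases hz : z ∈ K
        · exact hφ.continuous.continuousAt.smul (hELs z (hφU hz)).continuousAt
        · have hev : ∀ᶠ w in 𝓝 z, w ∉ K := (isClosed_tsupport φ).isOpen_compl.mem_nhds hz
          refine (continuousAt_const (y := (0 : ℝ))).congr ?_
          filter_upwards [hev] with w hw
          rw [φ0 w hw, zero_smul]
      have i1 : Integrable (fun z => φ z • EL z) :=
        hφEL.integrable_of_hasCompactSupport (HasCompactSupport.intro hK fun z hz => by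
          rw [φ0 z hz, zero_smul])
      have i2 : Integrable (fun z => (dz (variationField f φ) z).re) := by
        have hs : Continuous (dz (variationField f φ)) := continuous_iff_continuousAt.2 fun z =>
          (smooth_dz hvs.contDiffAt).continuousAt
        refine (Complex.continuous_re.comp hs).integrable_of_hasCompactSupport
          (HasCompactSupport.intro hK fun z hz => ?_)
        simp only [Function.comp, dz]
        rw [(hv0 z hz).fderiv_eq (𝕜 := ℝ)]
        simp
      rw [h0, integral_add (i1.const_mul 4) (i2.const_mul 8), integral_const_mul,
        integral_const_mul, integral_dz_re_eq_zero (hvs.of_le one_le_infty) hvc] at e2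
      linarith
    · intro q hq
      have h1 := smooth_rotated (hf q.2 hq.2) hφ.contDiffAt q.1
      refine (h1.congr_of_eventuallyEq ?_).contDiffWithinAt
      have : Set.univ ×ˢ U ∈ 𝓝 q := (isOpen_univ.prod hU).mem_nhds hq
      filter_upwards [this] with p hp using hF p.1 p.2 hp.2
    · intro z hz
      rw [hF 0 z hz]; simp [rotated]
    · intro t z hz
      rw [hF t z hz.1]; simp [rotated, φ0 z hz.2]
  -- The fundamental lemma of the calculus of variations gives vanishing almost everywhere, and
  -- continuity gives it everywhere on `U`.
  have hae := hU.ae_eq_zero_of_integral_contDiff_smul_eq_zero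
    (hELc.locallyIntegrableOn hU.measurableSet) key
  have heq := Measure.eqOn_open_of_ae_eq (μ := (volume : Measure ℂ)) (g := fun _ => (0 : ℝ))
    ((ae_restrict_iff' hU.measurableSet).2 hae) hU hELc continuousOn_const
  intro z hz
  obtain ⟨r, hr⟩ := meanCurvature_laplacian (hf z hz)
  have h1 : EL z = 0 := heq hz
  rw [WillmoreAt]
  simp only [hEL, hr] at h1
  rw [hr]
  have h2 : hopfCoeff f z * star (hopfCoeff f z) = ((Complex.normSq (hopfCoeff f z) : ℝ) : ℂ) :=
    Complex.mul_conj _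
  rw [h2] at h1 ⊢
  rw [show (r : ℂ) + 2 * (Complex.normSq (hopfCoeff f z) : ℂ) * (meanCurvature f z : ℂ) =
    ((r + 2 * Complex.normSq (hopfCoeff f z) * meanCurvature f z : ℝ) : ℂ) by push_cast; rfl] at h1 ⊢
  rw [Complex.ofReal_re] at h1
  rw [h1, Complex.ofReal_zero]

end

/-! ### The invariants depend on germs only -/

section Congr

variable {f g : ℂ → E4} {z : ℂ}

theorem fderiv_apply_congr (h : f =ᶠ[𝓝 z] g) (v : ℂ) :
    (fun w => fderiv ℝ f w v) =ᶠ[𝓝 z] fun w => fderiv ℝ g w v := by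
  filter_upwards [h.fderiv (𝕜 := ℝ)] with w hw
  rw [hw]

theorem gramDet_congr (h : f =ᶠ[𝓝 z] g) : gramDet f z = gramDet g z := by
  have a : du f z = du g z := (fderiv_apply_congr h 1).eq_of_nhds
  have b : dv f z = dv g z := (fderiv_apply_congr h Complex.I).eq_of_nhds
  simp only [gramDet, formE, formF, formG, a, b]

theorem normalComponent_congr (h : f =ᶠ[𝓝 z] g) : normalComponent f z = normalComponent g z := by
  have a : du f z = du g z := (fderiv_apply_congr h 1).eq_of_nhds
  have b : dv f z = dv g z := (fderiv_apply_congr h Complex.I).eq_of_nhds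
  funext w
  rw [normalComponent_eq_det4, normalComponent_eq_det4, gramDet_congr h, h.eq_of_nhds, a, b]

theorem forms_congr (h : f =ᶠ[𝓝 z] g) : formE f z = formE g z ∧ formF f z = formF g z ∧
    formG f z = formG g z ∧ formL f z = formL g z ∧ formM f z = formM g z ∧
    formN f z = formN g z := by
  have a : du f z = du g z := (fderiv_apply_congr h 1).eq_of_nhds
  have b : dv f z = dv g z := (fderiv_apply_congr h Complex.I).eq_of_nhds
  have p : du (du f) z = du (du g) z :=
    (fderiv_apply_congr (fderiv_apply_congr h 1) 1).eq_of_nhds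
  have q : du (dv f) z = du (dv g) z :=
    (fderiv_apply_congr (fderiv_apply_congr h Complex.I) 1).eq_of_nhds
  have r : dv (dv f) z = dv (dv g) z :=
    (fderiv_apply_congr (fderiv_apply_congr h Complex.I) Complex.I).eq_of_nhds
  simp only [formE, formF, formG, formL, formM, formN, normalComponent_congr h, a, b, p, q, r,
    and_self]

theorem meanCurvature_congr (h : f =ᶠ[𝓝 z] g) : meanCurvature f z = meanCurvature g z := by
  obtain ⟨h1, h2, h3, h4, h5, h6⟩ := forms_congr h
  rw [meanCurvature, meanCurvature, h1, h2, h3, h4, h5, h6, gramDet_congr h]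

theorem coneLift_congr (h : f =ᶠ[𝓝 z] g) : coneLift f =ᶠ[𝓝 z] coneLift g := by
  filter_upwards [h] with w hw
  funext i
  simp only [coneLift, hw]

theorem canonicalLift_congr (h : f =ᶠ[𝓝 z] g) : canonicalLift f =ᶠ[𝓝 z] canonicalLift g := by
  filter_upwards [h.eventuallyEq_nhds] with w hw
  have h1 := coneLift_congr hw
  rw [canonicalLift, canonicalLift, (dz_congr h1).eq_of_nhds, (dzbar_congr h1).eq_of_nhds,
    h1.eq_of_nhds]

theorem gaussMap_congr (h : f =ᶠ[𝓝 z] g) : gaussMap f =ᶠ[𝓝 z] gaussMap g := by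
  filter_upwards [h.eventuallyEq_nhds] with w hw
  simp only [gaussMap, normalLift, unitNormal, normalComponent_congr hw, meanCurvature_congr hw,
    (coneLift_congr hw).eq_of_nhds]

theorem hopfCoeff_congr (h : f =ᶠ[𝓝 z] g) : hopfCoeff f z = hopfCoeff g z := by
  rw [hopfCoeff, hopfCoeff, (dz_congr (dz_congr (canonicalLift_congr h))).eq_of_nhds,
    (gaussMap_congr h).eq_of_nhds]

theorem bryantCoeff_congr (h : f =ᶠ[𝓝 z] g) : bryantCoeff f z = bryantCoeff g z := by
  rw [bryantCoeff, bryantCoeff, (dz_congr (dz_congr (gaussMap_congr h))).eq_of_nhds]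

theorem willmoreAt_congr (h : f =ᶠ[𝓝 z] g) (hf : WillmoreAt f z) : WillmoreAt g z := by
  have h1 : (fun w => (meanCurvature g w : ℂ)) =ᶠ[𝓝 z] fun w => (meanCurvature f w : ℂ) := by
    filter_upwards [h.eventuallyEq_nhds] with w hw
    rw [meanCurvature_congr hw]
  rw [WillmoreAt, (dzbar_congr (dz_congr h1)).eq_of_nhds, ← hopfCoeff_congr h,
    ← meanCurvature_congr h]
  exact hf

theorem ConfAt.congr (hf : ConfAt f z) (h : f =ᶠ[𝓝 z] g) : ConfAt g z := by
  filter_upwards [hf, h.eventuallyEq_nhds] with w hw hfg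
  refine ⟨hw.1.congr_of_eventuallyEq hfg.symm, by rw [← hfg.eq_of_nhds]; exact hw.2.1, ?_⟩
  have := hw.2.2
  rw [conformalAt_iff_isConformalMap_fderiv] at this ⊢
  rwa [← hfg.fderiv_eq (𝕜 := ℝ)]

end Congr

/-! ### Holomorphic parametrizations of a Riemann surface -/

theorem localExpr_eventuallyEq {M : Type*} [TopologicalSpace M] {y : M → S3} {e e' : OpenPartialHomeomorph M ℂ} {z : ℂ} (hz : z ∈ e.target)
    (hs : e.symm z ∈ e'.source) :
    localExpr y e' ∘ (fun w => e' (e.symm w)) =ᶠ[𝓝 z] localExpr y e := by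
  have hs' : ∀ᶠ w in 𝓝 z, e.symm w ∈ e'.source :=
    (e.continuousAt_symm hz).eventually (e'.open_source.mem_nhds hs)
  filter_upwards [hs'] with w hw
  simp only [Function.comp, localExpr, e'.left_inv hw]

section Manifold

variable {M : Type*} [TopologicalSpace M] [ChartedSpace ℂ M]

/-- The map `Φ : ℂ → M` is biholomorphic near `z`. -/
def HolParam (Φ : ℂ → M) (z : ℂ) : Prop :=
  ContinuousAt Φ z ∧ ∃ e ∈ atlas ℂ M, Φ z ∈ e.source ∧ HolAt (fun w => e (Φ w)) z

/-- The surface `y` in the parametrization `Φ`. -/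
def surf (y : M → S3) (Φ : ℂ → M) (z : ℂ) : E4 := y (Φ z)

theorem differentiableAt_transition [IsManifold 𝓘(ℂ) ω M] {e e' : OpenPartialHomeomorph M ℂ}
    (he : e ∈ atlas ℂ M) (he' : e' ∈ atlas ℂ M) {z : ℂ} (hz : z ∈ e.target)
    (hz' : e.symm z ∈ e'.source) : AnalyticAt ℂ (fun w => e' (e.symm w)) z := by
  have h1 := (contDiffGroupoid ω 𝓘(ℂ)).compatible he he'
  rw [contDiffGroupoid, mem_groupoid_of_pregroupoid] at h1
  have h2 : ContDiffOn ℂ ω _ _ := h1.1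
  simp only [modelWithCornersSelf_coe, modelWithCornersSelf_coe_symm, Set.range_id, Set.inter_univ,
    Set.preimage_id, Function.id_comp, Function.comp_id] at h2
  have hmem : z ∈ (e.symm ≫ₕ e').source := by
    rw [OpenPartialHomeomorph.trans_source]; exact ⟨hz, hz'⟩
  exact (h2.contDiffAt ((e.symm ≫ₕ e').open_source.mem_nhds hmem)).analyticAt

/-- The derivative does not vanish because composing with the opposite transition gives the
identity. -/
theorem holAt_transition [IsManifold 𝓘(ℂ) ω M] {e e' : OpenPartialHomeomorph M ℂ}
    (he : e ∈ atlas ℂ M) (he' : e' ∈ atlas ℂ M) {z : ℂ} (hz : z ∈ e.target)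
    (hz' : e.symm z ∈ e'.source) : HolAt (fun w => e' (e.symm w)) z := by
  have h1 := differentiableAt_transition he he' hz hz'
  have h2 := differentiableAt_transition he' he (z := e' (e.symm z)) (e'.map_source hz')
    (by rw [e'.left_inv hz']; exact e.map_target hz)
  refine ⟨h1, fun h0 => ?_⟩
  have h3 : (fun w => e (e'.symm (e' (e.symm w)))) =ᶠ[𝓝 z] id := by
    have hs : ∀ᶠ w in 𝓝 z, w ∈ (e.symm ≫ₕ e').source :=
      (e.symm ≫ₕ e').open_source.mem_nhds
        (by rw [OpenPartialHomeomorph.trans_source]; exact ⟨hz, hz'⟩)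
    filter_upwards [hs] with w hw
    rw [OpenPartialHomeomorph.trans_source] at hw
    rw [e'.left_inv hw.2, e.right_inv hw.1]; rfl
  have h4 := h3.deriv_eq
  rw [deriv_id] at h4
  have h5 := deriv_comp z h2.differentiableAt h1.differentiableAt
  have h6 : deriv (fun w => e (e'.symm (e' (e.symm w)))) z = _ := h5
  rw [h6, h0, mul_zero] at h4
  exact zero_ne_one h4

namespace HolParam

variable {Φ Ψ : ℂ → M} {z : ℂ}

theorem congr (h : HolParam Φ z) (he : Φ =ᶠ[𝓝 z] Ψ) : HolParam Ψ z := by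
  obtain ⟨h1, e, hmem, hs, h2⟩ := h
  have h3 : (fun w => e (Φ w)) =ᶠ[𝓝 z] fun w => e (Ψ w) := he.fun_comp e
  exact ⟨h1.congr he, e, hmem, he.eq_of_nhds ▸ hs, h2.1.congr h3, h3.deriv_eq ▸ h2.2⟩

theorem of_chart {e : OpenPartialHomeomorph M ℂ} (he : e ∈ atlas ℂ M) {τ : ℂ → ℂ}
    (hz : τ z ∈ e.target) (hτ : HolAt τ z) : HolParam (fun w => e.symm (τ w)) z := by
  refine ⟨(e.continuousAt_symm hz).comp hτ.1.continuousAt, e, he, e.map_target hz, ?_⟩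
  have h3 : (fun w => e (e.symm (τ w))) =ᶠ[𝓝 z] τ := by
    filter_upwards [hτ.tendsto.eventually (e.open_target.mem_nhds hz)] with w hw
    exact e.right_inv hw
  exact ⟨hτ.1.congr h3.symm, h3.deriv_eq ▸ hτ.2⟩

theorem eventually (h : HolParam Φ z) : ∀ᶠ w in 𝓝 z, HolParam Φ w := by
  obtain ⟨h1, e, hmem, hs, h2⟩ := h
  have hs' : ∀ᶠ w in 𝓝 z, Φ w ∈ e.source := h1.eventually (e.open_source.mem_nhds hs)
  filter_upwards [hs'.eventually_nhds, h2.eventually] with w hw h3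
  refine congr (of_chart (τ := fun w => e (Φ w)) hmem (e.map_source hw.self_of_nhds) h3) ?_
  filter_upwards [hw] with x hx using e.left_inv hx

theorem comp {τ : ℂ → ℂ} (h : HolParam Φ (τ z)) (hτ : HolAt τ z) : HolParam (Φ ∘ τ) z := by
  obtain ⟨h1, e, hmem, hs, h2⟩ := h
  exact ⟨h1.comp hτ.1.continuousAt, e, hmem, hs, HolAt.comp (σ := fun w => e (Φ w)) h2 hτ⟩

theorem chart [IsManifold 𝓘(ℂ) ω M] (h : HolParam Φ z) {e : OpenPartialHomeomorph M ℂ}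
    (he : e ∈ atlas ℂ M) (hs : Φ z ∈ e.source) : HolAt (fun w => e (Φ w)) z := by
  obtain ⟨h1, e', hmem, hs', h2⟩ := h
  have h3 : HolAt ((fun w => e (e'.symm w)) ∘ fun w => e' (Φ w)) z :=
    HolAt.comp (holAt_transition hmem he (e'.map_source hs') (by rwa [e'.left_inv hs'])) h2
  have h4 : ((fun w => e (e'.symm w)) ∘ fun w => e' (Φ w)) =ᶠ[𝓝 z] fun w => e (Φ w) := by
    filter_upwards [h1.eventually (e'.open_source.mem_nhds hs')] with w hw
    simp only [Function.comp, e'.left_inv hw]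
  exact ⟨h3.1.congr h4, h4.deriv_eq ▸ h3.2⟩

theorem surf_eventuallyEq (h : HolParam Φ z) (y : M → S3) {e : OpenPartialHomeomorph M ℂ}
    (hs : Φ z ∈ e.source) : localExpr y e ∘ (fun w => e (Φ w)) =ᶠ[𝓝 z] surf y Φ := by
  filter_upwards [h.1.eventually (e.open_source.mem_nhds hs)] with w hw
  simp only [Function.comp, localExpr, surf, e.left_inv hw]

end HolParam

variable {y : M → S3}

namespace IsConformalImmersion

theorem smooth_center (hy : IsConformalImmersion y) (p : M) :
    ContDiffAt ℝ ∞ (localExpr y (chartAt ℂ p)) (chartAt ℂ p p) := by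
  have h1 := (contMDiffAt_iff.1 (hy.smooth p)).2
  simp only [extChartAt, mfld_simps] at h1
  exact h1.contDiffAt univ_mem

variable [IsManifold 𝓘(ℂ) ω M]

/-- Conformality is postulated only at p, in the preferred chart of p. Every point of a chart has a
preferred chart of its own, and the biholomorphic transition carries the condition over. -/
theorem confAt_localExpr (hy : IsConformalImmersion y) {e : OpenPartialHomeomorph M ℂ}
    (he : e ∈ atlas ℂ M) {z : ℂ} (hz : z ∈ e.target) : ConfAt (localExpr y e) z := by
  filter_upwards [e.open_target.mem_nhds hz] with w hw
  have hs := mem_chart_source ℂ (e.symm w)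
  have h1 := localExpr_eventuallyEq (y := y) hw hs
  have hτ := holAt_transition he (chart_mem_atlas ℂ (e.symm w)) hw hs
  have hc : ConformalAt (localExpr y (chartAt ℂ (e.symm w)) ∘
      fun x => chartAt ℂ (e.symm w) (e.symm x)) w :=
    ConformalAt.comp w (hy.conformal (e.symm w)) hτ.conformalAt
  have hd : ContDiffAt ℝ ∞ (localExpr y (chartAt ℂ (e.symm w)) ∘
      fun x => chartAt ℂ (e.symm w) (e.symm x)) w :=
    ContDiffAt.comp w (hy.smooth_center (e.symm w)) hτ.smooth
  refine ⟨hd.congr_of_eventuallyEq h1.symm, by simp [localExpr], ?_⟩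
  rw [conformalAt_iff_isConformalMap_fderiv] at hc ⊢
  rwa [← h1.fderiv_eq (𝕜 := ℝ)]

theorem confAt_surf (hy : IsConformalImmersion y) {Φ : ℂ → M} {z : ℂ} (h : HolParam Φ z) :
    ConfAt (surf y Φ) z := by
  have hs := mem_chart_source ℂ (Φ z)
  have he := chart_mem_atlas ℂ (Φ z)
  exact (ConfAt.comp (hy.confAt_localExpr he ((chartAt ℂ (Φ z)).map_source hs))
    (h.chart he hs)).congr (h.surf_eventuallyEq y hs)

theorem surf_comp_chart (hy : IsConformalImmersion y) {Φ : ℂ → M} {z : ℂ} (h : HolParam Φ z) :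
    ConfAt (localExpr y (chartAt ℂ (Φ z))) (chartAt ℂ (Φ z) (Φ z)) ∧
      HolAt (fun w => chartAt ℂ (Φ z) (Φ w)) z ∧
      localExpr y (chartAt ℂ (Φ z)) ∘ (fun w => chartAt ℂ (Φ z) (Φ w)) =ᶠ[𝓝 z] surf y Φ :=
  have hs := mem_chart_source ℂ (Φ z)
  have he := chart_mem_atlas ℂ (Φ z)
  ⟨hy.confAt_localExpr he ((chartAt ℂ (Φ z)).map_source hs), h.chart he hs,
    h.surf_eventuallyEq y hs⟩

/-- k = 0 means L = N and M = 0, and then the second form is L/E times the first. -/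
theorem hopfCoeff_center_ne_zero (hy : IsConformalImmersion y) {p : M} (hp : ¬ IsUmbilic y p) :
    hopfCoeff (localExpr y (chartAt ℂ p)) (chartAt ℂ p p) ≠ 0 := by
  intro h0
  have h := hy.confAt_localExpr (chart_mem_atlas ℂ p) (mem_chart_target ℂ p)
  rw [h.hopfCoeff_eq] at h0
  set f := localExpr y (chartAt ℂ p)
  set z := chartAt ℂ p p
  have hs : (liftScale f z : ℂ) ≠ 0 := by
    simp [liftScale, (Real.sqrt_pos.2 h.formE_pos).ne']
  have h1 := (mul_eq_zero.1 h0).resolve_left hs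
  rw [div_eq_zero_iff, or_iff_left (by norm_num)] at h1
  have h2 := congrArg Complex.re h1
  have h3 := congrArg Complex.im h1
  simp at h2 h3
  refine hp ⟨formL f z / formE f z, ?_, ?_, ?_⟩
  · exact (div_mul_cancel₀ _ h.formE_pos.ne').symm
  · change formM f z = _ * formF f z
    rw [h3, h.formF_eq, mul_zero]
  · change formN f z = _ * formG f z
    rw [h.formG_eq, div_mul_cancel₀ _ h.formE_pos.ne']
    linarith

theorem hopfCoeff_ne_zero (hy : IsConformalImmersion y) (humb : ∀ p, ¬ IsUmbilic y p) {Φ : ℂ → M}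
    {z : ℂ} (h : HolParam Φ z) : hopfCoeff (surf y Φ) z ≠ 0 := by
  obtain ⟨h1, h2, h3⟩ := hy.surf_comp_chart h
  rw [← hopfCoeff_congr h3, ← norm_ne_zero_iff, h1.norm_hopfCoeff_comp h2]
  exact mul_ne_zero (norm_ne_zero_iff.2 h2.2)
    (norm_ne_zero_iff.2 (hy.hopfCoeff_center_ne_zero (humb _)))

/-- The curvature is defined point by point in varying charts. Both sides scale by the sixth power
of the modulus of the coordinate derivative, so the identity holds in every holomorphic
parametrization. -/
theorem mobiusCurvature_eq (hy : IsConformalImmersion y) (humb : ∀ p, ¬ IsUmbilic y p) {Φ : ℂ → M}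
    {z : ℂ} (h : HolParam Φ z) :
    (bryantCoeff (surf y Φ) z * star (hopfCoeff (surf y Φ) z) ^ 2).re =
      (1 - mobiusCurvature y (Φ z)) * ‖hopfCoeff (surf y Φ) z‖ ^ 6 := by
  obtain ⟨h1, h2, h3⟩ := hy.surf_comp_chart h
  rw [← bryantCoeff_congr h3, ← hopfCoeff_congr h3, h1.bryant_re_comp h2, h1.norm_hopfCoeff_comp h2,
    h1.bryant_curvature (hy.hopfCoeff_center_ne_zero (humb _)), mobiusCurvature]
  ring

/-- Reads the metric, defined through preferred charts, as 2|k||dz| in the parametrization Φ. -/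
theorem mobiusFactor_center (hy : IsConformalImmersion y) {Φ : ℂ → M} {z : ℂ} (h : HolParam Φ z) :
    √(mobiusFactor (localExpr y (chartAt ℂ (Φ z))) (chartAt ℂ (Φ z) (Φ z))) *
      ‖deriv (fun w => chartAt ℂ (Φ z) (Φ w)) z‖ = 2 * ‖hopfCoeff (surf y Φ) z‖ := by
  obtain ⟨h1, h2, h3⟩ := hy.surf_comp_chart h
  rw [← hopfCoeff_congr h3, h1.norm_hopfCoeff_comp h2, h1.mobiusFactor_eq,
    show 4 * ‖hopfCoeff (localExpr y (chartAt ℂ (Φ z))) (chartAt ℂ (Φ z) (Φ z))‖ ^ 2 =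
      (2 * ‖hopfCoeff (localExpr y (chartAt ℂ (Φ z))) (chartAt ℂ (Φ z) (Φ z))‖) ^ 2 by ring,
    Real.sqrt_sq (by positivity)]
  ring

theorem willmoreAt_surf (hy : IsConformalImmersion y) (hW : IsWillmore y) {Φ : ℂ → M}
    {z : ℂ} (h : HolParam Φ z) : WillmoreAt (surf y Φ) z := by
  obtain ⟨h1, h2, h3⟩ := hy.surf_comp_chart h
  refine willmoreAt_congr h3 (h1.willmoreAt_comp h2 ?_)
  have he := chart_mem_atlas ℂ (Φ z)
  refine willmoreAt_of_critical (chartAt ℂ (Φ z)).open_target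
    (fun w hw => hy.confAt_localExpr he hw) ?_ _ (mem_chart_target ℂ (Φ z))
  intro K hK hKc F hF hF0 hFt
  exact hW _ he K hK hKc F hF (fun w hw => Subtype.ext (hF0 w hw))
    fun t w hw => Subtype.ext (hFt t w hw)

end IsConformalImmersion

end Manifold

/-! ### Natural coordinates for Bryant's differential. -/

theorem HolAt.exists_inverse {τ : ℂ → ℂ} {z : ℂ} (h : HolAt τ z) : ∃ σ : ℂ → ℂ,
    HolAt σ (τ z) ∧ σ (τ z) = z ∧ (∀ᶠ w in 𝓝 z, σ (τ w) = w) ∧ ∀ᶠ x in 𝓝 (τ z), τ (σ x) = x := by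
  have hs := h.1.hasStrictDerivAt
  have e1 := hs.eventually_left_inverse h.2
  have e2 := hs.eventually_right_inverse h.2
  refine ⟨_, ⟨h.1.analyticAt_localInverse h.2, ?_⟩, e1.self_of_nhds, e1, e2⟩
  rw [(hs.to_localInverse h.2).hasDerivAt.deriv]
  exact inv_ne_zero h.2

theorem HolAt.map_nhds {τ : ℂ → ℂ} {z : ℂ} (h : HolAt τ z) : map τ (𝓝 z) = 𝓝 (τ z) :=
  h.1.hasStrictDerivAt.map_nhds_eq h.2

theorem holAt_affine {c : ℂ} (hc : c ≠ 0) (b z : ℂ) : HolAt (fun w => b + c * w) z := by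
  have h : HasDerivAt (fun w => b + c * w) c z := by
    simpa using ((hasDerivAt_id z).const_mul c).const_add b
  refine ⟨by fun_prop, ?_⟩
  rw [h.deriv]; exact hc

/-- Every nonvanishing holomorphic function is the fourth power of the derivative of a local
biholomorphism. -/
theorem exists_holAt_deriv_pow {Q : ℂ → ℂ} {z : ℂ} (hQ : AnalyticAt ℂ Q z) (h0 : Q z ≠ 0) :
    ∃ W : ℂ → ℂ, HolAt W z ∧ ∀ᶠ w in 𝓝 z, deriv W w ^ 4 = Q w := by
  obtain ⟨c, hc⟩ := IsAlgClosed.exists_pow_nat_eq (Q z) (n := 4) (by norm_num)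
  have hc0 : c ≠ 0 := by rintro rfl; apply h0; rw [← hc]; norm_num
  -- The logarithm is applied to Q(w)/Q(z), which is 1 at w = z and so lies in the slit plane near
  -- z; then `W` is a primitive of this fourth root.
  set q : ℂ → ℂ := fun w => c * Complex.exp (Complex.log (Q w / Q z) / 4) with hq
  have h1 : Q z / Q z ∈ Complex.slitPlane := by rw [div_self h0]; exact Complex.one_mem_slitPlane
  have hqa : AnalyticAt ℂ q z := by
    have ha : AnalyticAt ℂ (fun w => Q w / Q z) z := hQ.div analyticAt_const h0
    exact analyticAt_const.mul (((ha.clog h1).div analyticAt_const (by norm_num)).cexp)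
  have hq4 : ∀ᶠ w in 𝓝 z, q w ^ 4 = Q w := by
    filter_upwards [hQ.continuousAt.eventually_ne h0] with w hw
    rw [hq, mul_pow, hc, ← Complex.exp_nat_mul]
    rw [show ((4 : ℕ) : ℂ) * (Complex.log (Q w / Q z) / 4) = Complex.log (Q w / Q z) by push_cast; ring,
      Complex.exp_log (div_ne_zero hw h0)]
    field_simp
  have hqz : q z ≠ 0 := by simp [hq, hc0]
  obtain ⟨r, hr, hball⟩ := Metric.eventually_nhds_iff_ball.1 hqa.eventually_analyticAt
  obtain ⟨W, hW⟩ := DifferentiableOn.isExactOn_ball (c := z) (r := r) (f := q)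
    fun w hw => (hball w hw).differentiableAt.differentiableWithinAt
  have hWd : ∀ᶠ w in 𝓝 z, HasDerivAt W (q w) w := by
    filter_upwards [Metric.ball_mem_nhds z hr] with w hw using hW w hw
  refine ⟨W, ⟨?_, ?_⟩, ?_⟩
  · rw [Complex.analyticAt_iff_eventually_differentiableAt]
    filter_upwards [hWd] with w hw using hw.differentiableAt
  · rw [hWd.self_of_nhds.deriv]; exact hqz
  · filter_upwards [hWd, hq4] with w hw h4
    rw [hw.deriv, h4]

/-- A local biholomorphism whose derivative is a fourth root of unity is affine. -/
theorem eventually_affine {τ : ℂ → ℂ} {z : ℂ} (h : HolAt τ z) (h4 : ∀ᶠ w in 𝓝 z, deriv τ w ^ 4 = 1) :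
    ∃ c : ℂ, c ^ 4 = 1 ∧ ∀ᶠ w in 𝓝 z, τ w = τ z + c * (w - z) := by
  obtain ⟨r, hr, hball⟩ := Metric.eventually_nhds_iff_ball.1 (h4.and h.eventually)
  -- Differentiating τ'⁴ = 1 gives 4τ'³τ'' = 0 with τ' ≠ 0.
  have hd : ∀ w ∈ Metric.ball z r, deriv (deriv τ) w = 0 := by
    intro w hw
    have h1 : (fun x => deriv τ x ^ 4) =ᶠ[𝓝 w] fun _ => 1 := by
      filter_upwards [Metric.isOpen_ball.mem_nhds hw] with x hx using (hball x hx).1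
    have h2 := (hball w hw).2.1.deriv.differentiableAt.hasDerivAt.pow 4
    have h3 := h2.deriv.symm.trans (h1.deriv_eq.trans (deriv_const w 1))
    simpa [(hball w hw).2.2] using h3
  have hc : ∀ w ∈ Metric.ball z r, deriv τ w = deriv τ z := by
    intro w hw
    refine (convex_ball z r).is_const_of_fderivWithin_eq_zero (𝕜 := ℂ) (f := deriv τ) ?_ ?_ hw
      (Metric.mem_ball_self hr)
    · exact fun x hx => (hball x hx).2.1.deriv.differentiableAt.differentiableWithinAt
    · intro x hx
      rw [fderivWithin_of_isOpen Metric.isOpen_ball hx]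
      ext
      simpa using hd x hx
  refine ⟨deriv τ z, (hball z (Metric.mem_ball_self hr)).1, ?_⟩
  filter_upwards [Metric.ball_mem_nhds z hr] with w hw
  have hg : ∀ x ∈ Metric.ball z r, HasDerivAt (fun x => τ x - deriv τ z * (x - z)) 0 x := by
    intro x hx
    have h1 : HasDerivAt (fun x => τ x - deriv τ z * (x - z)) (deriv τ x - deriv τ z * 1) x :=
      (hball x hx).2.1.differentiableAt.hasDerivAt.sub
        (((hasDerivAt_id x).sub_const z).const_mul (deriv τ z))
    rw [hc x hx] at h1
    simpa using h1
  have hk := (convex_ball z r).is_const_of_fderivWithin_eq_zero (𝕜 := ℂ)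
    (f := fun x => τ x - deriv τ z * (x - z))
    (fun x hx => (hg x hx).differentiableAt.differentiableWithinAt)
    (fun x hx => by
      rw [fderivWithin_of_isOpen Metric.isOpen_ball hx, (hg x hx).hasFDerivAt.fderiv]
      ext
      simp) hw (Metric.mem_ball_self hr)
  simp only [sub_self, mul_zero, sub_zero] at hk
  rw [← hk]; ring

section Manifold

variable {M : Type*} [TopologicalSpace M] [ChartedSpace ℂ M]

theorem HolParam.map_nhds {Φ : ℂ → M} {z : ℂ} (h : HolParam Φ z) : map Φ (𝓝 z) = 𝓝 (Φ z) := by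
  obtain ⟨h1, e, hmem, hs, h2⟩ := h
  have h3 : Φ =ᶠ[𝓝 z] fun w => e.symm (e (Φ w)) := by
    filter_upwards [h1.eventually (e.open_source.mem_nhds hs)] with w hw using (e.left_inv hw).symm
  have h4 : map (fun w => e.symm (e (Φ w))) (𝓝 z) = map e.symm (map (fun w => e (Φ w)) (𝓝 z)) := rfl
  rw [Filter.map_congr h3, h4, h2.map_nhds, e.symm.map_nhds_eq (e.map_source hs), e.left_inv hs]

theorem HolParam.eventually_injOn {Φ : ℂ → M} {z : ℂ} (h : HolParam Φ z) :
    ∃ r > 0, Set.InjOn Φ (Metric.ball z r) := by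
  obtain ⟨h1, e, hmem, hs, h2⟩ := h
  obtain ⟨σ, -, -, hσ, -⟩ := h2.exists_inverse
  obtain ⟨r, hr, hball⟩ := Metric.eventually_nhds_iff_ball.1 hσ
  exact ⟨r, hr, fun a ha b hb hab => by rw [← hball a ha, hab, hball b hb]⟩

/-- A conformal Willmore immersion without umbilic points and with nonpositive Möbius curvature. -/
structure NonposWillmore (y : M → S3) : Prop where
  conformal : IsConformalImmersion y
  umbilic : ∀ p, ¬ IsUmbilic y p
  willmore : IsWillmore y
  nonpos : ∀ p, mobiusCurvature y p ≤ 0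

/-- A holomorphic parametrization in which Bryant's quartic differential is `dz⁴`. -/
def Natural (y : M → S3) (Φ : ℂ → M) (z : ℂ) : Prop :=
  HolParam Φ z ∧ ∀ᶠ w in 𝓝 z, bryantCoeff (surf y Φ) w = 1

variable {y : M → S3} {Φ Θ : ℂ → M} {z : ℂ}

namespace Natural

theorem eventually (h : Natural y Φ z) : ∀ᶠ w in 𝓝 z, Natural y Φ w := by
  filter_upwards [h.1.eventually, h.2.eventually_nhds] with w h1 h2 using ⟨h1, h2⟩

theorem congr (h : Natural y Φ z) (he : Φ =ᶠ[𝓝 z] Θ) : Natural y Θ z := by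
  refine ⟨h.1.congr he, ?_⟩
  filter_upwards [h.2, he.eventuallyEq_nhds] with w hw hew
  rw [← hw]
  refine (bryantCoeff_congr ?_).symm
  filter_upwards [hew] with x hx
  simp only [surf, hx]

theorem coeff_eq (h : Natural y Φ z) : bryantCoeff (surf y Φ) z = 1 := h.2.self_of_nhds

end Natural

variable [IsManifold 𝓘(ℂ) ω M]

namespace NonposWillmore

theorem confAt (hy : NonposWillmore y) (h : HolParam Φ z) : ConfAt (surf y Φ) z :=
  hy.conformal.confAt_surf h

theorem bryantCoeff_comp (hy : NonposWillmore y) {τ : ℂ → ℂ} (h : HolParam Φ (τ z))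
    (hτ : HolAt τ z) : bryantCoeff (surf y (Φ ∘ τ)) z = deriv τ z ^ 4 * bryantCoeff (surf y Φ) (τ z) :=
  (hy.confAt h).bryantCoeff_comp hτ

theorem bryantCoeff_re (hy : NonposWillmore y) (h : HolParam Φ z) :
    ‖hopfCoeff (surf y Φ) z‖ ^ 6 ≤
      (bryantCoeff (surf y Φ) z * star (hopfCoeff (surf y Φ) z) ^ 2).re := by
  rw [hy.conformal.mobiusCurvature_eq hy.umbilic h]
  have h1 := hy.nonpos (Φ z)
  have h2 : 0 ≤ ‖hopfCoeff (surf y Φ) z‖ ^ 6 := by positivity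
  nlinarith

theorem bryantCoeff_ne_zero (hy : NonposWillmore y) (h : HolParam Φ z) :
    bryantCoeff (surf y Φ) z ≠ 0 := by
  intro h0
  have h1 := hy.bryantCoeff_re h
  have h2 : 0 < ‖hopfCoeff (surf y Φ) z‖ ^ 6 :=
    pow_pos (norm_pos_iff.2 (hy.conformal.hopfCoeff_ne_zero hy.umbilic h)) 6
  rw [h0] at h1
  simp at h1
  linarith

/-- The Cauchy-Riemann equation is `dzbar_bryantCoeff`, which rests on the Euler-Lagrange equation
at all nearby points. -/
theorem analyticAt_bryantCoeff (hy : NonposWillmore y) (h : HolParam Φ z) :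
    AnalyticAt ℂ (bryantCoeff (surf y Φ)) z := by
  rw [Complex.analyticAt_iff_eventually_differentiableAt]
  filter_upwards [h.eventually] with w hw
  have hc := hy.confAt hw
  refine differentiableAt_of_dzbar (hc.smooth_bryantCoeff.differentiableAt (by simp))
    (hc.dzbar_bryantCoeff ?_)
  filter_upwards [hw.eventually] with x hx using hy.conformal.willmoreAt_surf hy.willmore hx

/-- For Q = 1 the curvature bound says |k|⁶ ≤ Re k̄² ≤ |k|². Hence the Möbius metric is at most
4|dz|² in natural coordinates, the estimate behind both the continuation and the Liouville argument.
-/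
theorem norm_hopfCoeff_le_one (hy : NonposWillmore y) (h : Natural y Φ z) :
    ‖hopfCoeff (surf y Φ) z‖ ≤ 1 := by
  have h1 := hy.bryantCoeff_re h.1
  rw [h.coeff_eq, one_mul] at h1
  have h2 := h1.trans (Complex.re_le_norm _)
  rw [norm_pow, norm_star] at h2
  have h3 : 0 < ‖hopfCoeff (surf y Φ) z‖ :=
    norm_pos_iff.2 (hy.conformal.hopfCoeff_ne_zero hy.umbilic h.1)
  by_contra! h4
  have := pow_lt_pow_right₀ h4 (show 2 < 6 by norm_num)
  linarith

theorem natural_comp (hy : NonposWillmore y) {b c : ℂ} (hc : c ^ 4 = 1)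
    (h : Natural y Φ (b + c * z)) : Natural y (fun w => Φ (b + c * w)) z := by
  have hc0 : c ≠ 0 := by rintro rfl; norm_num at hc
  refine ⟨HolParam.comp (τ := fun w => b + c * w) h.1 (holAt_affine hc0 b z), ?_⟩
  have ht := (holAt_affine hc0 b z).tendsto
  filter_upwards [ht.eventually h.eventually] with w hw
  have h1 := hy.bryantCoeff_comp (τ := fun w => b + c * w) hw.1 (holAt_affine hc0 b w)
  have hd : HasDerivAt (fun w => b + c * w) c w := by
    simpa using ((hasDerivAt_id w).const_mul c).const_add b
  rw [hd.deriv, hw.coeff_eq, hc, one_mul] at h1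
  exact h1

/-- Through every point there is a natural parametrization. -/
theorem exists_natural (hy : NonposWillmore y) (p : M) : ∃ Φ : ℂ → M, Φ 0 = p ∧ Natural y Φ 0 := by
  set e := chartAt ℂ p
  have he := chart_mem_atlas ℂ p
  have hp := mem_chart_source ℂ p
  have hid : HolAt (fun w : ℂ => w) (e p) := by
    have := holAt_affine (one_ne_zero (α := ℂ)) 0 (e p); simpa using this
  have h0 : HolParam (fun w => e.symm w) (e p) :=
    HolParam.of_chart (τ := fun w => w) he (e.map_source hp) hid
  -- A map W with W'⁴ = Q is a natural coordinate; the parametrization is its local inverse,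
  -- translated so that 0 goes to p.
  obtain ⟨W, hW, hW4⟩ := exists_holAt_deriv_pow (hy.analyticAt_bryantCoeff h0)
    (hy.bryantCoeff_ne_zero h0)
  obtain ⟨σ, hσ, hσz, hσ1, hσ2⟩ := hW.exists_inverse
  have ht : HolAt (fun w : ℂ => W (e p) + 1 * w) 0 := holAt_affine one_ne_zero _ _
  have hσ' : HolAt σ ((fun w : ℂ => W (e p) + 1 * w) 0) := by simpa using hσ
  set τ : ℂ → ℂ := σ ∘ fun w => W (e p) + 1 * w with hτdef
  have hτ : HolAt τ 0 := HolAt.comp (τ := fun w : ℂ => W (e p) + 1 * w) hσ' ht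
  have hτ0 : τ 0 = e p := by simp [hτdef, hσz]
  have h0' : HolParam (fun w => e.symm w) (τ 0) := by rw [hτ0]; exact h0
  refine ⟨(fun w => e.symm w) ∘ τ, by simp [hτ0, e.left_inv hp], h0'.comp hτ, ?_⟩
  have hWτ : ∀ᶠ w in 𝓝 0, W (τ w) = W (e p) + w := by
    have h1 : Tendsto (fun w : ℂ => W (e p) + 1 * w) (𝓝 0) (𝓝 (W (e p))) := by
      simpa using ht.tendsto
    filter_upwards [h1.eventually hσ2] with w hw
    rw [hτdef, Function.comp_apply, hw, one_mul]
  have htt : Tendsto τ (𝓝 0) (𝓝 (e p)) := hτ0 ▸ hτ.tendsto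
  filter_upwards [hWτ.eventually_nhds, hτ.eventually, htt.eventually hW4, htt.eventually hW.eventually,
    htt.eventually h0.eventually] with w h1 h2 h3 h4 h5
  rw [hy.bryantCoeff_comp h5 h2, ← h3]
  have h6 : deriv (fun x => W (τ x)) w = deriv W (τ w) * deriv τ w :=
    deriv_comp w h4.1.differentiableAt h2.1.differentiableAt
  have h7 : (fun x => W (τ x)) =ᶠ[𝓝 w] fun x => W (e p) + x := h1
  have h8 : deriv (fun x => W (e p) + x) w = 1 := ((hasDerivAt_id w).const_add (W (e p))).deriv
  rw [← mul_pow, mul_comm, ← h6, h7.deriv_eq, h8, one_pow]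

/-- Two natural parametrizations differ by an affine map. -/
theorem natural_unique (hy : NonposWillmore y) {a b : ℂ} (ha : Natural y Φ a) (hb : Natural y Θ b)
    (hab : Φ a = Θ b) : ∃ c : ℂ, c ^ 4 = 1 ∧ ∀ᶠ w in 𝓝 a, Φ w = Θ (b + c * (w - a)) := by
  obtain ⟨e, he, hp⟩ : ∃ e ∈ atlas ℂ M, Φ a ∈ e.source :=
    ⟨_, chart_mem_atlas ℂ _, mem_chart_source ℂ _⟩
  have h1 := ha.1.chart he hp
  have h2 := hb.1.chart he (hab ▸ hp)
  obtain ⟨σ, hσ, hσz, hσ1, hσ2⟩ := h2.exists_inverse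
  have hσ' : HolAt σ ((fun w => e (Φ w)) a) := by simpa [hab] using hσ
  set τ : ℂ → ℂ := σ ∘ fun w => e (Φ w) with hτdef
  have hτ : HolAt τ a := hσ'.comp h1
  have hτa : τ a = b := by simp [hτdef, hab, hσz]
  have htt : Tendsto τ (𝓝 a) (𝓝 b) := hτa ▸ hτ.tendsto
  have hΦ : ∀ᶠ w in 𝓝 a, Φ w = Θ (τ w) := by
    have t1 : Tendsto (fun w => e (Φ w)) (𝓝 a) (𝓝 (e (Θ b))) := by
      have := h1.tendsto; rwa [hab] at this
    filter_upwards [t1.eventually hσ2, ha.1.1.eventually (e.open_source.mem_nhds hp),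
      htt.eventually (hb.1.1.eventually (e.open_source.mem_nhds (hab ▸ hp)))] with w h3 h4 h5
    exact (e.injOn h5 h4 h3).symm
  -- The quartic coefficient is 1 in both coordinates, and it transforms by τ'⁴.
  have h4 : ∀ᶠ w in 𝓝 a, deriv τ w ^ 4 = 1 := by
    filter_upwards [hΦ.eventually_nhds, hτ.eventually, ha.2, htt.eventually hb.eventually]
      with w e1 e2 e3 e4
    have e5 : surf y Φ =ᶠ[𝓝 w] surf y (Θ ∘ τ) := by
      filter_upwards [e1] with x hx
      simp only [surf, Function.comp, hx]
    rw [bryantCoeff_congr e5, hy.bryantCoeff_comp e4.1 e2, e4.coeff_eq, mul_one] at e3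
    exact e3
  obtain ⟨c, hc, hcw⟩ := eventually_affine hτ h4
  refine ⟨c, hc, ?_⟩
  filter_upwards [hΦ, hcw] with w e1 e2
  rw [e1, e2, hτa]

end NonposWillmore

end Manifold

/-! ### Möbius distance against Euclidean distance in natural coordinates. -/

section Metric

variable {M : Type*} [TopologicalSpace M] [ChartedSpace ℂ M]

theorem mobiusENorm_smulClass (y : M → S3) (p : M) :
    @ENormSMulClass ℝ (TangentSpace 𝓘(ℝ, ℂ) p) _ (mobiusENorm y p) _ :=
  @ENormSMulClass.mk _ _ _ (mobiusENorm y p) _ fun r v => by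
    change ENNReal.ofReal (_ * @norm ℂ _ (r • (show ℂ from v))) =
      _ * ENNReal.ofReal (_ * @norm ℂ _ v)
    rw [norm_smul, mul_left_comm, ENNReal.ofReal_mul (norm_nonneg r), ofReal_norm]

theorem mobiusEDist_comm (y : M → S3) (p q : M) : mobiusEDist y p q = mobiusEDist y q p := by
  let _ : ∀ p : M, ENorm (TangentSpace 𝓘(ℝ, ℂ) p) := mobiusENorm y
  have _ := mobiusENorm_smulClass y
  exact Manifold.riemannianEDist_comm

variable [IsManifold 𝓘(ℂ) ω M] {y : M → S3} {Φ : ℂ → M}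

theorem HolParam.contMDiffAt {z : ℂ} (h : HolParam Φ z) : ContMDiffAt 𝓘(ℝ, ℂ) 𝓘(ℝ, ℂ) ∞ Φ z := by
  rw [contMDiffAt_iff]
  refine ⟨h.1, ?_⟩
  have h1 := h.chart (chart_mem_atlas ℂ (Φ z)) (mem_chart_source ℂ (Φ z))
  simp only [extChartAt, mfld_simps]
  exact h1.smooth.contDiffWithinAt

/-- The Möbius length of the velocity of a curve in a holomorphic parametrization. -/
theorem IsConformalImmersion.enorm_mfderiv (hy : IsConformalImmersion y) {γ : ℝ → M} {c : ℝ → ℂ}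
    {t : ℝ} {c' : ℂ} (h : HolParam Φ (c t)) (hγ : γ =ᶠ[𝓝 t] fun s => Φ (c s))
    (hc : HasDerivAt c c' t) :
    (mobiusENorm y (γ t)).enorm (mfderiv 𝓘(ℝ, ℝ) 𝓘(ℝ, ℂ) γ t (1 : ℝ)) =
      ENNReal.ofReal (2 * ‖hopfCoeff (surf y Φ) (c t)‖ * ‖c'‖) := by
  have hγt : γ t = Φ (c t) := hγ.eq_of_nhds
  have hτ := h.chart (chart_mem_atlas ℂ (Φ (c t))) (mem_chart_source ℂ (Φ (c t)))
  have hd : HasDerivAt (fun s => chartAt ℂ (γ t) (γ s))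
      (deriv (fun w => chartAt ℂ (Φ (c t)) (Φ w)) (c t) * c') t := by
    have h1 := (hτ.1.differentiableAt.hasDerivAt.hasFDerivAt.restrictScalars ℝ).comp_hasDerivAt t hc
    have h2 : (fun s => chartAt ℂ (γ t) (γ s)) =ᶠ[𝓝 t]
        (fun w => chartAt ℂ (Φ (c t)) (Φ w)) ∘ c := by
      filter_upwards [hγ] with s hs
      simp only [Function.comp, hs, hγt]
    refine (h1.congr_of_eventuallyEq h2).congr_deriv ?_
    simp [mul_comm]
  have hmd : MDifferentiableAt 𝓘(ℝ, ℝ) 𝓘(ℝ, ℂ) γ t := by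
    rw [mdifferentiableAt_iff]
    refine ⟨?_, ?_⟩
    · have h1 : ContinuousAt (fun s => Φ (c s)) t := ContinuousAt.comp h.1 hc.continuousAt
      exact h1.congr hγ.symm
    · simp only [extChartAt, writtenInExtChartAt, mfld_simps]
      exact hd.differentiableAt.differentiableWithinAt
  have hmf : (mfderiv 𝓘(ℝ, ℝ) 𝓘(ℝ, ℂ) γ t (1 : ℝ) : ℂ) =
      deriv (fun w => chartAt ℂ (Φ (c t)) (Φ w)) (c t) * c' := by
    have h3 := DFunLike.congr_fun hmd.mfderiv (1 : ℝ)
    refine h3.trans ?_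
    change fderivWithin ℝ (fun s => chartAt ℂ (γ t) (γ s)) (Set.range id) t 1 = _
    rw [Set.range_id, fderivWithin_univ, hd.hasFDerivAt.fderiv]
    simp
  change ENNReal.ofReal (_ * @norm ℂ _ (mfderiv 𝓘(ℝ, ℝ) 𝓘(ℝ, ℂ) γ t (1 : ℝ))) = _
  rw [hmf, norm_mul, hγt, ← mul_assoc, hy.mobiusFactor_center h]

/-- The image of the segment from a to b has speed 2|k||b − a|, and |k| ≤ 1. -/
theorem NonposWillmore.mobiusEDist_le (hy : NonposWillmore y) {D : Set ℂ} (hD : Convex ℝ D)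
    (hΦ : ∀ z ∈ D, Natural y Φ z) {a b : ℂ} (ha : a ∈ D) (hb : b ∈ D) :
    mobiusEDist y (Φ a) (Φ b) ≤ ENNReal.ofReal (2 * ‖b - a‖) := by
  let _ : ∀ p : M, ENorm (TangentSpace 𝓘(ℝ, ℂ) p) := mobiusENorm y
  have _ := mobiusENorm_smulClass y
  set c : ℝ → ℂ := fun t => a + t * (b - a) with hc
  have hcd : ∀ t, HasDerivAt c (b - a) t := fun t => by
    have h1 : HasDerivAt (fun t : ℝ => a + (t : ℂ) * (b - a)) (1 * (b - a)) t :=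
      ((Complex.ofRealCLM.hasDerivAt (x := t)).mul_const (b - a)).const_add a
    rwa [one_mul] at h1
  have hcm : ∀ t ∈ Set.Icc (0 : ℝ) 1, c t ∈ D := by
    intro t ht
    have := hD ha hb (sub_nonneg.2 ht.2) ht.1 (by ring)
    convert this using 1
    simp [hc, Complex.ext_iff]
    constructor <;> ring
  have h1 : ContMDiffOn 𝓘(ℝ, ℝ) 𝓘(ℝ, ℂ) 1 (fun t => Φ (c t)) (Set.Icc 0 1) := by
    intro t ht
    have h2 : ContMDiffAt 𝓘(ℝ, ℂ) 𝓘(ℝ, ℂ) 1 Φ (c t) :=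
      (hΦ _ (hcm t ht)).1.contMDiffAt.of_le one_le_infty
    have h3 : ContMDiffAt 𝓘(ℝ, ℝ) 𝓘(ℝ, ℂ) 1 c t := by
      rw [contMDiffAt_iff_contDiffAt]
      exact contDiffAt_const.add (Complex.ofRealCLM.contDiff.contDiffAt.mul contDiffAt_const)
    exact (ContMDiffAt.comp t h2 h3).contMDiffWithinAt
  have h4 := Manifold.riemannianEDist_le_pathELength (I := 𝓘(ℝ, ℂ)) h1 (x := Φ a) (y := Φ b)
    (by simp [hc]) (by simp [hc]) zero_le_one
  refine h4.trans ?_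
  rw [Manifold.pathELength_eq_lintegral_mfderiv_Icc]
  calc _ ≤ ∫⁻ t in Set.Icc (0 : ℝ) 1, ENNReal.ofReal (2 * ‖b - a‖) := by
        refine MeasureTheory.setLIntegral_mono' measurableSet_Icc fun t ht => ?_
        refine (hy.conformal.enorm_mfderiv (hΦ _ (hcm t ht)).1 (Eventually.of_forall fun _ => rfl)
          (hcd t)).le.trans (ENNReal.ofReal_le_ofReal ?_)
        have := hy.norm_hopfCoeff_le_one (hΦ _ (hcm t ht))
        have := norm_nonneg (b - a)
        nlinarith
    _ = _ := by simp

theorem HolParam.contMDiffAt_of_leftInverse {g : M → ℂ} {z : ℂ} (h : HolParam Φ z)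
    (hg : ∀ᶠ w in 𝓝 z, g (Φ w) = w) : ContMDiffAt 𝓘(ℝ, ℂ) 𝓘(ℝ, ℂ) ∞ g (Φ z) := by
  have hp := mem_chart_source ℂ (Φ z)
  have h1 := h.chart (chart_mem_atlas ℂ (Φ z)) hp
  obtain ⟨σ, hσ, hσz, hσ1, hσ2⟩ := h1.exists_inverse
  have hσt : Tendsto σ (𝓝 (chartAt ℂ (Φ z) (Φ z))) (𝓝 z) := by
    have := hσ.tendsto; rwa [hσz] at this
  have he : (fun x => g ((chartAt ℂ (Φ z)).symm x)) =ᶠ[𝓝 (chartAt ℂ (Φ z) (Φ z))] σ := by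
    filter_upwards [hσ2, hσt.eventually hg,
      hσt.eventually (h.1.eventually ((chartAt ℂ (Φ z)).open_source.mem_nhds hp))] with x h2 h3 h4
    rw [← h3]
    conv_lhs => rw [← h2]
    rw [(chartAt ℂ (Φ z)).left_inv h4, h3]
  have hc : ContinuousAt g (Φ z) := by
    rw [ContinuousAt, ← h.map_nhds, hg.self_of_nhds, tendsto_map'_iff]
    exact tendsto_id.congr' (hg.mono fun w hw => hw.symm)
  rw [contMDiffAt_iff]
  refine ⟨hc, ?_⟩
  simp only [extChartAt, mfld_simps]
  exact (hσ.smooth.congr_of_eventuallyEq he).contDiffWithinAt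

/-- Points at small Möbius distance from the centre of a natural disc lie in the disc. -/
theorem NonposWillmore.exists_mem_image_closedBall [T2Space M] (hy : NonposWillmore y) {R δ : ℝ}
    (hΦ : ∀ z ∈ Metric.ball 0 R, Natural y Φ z) (hinj : Set.InjOn Φ (Metric.ball 0 R))
    (hδ : 0 < δ) (hδR : δ < R) :
    ∃ ε > 0, ∀ q, mobiusEDist y (Φ 0) q < ε → q ∈ Φ '' Metric.closedBall 0 δ := by
  let _ : ∀ p : M, ENorm (TangentSpace 𝓘(ℝ, ℂ) p) := mobiusENorm y
  have _ := mobiusENorm_smulClass y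
  have hsub : Metric.closedBall (0 : ℂ) δ ⊆ Metric.ball 0 R := Metric.closedBall_subset_ball hδR
  have hk : ContinuousOn (fun z => ‖hopfCoeff (surf y Φ) z‖) (Metric.closedBall 0 δ) := fun z hz =>
    (hy.confAt (hΦ z (hsub hz)).1).smooth_hopfCoeff.continuousAt.norm.continuousWithinAt
  obtain ⟨z₀, hz₀, hmin⟩ := (isCompact_closedBall (0 : ℂ) δ).exists_isMinOn
    ⟨0, Metric.mem_closedBall_self hδ.le⟩ hk
  set m := ‖hopfCoeff (surf y Φ) z₀‖ with hm
  have hm0 : 0 < m := norm_pos_iff.2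
    (hy.conformal.hopfCoeff_ne_zero hy.umbilic (hΦ z₀ (hsub hz₀)).1)
  -- Since |k| ≥ m on the closed disc, a path in it of Möbius length less than 2mδ has Euclidean
  -- length less than δ in the coordinate, so starting at the centre it cannot reach the boundary
  -- circle.
  refine ⟨ENNReal.ofReal (2 * m * δ), ENNReal.ofReal_pos.2 (by positivity), fun q hq => ?_⟩
  obtain ⟨γ, h0, h1, hγ, hlen, -, -⟩ :=
    Manifold.exists_lt_locally_constant_of_riemannianEDist_lt (I := 𝓘(ℝ, ℂ)) hq zero_lt_one
  have hγc : Continuous γ := hγ.continuous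
  have hΦc : ContinuousOn Φ (Metric.closedBall 0 δ) := fun z hz =>
    (hΦ z (hsub hz)).1.1.continuousWithinAt
  have hcl : IsClosed (Φ '' Metric.closedBall 0 δ) :=
    ((isCompact_closedBall (0 : ℂ) δ).image_of_continuousOn hΦc).isClosed
  have hop : IsOpen (Φ '' Metric.ball 0 δ) := by
    rw [isOpen_iff_mem_nhds]
    rintro _ ⟨z, hz, rfl⟩
    rw [← (hΦ z (hsub (Metric.ball_subset_closedBall hz))).1.map_nhds]
    exact image_mem_map (Metric.isOpen_ball.mem_nhds hz)
  set g := Function.invFunOn Φ (Metric.ball 0 R) with hg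
  have hgi : ∀ z ∈ Metric.ball (0 : ℂ) R, g (Φ z) = z := hinj.leftInvOn_invFunOn
  have hgd : ∀ z ∈ Metric.ball (0 : ℂ) R, ContMDiffAt 𝓘(ℝ, ℂ) 𝓘(ℝ, ℂ) 1 g (Φ z) := fun z hz =>
    ((hΦ z hz).1.contMDiffAt_of_leftInverse (by
      filter_upwards [Metric.isOpen_ball.mem_nhds hz] with w hw using hgi w hw)).of_le one_le_infty
  -- Continuity argument: the times spent in the closed disc form a closed set, and if the path has
  -- stayed there up to time t, the length estimate puts it in the open disc at t, hence in the disc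
  -- shortly after.
  have key : Set.Icc 0 1 ⊆ γ ⁻¹' (Φ '' Metric.closedBall 0 δ) := by
    refine IsClosed.Icc_subset_of_forall_mem_nhdsGT_of_Icc_subset
      ((hcl.preimage hγc).inter isClosed_Icc) ⟨0, Metric.mem_closedBall_self hδ.le, h0.symm⟩ ?_
    intro t ht hsubt
    refine mem_nhdsWithin_of_mem_nhds (hγc.continuousAt.preimage_mem_nhds
      (mem_of_superset (hop.mem_nhds ?_) (Set.image_mono Metric.ball_subset_closedBall)))
    have hcd : ∀ s ∈ Set.Icc 0 t, ContDiffAt ℝ 1 (fun s => g (γ s)) s := by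
      intro s hs
      obtain ⟨z, hz, hzs⟩ := hsubt hs
      rw [← contMDiffAt_iff_contDiffAt]
      exact ContMDiffAt.comp s (hzs ▸ hgd z (hsub hz)) (hγ s)
    have hΦg : ∀ s ∈ Set.Icc 0 t, Φ (g (γ s)) = γ s ∧ g (γ s) ∈ Metric.closedBall 0 δ := by
      intro s hs
      obtain ⟨z, hz, hzs⟩ := hsubt hs
      rw [← hzs, hgi z (hsub hz)]
      exact ⟨rfl, hz⟩
    have e1 := enorm_sub_le_lintegral_deriv_of_contDiffOn_Icc (f := fun s => g (γ s))
      (fun s hs => (hcd s hs).contDiffWithinAt) ht.1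
    have e2 : ENNReal.ofReal (2 * m) * ∫⁻ s in Set.Icc 0 t, ‖deriv (fun s => g (γ s)) s‖ₑ ≤
        Manifold.pathELength 𝓘(ℝ, ℂ) γ 0 1 := by
      refine le_trans ?_ (Manifold.pathELength_mono (a := 0) le_rfl ht.2.le)
      rw [← MeasureTheory.lintegral_const_mul' _ _ ENNReal.ofReal_ne_top,
        Manifold.pathELength_eq_lintegral_mfderiv_Ioo, ← MeasureTheory.restrict_Ioo_eq_restrict_Icc]
      refine MeasureTheory.setLIntegral_mono' measurableSet_Ioo fun s hs => ?_
      have hs' := Set.Ioo_subset_Icc_self hs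
      obtain ⟨f1, f2⟩ := hΦg s hs'
      have h3 : γ =ᶠ[𝓝 s] fun s => Φ (g (γ s)) := by
        filter_upwards [Ioo_mem_nhds hs.1 hs.2] with r hr
        exact (hΦg r (Set.Ioo_subset_Icc_self hr)).1.symm
      have h4 := hy.conformal.enorm_mfderiv (hΦ _ (hsub f2)).1 h3
        ((hcd s hs').differentiableAt one_ne_zero).hasDerivAt
      refine le_trans ?_ h4.ge
      rw [← ofReal_norm, ← ENNReal.ofReal_mul (by positivity)]
      refine ENNReal.ofReal_le_ofReal ?_
      have := hmin f2
      gcongr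
      exact this
    have e3 : ENNReal.ofReal (2 * m) * ‖g (γ t)‖ₑ < ENNReal.ofReal (2 * m * δ) := by
      have h00 : g (γ 0) = 0 := by rw [h0, hgi 0 (hsub (Metric.mem_closedBall_self hδ.le))]
      simp only [h00, sub_zero] at e1
      exact (mul_le_mul_right e1 _).trans_lt (e2.trans_lt hlen)
    rw [← ofReal_norm, ← ENNReal.ofReal_mul (by positivity),
      ENNReal.ofReal_lt_ofReal_iff (by positivity)] at e3
    obtain ⟨f1, f2⟩ := hΦg t ⟨ht.1, le_rfl⟩
    exact ⟨_, mem_ball_zero_iff.2 (lt_of_mul_lt_mul_left e3 (by positivity)), f1⟩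
  have := key ⟨zero_le_one, le_rfl⟩
  rwa [Set.mem_preimage, h1] at this

end Metric

/-! ### Continuation of a natural parametrization to the whole plane. -/

section Extension

variable {M : Type*} [TopologicalSpace M] [ChartedSpace ℂ M] [IsManifold 𝓘(ℂ) ω M]
  {y : M → S3} {Φ Θ : ℂ → M}

namespace NonposWillmore

/-- Natural parametrizations of a connected domain that agree near a point agree everywhere. -/
theorem natural_eqOn [T2Space M] (hy : NonposWillmore y) {U : Set ℂ} (hU : IsPreconnected U)
    (hΦ : ∀ z ∈ U, Natural y Φ z) (hΘ : ∀ z ∈ U, Natural y Θ z) {a : ℂ} (ha : a ∈ U)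
    (h : Φ =ᶠ[𝓝 a] Θ) : Set.EqOn Φ Θ U := by
  have hA : IsOpen {z | Φ =ᶠ[𝓝 z] Θ} := by
    rw [isOpen_iff_mem_nhds]
    exact fun z hz => hz.eventuallyEq_nhds
  have key : U ⊆ {z | Φ =ᶠ[𝓝 z] Θ} := by
    refine hU.subset_of_closure_inter_subset hA ⟨a, ha, h⟩ ?_
    rintro z ⟨hz, hzU⟩
    have hf : ∃ᶠ w in 𝓝 z, Φ =ᶠ[𝓝 w] Θ := mem_closure_iff_frequently.1 hz
    have hzz : Φ z = Θ z := by
      by_contra hne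
      have h1 := ((hΦ z hzU).1.1.prodMk (hΘ z hzU).1.1).eventually
        ((isClosed_diagonal (X := M)).isOpen_compl.mem_nhds
          (show (Φ z, Θ z) ∈ (Set.diagonal M)ᶜ from hne))
      obtain ⟨w, hw1, hw2⟩ := (hf.and_eventually h1).exists
      exact hw2 hw1.eq_of_nhds
    -- At a limit point z of agreement, Φ(w) = Θ(z + c(w − z)) near z. If the germs differ at z,
    -- there is w ≠ z arbitrarily close with Φ(w) = Θ(w), and injectivity of Θ near z gives z + c(w
    -- − z) = w, so c = 1.
    obtain ⟨c, hc, hcw⟩ := hy.natural_unique (hΦ z hzU) (hΘ z hzU) hzz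
    obtain ⟨r, hr, hinj⟩ := (hΘ z hzU).1.eventually_injOn
    by_contra hnot
    obtain ⟨w, hw1, hw2, hw3⟩ := (hf.and_eventually (hcw.and (Metric.ball_mem_nhds z hr))).exists
    have hwz : w ≠ z := by rintro rfl; exact hnot hw1
    have hcn : ‖c‖ = 1 := (pow_eq_one_iff_of_nonneg (norm_nonneg c) (by norm_num : 4 ≠ 0)).1 (by
      rw [← norm_pow, hc, norm_one])
    have h3 : z + c * (w - z) ∈ Metric.ball z r := by
      rw [dist_eq_norm] at hw3
      rw [mem_ball_iff_norm]
      simpa [norm_mul, hcn] using hw3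
    have h4 : z + c * (w - z) = w := hinj h3 hw3 (hw2.symm.trans hw1.eq_of_nhds)
    have h5 : (c - 1) * (w - z) = 0 := by linear_combination h4
    have h6 : c = 1 := by
      rcases mul_eq_zero.1 h5 with h | h
      · exact sub_eq_zero.1 h
      · exact absurd (sub_eq_zero.1 h) hwz
    refine hnot (hcw.mono fun x hx => ?_)
    rw [hx, h6, one_mul, add_sub_cancel]
  exact fun z hz => (key hz).eq_of_nhds

/-- A natural parametrization of a connected domain is determined up to an affine map by one of
its values. -/
theorem natural_eqOn_affine [T2Space M] (hy : NonposWillmore y) {a b : ℂ} (ha : Natural y Φ a)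
    (hb : Natural y Θ b) (hab : Φ a = Θ b) : ∃ c : ℂ, c ^ 4 = 1 ∧ ‖c‖ = 1 ∧
      ∀ U : Set ℂ, IsPreconnected U → a ∈ U → (∀ z ∈ U, Natural y Φ z) →
        (∀ z ∈ U, Natural y Θ (b + c * (z - a))) →
        ∀ z ∈ U, Φ z = Θ (b + c * (z - a)) := by
  obtain ⟨c, hc, hcw⟩ := hy.natural_unique ha hb hab
  have hcn : ‖c‖ = 1 := (pow_eq_one_iff_of_nonneg (norm_nonneg c) (by norm_num : 4 ≠ 0)).1 (by
      rw [← norm_pow, hc, norm_one])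
  refine ⟨c, hc, hcn, fun U hU haU hΦ hΘ z hz => ?_⟩
  have e : ∀ w : ℂ, b + c * (w - a) = (b - c * a) + c * w := fun w => by ring
  refine hy.natural_eqOn (Θ := fun w => Θ (b + c * (w - a))) hU hΦ (fun w hw => ?_) haU hcw hz
  simp only [e]
  exact hy.natural_comp hc (by rw [← e]; exact hΘ w hw)

/-- `Ψ` is a natural extension of the germ of `Φ` at `0` to a convex open set containing `z`. -/
def IsExtension (y : M → S3) (Φ Ψ : ℂ → M) (C : Set ℂ) : Prop :=
  IsOpen C ∧ Convex ℝ C ∧ 0 ∈ C ∧ (∀ z ∈ C, Natural y Ψ z) ∧ Ψ =ᶠ[𝓝 0] Φ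

/-- Two convex domains around 0 have a convex, hence connected, intersection containing 0, so no
monodromy can occur. -/
theorem IsExtension.eqOn [T2Space M] (hy : NonposWillmore y) {Ψ₁ Ψ₂ : ℂ → M} {C₁ C₂ : Set ℂ}
    (h₁ : IsExtension y Φ Ψ₁ C₁) (h₂ : IsExtension y Φ Ψ₂ C₂) : Set.EqOn Ψ₁ Ψ₂ (C₁ ∩ C₂) :=
  hy.natural_eqOn (h₁.2.1.inter h₂.2.1).isPreconnected (fun z hz => h₁.2.2.2.1 z hz.1)
    (fun z hz => h₂.2.2.2.1 z hz.2) ⟨h₁.2.2.1, h₂.2.2.1⟩ (h₁.2.2.2.2.trans h₂.2.2.2.2.symm)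

/-- The maximal extension of a natural parametrization to a star-shaped domain. -/
theorem exists_maximal_extension [T2Space M] (hy : NonposWillmore y) (Φ : ℂ → M) :
    ∃ F : ℂ → M, ∀ C Ψ, IsExtension y Φ Ψ C → Set.EqOn F Ψ C := by
  classical
  refine ⟨fun z => if h : ∃ C Ψ, IsExtension y Φ Ψ C ∧ z ∈ C then h.choose_spec.choose z else Φ z,
    fun C Ψ hC z hz => ?_⟩
  have h : ∃ C Ψ, IsExtension y Φ Ψ C ∧ z ∈ C := ⟨C, Ψ, hC, hz⟩
  simp only [dif_pos h]
  exact h.choose_spec.choose_spec.1.eqOn hy hC ⟨h.choose_spec.choose_spec.2, hz⟩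

/-- Let D be the union of all convex domains of extension. If tζ ∈ D for 0 ≤ t < 1, the points
F(tₙζ) with tₙ → 1 are Möbius-Cauchy, because distances are at most twice the Euclidean ones.
Completeness provides a limit p, and a natural disc around p, composed with an affine map, continues
F past ζ. So no ray from 0 leaves D. -/
theorem exists_entire [T2Space M] (hy : NonposWillmore y) (hcomp : IsMobiusComplete y)
    {Φ : ℂ → M} (hΦ : Natural y Φ 0) : ∃ F : ℂ → M, ∀ z, Natural y F z := by
  obtain ⟨F, hF⟩ := hy.exists_maximal_extension Φ
  set D : Set ℂ := {z | ∃ C Ψ, IsExtension y Φ Ψ C ∧ z ∈ C} with hD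
  have hDo : IsOpen D := by
    rw [isOpen_iff_mem_nhds]
    rintro z ⟨C, Ψ, hC, hz⟩
    exact mem_of_superset (hC.1.mem_nhds hz) fun w hw => ⟨C, Ψ, hC, hw⟩
  have hFD : ∀ z ∈ D, Natural y F z := by
    rintro z ⟨C, Ψ, hC, hz⟩
    refine (hC.2.2.2.1 z hz).congr ?_
    filter_upwards [hC.1.mem_nhds hz] with w hw using (hF C Ψ hC hw).symm
  have h0 : (0 : ℂ) ∈ D := by
    obtain ⟨r, hr, hb⟩ := Metric.eventually_nhds_iff_ball.1 hΦ.eventually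
    exact ⟨Metric.ball 0 r, Φ, ⟨Metric.isOpen_ball, convex_ball 0 r, Metric.mem_ball_self hr, hb,
      EventuallyEq.rfl⟩, Metric.mem_ball_self hr⟩
  have key : ∀ ζ : ℂ, (∀ t : ℝ, 0 ≤ t → t < 1 → (t : ℂ) * ζ ∈ D) → ζ ∈ D := by
    intro ζ hζ
    set S : Set ℂ := (fun t : ℝ => (t : ℂ) * ζ) '' Set.Ico 0 1 with hS
    have hSc : Convex ℝ S := by
      have h1 := (convex_Ico (0 : ℝ) 1).linear_image
        (LinearMap.toSpanSingleton ℝ ℂ ζ)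
      have h2 : S = LinearMap.toSpanSingleton ℝ ℂ ζ '' Set.Ico 0 1 :=
        Set.image_congr fun t _ => by simp
      rwa [h2]
    have hSD : ∀ z ∈ S, Natural y F z := by
      rintro _ ⟨t, ht, rfl⟩
      exact hFD _ (hζ t ht.1 ht.2)
    set t : ℕ → ℝ := fun n => 1 - 1 / ((n : ℝ) + 1) with ht
    have ht1 : ∀ n, t n ∈ Set.Ico (0 : ℝ) 1 := by
      intro n
      have h1 : (0 : ℝ) < (n : ℝ) + 1 := by positivity
      have h2 : 1 / ((n : ℝ) + 1) ≤ 1 := by rw [div_le_one h1]; linarith [n.cast_nonneg (α := ℝ)]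
      have h3 : 0 < 1 / ((n : ℝ) + 1) := by positivity
      exact ⟨by simp only [ht]; linarith, by simp only [ht]; linarith⟩
    have htl : Tendsto t atTop (𝓝 1) := by
      simpa [ht] using (tendsto_one_div_add_atTop_nhds_zero_nat (𝕜 := ℝ)).const_sub 1
    have hzl : Tendsto (fun n => (t n : ℂ) * ζ) atTop (𝓝 ζ) := by
      simpa using ((Complex.continuous_ofReal.tendsto 1).comp htl).mul_const ζ
    obtain ⟨p, hp⟩ := hcomp (fun n => F (t n * ζ)) (by
      intro ε hε
      obtain ⟨ε', hε', hle⟩ : ∃ ε' : ℝ, 0 < ε' ∧ ENNReal.ofReal ε' ≤ ε := by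
        rcases eq_or_ne ε ⊤ with rfl | hne
        · exact ⟨1, one_pos, le_top⟩
        · exact ⟨ε.toReal, ENNReal.toReal_pos hε.ne' hne, ENNReal.ofReal_toReal_le⟩
      obtain ⟨n₀, hn₀⟩ := Metric.cauchySeq_iff.1 hzl.cauchySeq (ε' / 2) (by positivity)
      refine ⟨n₀, fun m hm n hn => ?_⟩
      refine (hy.mobiusEDist_le hSc hSD ⟨t m, ht1 m, rfl⟩ ⟨t n, ht1 n, rfl⟩).trans_lt
        (lt_of_lt_of_le ?_ hle)
      rw [ENNReal.ofReal_lt_ofReal_iff hε']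
      have := hn₀ n hn m hm
      rw [dist_eq_norm] at this
      linarith)
    obtain ⟨Θ, hΘp, hΘ⟩ := hy.exists_natural p
    obtain ⟨r₁, hr₁, hb₁⟩ := Metric.eventually_nhds_iff_ball.1 hΘ.eventually
    obtain ⟨r₂, hr₂, hinj⟩ := hΘ.1.eventually_injOn
    set R := min r₁ r₂ with hR
    have hR0 : 0 < R := lt_min hr₁ hr₂
    have hΘR : ∀ z ∈ Metric.ball 0 R, Natural y Θ z := fun z hz =>
      hb₁ z (Metric.ball_subset_ball (min_le_left _ _) hz)
    -- With |a| ≤ R/4 and |c| = 1, the map z ↦ a + c(z − zₙ) sends the ball of radius 3R/4 around zₙ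
    -- into the ball of radius R on which Θ is natural, and ζ is within R/4 of zₙ.
    obtain ⟨ε, hε, hεq⟩ := hy.exists_mem_image_closedBall hΘR
      (hinj.mono (Metric.ball_subset_ball (min_le_right _ _))) (δ := R / 4) (by positivity)
      (by linarith)
    obtain ⟨n, hn1, hn2⟩ := ((hp.eventually (gt_mem_nhds hε)).and
      (hzl.eventually (Metric.ball_mem_nhds ζ (show 0 < R / 4 by positivity)))).exists
    set zn : ℂ := t n * ζ with hzn
    rw [mobiusEDist_comm, ← hΘp] at hn1
    obtain ⟨a, ha, haF⟩ := hεq _ hn1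
    obtain ⟨C, Ψ, hC, hnC⟩ := hζ (t n) (ht1 n).1 (ht1 n).2
    have haR : ‖a‖ ≤ R / 4 := by simpa using ha
    have haB : a ∈ Metric.ball (0 : ℂ) R := by rw [mem_ball_zero_iff]; linarith
    have hΨn : Ψ zn = Θ a := by rw [haF, ← hF C Ψ hC hnC]
    obtain ⟨c, hc4, hcn, hc⟩ := hy.natural_eqOn_affine (hC.2.2.2.1 zn hnC) (hΘR a haB) hΨn
    set B := Metric.ball zn (3 * R / 4) with hB
    have hBR : ∀ z ∈ B, Natural y Θ (a + c * (z - zn)) := by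
      intro z hz
      refine hΘR _ ?_
      rw [mem_ball_zero_iff]
      rw [hB, mem_ball_iff_norm] at hz
      calc _ ≤ ‖a‖ + ‖c * (z - zn)‖ := norm_add_le _ _
        _ < R := by rw [norm_mul, hcn]; linarith
    have hnB : zn ∈ B := Metric.mem_ball_self (by positivity)
    have hζB : ζ ∈ B := by
      rw [hB, Metric.mem_ball, dist_comm]
      exact lt_trans (Metric.mem_ball.1 hn2) (by linarith)
    have hΨΘ : ∀ z ∈ C ∩ B, Ψ z = Θ (a + c * (z - zn)) :=
      hc (C ∩ B) (hC.2.1.inter (convex_ball _ _)).isPreconnected ⟨hnC, hnB⟩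
        (fun z hz => hC.2.2.2.1 z hz.1) fun z hz => hBR z hz.2
    classical
    set H : ℂ → M := fun z => if z ∈ C then Ψ z else Θ (a + c * (z - zn)) with hH
    have hHC : ∀ z ∈ C, H z = Ψ z := fun z hz => if_pos hz
    have hHB : ∀ z ∈ B, H z = Θ (a + c * (z - zn)) := by
      intro z hz
      by_cases h : z ∈ C
      · rw [hHC z h, hΨΘ z ⟨h, hz⟩]
      · exact if_neg h
    have hseg : segment ℝ 0 ζ ⊆ C ∪ B := by
      intro w hw
      rw [segment_eq_image] at hw
      obtain ⟨s, hs, rfl⟩ := hw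
      simp only [smul_zero, zero_add]
      rcases le_or_gt s (t n) with h | h
      · left
        have htn : t n ≠ 0 ∨ t n = 0 := ne_or_eq _ _
        have h1 := hC.2.1.segment_subset hC.2.2.1 hnC
        rcases htn with h0 | h0
        · refine h1 ?_
          rw [segment_eq_image]
          have htp : 0 < t n := lt_of_le_of_ne (ht1 n).1 h0.symm
          refine ⟨s / t n, ⟨div_nonneg hs.1 htp.le, (div_le_one htp).2 h⟩, ?_⟩
          simp only [smul_zero, zero_add, Complex.real_smul]
          rw [← mul_assoc, ← Complex.ofReal_mul, div_mul_cancel₀ _ h0]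
        · have : s = 0 := le_antisymm (h0 ▸ h) hs.1
          rw [this, zero_smul]; exact hC.2.2.1
      · right
        rw [hB, mem_ball_iff_norm]
        rw [dist_eq_norm] at hn2
        have e1 : s • ζ - zn = ((s - t n : ℝ) : ℂ) * ζ := by
          rw [hzn, Complex.real_smul]; push_cast; ring
        have e2 : zn - ζ = ((t n - 1 : ℝ) : ℂ) * ζ := by rw [hzn]; push_cast; ring
        have e3 : ((t n : ℂ) * ζ - ζ) = ((t n - 1 : ℝ) : ℂ) * ζ := e2
        rw [e3, norm_mul, Complex.norm_real, Real.norm_eq_abs, abs_sub_comm,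
          abs_of_nonneg (by linarith [(ht1 n).2])] at hn2
        rw [e1, norm_mul, Complex.norm_real, Real.norm_eq_abs, abs_of_nonneg (by linarith)]
        have : (s - t n) * ‖ζ‖ ≤ (1 - t n) * ‖ζ‖ := by
          have := hs.2; gcongr
        linarith
    have hCB : IsOpen (C ∪ B) := hC.1.union Metric.isOpen_ball
    have hsegc : IsCompact (segment ℝ (0 : ℂ) ζ) := by
      rw [segment_eq_image]
      exact isCompact_Icc.image (by fun_prop)
    -- `C ∪ B` need not be convex, but it contains the compact segment from 0 to ζ, and a thin
    -- neighbourhood of a segment is convex.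
    obtain ⟨η, hη, hηs⟩ := hsegc.exists_thickening_subset_open hCB hseg
    have hsub := Metric.self_subset_thickening hη (segment ℝ (0 : ℂ) ζ)
    refine ⟨Metric.thickening η (segment ℝ 0 ζ), H, ⟨Metric.isOpen_thickening,
      (convex_segment 0 ζ).thickening η, hsub (left_mem_segment ℝ 0 ζ), ?_, ?_⟩,
      hsub (right_mem_segment ℝ 0 ζ)⟩
    · intro z hz
      rcases hηs hz with h | h
      · refine (hC.2.2.2.1 z h).congr ?_
        filter_upwards [hC.1.mem_nhds h] with w hw using (hHC w hw).symm
      · have e : ∀ w : ℂ, a + c * (w - zn) = (a - c * zn) + c * w := fun w => by ring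
        refine Natural.congr (Φ := fun w => Θ ((a - c * zn) + c * w))
          (hy.natural_comp hc4 (by rw [← e]; exact hBR z h)) ?_
        filter_upwards [Metric.isOpen_ball.mem_nhds h] with w hw
        rw [hHB w hw, e]
    · filter_upwards [hC.1.mem_nhds hC.2.2.1, hC.2.2.2.2] with w hw hw2
      rw [hHC w hw, hw2]
  refine ⟨F, fun z => hFD z ?_⟩
  by_contra hz
  -- The least exit time t₀ along the ray contradicts `key` at ζ = t₀z.
  set K : Set ℝ := {t | (t : ℂ) * z ∉ D} ∩ Set.Icc 0 1 with hK
  have hKc : IsCompact K := isCompact_Icc.inter_left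
    ((hDo.isClosed_compl).preimage (f := fun t : ℝ => (t : ℂ) * z) (by fun_prop))
  obtain ⟨t₀, ht₀, hmin⟩ := hKc.exists_isLeast ⟨1, by simpa using hz, by simp⟩
  refine ht₀.1 (key _ fun s hs0 hs1 => ?_)
  by_contra hs
  have ht0 : 0 < t₀ := by
    refine lt_of_le_of_ne ht₀.2.1 fun h => ht₀.1 ?_
    rw [← h]; simpa using h0
  have h1 : s * t₀ ∈ K := by
    refine ⟨?_, mul_nonneg hs0 ht0.le, ?_⟩
    · simp only [Set.mem_ofPred_eq]; push_cast; rwa [mul_assoc]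
    · have := ht₀.2.2; nlinarith
  have h2 := hmin h1
  nlinarith

/-- An entire natural parametrization is onto. -/
theorem surjective_of_natural [T2Space M] [ConnectedSpace M] (hy : NonposWillmore y)
    (hΦ : ∀ z, Natural y Φ z) : Function.Surjective Φ := by
  have ho : IsOpen (Set.range Φ) := by
    rw [isOpen_iff_mem_nhds]
    rintro _ ⟨z, rfl⟩
    rw [← (hΦ z).1.map_nhds]
    exact range_mem_map
  have hcl : IsClosed (Set.range Φ) := by
    refine isClosed_of_closure_subset fun p hp => ?_
    obtain ⟨Θ, hΘp, hΘ⟩ := hy.exists_natural p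
    obtain ⟨r, hr, hb⟩ := Metric.eventually_nhds_iff_ball.1 hΘ.eventually
    have h1 : Θ '' Metric.ball 0 r ∈ 𝓝 p := by
      rw [← hΘp, ← hΘ.1.map_nhds]
      exact image_mem_map (Metric.ball_mem_nhds _ hr)
    obtain ⟨_, ⟨b, hb', rfl⟩, ⟨a, hab⟩⟩ := mem_closure_iff_nhds.1 hp _ h1
    -- A natural disc around a limit point of the range meets the range, and there it agrees with Φ
    -- up to an affine map. Since Φ is entire, the agreement extends over the disc to its centre.
    obtain ⟨c, -, hcn, hc⟩ := hy.natural_eqOn_affine (hb b hb') (hΦ a) hab.symm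
    have := hc (Metric.ball 0 r) (convex_ball _ _).isPreconnected hb' hb (fun z _ => hΦ _) 0
      (Metric.mem_ball_self hr)
    exact ⟨_, this.symm.trans hΘp⟩
  exact Set.range_eq_univ.1 (IsClopen.eq_univ ⟨hcl, ho⟩ ⟨_, Set.mem_range_self 0⟩)

end NonposWillmore

end Extension

/-! ### Subharmonic functions in the plane -/

section Subharmonic

variable {g : ℂ → ℝ}

/-- If the second derivative along v were positive, the restriction to that line would also have a
local minimum, so it would be locally constant with zero second derivative. -/
theorem iteratedFDeriv_two_nonpos_of_isLocalMax {z : ℂ} (hg : ContDiffAt ℝ 2 g z)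
    (h : IsLocalMax g z) (v : ℂ) : iteratedFDeriv ℝ 2 g z ![v, v] ≤ 0 := by
  by_contra! hpos
  set ℓ : ℝ → ℂ := fun t => z + t • v with hℓ
  have hℓd : ∀ t, HasDerivAt ℓ v t := fun t => by
    have h1 : HasDerivAt ℓ ((1 : ℝ) • v) t := ((hasDerivAt_id t).smul_const v).const_add z
    rwa [one_smul] at h1
  have hℓ0 : ℓ 0 = z := by simp [hℓ]
  have hℓt : Tendsto ℓ (𝓝 0) (𝓝 z) := by
    have := (hℓd 0).continuousAt.tendsto; rwa [hℓ0] at this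
  have hd : ∀ᶠ w in 𝓝 z, DifferentiableAt ℝ g w := by
    filter_upwards [hg.eventually (by simp)] with w hw using hw.differentiableAt (by simp)
  have h1 : deriv (fun t => g (ℓ t)) =ᶠ[𝓝 0] fun t => fderiv ℝ g (ℓ t) v := by
    filter_upwards [hℓt.eventually hd] with t ht
    exact (ht.hasFDerivAt.comp_hasDerivAt t (hℓd t)).deriv
  have hd2 : DifferentiableAt ℝ (fderiv ℝ g) z :=
    (hg.fderiv_right (m := 1) (by norm_num)).differentiableAt (by simp)
  have h2 : HasDerivAt (fun t => fderiv ℝ g (ℓ t) v) (fderiv ℝ (fderiv ℝ g) z v v) 0 := by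
    have e1 : HasFDerivAt (fderiv ℝ g) (fderiv ℝ (fderiv ℝ g) z) (ℓ 0) := hℓ0 ▸ hd2.hasFDerivAt
    have e2 := (e1.comp_hasDerivAt 0 (hℓd 0)).clm_apply (hasDerivAt_const (0 : ℝ) v)
    simpa using e2
  have h3 : deriv (deriv fun t => g (ℓ t)) 0 = iteratedFDeriv ℝ 2 g z ![v, v] := by
    rw [h1.deriv_eq, h2.deriv, iteratedFDeriv_two_apply]; rfl
  have hmax : IsLocalMax (fun t => g (ℓ t)) 0 := by
    have := hℓt.eventually h
    filter_upwards [this] with t ht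
    rwa [hℓ0]
  have hmin : IsLocalMin (fun t => g (ℓ t)) 0 := by
    refine isLocalMin_of_deriv_deriv_pos (h3 ▸ hpos) hmax.deriv_eq_zero ?_
    exact ContinuousAt.comp (by rw [hℓ0]; exact hg.continuousAt) (hℓd 0).continuousAt
  have hc : (fun t => g (ℓ t)) =ᶠ[𝓝 0] fun _ => g (ℓ 0) := by
    filter_upwards [hmax, hmin] with t e1 e2 using le_antisymm e1 e2
  have h4 : deriv (fun t => g (ℓ t)) =ᶠ[𝓝 0] fun _ => 0 := by
    have := hc.deriv
    filter_upwards [this] with t ht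
    rw [ht, deriv_const]
  rw [← h3, h4.deriv_eq, deriv_const] at hpos
  exact lt_irrefl _ hpos

theorem laplacian_nonpos_of_isLocalMax {z : ℂ} (hg : ContDiffAt ℝ 2 g z) (h : IsLocalMax g z) :
    Laplacian.laplacian g z ≤ 0 := by
  rw [InnerProductSpace.laplacian_eq_iteratedFDeriv_complexPlane]
  exact add_nonpos (iteratedFDeriv_two_nonpos_of_isLocalMax hg h 1)
    (iteratedFDeriv_two_nonpos_of_isLocalMax hg h Complex.I)

theorem laplacian_re_sq (z : ℂ) : Laplacian.laplacian (fun w : ℂ => w.re ^ 2) z = 2 := by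
  have h1 : fderiv ℝ (fun w : ℂ => w.re ^ 2) = fun w => (2 * w.re) • Complex.reCLM := by
    funext w
    have h : HasFDerivAt (fun w : ℂ => w.re ^ 2) _ w := (Complex.reCLM.hasFDerivAt (x := w)).pow 2
    rw [h.fderiv]; ext; simp
  have h2 : HasFDerivAt (fun w : ℂ => (2 * w.re) • Complex.reCLM)
      (((2 : ℝ) • Complex.reCLM).smulRight Complex.reCLM) z :=
    ((Complex.reCLM.hasFDerivAt (x := z)).const_mul 2).smul_const Complex.reCLM
  rw [InnerProductSpace.laplacian_eq_iteratedFDeriv_complexPlane]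
  simp only [iteratedFDeriv_two_apply, h1, h2.fderiv]
  simp

/-- The weak maximum principle. -/
theorem le_of_laplacian_nonneg {K U : Set ℂ} (hK : IsCompact K) (hU : IsOpen U) (hUK : U ⊆ K)
    (hc : ContinuousOn g K) (hg : ∀ z ∈ U, ContDiffAt ℝ 2 g z)
    (hΔ : ∀ z ∈ U, 0 ≤ Laplacian.laplacian g z) {m : ℝ} (hm : ∀ z ∈ K \ U, g z ≤ m) :
    ∀ z ∈ K, g z ≤ m := by
  intro z₀ hz₀
  by_contra! hlt
  obtain ⟨B, hB⟩ := (hK.image (f := fun w : ℂ => w.re ^ 2) (by fun_prop)).bddAbove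
  have hB' : ∀ w ∈ K, w.re ^ 2 ≤ B := fun w hw => hB ⟨w, hw, rfl⟩
  have hB0 : 0 ≤ B := (sq_nonneg _).trans (hB' z₀ hz₀)
  -- δ is small enough that adding δ(Re w)² cannot move the maximum to the boundary part; at the
  -- interior maximum the Laplacian would be at least 2δ > 0.
  set δ : ℝ := (g z₀ - m) / (2 * (B + 1)) with hδ
  have hδ0 : 0 < δ := div_pos (sub_pos.2 hlt) (by positivity)
  have hδB : δ * B < g z₀ - m := by
    have : δ * (2 * (B + 1)) = g z₀ - m := div_mul_cancel₀ _ (by positivity)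
    nlinarith
  have hcr : ContDiff ℝ 2 (fun w : ℂ => w.re ^ 2) := Complex.reCLM.contDiff.pow 2
  obtain ⟨z₁, hz₁, hmax⟩ := hK.exists_isMaxOn ⟨z₀, hz₀⟩
    (hc.add ((hcr.const_smul δ).continuous.continuousOn))
  have h1 := hmax hz₀
  simp only [Set.mem_ofPred_eq, Pi.add_apply, smul_eq_mul] at h1
  have h2 : z₁ ∈ U := by
    by_contra hn
    have h3 := hm z₁ ⟨hz₁, hn⟩
    have h4 := hB' z₁ hz₁
    have h5 : 0 ≤ δ * z₀.re ^ 2 := by positivity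
    have h6 : δ * z₁.re ^ 2 ≤ δ * B := by gcongr
    linarith
  have hloc := hmax.isLocalMax (mem_of_superset (hU.mem_nhds h2) hUK)
  have hcd : ContDiffAt ℝ 2 (δ • fun w : ℂ => w.re ^ 2) z₁ := (hcr.const_smul δ).contDiffAt
  have h3 := laplacian_nonpos_of_isLocalMax ((hg z₁ h2).add hcd) hloc
  have h4 := (hg z₁ h2).laplacian_add hcd
  have h5 := InnerProductSpace.laplacian_smul δ (hcr.contDiffAt (x := z₁))
  rw [h5, laplacian_re_sq] at h4
  have h6 := hΔ z₁ h2
  have h7 : Laplacian.laplacian (g + δ • fun w : ℂ => w.re ^ 2) z₁ ≤ 0 := h3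
  rw [h4] at h7
  simp only [smul_eq_mul] at h7
  linarith

/-- Liouville's theorem for subharmonic functions that are bounded above. -/
theorem eq_of_laplacian_nonneg (hg : ContDiff ℝ 2 g) (hΔ : ∀ z, 0 ≤ Laplacian.laplacian g z)
    {C : ℝ} (hC : ∀ z, g z ≤ C) (z c : ℂ) : g z = g c := by
  suffices H : ∀ z c : ℂ, g z ≤ g c from le_antisymm (H z c) (H c z)
  intro z c
  rcases eq_or_ne z c with rfl | hzc
  · exact le_rfl
  refine le_of_forall_pos_le_add fun η hη => ?_
  obtain ⟨r₀, hr₀, hball⟩ := Metric.eventually_nhds_iff_ball.1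
    (hg.continuous.continuousAt.eventually (gt_mem_nhds (show g c < g c + η by linarith)))
  have hd : 0 < ‖z - c‖ := norm_pos_iff.2 (sub_ne_zero.2 hzc)
  set r := min (r₀ / 2) (‖z - c‖ / 2) with hr
  have hr0 : 0 < r := lt_min (by positivity) (by positivity)
  have hrz : r < ‖z - c‖ := (min_le_right _ _).trans_lt (by linarith)
  have hrr : r < r₀ := (min_le_left _ _).trans_lt (by linarith)
  -- Comparison on an annulus around c with a multiple of the logarithm, which is harmonic off c and
  -- unbounded at infinity; afterwards ε tends to 0.
  have key : ∀ ε > 0, g z ≤ g c + η + ε * (Real.log ‖z - c‖ - Real.log r) := by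
    intro ε hε
    -- Chosen so that log R ≥ A makes g(c) + η + ε(log R − log r) at least the bound C on the outer
    -- circle.
    set A : ℝ := (C - g c - η) / ε + Real.log r with hA
    set R := max (‖z - c‖ + 1) (Real.exp A) with hR
    have hRz : ‖z - c‖ < R := lt_of_lt_of_le (by linarith) (le_max_left _ _)
    have hRA : A ≤ Real.log R := by
      rw [← Real.log_exp A]
      exact Real.log_le_log (Real.exp_pos A) (le_max_right _ _)
    have hne : ∀ w : ℂ, r ≤ ‖w - c‖ → w - c ≠ 0 := fun w hw h => by
      rw [h, norm_zero] at hw; linarith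
    have hharm : ∀ w : ℂ, r ≤ ‖w - c‖ → InnerProductSpace.HarmonicAt (fun w => Real.log ‖w - c‖) w :=
      fun w hw => AnalyticAt.harmonicAt_log_norm (f := fun w => w - c) (by fun_prop) (hne w hw)
    set h : ℂ → ℝ := g + (-ε) • fun w => Real.log ‖w - c‖ with hh
    have hhd : ∀ w : ℂ, r ≤ ‖w - c‖ → ContDiffAt ℝ 2 h w := fun w hw =>
      hg.contDiffAt.add ((hharm w hw).1.const_smul (-ε))
    have hmp := le_of_laplacian_nonneg (g := h) (K := {w | r ≤ ‖w - c‖ ∧ ‖w - c‖ ≤ R})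
      (U := {w | r < ‖w - c‖ ∧ ‖w - c‖ < R}) (m := g c + η - ε * Real.log r) ?_ ?_ ?_ ?_ ?_ ?_ ?_ z
      ⟨hrz.le, hRz.le⟩
    · simp only [hh, Pi.add_apply, Pi.smul_apply, smul_eq_mul] at hmp
      linarith
    · refine (isCompact_closedBall c R).of_isClosed_subset
        ((isClosed_Icc (a := r) (b := R)).preimage (f := fun w : ℂ => ‖w - c‖) (by fun_prop))
        fun w hw => ?_
      rw [mem_closedBall_iff_norm]; exact hw.2
    · exact (isOpen_Ioo (a := r) (b := R)).preimage (f := fun w : ℂ => ‖w - c‖) (by fun_prop)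
    · exact fun w hw => ⟨hw.1.le, hw.2.le⟩
    · exact fun w hw => (hhd w hw.1).continuousAt.continuousWithinAt
    · exact fun w hw => hhd w hw.1.le
    · intro w hw
      have e1 := (hharm w hw.1.le).1
      have e3 : ContDiffAt ℝ 2 ((-ε) • fun w => Real.log ‖w - c‖) w := e1.const_smul (-ε)
      have e2 := hg.contDiffAt.laplacian_add (x := w) e3
      rw [InnerProductSpace.laplacian_smul _ e1, (hharm w hw.1.le).2.self_of_nhds] at e2
      rw [hh, e2]
      simpa using hΔ w
    · rintro w ⟨hw1, hw2⟩
      simp only [hh, Pi.add_apply, Pi.smul_apply, smul_eq_mul]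
      by_cases hw3 : ‖w - c‖ < R
      · have hwr : ‖w - c‖ = r := by
          by_contra hne
          exact hw2 ⟨lt_of_le_of_ne hw1.1 (Ne.symm hne), hw3⟩
        have := hball w (by rw [mem_ball_iff_norm, hwr]; exact hrr)
        rw [hwr]; linarith
      · have hwR : ‖w - c‖ = R := le_antisymm hw1.2 (not_lt.1 hw3)
        have e1 := hC w
        have e2 : ε * A = C - g c - η + ε * Real.log r := by
          rw [hA]; field_simp
        have e3 : ε * A ≤ ε * Real.log R := by gcongr
        rw [hwR]; linarith
  refine le_of_forall_pos_le_add fun ε hε => ?_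
  set ℓ := Real.log ‖z - c‖ - Real.log r with hℓ
  have hℓ0 : 0 < ℓ := sub_pos.2 (Real.log_lt_log hr0 hrz)
  have := key (ε / ℓ) (by positivity)
  rwa [div_mul_cancel₀ _ hℓ0.ne'] at this

end Subharmonic

/-- An entire conformal Willmore surface without umbilic points and with nonpositive Möbius
curvature, in a coordinate in which Bryant's quartic differential is `dz⁴`. -/
structure EntireNatural (f : ℂ → E4) : Prop where
  conf : ∀ z, ConfAt f z
  willmore : ∀ z, WillmoreAt f z
  bryant : ∀ z, bryantCoeff f z = 1
  hopf_ne_zero : ∀ z, hopfCoeff f z ≠ 0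
  hopf_le_one : ∀ z, ‖hopfCoeff f z‖ ≤ 1
  nonpos : ∀ z, mobiusCurvatureAt f z ≤ 0

/-! ### Rigidity: the curvature vanishes and `k` is constant. -/

namespace EntireNatural

variable {f : ℂ → E4}

/-- 𝒦 ≤ 0 makes ω subharmonic, |k| ≤ 1 bounds it by (log 4)/2, and Liouville's theorem applies. -/
theorem log_mobiusFactor (h : EntireNatural f) : ∃ C : ℝ, ∀ z, Real.log (mobiusFactor f z) / 2 = C := by
  have hpos : ∀ z, 0 < mobiusFactor f z := fun z => by
    rw [(h.conf z).mobiusFactor_eq]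
    have := norm_pos_iff.2 (h.hopf_ne_zero z)
    positivity
  have hle : ∀ z, mobiusFactor f z ≤ 4 := fun z => by
    rw [(h.conf z).mobiusFactor_eq]
    have := pow_le_one₀ (norm_nonneg _) (h.hopf_le_one z) (n := 2)
    linarith
  have hsm : ContDiff ℝ 2 (fun z => Real.log (mobiusFactor f z) / 2) := by
    rw [contDiff_iff_contDiffAt]
    intro z
    have h1 : ContDiffAt ℝ 2 (fun z => 4 * ‖hopfCoeff f z‖ ^ 2) z :=
      contDiffAt_const.mul (((h.conf z).smooth_hopfCoeff.of_le two_le_infty).norm_sq ℝ)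
    have h2 : (fun z => 4 * ‖hopfCoeff f z‖ ^ 2) = mobiusFactor f :=
      funext fun z => ((h.conf z).mobiusFactor_eq).symm
    rw [h2] at h1
    exact (h1.log (hpos z).ne').div_const 2
  refine ⟨Real.log (mobiusFactor f 0) / 2, fun z => eq_of_laplacian_nonneg hsm (fun z => ?_)
    (C := Real.log 4 / 2) (fun z => ?_) z 0⟩
  · have h1 := h.nonpos z
    rw [mobiusCurvatureAt, neg_mul, neg_nonpos] at h1
    exact nonneg_of_mul_nonneg_right h1 (inv_pos.2 (hpos z))
  · have := Real.log_le_log (hpos z) (hle z)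
    linarith

theorem curvature_eq_zero (h : EntireNatural f) (z : ℂ) : mobiusCurvatureAt f z = 0 := by
  obtain ⟨C, hC⟩ := h.log_mobiusFactor
  rw [mobiusCurvatureAt, show (fun w => Real.log (mobiusFactor f w) / 2) = fun _ => C from funext hC,
    InnerProductSpace.laplacian_const]
  simp

theorem norm_hopfCoeff (h : EntireNatural f) (z : ℂ) : ‖hopfCoeff f z‖ = ‖hopfCoeff f 0‖ := by
  obtain ⟨C, hC⟩ := h.log_mobiusFactor
  have hp : ∀ z, 0 < ‖hopfCoeff f z‖ := fun z => norm_pos_iff.2 (h.hopf_ne_zero z)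
  have h1 := (hC z).trans (hC 0).symm
  rw [(h.conf z).mobiusFactor_eq, (h.conf 0).mobiusFactor_eq] at h1
  have := hp z
  have := hp 0
  have h2 : 4 * ‖hopfCoeff f z‖ ^ 2 = 4 * ‖hopfCoeff f 0‖ ^ 2 :=
    Real.log_injOn_pos (Set.mem_Ioi.2 (by positivity)) (Set.mem_Ioi.2 (by positivity)) (by linarith)
  exact (pow_left_inj₀ (norm_nonneg _) (norm_nonneg _) two_ne_zero).1 (by linarith)

/-- With 𝒦 = 0, Q = 1 and |k| = ρ constant, k² + k̄² = 2ρ⁶ and kk̄ = ρ². Eliminating k̄ leaves k⁴ −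
2ρ⁶k² + ρ⁴ = 0, and a continuous function on the plane with finitely many values is constant. -/
theorem hopfCoeff_const (h : EntireNatural f) (z : ℂ) : hopfCoeff f z = hopfCoeff f 0 := by
  set ρ := ‖hopfCoeff f 0‖ with hρ
  set p : Polynomial ℂ := Polynomial.X ^ 4 - Polynomial.C (2 * (ρ : ℂ) ^ 6) * Polynomial.X ^ 2 +
    Polynomial.C ((ρ : ℂ) ^ 4) with hp
  have hp0 : p ≠ 0 := by
    intro h0
    have h1 := congrArg (fun q => Polynomial.coeff q 4) h0
    rw [hp, Polynomial.coeff_add, Polynomial.coeff_sub, Polynomial.coeff_C_mul,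
      Polynomial.coeff_X_pow, Polynomial.coeff_X_pow, Polynomial.coeff_C] at h1
    norm_num at h1
  have hroot : ∀ z, hopfCoeff f z ∈ (p.roots.toFinset : Set ℂ) := by
    intro z
    rw [Finset.mem_coe, Multiset.mem_toFinset, Polynomial.mem_roots hp0, Polynomial.IsRoot.def]
    have h1 := (h.conf z).bryant_curvature (h.hopf_ne_zero z)
    rw [h.bryant, h.curvature_eq_zero, one_mul, sub_zero, one_mul, h.norm_hopfCoeff, ← hρ] at h1
    have h2 : hopfCoeff f z * star (hopfCoeff f z) = (ρ : ℂ) ^ 2 := by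
      rw [Complex.star_def, Complex.mul_conj, Complex.normSq_eq_norm_sq, h.norm_hopfCoeff, ← hρ]
      push_cast; ring
    have h3 : star (hopfCoeff f z) ^ 2 + hopfCoeff f z ^ 2 = 2 * (ρ : ℂ) ^ 6 := by
      have := Complex.add_conj (star (hopfCoeff f z) ^ 2)
      rw [h1] at this
      rw [← Complex.star_def, star_pow, star_star] at this
      rw [this]; push_cast; ring
    simp only [hp, Polynomial.eval_add, Polynomial.eval_sub, Polynomial.eval_mul,
      Polynomial.eval_pow, Polynomial.eval_X, Polynomial.eval_C]
    linear_combination (hopfCoeff f z) ^ 2 * h3 -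
      (hopfCoeff f z * star (hopfCoeff f z) + (ρ : ℂ) ^ 2) * h2
  have hcont : Continuous (hopfCoeff f) :=
    continuous_iff_continuousAt.2 fun z => (h.conf z).smooth_hopfCoeff.continuousAt
  have htd := (p.roots.toFinset.finite_toSet).countable.isTotallyDisconnected
  exact htd (Set.range (hopfCoeff f)) (Set.range_subset_iff.2 hroot)
    (isPreconnected_range hcont) ⟨z, rfl⟩ ⟨0, rfl⟩

/-- For constant k the derivative terms of Q drop out and Q = 1 reads k³k̄ = 1. Hence |k| = 1, then
k² = 1. -/
theorem hopfCoeff_sq (h : EntireNatural f) :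
    hopfCoeff f 0 ^ 2 = 1 ∧ star (hopfCoeff f 0) = hopfCoeff f 0 := by
  have h1 := (h.conf 0).germ_bryantCoeff
  have h2 : hopfCoeff f = fun _ => hopfCoeff f 0 := funext h.hopfCoeff_const
  have h3 : bryantCoeff f = fun _ => 1 := funext h.bryant
  have h4 : germ 0 (hopfCoeff f) = algebraMap ℂ _ (hopfCoeff f 0) := by rw [h2, germ_const]
  have h5 : germ 0 (fun w => star (hopfCoeff f w)) = algebraMap ℂ _ (star (hopfCoeff f 0)) := by
    rw [← germ_const]; congr 1; funext w; rw [h.hopfCoeff_const]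
  rw [h3, h4, h5] at h1
  simp only [Derivation.map_algebraMap, map_zero, mul_zero, sub_zero, zero_add] at h1
  rw [← map_pow, ← map_mul, ← germ_const] at h1
  have h6 : (1 : ℂ) = hopfCoeff f 0 ^ 3 * star (hopfCoeff f 0) :=
    germ_eq_apply (z := 0) (g := fun _ => hopfCoeff f 0 ^ 3 * star (hopfCoeff f 0))
      contDiffAt_const contDiffAt_const h1
  have h7 : ‖hopfCoeff f 0‖ = 1 := by
    have := congrArg norm h6
    rw [norm_one, norm_mul, norm_pow, norm_star, ← pow_succ] at this
    exact (pow_eq_one_iff_of_nonneg (norm_nonneg _) (by norm_num)).1 this.symm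
  have h8 : hopfCoeff f 0 * star (hopfCoeff f 0) = 1 := by
    rw [Complex.star_def, Complex.mul_conj, Complex.normSq_eq_norm_sq, h7]; simp
  have h9 : hopfCoeff f 0 ^ 2 = 1 := by
    linear_combination -h6 - hopfCoeff f 0 ^ 2 * h8
  refine ⟨h9, ?_⟩
  linear_combination hopfCoeff f 0 * h8 - star (hopfCoeff f 0) * h9

end EntireNatural

/-! ### The structure equations of the model surface -/

theorem eq_of_vgerm_eq {z : ℂ} {F G : ℂ → Fin 5 → ℂ} (hF : ContDiffAt ℝ ∞ F z)
    (hG : ContDiffAt ℝ ∞ G z) (h : vgerm z F = vgerm z G) : F z = G z :=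
  funext fun i => germ_eq_apply (smooth_apply hF i) (smooth_apply hG i) (congrFun h i)

theorem mink_eq_of_germ {z c : ℂ} {F G : ℂ → Fin 5 → ℂ} (hF : ContDiffAt ℝ ∞ F z)
    (hG : ContDiffAt ℝ ∞ G z) (h : mink (vgerm z F) (vgerm z G) = algebraMap ℂ _ c) :
    mink (F z) (G z) = c := by
  rw [← germ_mink hF hG, ← germ_const] at h
  exact germ_eq_apply (smooth_mink hF hG) contDiffAt_const h

theorem dz_dzbar_comm {z : ℂ} {F : ℂ → Fin 5 → ℂ} (hF : ContDiffAt ℝ ∞ F z) :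
    dz (dzbar F) z = dzbar (dz F) z := by
  refine eq_of_vgerm_eq (smooth_dz (smooth_dzbar hF)) (smooth_dzbar (smooth_dz hF)) ?_
  rw [← vd_del_vgerm (smooth_dzbar hF), ← vd_delbar_vgerm hF, ← vd_delbar_vgerm (smooth_dz hF),
    ← vd_del_vgerm hF]
  exact funext fun i => del_delbar_comm _

theorem vgerm_const_smul {z c : ℂ} {F : ℂ → Fin 5 → ℂ} (hF : ContDiffAt ℝ ∞ F z) :
    vgerm z (fun w => c • F w) = algebraMap ℂ (SmoothGerm z) c • vgerm z F := by
  rw [vgerm_smul contDiffAt_const hF, germ_const]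

/-- The first-order system satisfied by the lift `Y`, `Y_z`, `Y_z̄`, `S = Y_zz` and `ν = Y_zz̄` of the
Clifford torus, together with its Gram relations. -/
structure CliffordSystem (Y : ℂ → Fin 5 → ℂ) : Prop where
  smooth : ∀ z, ContDiffAt ℝ ∞ Y z
  real : ∀ z, star (Y z) = Y z
  dd : ∀ z, dzbar (dzbar Y) z = dz (dz Y) z
  ddd : ∀ z, dz (dz (dz Y)) z = -(2 : ℂ) • dzbar Y z
  bdd : ∀ z, dzbar (dz (dz Y)) z = -(2 : ℂ) • dz Y z
  YY : ∀ z, mink (Y z) (Y z) = 0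
  Yd : ∀ z, mink (Y z) (dz Y z) = 0
  Yb : ∀ z, mink (Y z) (dzbar Y z) = 0
  YS : ∀ z, mink (Y z) (dz (dz Y) z) = 0
  Yn : ∀ z, mink (Y z) (dzbar (dz Y) z) = -1 / 2
  ddYdY : ∀ z, mink (dz Y z) (dz Y z) = 0
  bYbY : ∀ z, mink (dzbar Y z) (dzbar Y z) = 0
  dYbY : ∀ z, mink (dz Y z) (dzbar Y z) = 1 / 2
  SS : ∀ z, mink (dz (dz Y) z) (dz (dz Y) z) = 1
  Sd : ∀ z, mink (dz (dz Y) z) (dz Y z) = 0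
  Sb : ∀ z, mink (dz (dz Y) z) (dzbar Y z) = 0
  Sn : ∀ z, mink (dz (dz Y) z) (dzbar (dz Y) z) = 0
  nd : ∀ z, mink (dzbar (dz Y) z) (dz Y z) = 0
  nb : ∀ z, mink (dzbar (dz Y) z) (dzbar Y z) = 0
  nn : ∀ z, mink (dzbar (dz Y) z) (dzbar (dz Y) z) = 1

namespace EntireNatural

variable {f : ℂ → E4}

/-- For constant k = c = ±1 the Willmore equation forces the Schwarzian to vanish. Then Y_zz =
Y_z̄z̄ = cξ and ξ_z = −2cY_z̄, and c disappears because c² = 1. -/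
theorem cliffordSystem (h : EntireNatural f) : CliffordSystem (canonicalLift f) := by
  obtain ⟨hc2, hcs⟩ := h.hopfCoeff_sq
  set c := hopfCoeff f 0 with hc
  have hk : ∀ z, germ z (hopfCoeff f) = algebraMap ℂ _ c := fun z => by
    rw [show hopfCoeff f = fun _ => c from funext h.hopfCoeff_const, germ_const]
  have hkb : ∀ z, germ z (fun w => star (hopfCoeff f w)) = algebraMap ℂ _ c := fun z => by
    rw [show (fun w => star (hopfCoeff f w)) = fun _ => c from
      funext fun w => by rw [h.hopfCoeff_const, hcs], germ_const]
  have sY : ∀ z, ContDiffAt ℝ ∞ (canonicalLift f) z := fun z => (h.conf z).smooth_canonicalLift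
  have sξ : ∀ z, ContDiffAt ℝ ∞ (gaussMap f) z := fun z => (h.conf z).smooth_gaussMap
  have hcc : ∀ z, algebraMap ℂ (SmoothGerm z) c * algebraMap ℂ (SmoothGerm z) c = 1 := fun z => by
    rw [← map_mul, ← sq, hc2, map_one]
  have hP : ∀ z, frameP (delbar z) (del z) (vgerm z (canonicalLift f)) = 0 := fun z => by
    have h1 := (h.conf z).frame_willmore (Eventually.of_forall h.willmore)
    rw [hk] at h1
    simp only [Derivation.map_algebraMap, map_zero, zero_add] at h1
    have h2 := congrArg (· * algebraMap ℂ (SmoothGerm z) c) h1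
    simpa only [mul_assoc, hcc, mul_one, zero_mul] using h2
  have hbb : ∀ z, dzbar (dzbar (canonicalLift f)) z = c • gaussMap f z := fun z => by
    refine eq_of_vgerm_eq (G := fun w => c • gaussMap f w) (smooth_dzbar (smooth_dzbar (sY z)))
      ((sξ z).const_smul c) ?_
    rw [← vd_delbar_vgerm (smooth_dzbar (sY z)), ← vd_delbar_vgerm (sY z), vgerm_const_smul (sξ z),
      (h.conf z).conformalFrame.bbY, hP, ← (h.conf z).germ_star_hopfCoeff, hkb, neg_zero, zero_smul,
      zero_add]
  have hdd : ∀ z, dz (dz (canonicalLift f)) z = c • gaussMap f z := fun z => by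
    have h1 := dzbar_dzbar_eq_star (star_canonicalLift f) z
    rw [hbb] at h1
    have h2 := congrArg star h1
    rw [star_star, star_smul, star_gaussMap, hcs] at h2
    exact h2.symm
  have hdd' : dz (dz (canonicalLift f)) = fun w => c • gaussMap f w := funext hdd
  have hK : ∀ z, frameK (del z) (vgerm z (canonicalLift f)) (vgerm z (gaussMap f)) =
      algebraMap ℂ _ c := fun z => by rw [← (h.conf z).germ_hopfCoeff, hk]
  have hK' : ∀ z, frameK (delbar z) (vgerm z (canonicalLift f)) (vgerm z (gaussMap f)) =
      algebraMap ℂ _ c := fun z => by rw [← (h.conf z).germ_star_hopfCoeff, hkb]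
  have hvd : ∀ z (D : Derivation ℂ (SmoothGerm z) (SmoothGerm z)) (v : Fin 5 → SmoothGerm z),
      vd D (algebraMap ℂ (SmoothGerm z) c • v) = algebraMap ℂ (SmoothGerm z) c • vd D v := by
    intro z D v
    rw [vd_smul, Derivation.map_algebraMap, zero_smul, zero_add]
  have hm2 : ∀ z (v : Fin 5 → SmoothGerm z), algebraMap ℂ (SmoothGerm z) c •
      ((2 * algebraMap ℂ (SmoothGerm z) 0) • (0 : Fin 5 → SmoothGerm z) -
        (2 * algebraMap ℂ (SmoothGerm z) c) • v) = algebraMap ℂ (SmoothGerm z) (-2) • v := by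
    intro z v
    rw [smul_zero, zero_sub, smul_neg, smul_smul, mul_left_comm, hcc, mul_one, map_neg, map_ofNat,
      neg_smul]
  have hY := fun z => h.conf z
  have key : ∀ (z : ℂ) {F G : ℂ → Fin 5 → ℂ} (r : ℂ), ContDiffAt ℝ ∞ F z → ContDiffAt ℝ ∞ G z →
      mink (vgerm z F) (vgerm z G) = algebraMap ℂ _ r → mink (F z) (G z) = r :=
    fun z F G r hF hG hh => mink_eq_of_germ hF hG hh
  have e0 : ∀ z, vgerm z (dz (canonicalLift f)) = vd (del z) (vgerm z (canonicalLift f)) :=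
    fun z => (vd_del_vgerm (sY z)).symm
  have e1 : ∀ z, vgerm z (dzbar (canonicalLift f)) = vd (delbar z) (vgerm z (canonicalLift f)) :=
    fun z => (vd_delbar_vgerm (sY z)).symm
  have e2 : ∀ z, vgerm z (dzbar (dz (canonicalLift f))) =
      vd (delbar z) (vd (del z) (vgerm z (canonicalLift f))) :=
    fun z => by rw [← e0, vd_delbar_vgerm (smooth_dz (sY z))]
  have d1 := fun z => smooth_dz (sY z)
  have d2 := fun z => smooth_dzbar (sY z)
  have d3 := fun z => smooth_dzbar (smooth_dz (sY z))
  have half : ∀ z {a : SmoothGerm z} {r : ℂ}, 2 * a = algebraMap ℂ _ (2 * r) →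
      a = algebraMap ℂ _ r := by
    intro z a r ha
    rw [map_mul, map_ofNat] at ha
    exact isUnit_two_of_algebra.mul_left_cancel ha
  refine ⟨sY, star_canonicalLift f, fun z => (hbb z).trans (hdd z).symm, fun z => ?_, fun z => ?_,
    fun z => key z 0 (sY z) (sY z) ?_, fun z => key z 0 (sY z) (d1 z) ?_,
    fun z => key z 0 (sY z) (d2 z) ?_, fun z => ?_, fun z => key z _ (sY z) (d3 z) (half z ?_),
    fun z => key z 0 (d1 z) (d1 z) ?_, fun z => key z 0 (d2 z) (d2 z) ?_,
    fun z => key z _ (d1 z) (d2 z) (half z ?_), fun z => ?_, fun z => ?_, fun z => ?_, fun z => ?_,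
    fun z => key z 0 (d3 z) (d1 z) ?_, fun z => key z 0 (d3 z) (d2 z) ?_,
    fun z => key z 1 (d3 z) (d3 z) ?_⟩
  · rw [hdd']
    refine eq_of_vgerm_eq (G := fun w => (-2 : ℂ) • dzbar (canonicalLift f) w)
      (smooth_dz ((sξ z).const_smul c)) ((d2 z).const_smul (-2 : ℂ)) ?_
    rw [← vd_del_vgerm ((sξ z).const_smul c), vgerm_const_smul (sξ z), hvd, vgerm_const_smul (d2 z),
      e1, (hY z).conformalFrame.dξ, hK, Derivation.map_algebraMap, ← hm2, map_zero, mul_zero,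
      zero_smul, zero_smul]
  · rw [hdd']
    refine eq_of_vgerm_eq (G := fun w => (-2 : ℂ) • dz (canonicalLift f) w)
      (smooth_dzbar ((sξ z).const_smul c)) ((d1 z).const_smul (-2 : ℂ)) ?_
    rw [← vd_delbar_vgerm ((sξ z).const_smul c), vgerm_const_smul (sξ z), hvd,
      vgerm_const_smul (d1 z), e0, (hY z).conformalFrame.symm.dξ, hK', Derivation.map_algebraMap,
      ← hm2, map_zero, mul_zero, zero_smul, zero_smul]
  · rw [(hY z).conformalFrame.YY, map_zero]
  · rw [e0, (hY z).conformalFrame.YdY, map_zero]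
  · rw [e1, (hY z).conformalFrame.YbY, map_zero]
  · rw [hdd, mink_smul_right, key z 0 (sY z) (sξ z)
      (by rw [mink_comm, (hY z).conformalFrame.ξY, map_zero]), mul_zero]
  · rw [e2, (hY z).conformalFrame.YbdY]; norm_num
  · rw [e0, (hY z).conformalFrame.dYdY, map_zero]
  · rw [e1, (hY z).conformalFrame.bYbY, map_zero]
  · rw [e0, e1, (hY z).conformalFrame.dYbY]; norm_num
  · rw [hdd, mink_smul_right, mink_smul_left, (hY z).gaussMap_sq]
    linear_combination hc2
  · rw [hdd, mink_smul_left, key z 0 (sξ z) (d1 z)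
      (by rw [e0, (hY z).conformalFrame.ξdY, map_zero]), mul_zero]
  · rw [hdd, mink_smul_left, key z 0 (sξ z) (d2 z)
      (by rw [e1, (hY z).conformalFrame.ξbY, map_zero]), mul_zero]
  · rw [hdd, mink_smul_left, key z 0 (sξ z) (d3 z)
      (by rw [e2, ← (hY z).conformalFrame.vcomm, (hY z).conformalFrame.ξdbY, map_zero]), mul_zero]
  · rw [e0, e2, mink_comm, (hY z).conformalFrame.dYbdY, map_zero]
  · rw [e1, e2, mink_comm, (hY z).conformalFrame.bYbdY, map_zero]
  · rw [e2, (hY z).conformalFrame.bdY_sq, hK, hK', hcc, map_one]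

end EntireNatural

/-! ### Explicit integration of the structure equations. -/

theorem hasFDerivAt_of_dz {V : Type*} [NormedAddCommGroup V] [NormedSpace ℂ V] {F : ℂ → V} {z : ℂ}
    (hF : DifferentiableAt ℝ F z) :
    HasFDerivAt F (Complex.reCLM.smulRight (dz F z + dzbar F z) +
      Complex.imCLM.smulRight (Complex.I • (dz F z - dzbar F z))) z := by
  have h1 : fderiv ℝ F z 1 = dz F z + dzbar F z := by
    simp only [dz, dzbar]; module
  have h2 : fderiv ℝ F z Complex.I = Complex.I • (dz F z - dzbar F z) := by
    simp only [dz, dzbar, smul_sub, smul_add, smul_smul]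
    have : Complex.I * (1 / 2 * Complex.I) = -(1 / 2) := by
      linear_combination (1 / 2) * Complex.I_mul_I
    rw [this]; module
  convert hF.hasFDerivAt using 1
  ext v
  have hv : v = v.re • (1 : ℂ) + v.im • Complex.I := by
    simp [Complex.re_add_im]
  conv_rhs => rw [hv, map_add, map_smul, map_smul, h1, h2]
  rfl

/-- Solutions of the harmonic oscillator equation in one direction. -/
theorem oscillator {V : Type*} [NormedAddCommGroup V] [NormedSpace ℝ V] (L : ℂ →L[ℝ] ℝ)
    {p w : ℂ → V} (hp : ∀ z, HasFDerivAt p (L.smulRight ((2 : ℝ) • w z)) z)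
    (hw : ∀ z, HasFDerivAt w (L.smulRight ((-4 : ℝ) • p z)) z) (z : ℂ) :
    w z = Real.cos (2 * √2 * L z) • w 0 - (√2 * Real.sin (2 * √2 * L z)) • p 0 := by
  have hs : √2 * √2 = 2 := Real.mul_self_sqrt (by norm_num)
  have hcos : ∀ z, HasFDerivAt (fun z => Real.cos (2 * √2 * L z))
      (-Real.sin (2 * √2 * L z) • (2 * √2) • L) z := fun z =>
    (L.hasFDerivAt.const_mul (2 * √2)).cos
  have hsin : ∀ z, HasFDerivAt (fun z => Real.sin (2 * √2 * L z))
      (Real.cos (2 * √2 * L z) • (2 * √2) • L) z := fun z =>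
    (L.hasFDerivAt.const_mul (2 * √2)).sin
  -- The pair (w, √2 p) rotates with angular speed 2√2; undoing the rotation yields two constants,
  -- from which w is recovered.
  have h1 : ∀ z, HasFDerivAt (fun z => Real.cos (2 * √2 * L z) • w z +
      √2 • Real.sin (2 * √2 * L z) • p z) (0 : ℂ →L[ℝ] V) z := by
    intro z
    refine (((hcos z).smul (hw z)).add (((hsin z).smul (hp z)).const_smul √2)).congr_fderiv ?_
    ext v
    simp only [add_apply, smul_apply,
      ContinuousLinearMap.smulRight_apply, zero_apply, smul_smul, smul_add,
      smul_eq_mul]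
    match_scalars
    · linear_combination (2 * Real.cos (2 * √2 * L z) * L v) * hs
    · ring
  have h2 : ∀ z, HasFDerivAt (fun z => Real.sin (2 * √2 * L z) • w z -
      √2 • Real.cos (2 * √2 * L z) • p z) (0 : ℂ →L[ℝ] V) z := by
    intro z
    refine (((hsin z).smul (hw z)).sub (((hcos z).smul (hp z)).const_smul √2)).congr_fderiv ?_
    ext v
    simp only [add_apply, sub_apply,
      smul_apply,
      ContinuousLinearMap.smulRight_apply, zero_apply, smul_smul, smul_add,
      smul_eq_mul]
    match_scalars
    · linear_combination (2 * Real.sin (2 * √2 * L z) * L v) * hs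
    · ring
  have e1 := is_const_of_fderiv_eq_zero (𝕜 := ℝ) (fun z => (h1 z).differentiableAt)
    (fun z => (h1 z).fderiv) z 0
  have e2 := is_const_of_fderiv_eq_zero (𝕜 := ℝ) (fun z => (h2 z).differentiableAt)
    (fun z => (h2 z).fderiv) z 0
  simp only [map_zero, mul_zero, Real.cos_zero, Real.sin_zero, one_smul, zero_smul, smul_zero,
    add_zero, zero_sub] at e1 e2
  have h3 := Real.sin_sq_add_cos_sq (2 * √2 * L z)
  have e3 : w z = Real.cos (2 * √2 * L z) • (Real.cos (2 * √2 * L z) • w z +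
      √2 • Real.sin (2 * √2 * L z) • p z) + Real.sin (2 * √2 * L z) •
      (Real.sin (2 * √2 * L z) • w z - √2 • Real.cos (2 * √2 * L z) • p z) := by
    match_scalars
    · linear_combination -h3
    · ring
  rw [e3, e1, e2]
  module

/-- The moving frame of the Clifford torus. -/
def cliffordFrame (Y : ℂ → Fin 5 → ℂ) (z : ℂ) : Fin 5 → Fin 5 → ℂ :=
  ![(2 : ℂ) • Y z + dzbar (dz Y) z,
    (-(√2 / 2 : ℝ) : ℂ) • (dz (dz Y) z + dzbar (dz Y) z),
    dz Y z + dzbar Y z,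
    (-(√2 / 2 : ℝ) : ℂ) • (dzbar (dz Y) z - dz (dz Y) z),
    Complex.I • (dz Y z - dzbar Y z)]

theorem mink_ofReal (v w : Fin 5 → ℝ) :
    mink (fun i => (v i : ℂ)) (fun i => (w i : ℂ)) = ((mink v w : ℝ) : ℂ) := by
  simp [mink]

namespace CliffordSystem

variable {Y : ℂ → Fin 5 → ℂ}

/-- The combinations in `cliffordFrame` diagonalize the Gram relations of the system, with the
timelike vector first. With `real_frame` this gives a real Lorentz frame. -/
theorem gram (h : CliffordSystem Y) (z : ℂ) (i j : Fin 5) :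
    mink (cliffordFrame Y z i) (cliffordFrame Y z j) =
      if i = j then if i = 0 then -1 else 1 else 0 := by
  have hs : ((√2 : ℝ) : ℂ) * ((√2 : ℝ) : ℂ) = 2 := by
    rw [← Complex.ofReal_mul, Real.mul_self_sqrt (by norm_num)]; norm_num
  have hI := Complex.I_mul_I
  have a1 := h.Yd z; rw [mink_comm] at a1
  have a2 := h.Yb z; rw [mink_comm] at a2
  have a3 := h.YS z; rw [mink_comm] at a3
  have a4 := h.Yn z; rw [mink_comm] at a4
  have a5 := h.dYbY z; rw [mink_comm] at a5
  have a6 := h.Sd z; rw [mink_comm] at a6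
  have a7 := h.Sb z; rw [mink_comm] at a7
  have a8 := h.Sn z; rw [mink_comm] at a8
  have a9 := h.nd z; rw [mink_comm] at a9
  have a10 := h.nb z; rw [mink_comm] at a10
  fin_cases i <;> fin_cases j <;>
    simp [cliffordFrame, mink_add_left, mink_add_right, mink_sub_left, mink_sub_right,
      mink_smul_left, mink_smul_right, mink_neg_left, mink_neg_right,
      h.YY, h.Yd, h.Yb, h.YS, h.Yn, h.ddYdY, h.bYbY, h.dYbY, h.SS, h.Sd,
      h.Sb, h.Sn, h.nd, h.nb, h.nn, a1, a2, a3, a4, a5, a6, a7, a8, a9, a10] <;>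
    first
    | done
    | ring1
    | linear_combination (1 / 2) * hs
    | linear_combination -hI

theorem real_frame (h : CliffordSystem Y) (z : ℂ) (i : Fin 5) :
    star (cliffordFrame Y z i) = cliffordFrame Y z i := by
  have e1 : star (dz Y z) = dzbar Y z := (dzbar_eq_star h.real z).symm
  have e2 : star (dzbar Y z) = dz Y z := by rw [← e1, star_star]
  have e3 : star (dz (dz Y) z) = dz (dz Y) z := by
    rw [← dzbar_dzbar_eq_star h.real, h.dd]
  have e4 : star (dzbar (dz Y) z) = dzbar (dz Y) z := by
    rw [← dz_star, ← dz_dzbar_comm (h.smooth z)]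
    congr 1
    funext w
    exact (dzbar_eq_star h.real w).symm
  fin_cases i <;>
    simp [cliffordFrame, star_add, star_sub, star_smul, h.real, e1, e2, e3, e4, add_comm]
  rw [← smul_neg, neg_sub]

theorem bnu (h : CliffordSystem Y) (z : ℂ) : dz (dzbar (dz Y)) z = -(2 : ℂ) • dz Y z := by
  rw [dz_dzbar_comm (smooth_dz (h.smooth z)), h.bdd]

theorem bbnu (h : CliffordSystem Y) (z : ℂ) : dzbar (dzbar (dz Y)) z = -(2 : ℂ) • dzbar Y z := by
  have e : dzbar (dz Y) = dz (dzbar Y) := funext fun w => (dz_dzbar_comm (h.smooth w)).symm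
  rw [e, ← dz_dzbar_comm (smooth_dzbar (h.smooth z)), ← h.ddd]
  congr 1
  exact funext h.dd

/-- The explicit form of the lift. -/
theorem eq_frame (h : CliffordSystem Y) (z : ℂ) : Y z = (1 / 2 : ℝ) • cliffordFrame Y 0 0 +
    (√2 / 4) • (Real.cos (2 * √2 * z.re) • cliffordFrame Y 0 1 +
      Real.sin (2 * √2 * z.re) • cliffordFrame Y 0 2 +
      Real.cos (2 * √2 * z.im) • cliffordFrame Y 0 3 +
      Real.sin (2 * √2 * z.im) • cliffordFrame Y 0 4) := by
  have sd : ∀ z, DifferentiableAt ℝ Y z := fun z => (h.smooth z).differentiableAt (by simp)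
  have d1 : ∀ z, HasFDerivAt (dz Y) _ z := fun z =>
    hasFDerivAt_of_dz ((smooth_dz (h.smooth z)).differentiableAt (by simp))
  have d2 : ∀ z, HasFDerivAt (dzbar Y) _ z := fun z =>
    hasFDerivAt_of_dz ((smooth_dzbar (h.smooth z)).differentiableAt (by simp))
  have d3 : ∀ z, HasFDerivAt (dz (dz Y)) _ z := fun z =>
    hasFDerivAt_of_dz ((smooth_dz (smooth_dz (h.smooth z))).differentiableAt (by simp))
  have d4 : ∀ z, HasFDerivAt (dzbar (dz Y)) _ z := fun z =>
    hasFDerivAt_of_dz ((smooth_dzbar (smooth_dz (h.smooth z))).differentiableAt (by simp))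
  have hdb : ∀ z, dz (dzbar Y) z = dzbar (dz Y) z := fun z => dz_dzbar_comm (h.smooth z)
  have hI := Complex.I_mul_I
  -- p is Y_u and w = Y_zz + Y_zz̄; both depend on u alone, with p_u = 2w and w_u = −4p. The next
  -- block is the same in v, with p = Y_v and w = Y_zz̄ − Y_zz.
  have o1 := oscillator Complex.reCLM (p := fun z => dz Y z + dzbar Y z)
    (w := fun z => dz (dz Y) z + dzbar (dz Y) z)
    (fun z => ((d1 z).add (d2 z)).congr_fderiv (by
      rw [hdb, h.dd]; ext v i
      simp; ring))
    (fun z => ((d3 z).add (d4 z)).congr_fderiv (by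
      rw [h.ddd, h.bdd, h.bnu, h.bbnu]; ext v i
      simp; ring)) z
  have o2 := oscillator Complex.imCLM (p := fun z => Complex.I • (dz Y z - dzbar Y z))
    (w := fun z => dzbar (dz Y) z - dz (dz Y) z)
    (fun z => (((d1 z).sub (d2 z)).const_smul Complex.I).congr_fderiv (by
      rw [hdb, h.dd]; ext v i
      simp
      linear_combination (2 * (v.im : ℂ) * (dz (dz Y) z i - dzbar (dz Y) z i)) * hI))
    (fun z => ((d4 z).sub (d3 z)).congr_fderiv (by
      rw [h.ddd, h.bdd, h.bnu, h.bbnu]; ext v i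
      simp; ring)) z
  -- This timelike vector is constant. Since Y_zz̄ is half the sum of the two oscillators, it
  -- determines Y.
  have hT : ∀ z, HasFDerivAt (fun z => (2 : ℂ) • Y z + dzbar (dz Y) z)
      (0 : ℂ →L[ℝ] Fin 5 → ℂ) z := fun z =>
    (((hasFDerivAt_of_dz (sd z)).const_smul (2 : ℂ)).add (d4 z)).congr_fderiv (by
      rw [h.bnu, h.bbnu]; ext v i
      simp; ring)
  have o3 := is_const_of_fderiv_eq_zero (𝕜 := ℝ) (fun z => (hT z).differentiableAt)
    (fun z => (hT z).fderiv) z 0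
  funext i
  have p1 := congrFun o1 i
  have p2 := congrFun o2 i
  have p3 := congrFun o3 i
  have hs : ((√2 : ℝ) : ℂ) * ((√2 : ℝ) : ℂ) = 2 := by
    rw [← Complex.ofReal_mul, Real.mul_self_sqrt (by norm_num)]; norm_num
  simp [cliffordFrame] at p1 p2 p3 ⊢
  linear_combination (1 / 2) * p3 - (1 / 4) * p1 - (1 / 4) * p2 +
    (1 / 8) * (Complex.cos (2 * √2 * z.re) * (dz (dz Y) 0 i + dzbar (dz Y) 0 i) +
      Complex.cos (2 * √2 * z.im) * (dzbar (dz Y) 0 i - dz (dz Y) 0 i)) * hs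

end CliffordSystem

/-- A map out of a quotient of the plane by translations that a periodic map factors through is a
covering map. -/
theorem isCoveringMap_of_translations {M T : Type*} [TopologicalSpace M] [TopologicalSpace T]
    {Φ : ℂ → M} {Ψ : ℂ → T} {g : M → T} (hΦc : Continuous Φ) (hΦo : IsOpenMap Φ)
    (hΦs : Function.Surjective Φ) (hgc : Continuous g) (hg : ∀ z, g (Φ z) = Ψ z)
    (hΨ : IsQuotientMap Ψ) (hadd : ∀ a b, Ψ a = Ψ b ↔ Ψ (b - a) = Ψ 0) {r : ℝ} (hr : 0 < r)
    (hloc : ∀ s, ‖s‖ < r → Ψ s = Ψ 0 → s = 0)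
    (hΦadd : ∀ a b, Φ a = Φ b → ∀ w, Φ (a + w) = Φ (b + w)) : IsCoveringMap g := by
  -- Γ is the group of periods of Φ; Φ induces a homeomorphism of ℂ/Γ with M.
  let Γ : AddSubgroup ℂ :=
    { carrier := {l | Φ l = Φ 0}
      zero_mem' := rfl
      add_mem' := fun {a b} ha hb => by
        have h1 := hΦadd a 0 ha b
        rw [zero_add] at h1
        exact h1.trans hb
      neg_mem' := fun {a} ha => by
        have h1 := hΦadd a 0 ha (-a)
        rw [zero_add, add_neg_cancel] at h1
        exact h1.symm }
  have hΓ : ∀ l, l ∈ Γ ↔ Φ l = Φ 0 := fun l => Iff.rfl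
  have hΓΦ : ∀ a b, -a + b ∈ Γ ↔ Φ a = Φ b := by
    intro a b
    rw [hΓ]
    constructor <;> intro h
    · have := hΦadd _ _ h a
      rw [zero_add, neg_add_cancel_comm] at this
      exact this.symm
    · have := hΦadd _ _ h (-a)
      rw [add_neg_cancel, add_comm] at this
      exact this.symm
  let q : ℂ ⧸ Γ → M := Quotient.lift Φ fun a b hab =>
    (hΓΦ a b).1 (QuotientAddGroup.leftRel_apply.1 hab)
  have hq : ∀ z : ℂ, q (z : ℂ ⧸ Γ) = Φ z := fun z => rfl
  have hqb : Function.Bijective q := by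
    constructor
    · intro a b
      induction a using QuotientAddGroup.induction_on with | H a => ?_
      induction b using QuotientAddGroup.induction_on with | H b => ?_
      intro hab
      rw [QuotientAddGroup.eq, hΓΦ]; exact hab
    · intro p
      obtain ⟨z, rfl⟩ := hΦs p
      exact ⟨z, hq z⟩
  have hqc : Continuous q := continuous_quot_lift _ hΦc
  have hqo : IsOpenMap q := by
    intro U hU
    have : q '' U = Φ '' ((fun z : ℂ => (z : ℂ ⧸ Γ)) ⁻¹' U) := by
      ext p; constructor
      · rintro ⟨a, ha, rfl⟩
        induction a using QuotientAddGroup.induction_on with | H a => ?_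
        exact ⟨a, ha, rfl⟩
      · rintro ⟨a, ha, rfl⟩
        exact ⟨a, ha, rfl⟩
    rw [this]
    exact hΦo _ (hU.preimage QuotientAddGroup.continuous_mk)
  let e : ℂ ⧸ Γ ≃ₜ M := (Equiv.ofBijective q hqb).toHomeomorphOfContinuousOpen hqc hqo
  have hFz : ∀ z : ℂ, (g ∘ q) (z : ℂ ⧸ Γ) = Ψ z := hg
  have hF : IsQuotientMap (g ∘ q) :=
    IsQuotientMap.of_comp (f := fun z : ℂ => (z : ℂ ⧸ Γ)) QuotientAddGroup.continuous_mk
      (hgc.comp hqc) (by convert hΨ using 1; exact funext hFz)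
  have hFadd : ∀ a b : ℂ ⧸ Γ, (g ∘ q) a = (g ∘ q) b ↔ (g ∘ q) (b + -a) = (g ∘ q) 0 := by
    intro a b
    induction a using QuotientAddGroup.induction_on with | H a => ?_
    induction b using QuotientAddGroup.induction_on with | H b => ?_
    rw [← QuotientAddGroup.mk_neg, ← QuotientAddGroup.mk_add, ← QuotientAddGroup.mk_zero, hFz, hFz,
      hFz, hFz, ← sub_eq_add_neg]
    exact hadd a b
  -- The fibres of the induced map on ℂ/Γ are cosets of this subgroup. It is discrete, because an
  -- element close to 0 lifts to a small s with Ψ s = Ψ 0, so s = 0.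
  let G : AddSubgroup (ℂ ⧸ Γ) :=
    { carrier := {a | (g ∘ q) a = (g ∘ q) 0}
      zero_mem' := rfl
      add_mem' := fun {a b} ha hb => by
        have h1 := (hFadd (-a) b).2 (by
          rw [neg_neg]
          have h2 := (hFadd (b + a) b).2 (by
            rw [show b + -(b + a) = 0 + -a by abel]; exact (hFadd a 0).1 ha)
          exact h2.trans hb)
        have h3 := (hFadd (-a) b).1 h1
        rw [neg_neg, add_comm] at h3
        exact h3
      neg_mem' := fun {a} ha => by
        have h1 := (hFadd a 0).1 ha
        rwa [zero_add] at h1 }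
  have hGd : IsDiscrete (G : Set (ℂ ⧸ Γ)) := by
    rw [isDiscrete_iff_discreteTopology]
    have : DiscreteTopology G := by
      refine discreteTopology_of_isOpen_singleton_zero ?_
      have hV : IsOpen ((fun z : ℂ => (z : ℂ ⧸ Γ)) '' Metric.ball 0 r) :=
        QuotientAddGroup.isOpenMap_coe _ Metric.isOpen_ball
      convert hV.preimage (continuous_subtype_val (p := (· ∈ G))) using 1
      ext ⟨a, ha⟩
      simp only [Set.mem_singleton_iff, Set.mem_preimage, Set.mem_image]
      constructor
      · intro h
        rw [AddSubgroup.mk_eq_zero] at h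
        exact ⟨0, Metric.mem_ball_self hr, h.symm⟩
      · rintro ⟨s, hs, hsa⟩
        rw [AddSubgroup.mk_eq_zero, ← hsa]
        have h1 : Ψ s = Ψ 0 := by
          have : (g ∘ q) (s : ℂ ⧸ Γ) = (g ∘ q) ((0 : ℂ) : ℂ ⧸ Γ) := by rw [hsa]; exact ha
          rwa [hFz, hFz] at this
        rw [hloc s (mem_ball_zero_iff.1 hs) h1]; rfl
    exact this
  have hcov : IsCoveringMap (g ∘ q) := (hF.isAddQuotientCoveringMap_of_addSubgroup G hGd
    (fun {a b} => hFadd a b)).isCoveringMap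
  have hge : g = (g ∘ q) ∘ e.symm := by
    funext p
    exact congrArg g (e.apply_symm_apply p).symm
  rw [hge]
  exact hcov.comp_homeomorph e.symm

/-! ### The Clifford torus -/

/-- The conformal parametrization of the Clifford torus. -/
def cliffordMap (z : ℂ) : S3 :=
  ⟨!₂[√2 / 2 * Real.cos (2 * √2 * z.re), √2 / 2 * Real.sin (2 * √2 * z.re),
      √2 / 2 * Real.cos (2 * √2 * z.im), √2 / 2 * Real.sin (2 * √2 * z.im)], by
    have hs : √2 * √2 = 2 := Real.mul_self_sqrt (by norm_num)
    have h1 := Real.sin_sq_add_cos_sq (2 * √2 * z.re)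
    have h2 := Real.sin_sq_add_cos_sq (2 * √2 * z.im)
    rw [mem_sphere_zero_iff_norm, ← sq_eq_sq₀ (norm_nonneg _) zero_le_one,
      ← real_inner_self_eq_norm_sq, inner_E4]
    simp
    linear_combination (1 / 2) * (h1 + h2) + (1 / 4) * (Real.cos (2 * √2 * z.re) ^ 2 +
      Real.sin (2 * √2 * z.re) ^ 2 + Real.cos (2 * √2 * z.im) ^ 2 +
      Real.sin (2 * √2 * z.im) ^ 2) * hs⟩

theorem cliffordMap_mem (z : ℂ) : cliffordMap z ∈ cliffordTorus := by
  have hs : √2 * √2 = 2 := Real.mul_self_sqrt (by norm_num)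
  have h1 := Real.sin_sq_add_cos_sq (2 * √2 * z.re)
  have h2 := Real.sin_sq_add_cos_sq (2 * √2 * z.im)
  simp only [cliffordTorus, cliffordMap, Set.mem_ofPred_eq]
  constructor
  · simp
    linear_combination (1 / 2) * h1 + (1 / 4) * (Real.cos (2 * √2 * z.re) ^ 2 +
      Real.sin (2 * √2 * z.re) ^ 2) * hs
  · simp
    linear_combination (1 / 2) * h2 + (1 / 4) * (Real.cos (2 * √2 * z.im) ^ 2 +
      Real.sin (2 * √2 * z.im) ^ 2) * hs

theorem continuous_cliffordMap : Continuous cliffordMap := by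
  refine Continuous.subtype_mk ?_ _
  refine (PiLp.continuous_toLp 2 _).comp (continuous_pi fun i => ?_)
  fin_cases i <;> simp <;> fun_prop

/-- The squared distance of the two points of the unit circle is 2 − 2cos(t − s). -/
theorem angle_eq_iff (s t : ℝ) : (Real.cos s = Real.cos t ∧ Real.sin s = Real.sin t) ↔
    Real.cos (t - s) = 1 := by
  rw [Real.cos_sub]
  have h1 := Real.sin_sq_add_cos_sq s
  have h2 := Real.sin_sq_add_cos_sq t
  constructor
  · rintro ⟨h3, h4⟩
    rw [← h3, ← h4]; linear_combination h1
  · intro h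
    have h3 : (Real.cos s - Real.cos t) ^ 2 + (Real.sin s - Real.sin t) ^ 2 = 0 := by
      linear_combination h1 + h2 - 2 * h
    constructor
    · nlinarith [sq_nonneg (Real.cos s - Real.cos t), sq_nonneg (Real.sin s - Real.sin t)]
    · nlinarith [sq_nonneg (Real.cos s - Real.cos t), sq_nonneg (Real.sin s - Real.sin t)]

theorem cliffordMap_eq_iff (a b : ℂ) : cliffordMap a = cliffordMap b ↔
    Real.cos (2 * √2 * (b - a).re) = 1 ∧ Real.cos (2 * √2 * (b - a).im) = 1 := by
  have e1 : 2 * √2 * (b - a).re = 2 * √2 * b.re - 2 * √2 * a.re := by rw [Complex.sub_re]; ring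
  have e2 : 2 * √2 * (b - a).im = 2 * √2 * b.im - 2 * √2 * a.im := by rw [Complex.sub_im]; ring
  have hs : √2 / 2 ≠ 0 := by positivity
  rw [e1, e2, ← angle_eq_iff, ← angle_eq_iff, Subtype.ext_iff]
  constructor
  · intro h
    have h0 := congrArg (fun v : E4 => v 0) h
    have h1 := congrArg (fun v : E4 => v 1) h
    have h2 := congrArg (fun v : E4 => v 2) h
    have h3 := congrArg (fun v : E4 => v 3) h
    simp only [cliffordMap] at h0 h1 h2 h3
    exact ⟨⟨mul_left_cancel₀ hs h0, mul_left_cancel₀ hs h1⟩,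
      ⟨mul_left_cancel₀ hs h2, mul_left_cancel₀ hs h3⟩⟩
  · rintro ⟨⟨h0, h1⟩, h2, h3⟩
    simp only [cliffordMap, h0, h1, h2, h3]

theorem exists_angle {x y : ℝ} (h : x ^ 2 + y ^ 2 = 1 / 2) : ∃ t : ℝ, |t| ≤ 2 ∧
    √2 / 2 * Real.cos (2 * √2 * t) = x ∧ √2 / 2 * Real.sin (2 * √2 * t) = y := by
  have hs : √2 * √2 = 2 := Real.mul_self_sqrt (by norm_num)
  have hs0 : 0 < √2 := by positivity
  set c : ℂ := ⟨√2 * x, √2 * y⟩ with hc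
  have hn : ‖c‖ = 1 := by
    have : ‖c‖ ^ 2 = 1 := by
      rw [← Complex.normSq_eq_norm_sq, Complex.normSq_mk]
      linear_combination 2 * h + (x * x + y * y) * hs
    exact (pow_eq_one_iff_of_nonneg (norm_nonneg _) two_ne_zero).1 this
  have hc0 : c ≠ 0 := by rw [← norm_pos_iff, hn]; exact one_pos
  have h1 : 2 * √2 * (c.arg / (2 * √2)) = c.arg := by field_simp
  -- Since |arg c| ≤ π ≤ 4 ≤ 4√2, the parameter is at most 2 in absolute value; this puts a full set
  -- of parameters of the torus in a disc of radius 4.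
  refine ⟨c.arg / (2 * √2), ?_, ?_, ?_⟩
  · rw [abs_div, abs_of_pos (show 0 < 2 * √2 by positivity), div_le_iff₀ (by positivity)]
    have h2 := Complex.abs_arg_le_pi c
    have h3 := Real.pi_le_four
    have h4 : 1 ≤ √2 := Real.one_le_sqrt.2 (by norm_num)
    linarith
  · rw [h1, Complex.cos_arg hc0, hn, div_one, hc]
    linear_combination (x / 2) * hs
  · rw [h1, Complex.sin_arg, hn, div_one, hc]
    linear_combination (y / 2) * hs

/-- The parametrization of the Clifford torus as a map onto the torus. -/
def cliffordParam (z : ℂ) : cliffordTorus := ⟨cliffordMap z, cliffordMap_mem z⟩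

theorem exists_cliffordParam (x : cliffordTorus) : ∃ z ∈ Metric.closedBall (0 : ℂ) 4,
    cliffordParam z = x := by
  obtain ⟨x, h1, h2⟩ := x
  obtain ⟨s, hs, hs1, hs2⟩ := exists_angle h1
  obtain ⟨t, ht, ht1, ht2⟩ := exists_angle h2
  refine ⟨⟨s, t⟩, ?_, ?_⟩
  · rw [mem_closedBall_zero_iff]
    refine (Complex.norm_le_abs_re_add_abs_im _).trans ?_
    simp only; linarith
  · apply Subtype.ext
    apply Subtype.ext
    ext i
    fin_cases i
    · exact hs1
    · exact hs2
    · exact ht1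
    · exact ht2

/-- Already the restriction to a compact disc is onto, and a continuous surjection from a compact
space onto a Hausdorff space is a quotient map. -/
theorem isQuotientMap_cliffordParam : IsQuotientMap cliffordParam := by
  have hc : Continuous cliffordParam := continuous_cliffordMap.subtype_mk _
  have : CompactSpace (Metric.closedBall (0 : ℂ) 4) :=
    isCompact_iff_compactSpace.1 (isCompact_closedBall _ _)
  refine IsQuotientMap.of_comp (f := fun z : Metric.closedBall (0 : ℂ) 4 => (z : ℂ))
    continuous_subtype_val hc ?_
  have hcc := hc.comp (continuous_subtype_val (p := (· ∈ Metric.closedBall (0 : ℂ) 4)))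
  refine hcc.isClosedMap.isQuotientMap hcc fun x => ?_
  obtain ⟨z, hz, hx⟩ := exists_cliffordParam x
  exact ⟨⟨z, hz⟩, hx⟩

theorem cliffordMap_add_iff (a b : ℂ) :
    cliffordMap a = cliffordMap b ↔ cliffordMap (b - a) = cliffordMap 0 := by
  rw [cliffordMap_eq_iff, cliffordMap_eq_iff, zero_sub, Complex.neg_re, Complex.neg_im, mul_neg,
    mul_neg, Real.cos_neg, Real.cos_neg]

/-- For |t| < 1 the angle 2√2 t lies strictly between −2π and 2π, where the cosine equals 1 only at
0. -/
theorem cliffordMap_locally_injective {s : ℂ} (hs : ‖s‖ < 1) (h : cliffordMap s = cliffordMap 0) :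
    s = 0 := by
  rw [cliffordMap_eq_iff, zero_sub, Complex.neg_re, Complex.neg_im, mul_neg, mul_neg, Real.cos_neg,
    Real.cos_neg] at h
  have h2 : √2 < 2 := by rw [Real.sqrt_lt' (by norm_num)]; norm_num
  have h0 : 0 < √2 := by positivity
  have key : ∀ t : ℝ, |t| < 1 → Real.cos (2 * √2 * t) = 1 → t = 0 := by
    intro t ht h
    have h3 := Real.pi_gt_three
    obtain ⟨h4, h5⟩ := abs_lt.1 ht
    rw [Real.cos_eq_one_iff_of_lt_of_lt (by nlinarith) (by nlinarith)] at h
    rcases mul_eq_zero.1 h with h | h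
    · exact absurd h (by positivity)
    · exact h
  exact Complex.ext (key _ ((Complex.abs_re_le_norm s).trans_lt hs) h.1)
    (key _ ((Complex.abs_im_le_norm s).trans_lt hs) h.2)

/-! ### Möbius transformations -/

/-- Coordinates with respect to a Lorentz frame. -/
def lorentzCoord (E : Fin 5 → Fin 5 → ℝ) : (Fin 5 → ℝ) →ₗ[ℝ] (Fin 5 → ℝ) where
  toFun v := Fin.cons (-mink v (E 0)) fun i : Fin 4 => mink v (E i.succ)
  map_add' v w := by
    funext i
    refine Fin.cases ?_ (fun j => ?_) i
    · simp [mink_add_left]; ring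
    · simp [mink_add_left]
  map_smul' c v := by
    funext i
    refine Fin.cases ?_ (fun j => ?_) i
    · simp [mink_smul_left]
    · simp [mink_smul_left]

section Lorentz

variable {E : Fin 5 → Fin 5 → ℝ}

theorem mink_lorentzCoord
    (hE : ∀ i j, mink (E i) (E j) = if i = j then if i = 0 then -1 else 1 else 0)
    (v w : Fin 5 → ℝ) : mink (lorentzCoord E v) (lorentzCoord E w) = mink v w := by
  have hv : v - (-mink v (E 0) • E 0 + ∑ i : Fin 4, mink v (E i.succ) • E i.succ) = 0 := by
    refine eq_zero_of_mink_eq_zero E (Matrix.diagonal fun i => if i = 0 then -1 else 1) ?_ ?_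
    · have : Matrix.of (fun i j => mink (E i) (E j)) =
          Matrix.diagonal fun i => if i = 0 then -1 else 1 := by
        ext i j
        rw [Matrix.of_apply, hE, Matrix.diagonal_apply]
      rw [this, Matrix.diagonal_mul_diagonal, ← Matrix.diagonal_one]
      congr 1
      funext i
      split_ifs <;> norm_num
    · intro i
      rw [Fin.sum_univ_four]
      simp only [mink_sub_right, mink_add_right, mink_smul_right, hE, mink_comm _ v]
      fin_cases i <;> simp [Fin.ext_iff]
  rw [sub_eq_zero] at hv
  conv_rhs => rw [hv]
  simp only [mink_add_left, mink_smul_left, Fin.sum_univ_four]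
  simp only [mink, lorentzCoord, LinearMap.coe_mk, AddHom.coe_mk, Fin.cons_zero, Fin.cons_succ,
    Fin.sum_univ_four]
  ring

/-- The Möbius transformation defined by a Lorentz frame. -/
theorem exists_mobius
    (hE : ∀ i j, mink (E i) (E j) = if i = j then if i = 0 then -1 else 1 else 0) :
    ∃ φ : S3 → S3, IsMobiusTransformation φ ∧ Continuous φ ∧ ∀ (x q : S3) (c : ℝ), c ≠ 0 →
      lorentzCoord E (coneVector x) = c • coneVector q → φ x = q := by
  have hA := mink_lorentzCoord hE
  set A := lorentzCoord E with hAdef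
  have hnull : ∀ x : S3, mink (A (coneVector x)) (A (coneVector x)) = 0 := by
    intro x
    have hx : inner ℝ (x : E4) (x : E4) = (1 : ℝ) := by
      rw [real_inner_self_eq_norm_sq, mem_sphere_zero_iff_norm.1 x.2, one_pow]
    rw [inner_E4] at hx
    rw [hA]
    simp only [mink, coneVector, Fin.cons_zero, Fin.cons_succ, Fin.sum_univ_four]
    linarith
  -- A null vector with vanishing time coordinate is zero, but the image of (1, x) cannot be zero
  -- because ⟨(1, x), (1, 0)⟩ = −1 is preserved.
  have h0 : ∀ x : S3, A (coneVector x) 0 ≠ 0 := by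
    intro x hx
    have h1 := hnull x
    simp only [mink, hx, mul_zero, neg_zero, zero_add] at h1
    set u := A (coneVector x)
    have h2 : u = 0 := by
      funext i
      refine Fin.cases hx (fun j => ?_) i
      exact mul_self_eq_zero.1 ((Finset.sum_eq_zero_iff_of_nonneg
        fun j _ => mul_self_nonneg (u j.succ)).1 h1 j (Finset.mem_univ j))
    have h3 := hA (coneVector x) (Fin.cons 1 0)
    change mink u _ = _ at h3
    rw [h2, mink_zero_left] at h3
    simp [mink, coneVector] at h3
  have hn : ∀ x : S3, (WithLp.toLp 2 fun i : Fin 4 =>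
      A (coneVector x) i.succ / A (coneVector x) 0 : E4) ∈ Metric.sphere (0 : E4) 1 := by
    intro x
    have h1 := hnull x
    have h2 := h0 x
    simp only [mink, Fin.sum_univ_four] at h1
    rw [mem_sphere_zero_iff_norm, ← sq_eq_sq₀ (norm_nonneg _) zero_le_one,
      ← real_inner_self_eq_norm_sq, inner_E4]
    simp only
    field_simp
    linear_combination h1
  have hφ : ∀ x : S3, A (coneVector x) =
      A (coneVector x) 0 • coneVector (⟨_, hn x⟩ : S3) := by
    intro x
    funext i
    refine Fin.cases ?_ (fun j => ?_) i
    · simp [coneVector]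
    · simp only [coneVector, Pi.smul_apply, Fin.cons_succ, smul_eq_mul]
      exact (mul_div_cancel₀ _ (h0 x)).symm
  have hcc : Continuous fun x : S3 => A (coneVector x) := by
    refine (LinearMap.continuous_of_finiteDimensional A).comp (continuous_pi fun i => ?_)
    refine Fin.cases ?_ (fun j => ?_) i
    · simp only [coneVector, Fin.cons_zero]; exact continuous_const
    · simp only [coneVector, Fin.cons_succ]
      exact (EuclideanSpace.proj j : E4 →L[ℝ] ℝ).continuous.comp continuous_subtype_val
  refine ⟨fun x => ⟨_, hn x⟩, ⟨A, hA, fun x => ⟨_, h0 x, hφ x⟩⟩, ?_, ?_⟩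
  · refine Continuous.subtype_mk ((PiLp.continuous_toLp 2 _).comp (continuous_pi fun i => ?_)) _
    exact ((continuous_apply i.succ).comp hcc).div ((continuous_apply 0).comp hcc) h0
  · intro x q c hc hx
    apply Subtype.ext
    ext i
    have e0 := congrFun hx 0
    have e1 := congrFun hx i.succ
    simp only [coneVector, Pi.smul_apply, Fin.cons_zero, Fin.cons_succ, smul_eq_mul, mul_one]
      at e0 e1
    change A (Fin.cons 1 fun i => (x : E4) i) i.succ / A (Fin.cons 1 fun i => (x : E4) i) 0 = _
    rw [e0, e1, mul_div_cancel_left₀ _ hc]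

end Lorentz

namespace CliffordSystem

variable {Y : ℂ → Fin 5 → ℂ}

/-- The coordinates of the lift in its initial frame. -/
theorem mink_frame (h : CliffordSystem Y) (z : ℂ) :
    mink (Y z) (cliffordFrame Y 0 0) = ((-(1 / 2) : ℝ) : ℂ) ∧
    mink (Y z) (cliffordFrame Y 0 1) = ((√2 / 4 * Real.cos (2 * √2 * z.re) : ℝ) : ℂ) ∧
    mink (Y z) (cliffordFrame Y 0 2) = ((√2 / 4 * Real.sin (2 * √2 * z.re) : ℝ) : ℂ) ∧
    mink (Y z) (cliffordFrame Y 0 3) = ((√2 / 4 * Real.cos (2 * √2 * z.im) : ℝ) : ℂ) ∧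
    mink (Y z) (cliffordFrame Y 0 4) = ((√2 / 4 * Real.sin (2 * √2 * z.im) : ℝ) : ℂ) := by
  simp only [h.eq_frame z, ← Complex.coe_smul, mink_add_left, mink_smul_left, h.gram]
  simp [Fin.ext_iff]

end CliffordSystem

/-! ### Identification with the Clifford torus. -/

section Main

variable {M : Type*} [TopologicalSpace M] [ChartedSpace ℂ M] [IsManifold 𝓘(ℂ) ω M]
  {y : M → S3} {Φ : ℂ → M}

namespace NonposWillmore

/-- `bryant_curvature` and `mobiusCurvature_eq` have the same left side and |k|⁶ ≠ 0, so the
curvature is seen to be independent of the coordinate without transforming the Laplacian. -/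
theorem mobiusCurvatureAt_surf (hy : NonposWillmore y) {z : ℂ} (h : HolParam Φ z) :
    mobiusCurvatureAt (surf y Φ) z = mobiusCurvature y (Φ z) := by
  have h0 := hy.conformal.hopfCoeff_ne_zero hy.umbilic h
  have h1 := (hy.confAt h).bryant_curvature h0
  rw [hy.conformal.mobiusCurvature_eq hy.umbilic h] at h1
  have h2 := mul_right_cancel₀ (pow_pos (norm_pos_iff.2 h0) 6).ne' h1
  linarith

theorem entireNatural (hy : NonposWillmore y) (hΦ : ∀ z, Natural y Φ z) :
    EntireNatural (surf y Φ) where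
  conf z := hy.confAt (hΦ z).1
  willmore z := hy.conformal.willmoreAt_surf hy.willmore (hΦ z).1
  bryant z := (hΦ z).coeff_eq
  hopf_ne_zero z := hy.conformal.hopfCoeff_ne_zero hy.umbilic (hΦ z).1
  hopf_le_one z := hy.norm_hopfCoeff_le_one (hΦ z)
  nonpos z := by rw [hy.mobiusCurvatureAt_surf (hΦ z).1]; exact hy.nonpos _

/-- A Möbius transformation takes the surface to the standard parametrization of the Clifford
torus. -/
theorem exists_mobius_cliffordMap (hy : NonposWillmore y) (hΦ : ∀ z, Natural y Φ z) :
    ∃ φ : S3 → S3, IsMobiusTransformation φ ∧ Continuous φ ∧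
      ∀ z, φ (y (Φ z)) = cliffordMap z := by
  have hC := (hy.entireNatural hΦ).cliffordSystem
  set Y := canonicalLift (surf y Φ) with hY
  set E : Fin 5 → Fin 5 → ℝ := fun i j => (cliffordFrame Y 0 i j).re with hEdef
  have hEc : ∀ i, (fun j => (E i j : ℂ)) = cliffordFrame Y 0 i := by
    intro i
    funext j
    exact Complex.conj_eq_iff_re.1 (congrFun (hC.real_frame 0 i) j)
  have hE : ∀ i j, mink (E i) (E j) = if i = j then if i = 0 then -1 else 1 else 0 := by
    intro i j
    have h1 := hC.gram 0 i j
    rw [← hEc, ← hEc, mink_ofReal] at h1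
    have h2 : ((if i = j then if i = 0 then -1 else 1 else 0 : ℂ)) =
        ((if i = j then if i = 0 then -1 else 1 else 0 : ℝ) : ℂ) := by
      split_ifs <;> simp
    rw [h2] at h1
    exact_mod_cast h1
  obtain ⟨φ, hφ, hφc, hφq⟩ := exists_mobius hE
  refine ⟨φ, hφ, hφc, fun z => ?_⟩
  have hconf := hy.confAt (hΦ z).1
  set σ := liftScale (surf y Φ) z with hσ
  have hσ0 : 0 < σ := inv_pos.2 (Real.sqrt_pos.2 hconf.formE_pos)
  have hYz : Y z = fun i => ((σ • coneVector (y (Φ z)) : Fin 5 → ℝ) i : ℂ) := by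
    rw [hY, hconf.canonicalLift_apply]
    funext i
    simp [coneLift, surf, hσ]
  have hm : ∀ i, mink (Y z) (cliffordFrame Y 0 i) =
      ((σ * mink (coneVector (y (Φ z))) (E i) : ℝ) : ℂ) := by
    intro i
    rw [hYz, ← hEc, mink_ofReal, mink_smul_left]
  obtain ⟨m0, m1, m2, m3, m4⟩ := hC.mink_frame z
  rw [hm, Complex.ofReal_inj] at m0 m1 m2 m3 m4
  -- Y = σ(1, y), and the Lorentz coordinates of Y(z) in the frame at 0 are half of (1, `cliffordMap
  -- z`), whence the factor.
  refine hφq _ _ (1 / (2 * σ)) (by positivity) ?_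
  have hσσ : σ * (1 / (2 * σ)) = 1 / 2 := by field_simp
  funext i
  refine mul_left_cancel₀ hσ0.ne' ?_
  rw [Pi.smul_apply, smul_eq_mul, ← mul_assoc, hσσ]
  refine Fin.cases ?_ (fun j => ?_) i
  · change σ * -mink _ _ = 1 / 2 * 1
    linarith
  · fin_cases j
    · change σ * mink _ (E 1) = 1 / 2 * (√2 / 2 * Real.cos (2 * √2 * z.re))
      rw [m1]; ring
    · change σ * mink _ (E 2) = 1 / 2 * (√2 / 2 * Real.sin (2 * √2 * z.re))
      rw [m2]; ring
    · change σ * mink _ (E 3) = 1 / 2 * (√2 / 2 * Real.cos (2 * √2 * z.im))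
      rw [m3]; ring
    · change σ * mink _ (E 4) = 1 / 2 * (√2 / 2 * Real.sin (2 * √2 * z.im))
      rw [m4]; ring

/-- Points identified by an entire natural parametrization differ by a period. -/
theorem natural_period [T2Space M] (hy : NonposWillmore y) (hΦ : ∀ z, Natural y Φ z)
    {φ : S3 → S3} (hφ : ∀ z, φ (y (Φ z)) = cliffordMap z) {a b : ℂ} (hab : Φ a = Φ b) (w : ℂ) :
    Φ (a + w) = Φ (b + w) := by
  obtain ⟨c, -, hcn, hc⟩ := hy.natural_eqOn_affine (hΦ a) (hΦ b) hab
  have h1 : ∀ s, Φ (a + s) = Φ (b + c * s) := fun s => by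
    have := hc Set.univ isPreconnected_univ trivial (fun z _ => hΦ z) (fun z _ => hΦ _) (a + s)
      trivial
    rwa [add_sub_cancel_left] at this
  have h2 : cliffordMap a = cliffordMap b := by rw [← hφ, ← hφ, hab]
  have h3 : ∀ s, cliffordMap ((c - 1) * s) = cliffordMap 0 := fun s => by
    have h4 : cliffordMap (a + s) = cliffordMap (b + c * s) := by rw [← hφ, ← hφ, h1]
    have h5 : cliffordMap (a + s) = cliffordMap (b + s) := by
      rw [cliffordMap_add_iff, add_sub_add_right_eq_sub, ← cliffordMap_add_iff]; exact h2
    have h6 := (cliffordMap_add_iff _ _).1 (h5.symm.trans h4)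
    rwa [show b + c * s - (b + s) = (c - 1) * s by ring] at h6
  have h7 : c = 1 := by
    -- All multiples of c − 1 are periods of the torus parametrization. As |c − 1| ≤ 2, the multiple
    -- by 1/4 lies in the disc where 0 is the only period, so c = 1 and the identification is a
    -- translation.
    have h8 : ‖(c - 1) * (1 / 4 : ℂ)‖ < 1 := by
      rw [norm_mul]
      have h9 := norm_sub_le c 1
      rw [hcn, norm_one] at h9
      norm_num
      linarith
    have h10 := cliffordMap_locally_injective h8 (h3 _)
    have h11 : c - 1 = 0 := by simpa using h10
    exact sub_eq_zero.1 h11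
  rw [h1, h7, one_mul]

end NonposWillmore

end Main

end MobiusSurface

end

theorem mainTheorem6 {M : Type*} [TopologicalSpace M] [T2Space M] [ConnectedSpace M]
    [ChartedSpace ℂ M] [IsManifold 𝓘(ℂ) ω M] (y : M → S3)
    (hy : IsConformalImmersion y) (humb : ∀ p, ¬ IsUmbilic y p) (hW : IsWillmore y)
    (hcomplete : IsMobiusComplete y) (hK : ∀ p, mobiusCurvature y p ≤ 0) :
    (∀ p, mobiusCurvature y p = 0) ∧ IsMobiusEquivalentToCliffordTorus y := by
  have H : NonposWillmore y := ⟨hy, humb, hW, hK⟩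
  obtain ⟨p₀⟩ := (inferInstance : Nonempty M)
  obtain ⟨Φ₀, -, hΦ₀⟩ := H.exists_natural p₀
  obtain ⟨Φ, hΦ⟩ := H.exists_entire hcomplete hΦ₀
  have hsurj := H.surjective_of_natural hΦ
  refine ⟨fun p => ?_, ?_⟩
  · obtain ⟨z, rfl⟩ := hsurj p
    rw [← H.mobiusCurvatureAt_surf (hΦ z).1]
    exact (H.entireNatural hΦ).curvature_eq_zero z
  obtain ⟨φ, hφ, hφc, hφz⟩ := H.exists_mobius_cliffordMap hΦ
  have hmem : ∀ p, φ (y p) ∈ cliffordTorus := by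
    intro p
    obtain ⟨z, rfl⟩ := hsurj p
    rw [hφz]
    exact cliffordMap_mem z
  have hyc : Continuous y := continuous_induced_rng.2 hy.smooth.continuous
  have hg : ∀ z, Set.codRestrict (fun p => φ (y p)) cliffordTorus hmem (Φ z) = cliffordParam z :=
    fun z => Subtype.ext (hφz z)
  refine ⟨φ, hφ, hmem, ?_, ?_⟩
  · refine isCoveringMap_of_translations (Φ := Φ) (Ψ := cliffordParam)
      (continuous_iff_continuousAt.2 fun z => (hΦ z).1.1) ?_ hsurj
      ((hφc.comp hyc).codRestrict hmem) hg isQuotientMap_cliffordParam (fun a b => ?_) one_pos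
      (fun s hs h => cliffordMap_locally_injective hs (congrArg Subtype.val h))
      (fun a b hab w => H.natural_period hΦ hφz hab w)
    · exact isOpenMap_iff_nhds_le.2 fun z => (hΦ z).1.map_nhds.ge
    · have hp : ∀ s t, cliffordParam s = cliffordParam t ↔ cliffordMap s = cliffordMap t :=
        fun s t => Subtype.ext_iff
      rw [hp, hp]
      exact cliffordMap_add_iff a b
  · intro x
    obtain ⟨z, -, hz⟩ := exists_cliffordParam x
    exact ⟨Φ z, (hg z).trans hz⟩
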